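/- Let $\Bbbk$ be a field and $H$ a Hopf algebra over $\Bbbk$ with bijective antipode $\mathcal S$. For a left-left Yetter-Drinfeld module $U$ over $H$ write $h\cdot u$ for the action and $u_{(-1)}\otimes u_{(0)}$ for the coaction. The Nichols algebra $\mathcal B(U)$ is the quotient of the tensor algebra $T(U)$ (a braided Hopf algebra in which the elements of $U$ are primitive) by its largest ideal which is a Yetter-Drinfeld submodule, a coideal, and spanned by homogeneous elements of degree $\ge 2$; $x\mapsto x^{(1)}\otimes x^{(2)}$ denotes its (braided) comultiplication. If $\dim U<\infty$, the dual $U^*$ is the Yetter-Drinfeld module with $\langle h\cdot f,u\rangle=\langle f,\mathcal S(h)\cdot u\rangle$ and $f_{(-1)}\langle f_{(0)},u\rangle=\mathcal S^{-1}(u_{(-1)})\langle f,u_{(0)}\rangle$. Let $\theta\in\mathbb N$, $\mathbb I=\{1,\dots,\theta\}$, and let $M=(M_1,\dots,M_\theta)$ be a family of finite-dimensional irreducible Yetter-Drinfeld modules over $H$. Put $W=\bigoplus_{j\in\mathbb I}M_j$, and let $(\alpha_j)_{j\in\mathbb I}$ be the standard basis of $\mathbb Z^\theta$; $\mathcal B(W)$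 is $\mathbb Z^\theta$-graded with $\deg M_j=\alpha_j$. Fix $i\in\mathbb I$ and put $V=M_i$. With $\operatorname{ad}_c x(y)=xy-(x_{(-1)}\cdot y)x_{(0)}$, for $j\ne i$ let $L_j=\operatorname{ad}\mathcal B(V)(M_j)\subset\mathcal B(W)$ be the span of all $\operatorname{ad}_c x_1(\cdots(\operatorname{ad}_c x_m(y)))$, $m\ge0$, $x_1,\dots,x_m\in M_i$, $y\in M_j$. The family $M$ satisfies condition $(F_i)$ if $\dim L_j<\infty$ for all $j\neq i$. In that case put $a_{ii}^M=2$ and, for $j\ne i$, let $-a_{ij}^M$ be the largest $h\ge 0$ such that $L_j$ has a nonzero component of degree $\alpha_j+h\alpha_i$, and let $L_j^{\max}$ be that component, with the Yetter-Drinfeld structure inherited from $\mathcal B(W)$. Let $s_{i,M}\in GL(\theta,\mathbb Z)$, $s_{i,M}(\alpha_j)=\alpha_j-a_{ij}^M\alpha_i$ for $j\in\mathbb I$, and let $\mathcal R_i(M)=(M'_1,\dots,M'_\theta)$ with $M'_j=L_j^{\max}$ for $j\ne i$ and $M'_i=M_i^*=V^*$. Let $\pi:\mathcal B(W)\to\mathcal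 B(V)$ be induced by the projection $W\to V$ and $$\mathcal K=\mathcal B(W)^{\operatorname{co}\mathcal B(V)}=\{x\in\mathcal B(W): x^{(1)}\otimes\pi(x^{(2)})=x\otimes1\}.$$ For $f\in V^*$ (extended by $0$ on $M_j$, $j\neq i$, and on all components of $\mathcal B(W)$ of $\mathbb N_0$-degree $\ne1$) let $\partial_f(x)=\langle f,x^{(1)}\rangle x^{(2)}$ on $\mathcal B(W)$; this extends to an algebra map $\partial:\mathcal B(V^*)\to\operatorname{End}\mathcal B(W)$. The linear map $\Psi:\mathcal B(W)\otimes\mathcal B(V^*)\to\operatorname{End}\mathcal B(W)$, $b\otimes\xi\mapsto(x\mapsto b\,\partial_\xi(x))$, is injective, and $\mathcal K\#\mathcal B(V^*)$ denotes the space $\mathcal K\otimes\mathcal B(V^*)$ with unit $1\otimes 1$, with the multiplication transported along $\Psi$, with the diagonal action and coaction of $H$, and with the $\mathbb Z^\theta$-grading in which $\mathcal K$ is graded as a subspace of $\mathcal B(W)$ and $\deg V^*=-\alpha_i$. Assume that $M$ satisfies $(F_i)$, and let $W'=\bigoplus_{j\in\mathbb I}M'_j$ with $\deg M'_j=s_{i,M}(\alpha_j)$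 for all $j$. Then: 1. The embedding $W'\hookrightarrow\mathcal K\#\mathcal B(V^*)$, given by $x\mapsto x\otimes1$ on $M'_j\subset\mathcal K$ for $j\neq i$ and by $f\mapsto1\otimes f$ on $M'_i=V^*$, extends to an isomorphism $\mathcal B(W')\cong\mathcal K\#\mathcal B(V^*)$ of $\mathbb Z^\theta$-graded algebras and of Yetter-Drinfeld modules over $H$. 2. $\mathcal R_i(M)$ is again a family of finite-dimensional irreducible Yetter-Drinfeld modules, it satisfies $(F_i)$, $s_{i,\mathcal R_i(M)}=s_{i,M}$, and $\mathcal R_i(\mathcal R_i(M))\cong M$, that is, $\mathcal R_i(\mathcal R_i(M))_j\cong M_j$ as Yetter-Drinfeld modules for all $j\in\mathbb I$. -/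

import Mathlib

open TensorProduct Coalgebra HopfAlgebra

universe u w v

/-- The antipode of the Hopf algebra `H` is bijective. -/
class BijectiveAntipode (k H : Type*) [Field k] [Ring H] [HopfAlgebra k H] : Prop where
  bijective : Function.Bijective (antipode k : H →ₗ[k] H)

noncomputable section

section Hopf

variable (k : Type u) {H : Type w} [Field k] [Ring H] [HopfAlgebra k H]

/-- `S(h₍₂₎) h₍₃₎ ⊗ S(h₍₁₎) h₍₄₎ = ε(h) 1 ⊗ 1`. -/
theorem comul_left_inv :
    WithConv.toConv ((TensorProduct.comm k H H).toLinearMap ∘ₗ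
        TensorProduct.map (antipode k) (antipode k) ∘ₗ comul) *
      WithConv.toConv (comul (R := k) (A := H)) = 1 := by
  have h1 : ∀ (a b : H), LinearMap.mul' k (H ⊗[k] H)
      (TensorProduct.map ((TensorProduct.comm k H H).toLinearMap ∘ₗ
        TensorProduct.map (antipode k) (antipode k)) comul
        ((TensorProduct.assoc k H H H).symm (a ⊗ₜ comul (R := k) b))) =
      1 ⊗ₜ (antipode k a * b) := by
    intro a b
    let F : H ⊗[k] (H ⊗[k] H) →ₗ[k] H ⊗[k] H :=
      TensorProduct.map LinearMap.id (LinearMap.mulLeft k (antipode k a)) ∘ₗ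
      TensorProduct.map (LinearMap.mul' k H ∘ₗ (antipode k).rTensor H) LinearMap.id ∘ₗ
      (TensorProduct.assoc k H H H).symm.toLinearMap
    have e1 : ∀ t : H ⊗[k] H, LinearMap.mul' k (H ⊗[k] H)
      (TensorProduct.map ((TensorProduct.comm k H H).toLinearMap ∘ₗ
        TensorProduct.map (antipode k) (antipode k)) comul
        ((TensorProduct.assoc k H H H).symm (a ⊗ₜ t))) = F (comul.lTensor H t) := by
      intro t
      induction t with
      | zero => simp
      | add x y hx hy => simp only [tmul_add, map_add, hx, hy]
      | tmul x y =>
        simp only [assoc_symm_tmul, map_tmul, LinearMap.lTensor_tmul, LinearMap.comp_apply,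
          LinearEquiv.coe_coe, comm_tmul]
        generalize comul (R := k) y = s
        induction s with
        | zero => simp
        | add x y hx hy => simp only [tmul_add, map_add, hx, hy]
        | tmul y z => simp [F]
    rw [e1, ← Coalgebra.coassoc_apply]
    have e2 : ∀ t : H ⊗[k] H, F (TensorProduct.assoc k H H H (comul.rTensor H t)) =
        1 ⊗ₜ (antipode k a * TensorProduct.lid k H (counit.rTensor H t)) := by
      intro t
      induction t with
      | zero => simp
      | add x y hx hy => simp only [tmul_add, mul_add, map_add, hx, hy]
      | tmul x y =>
        simp only [F, LinearMap.rTensor_tmul, LinearMap.comp_apply, LinearEquiv.coe_coe,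
          LinearEquiv.symm_apply_apply, map_tmul, mul_antipode_rTensor_comul_apply,
          LinearMap.id_apply, lid_tmul, LinearMap.mulLeft_apply, mul_smul_comm, tmul_smul,
          Algebra.algebraMap_eq_smul_one, smul_tmul']
    rw [e2]
    simp
  have h2 : ∀ t : H ⊗[k] H, LinearMap.mul' k (H ⊗[k] H)
      (TensorProduct.map ((TensorProduct.comm k H H).toLinearMap ∘ₗ
        TensorProduct.map (antipode k) (antipode k)) comul
        ((TensorProduct.assoc k H H H).symm (comul.lTensor H t))) =
      1 ⊗ₜ (LinearMap.mul' k H ((antipode k).rTensor H t)) := by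
    intro t
    induction t with
    | zero => simp
    | add x y hx hy => simp only [tmul_add, map_add, hx, hy]
    | tmul x y => simp [h1]
  ext h
  rw [LinearMap.convMul_apply, LinearMap.convOne_apply]
  have h3 := h2 (comul h)
  rw [← Coalgebra.coassoc_apply, LinearEquiv.symm_apply_apply, mul_antipode_rTensor_comul_apply]
    at h3
  rw [Algebra.TensorProduct.algebraMap_apply, Algebra.algebraMap_eq_smul_one, smul_tmul,
    ← Algebra.algebraMap_eq_smul_one, ← h3]
  congr 1
  generalize comul (R := k) h = t
  induction t with
  | zero => simp
  | add x y hx hy => simp only [map_add, hx, hy]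
  | tmul x y => simp

theorem comul_antipode_eq (h : H) :
    comul (R := k) (antipode k h) =
      TensorProduct.comm k H H (TensorProduct.map (antipode k) (antipode k) (comul h)) := by
  have key : WithConv.toConv (comul (R := k) (A := H) ∘ₗ antipode k) =
      WithConv.toConv ((TensorProduct.comm k H H).toLinearMap ∘ₗ
        TensorProduct.map (antipode k) (antipode k) ∘ₗ comul) := by
    symm
    apply left_inv_eq_right_inv (a := WithConv.toConv (comul (R := k) (A := H)))
    · exact comul_left_inv k
    · exact LinearMap.comul_right_inv
  exact LinearMap.congr_fun (congrArg WithConv.ofConv key) h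

variable [BijectiveAntipode k H]

/-- The inverse of the antipode. -/
def antipodeInv : H →ₗ[k] H :=
  (LinearEquiv.ofBijective (antipode k : H →ₗ[k] H) BijectiveAntipode.bijective).symm.toLinearMap

theorem antipode_antipodeInv (h : H) : antipode k (antipodeInv k h) = h :=
  (LinearEquiv.ofBijective (antipode k : H →ₗ[k] H)
    BijectiveAntipode.bijective).apply_symm_apply h

theorem antipodeInv_antipode (h : H) : antipodeInv k (antipode k h) = h :=
  (LinearEquiv.ofBijective (antipode k : H →ₗ[k] H)
    BijectiveAntipode.bijective).symm_apply_apply h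

theorem antipodeInv_one : antipodeInv k (1 : H) = 1 := by
  rw [← antipode_one (R := k) (A := H), antipodeInv_antipode, antipode_one]

theorem antipodeInv_mul (a b : H) :
    antipodeInv k (a * b) = antipodeInv k b * antipodeInv k a := by
  apply (BijectiveAntipode.bijective (k := k) (H := H)).1
  rw [antipode_mul_antidistrib]
  simp only [antipode_antipodeInv]

theorem counit_antipodeInv (a : H) : counit (R := k) (antipodeInv k a) = counit (R := k) a := by
  rw [← counit_antipode (R := k), antipode_antipodeInv]

theorem comul_antipodeInv_eq (h : H) :
    comul (R := k) (antipodeInv k h) =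
      TensorProduct.comm k H H (TensorProduct.map (antipodeInv k) (antipodeInv k) (comul h)) := by
  conv_rhs => rw [← antipode_antipodeInv k h, comul_antipode_eq]
  generalize comul (R := k) (antipodeInv k h) = t
  induction t with
  | zero => simp
  | tmul x y => simp [antipodeInv_antipode]
  | add x y hx hy => simp only [map_add]; rw [← hx, ← hy]

end Hopf

variable {k : Type u} {H : Type w} [Field k] [Ring H] [HopfAlgebra k H]

section Raw

variable {V : Type*} [AddCommGroup V] [Module k V]

/-- The action `(a ⊗ b) · (y ⊗ v) = a y ⊗ b · v` of `H ⊗ H` on `H ⊗ V`. -/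
def ydLeft (act : H →ₐ[k] Module.End k V) : H ⊗[k] H →ₐ[k] Module.End k (H ⊗[k] V) :=
  (Module.endTensorEndAlgHom (R := k) (S := k) (A := k)).comp
    (Algebra.TensorProduct.map (Algebra.lmul k H) act)

/-- The map `a ⊗ b ↦ (a · v)₍₋₁₎ b ⊗ (a · v)₍₀₎`. -/
def ydRight (act : H →ₐ[k] Module.End k V) (coact : V →ₗ[k] H ⊗[k] V) (v : V) :
    H ⊗[k] H →ₗ[k] H ⊗[k] V :=
  TensorProduct.lift (((LinearMap.rTensorHom V ∘ₗ (LinearMap.mul k H).flip).flip) ∘ₗ coact ∘ₗ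
    act.toLinearMap.flip v)

@[simp] theorem ydLeft_tmul (act : H →ₐ[k] Module.End k V) (a b y : H) (v : V) :
    ydLeft act (a ⊗ₜ b) (y ⊗ₜ v) = (a * y) ⊗ₜ act b v := rfl

@[simp] theorem ydRight_tmul (act : H →ₐ[k] Module.End k V) (coact : V →ₗ[k] H ⊗[k] V) (v : V)
    (a b : H) :
    ydRight act coact v (a ⊗ₜ b) =
      LinearMap.rTensor V (LinearMap.mulRight k b) (coact (act a v)) := rfl

end Raw

section Raw

variable {V W : Type*} [AddCommGroup V] [Module k V] [AddCommGroup W] [Module k W]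

/-- The axioms of a Yetter-Drinfeld module at a vector `v`, besides those of an `H`-module:
`ε(v₍₋₁₎) v₍₀₎ = v`, coassociativity, and
`h₍₁₎ v₍₋₁₎ ⊗ h₍₂₎ · v₍₀₎ = (h₍₁₎ · v)₍₋₁₎ h₍₂₎ ⊗ (h₍₁₎ · v)₍₀₎` for all `h`.
In the presence of an antipode the last condition is the same as
`δ(h · v) = h₍₁₎ v₍₋₁₎ S(h₍₃₎) ⊗ h₍₂₎ · v₍₀₎`. -/
structure YDAt (act : H →ₐ[k] Module.End k V) (coact : V →ₗ[k] H ⊗[k] V) (v : V) : Prop where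
  counit_coact : (counit (R := k) (A := H)).rTensor V (coact v) = 1 ⊗ₜ v
  coassoc : TensorProduct.assoc k H H V ((comul (R := k) (A := H)).rTensor V (coact v)) =
    coact.lTensor H (coact v)
  compat : ∀ h : H, ydLeft act (comul h) (coact v) = ydRight act coact v (comul h)

/-- A linear map that is a morphism of Yetter-Drinfeld modules. -/
structure IsYDMap (actV : H →ₐ[k] Module.End k V) (coactV : V →ₗ[k] H ⊗[k] V)
    (actW : H →ₐ[k] Module.End k W) (coactW : W →ₗ[k] H ⊗[k] W) (f : V →ₗ[k] W) : Prop where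
  map_act : ∀ h v, f (actV h v) = actW h (f v)
  map_coact : ∀ v, coactW (f v) = f.lTensor H (coactV v)

theorem ydRight_add (act : H →ₐ[k] Module.End k V) (coact : V →ₗ[k] H ⊗[k] V) (v w : V)
    (t : H ⊗[k] H) : ydRight act coact (v + w) t = ydRight act coact v t + ydRight act coact w t := by
  induction t with
  | zero => simp
  | tmul x y => simp
  | add x y hx hy => simp only [map_add, hx, hy]; abel

theorem ydRight_smul (act : H →ₐ[k] Module.End k V) (coact : V →ₗ[k] H ⊗[k] V) (c : k) (v : V)
    (t : H ⊗[k] H) : ydRight act coact (c • v) t = c • ydRight act coact v t := by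
  induction t with
  | zero => simp
  | tmul x y => simp
  | add x y hx hy => simp only [map_add, hx, hy, smul_add]

theorem YDAt.add {act : H →ₐ[k] Module.End k V} {coact : V →ₗ[k] H ⊗[k] V} {v w : V}
    (hv : YDAt act coact v) (hw : YDAt act coact w) : YDAt act coact (v + w) where
  counit_coact := by simp only [map_add, hv.counit_coact, hw.counit_coact, tmul_add]
  coassoc := by simp only [map_add, hv.coassoc, hw.coassoc]
  compat h := by simp only [map_add, hv.compat, hw.compat, ydRight_add]

theorem YDAt.smul {act : H →ₐ[k] Module.End k V} {coact : V →ₗ[k] H ⊗[k] V} {v : V} (c : k)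
    (hv : YDAt act coact v) : YDAt act coact (c • v) where
  counit_coact := by simp only [map_smul, hv.counit_coact, tmul_smul]
  coassoc := by simp only [map_smul, hv.coassoc]
  compat h := by simp only [map_smul, hv.compat, ydRight_smul]

theorem rTensor_counit_lTensor (f : V →ₗ[k] W) (t : H ⊗[k] V) :
    (counit (R := k) (A := H)).rTensor W (f.lTensor H t) =
      f.lTensor k ((counit (R := k) (A := H)).rTensor V t) := by
  rw [← LinearMap.comp_apply, LinearMap.rTensor_comp_lTensor,
    ← LinearMap.lTensor_comp_rTensor, LinearMap.comp_apply]

theorem assoc_rTensor_comul_lTensor (f : V →ₗ[k] W) (t : H ⊗[k] V) :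
    TensorProduct.assoc k H H W ((comul (R := k) (A := H)).rTensor W (f.lTensor H t)) =
      (f.lTensor H).lTensor H
        (TensorProduct.assoc k H H V ((comul (R := k) (A := H)).rTensor V t)) := by
  induction t with
  | zero => simp
  | add x y hx hy => simp only [map_add, hx, hy]
  | tmul x y =>
    simp only [LinearMap.lTensor_tmul, LinearMap.rTensor_tmul]
    generalize comul (R := k) x = s
    induction s with
    | zero => simp
    | add x y hx hy => simp only [add_tmul, map_add, hx, hy]
    | tmul x y => simp

section

variable {actV : H →ₐ[k] Module.End k V} {coactV : V →ₗ[k] H ⊗[k] V}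
  {actW : H →ₐ[k] Module.End k W} {coactW : W →ₗ[k] H ⊗[k] W} {f : V →ₗ[k] W}

theorem IsYDMap.lTensor_coact (hf : IsYDMap actV coactV actW coactW f) (t : H ⊗[k] V) :
    coactW.lTensor H (f.lTensor H t) = (f.lTensor H).lTensor H (coactV.lTensor H t) := by
  rw [← LinearMap.lTensor_comp_apply, ← LinearMap.lTensor_comp_apply,
    show coactW ∘ₗ f = f.lTensor H ∘ₗ coactV from LinearMap.ext hf.map_coact]

theorem IsYDMap.ydLeft (hf : IsYDMap actV coactV actW coactW f) (t : H ⊗[k] H) (s : H ⊗[k] V) :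
    ydLeft actW t (f.lTensor H s) = f.lTensor H (ydLeft actV t s) := by
  induction t with
  | zero => simp
  | add x y hx hy => simp only [map_add, LinearMap.add_apply, hx, hy]
  | tmul a b =>
    induction s with
    | zero => simp
    | add x y hx hy => simp only [map_add, hx, hy]
    | tmul y v => simp [hf.map_act]

theorem IsYDMap.ydRight (hf : IsYDMap actV coactV actW coactW f) (v : V) (t : H ⊗[k] H) :
    ydRight actW coactW (f v) t = f.lTensor H (ydRight actV coactV v t) := by
  induction t with
  | zero => simp
  | add x y hx hy => simp only [map_add, hx, hy]
  | tmul a b =>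
    rw [ydRight_tmul, ydRight_tmul, ← hf.map_act, hf.map_coact,
      ← LinearMap.comp_apply, LinearMap.rTensor_comp_lTensor,
      ← LinearMap.lTensor_comp_rTensor, LinearMap.comp_apply]

theorem YDAt.map (hf : IsYDMap actV coactV actW coactW f) {v : V} (hv : YDAt actV coactV v) :
    YDAt actW coactW (f v) where
  counit_coact := by
    rw [hf.map_coact, rTensor_counit_lTensor, hv.counit_coact]
    rfl
  coassoc := by
    rw [hf.map_coact, assoc_rTensor_comul_lTensor, hv.coassoc, hf.lTensor_coact]
  compat h := by rw [hf.map_coact, hf.ydLeft, hf.ydRight, hv.compat]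

/-- If `f` is injective then the axioms at `f v` imply those at `v`. -/
theorem YDAt.of_injective (hf : IsYDMap actV coactV actW coactW f) (hinj : Function.Injective f)
    {v : V} (hv : YDAt actW coactW (f v)) : YDAt actV coactV v := by
  have i0 := Module.Flat.lTensor_preserves_injective_linearMap (M := k) f hinj
  have i1 := Module.Flat.lTensor_preserves_injective_linearMap (M := H) f hinj
  have i2 := Module.Flat.lTensor_preserves_injective_linearMap (M := H) (f.lTensor H) i1
  refine ⟨i0 ?_, i2 ?_, fun h => i1 ?_⟩
  · rw [← rTensor_counit_lTensor, ← hf.map_coact, hv.counit_coact]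
    rfl
  · rw [← assoc_rTensor_comul_lTensor, ← hf.map_coact, hv.coassoc, hf.map_coact,
      hf.lTensor_coact]
  · rw [← hf.ydLeft, ← hf.ydRight, ← hf.map_coact, hv.compat]

end

end Raw

section Algebra

variable {R : Type*} [Ring R] [Algebra k R]

/-- The condition `h · (x y) = (h₍₁₎ · x) (h₍₂₎ · y)`. -/
def ActMul (act : H →ₐ[k] Module.End k R) (x y : R) : Prop :=
  ∀ h : H, act h (x * y) = LinearMap.mul' k R
    (TensorProduct.map (act.toLinearMap.flip x) (act.toLinearMap.flip y) (comul h))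

theorem YDAt.mul {act : H →ₐ[k] Module.End k R} {coact : R →ₐ[k] H ⊗[k] R} 
    (hm : ∀ x y, ActMul act x y) {x y : R}
    (hx : YDAt act coact.toLinearMap x) (hy : YDAt act coact.toLinearMap y) :
    YDAt act coact.toLinearMap (x * y) where
  counit_coact := by
    have e : ∀ t, (counit (R := k) (A := H)).rTensor R t =
        Algebra.TensorProduct.map (Bialgebra.counitAlgHom k H) (AlgHom.id k R) t := fun t => rfl
    have hx' := hx.counit_coact
    have hy' := hy.counit_coact
    simp only [e, AlgHom.toLinearMap_apply, map_mul] at *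
    rw [hx', hy', Algebra.TensorProduct.tmul_mul_tmul, one_mul]
  coassoc := by
    have e : ∀ t, TensorProduct.assoc k H H R ((comul (R := k) (A := H)).rTensor R t) =
        Algebra.TensorProduct.assoc k k k H H R
          (Algebra.TensorProduct.map (Bialgebra.comulAlgHom k H) (AlgHom.id k R) t) := fun t => rfl
    have e' : ∀ t, coact.toLinearMap.lTensor H t =
        Algebra.TensorProduct.map (AlgHom.id k H) coact t := fun t => rfl
    have hx' := hx.coassoc
    have hy' := hy.coassoc
    simp only [e, e', AlgHom.toLinearMap_apply, map_mul] at *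
    rw [hx', hy']
  compat := by
    let u : WithConv (H →ₗ[k] H ⊗[k] R) :=
      WithConv.toConv ((TensorProduct.mk k H R).flip 1)
    let a : R → WithConv (H →ₗ[k] H ⊗[k] R) := fun x =>
      WithConv.toConv (coact.toLinearMap ∘ₗ act.toLinearMap.flip x)
    let e : R → WithConv (H →ₗ[k] H ⊗[k] R) := fun x =>
      WithConv.toConv ((LinearMap.lTensorHom H).flip (coact x) ∘ₗ act.toLinearMap)
    have hL : ∀ x h, ydLeft act (comul h) (coact x) = (u * e x) h := by
      intro x h
      rw [LinearMap.convMul_apply]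
      generalize comul (R := k) h = t
      induction t with
      | zero => simp
      | add s t hs ht => simp only [map_add, LinearMap.add_apply, hs, ht]
      | tmul b c =>
        simp only [map_tmul, LinearMap.mul'_apply, u, e,
          LinearMap.comp_apply, LinearMap.flip_apply, TensorProduct.mk_apply]
        generalize coact x = s
        induction s with
        | zero => simp
        | add s t hs ht => simp only [map_add, mul_add, hs, ht]
        | tmul y z => simp
    have hR : ∀ x h, ydRight act coact.toLinearMap x (comul h) = (a x * u) h := by
      intro x h
      rw [LinearMap.convMul_apply]
      generalize comul (R := k) h = t
      induction t with
      | zero => simp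
      | add s t hs ht => simp only [map_add, hs, ht]
      | tmul b c =>
        simp only [map_tmul, LinearMap.mul'_apply, u, a,
          LinearMap.comp_apply, LinearMap.flip_apply, TensorProduct.mk_apply, ydRight_tmul,
          AlgHom.toLinearMap_apply]
        generalize coact (act b x) = s
        induction s with
        | zero => simp
        | add s t hs ht => simp only [map_add, add_mul, hs, ht]
        | tmul y z => simp
    have ha : ∀ x y, a (x * y) = a x * a y := by
      intro x y
      ext h
      rw [LinearMap.convMul_apply]
      simp only [a, LinearMap.comp_apply, LinearMap.flip_apply,
        AlgHom.toLinearMap_apply, hm x y h]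
      generalize comul (R := k) h = t
      induction t with
      | zero => simp
      | add s t hs ht => simp only [map_add, hs, ht]
      | tmul b c => simp
    have he : ∀ x y, e (x * y) = e x * e y := by
      intro x y
      ext h
      rw [LinearMap.convMul_apply]
      simp only [e, LinearMap.comp_apply, LinearMap.flip_apply,
        AlgHom.toLinearMap_apply, map_mul]
      generalize coact x = s
      generalize coact y = r
      induction s with
      | zero => simp
      | add s t hs ht => simp only [map_add, add_mul, hs, ht, LinearMap.add_comp,
          TensorProduct.map_add_left, LinearMap.add_apply]
      | tmul p q =>
        induction r with
        | zero => simp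
        | add s t hs ht => simp only [map_add, mul_add, hs, ht, LinearMap.add_comp,
          TensorProduct.map_add_right, LinearMap.add_apply]
        | tmul p' q' =>
          simp only [LinearMap.coe_lTensorHom, LinearMap.lTensor_tmul,
            Algebra.TensorProduct.tmul_mul_tmul, hm q q' h]
          generalize comul (R := k) h = t
          induction t with
          | zero => simp
          | add s t hs ht => simp only [map_add, tmul_add, hs, ht]
          | tmul b c => simp
    have hxx : a x * u = u * e x := by
      ext h; rw [← hL, ← hR]; exact (hx.compat h).symm
    have hyy : a y * u = u * e y := by
      ext h; rw [← hL, ← hR]; exact (hy.compat h).symm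
    intro h
    rw [AlgHom.toLinearMap_apply, hL, hR, ha, he, ← mul_assoc, ← hxx, mul_assoc, ← hyy, mul_assoc]

end Algebra

section Descend

variable {A B C : Type*} [AddCommGroup A] [Module k A] [AddCommGroup B] [Module k B]
  [AddCommGroup C] [Module k C]

/-- The linear map on the quotient `p : A ↠ B` induced by `f : A → C` with `ker p ⊆ ker f`. -/
def descend (p : A →ₗ[k] B) (hp : Function.Surjective p) (f : A →ₗ[k] C)
    (hf : LinearMap.ker p ≤ LinearMap.ker f) : B →ₗ[k] C :=
  (LinearMap.ker p).liftQ f hf ∘ₗ (p.quotKerEquivOfSurjective hp).symm.toLinearMap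

theorem descend_apply (p : A →ₗ[k] B) (hp : Function.Surjective p) (f : A →ₗ[k] C)
    (hf : LinearMap.ker p ≤ LinearMap.ker f) (a : A) : descend p hp f hf (p a) = f a := by
  have : (p.quotKerEquivOfSurjective hp).symm (p a) = (LinearMap.ker p).mkQ a := by
    rw [LinearEquiv.symm_apply_eq]; rfl
  simp [descend, this]

end Descend

/-- A Yetter-Drinfeld module over the Hopf algebra `H`: a left `H`-module and left `H`-comodule
whose structures are compatible. -/
structure YDMod (k : Type u) (H : Type w) [Field k] [Ring H] [HopfAlgebra k H] where
  /-- The underlying vector space. -/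
  carrier : Type v
  [addCommGroup : AddCommGroup carrier]
  [module : Module k carrier]
  /-- The action of `H`. -/
  act : H →ₐ[k] Module.End k carrier
  /-- The coaction `v ↦ v₍₋₁₎ ⊗ v₍₀₎`. -/
  coact : carrier →ₗ[k] H ⊗[k] carrier
  ydAt : ∀ v, YDAt act coact v

attribute [instance] YDMod.addCommGroup YDMod.module

namespace YDMod

instance : CoeSort (YDMod.{u, w, v} k H) (Type v) := ⟨YDMod.carrier⟩

/-- `f` is a morphism of Yetter-Drinfeld modules. -/
abbrev IsHom {V : YDMod.{u, w, v} k H} {W : YDMod k H} (f : V →ₗ[k] W) : Prop :=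
  IsYDMap V.act V.coact W.act W.coact f

/-- `P` is a Yetter-Drinfeld submodule of `V`. -/
structure IsSub (V : YDMod.{u, w, v} k H) (P : Submodule k V) : Prop where
  act_mem : ∀ h : H, P ≤ P.comap (V.act h)
  coact_mem : P ≤ (LinearMap.range (P.subtype.lTensor H)).comap V.coact

/-- `V` is an irreducible Yetter-Drinfeld module. -/
def IsIrreducible (V : YDMod.{u, w, v} k H) : Prop :=
  Nontrivial V ∧ ∀ P : Submodule k V, V.IsSub P → P = ⊥ ∨ P = ⊤

/-- `V` and `W` are isomorphic Yetter-Drinfeld modules. -/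
def Isomorphic (V : YDMod.{u, w, v} k H) (W : YDMod k H) : Prop :=
  ∃ e : V ≃ₗ[k] W, IsHom (e : V →ₗ[k] W)

variable (V : YDMod.{u, w, v} k H)

/-! ### The tensor algebra as a braided Hopf algebra -/

/-- The tensor algebra of `V`. -/
abbrev T : Type (max u v) := TensorAlgebra k V.carrier

/-- The algebra map from `T(V)` to the convolution algebra `Hom(H, T(V))` with
`v ↦ (h ↦ h · v)`. -/
def tActConv : V.T →ₐ[k] WithConv (H →ₗ[k] V.T) :=
  TensorAlgebra.lift k ((WithConv.linearEquiv k (H →ₗ[k] V.T)).symm.toLinearMap ∘ₗ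
    LinearMap.llcomp k H V.carrier V.T (TensorAlgebra.ι k) ∘ₗ V.act.toLinearMap.flip)

/-- The action of `H` on `T(V)` as a linear map; `h · (x y) = (h₍₁₎ · x) (h₍₂₎ · y)`. -/
def tActLin : H →ₗ[k] V.T →ₗ[k] V.T :=
  ((WithConv.linearEquiv k (H →ₗ[k] V.T)).toLinearMap ∘ₗ V.tActConv.toLinearMap).flip

theorem tActLin_mul (h : H) (x y : V.T) : V.tActLin h (x * y) = LinearMap.mul' k V.T
    (TensorProduct.map (V.tActLin.flip x) (V.tActLin.flip y) (comul h)) := by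
  have : V.tActLin h (x * y) = (V.tActConv (x * y)) h := rfl
  rw [this, map_mul, LinearMap.convMul_apply]
  rfl

theorem tActLin_algebraMap (h : H) (r : k) :
    V.tActLin h (algebraMap k V.T r) = algebraMap k V.T (r * counit (R := k) h) := by
  have : V.tActLin h (algebraMap k V.T r) = (V.tActConv (algebraMap k V.T r)) h := rfl
  rw [this, AlgHom.commutes, LinearMap.convAlgebraMap_apply, map_mul, Algebra.smul_def]

theorem tActLin_ι (h : H) (v : V) :
    V.tActLin h (TensorAlgebra.ι k v) = TensorAlgebra.ι k (V.act h v) := by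
  have : V.tActLin h (TensorAlgebra.ι k v) = (V.tActConv (TensorAlgebra.ι k v)) h := rfl
  rw [this, tActConv, TensorAlgebra.lift_ι_apply]
  rfl

theorem tActLin_mul_left (g h : H) (x : V.T) :
    V.tActLin (g * h) x = V.tActLin g (V.tActLin h x) := by
  induction x using TensorAlgebra.induction generalizing g h with
  | algebraMap r => simp only [tActLin_algebraMap, Bialgebra.counit_mul]; congr 1; ring
  | ι v => simp only [tActLin_ι, map_mul, Module.End.mul_apply]
  | add x y hx hy => simp only [map_add, hx, hy]
  | mul x y hx hy =>
    rw [tActLin_mul, tActLin_mul, Bialgebra.comul_mul]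
    generalize comul (R := k) h = s
    induction s with
    | zero => simp
    | add s t hs ht => simp only [mul_add, map_add, hs, ht]
    | tmul a b =>
      rw [map_tmul, LinearMap.mul'_apply, tActLin_mul]
      generalize comul (R := k) g = t
      induction t with
      | zero => simp
      | add s t hs ht => simp only [add_mul, map_add, hs, ht]
      | tmul c d => simp [hx, hy]

/-- The action of `H` on `T(V)`. -/
def tAct : H →ₐ[k] Module.End k V.T :=
  AlgHom.ofLinearMap V.tActLin
    (by
      ext x
      induction x using TensorAlgebra.induction with
      | algebraMap r => simp [tActLin_algebraMap]
      | ι v => simp [tActLin_ι]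
      | add x y hx hy => simp only [map_add, hx, hy]
      | mul x y hx hy =>
        rw [tActLin_mul, Bialgebra.comul_one, Algebra.TensorProduct.one_def]
        simp [hx, hy])
    (fun g h => LinearMap.ext (V.tActLin_mul_left g h))

theorem tAct_mul (x y : V.T) : ActMul V.tAct x y := fun h => V.tActLin_mul h x y

theorem tAct_algebraMap (h : H) (r : k) :
    V.tAct h (algebraMap k V.T r) = algebraMap k V.T (r * counit (R := k) h) :=
  V.tActLin_algebraMap h r

theorem tAct_ι (h : H) (v : V) :
    V.tAct h (TensorAlgebra.ι k v) = TensorAlgebra.ι k (V.act h v) := V.tActLin_ι h v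

/-- The coaction of `H` on `T(V)`, an algebra map. -/
def tCoact : V.T →ₐ[k] H ⊗[k] V.T :=
  TensorAlgebra.lift k ((TensorAlgebra.ι k).lTensor H ∘ₗ V.coact)

theorem tCoact_ι (v : V) :
    V.tCoact (TensorAlgebra.ι k v) = (TensorAlgebra.ι k).lTensor H (V.coact v) := by
  simp [tCoact]

theorem tYDAt (x : V.T) : YDAt V.tAct V.tCoact.toLinearMap x := by
  induction x using TensorAlgebra.induction with
  | algebraMap r =>
    rw [Algebra.algebraMap_eq_smul_one]
    refine YDAt.smul _ ⟨?_, ?_, ?_⟩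
    · simp [Algebra.TensorProduct.one_def]
    · simp [Algebra.TensorProduct.one_def]
    · intro h
      have h1 : ∀ t : H ⊗[k] H, ydLeft V.tAct t ((1 : H) ⊗ₜ[k] (1 : V.T)) =
          TensorProduct.rid k H (counit.lTensor H t) ⊗ₜ 1 := by
        intro t
        induction t with
        | zero => simp
        | add s t hs ht => simp only [map_add, LinearMap.add_apply, hs, ht, add_tmul]
        | tmul a b =>
          have := V.tAct_algebraMap b 1
          rw [map_one, one_mul] at this
          simp [this, Algebra.algebraMap_eq_smul_one, smul_tmul]
      have h2 : ∀ t : H ⊗[k] H, ydRight V.tAct V.tCoact.toLinearMap 1 t =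
          TensorProduct.lid k H (counit.rTensor H t) ⊗ₜ 1 := by
        intro t
        induction t with
        | zero => simp
        | add s t hs ht => simp only [map_add, hs, ht, add_tmul]
        | tmul a b =>
          have := V.tAct_algebraMap a 1
          rw [map_one, one_mul] at this
          simp [this, Algebra.algebraMap_eq_smul_one, Algebra.TensorProduct.one_def,
            smul_tmul']
      rw [h2, AlgHom.toLinearMap_apply, map_one, Algebra.TensorProduct.one_def, h1]
      simp
  | ι v =>
    exact YDAt.map (f := TensorAlgebra.ι k) ⟨fun h v => (V.tAct_ι h v).symm, V.tCoact_ι⟩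
      (V.ydAt v)
  | add x y hx hy => exact hx.add hy
  | mul x y hx hy => exact hx.mul V.tAct_mul hy

/-- `h ⊗ w ↦ (a ⊗ b ↦ h · a ⊗ w b)` for `h ∈ H`, `w ∈ V`, `a, b ∈ T(V)`. -/
def tBraidMul : H ⊗[k] V →ₗ[k] Module.End k (V.T ⊗[k] V.T) :=
  (Module.endTensorEndAlgHom (R := k) (S := k) (A := k)).toLinearMap ∘ₗ
    TensorProduct.map V.tAct.toLinearMap (LinearMap.mul k V.T ∘ₗ TensorAlgebra.ι k)

/-- Left multiplication by `v ⊗ 1 + 1 ⊗ v` in the braided tensor product algebra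
`T(V) ⊗ T(V)`, whose product is `(a ⊗ b) (a' ⊗ b') = a (b₍₋₁₎ · a') ⊗ b₍₀₎ b'`; that is,
`a ⊗ b ↦ v a ⊗ b + v₍₋₁₎ · a ⊗ v₍₀₎ b`. -/
def tComulLeft : V →ₗ[k] Module.End k (V.T ⊗[k] V.T) :=
  LinearMap.rTensorHom V.T ∘ₗ LinearMap.mul k V.T ∘ₗ TensorAlgebra.ι k + V.tBraidMul ∘ₗ V.coact

/-- The comultiplication of the braided Hopf algebra `T(V)`: the algebra map from `T(V)` to the
braided tensor product algebra `T(V) ⊗ T(V)` with `v ↦ v ⊗ 1 + 1 ⊗ v`, so that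
`Δ(v₁ ⋯ vₙ) = (v₁ ⊗ 1 + 1 ⊗ v₁) ⋯ (vₙ ⊗ 1 + 1 ⊗ vₙ)`. -/
def tComul : V.T →ₗ[k] V.T ⊗[k] V.T :=
  (TensorAlgebra.lift k V.tComulLeft).toLinearMap.flip (1 ⊗ₜ 1)

theorem tComul_one : V.tComul 1 = 1 ⊗ₜ 1 := by simp [tComul]

theorem tComul_ι_mul (v : V) (x : V.T) :
    V.tComul (TensorAlgebra.ι k v * x) = V.tComulLeft v (V.tComul x) := by simp [tComul]

@[simp] theorem tBraidMul_tmul (h : H) (w : V) (a b : V.T) :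
    V.tBraidMul (h ⊗ₜ w) (a ⊗ₜ b) = V.tAct h a ⊗ₜ (TensorAlgebra.ι k w * b) := rfl

theorem tComulLeft_apply (v : V) (t : V.T ⊗[k] V.T) :
    V.tComulLeft v t = (LinearMap.mulLeft k (TensorAlgebra.ι k v)).rTensor V.T t +
      V.tBraidMul (V.coact v) t := rfl

end YDMod

namespace YDMod

variable (V : YDMod.{u, w, v} k H)

/-! ### The Nichols algebra -/

/-- Two-sided ideals of `T(V)` that are Yetter-Drinfeld submodules and coideals,
`Δ(I) ⊆ I ⊗ T(V) + T(V) ⊗ I`, and are spanned by homogeneous elements of degree at least `2`. -/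
structure IsNicholsIdeal (I : Submodule k V.T) : Prop where
  mul_left : ∀ x : V.T, I ≤ I.comap (LinearMap.mulLeft k x)
  mul_right : ∀ x : V.T, I ≤ I.comap (LinearMap.mulRight k x)
  act : ∀ h : H, I ≤ I.comap (V.tAct h)
  coact : I ≤ (LinearMap.range (I.subtype.lTensor H)).comap V.tCoact.toLinearMap
  comul : I ≤ (LinearMap.range (I.subtype.rTensor V.T) ⊔
    LinearMap.range (I.subtype.lTensor V.T)).comap V.tComul
  graded : I ≤ ⨆ n : ℕ, I ⊓ LinearMap.range (TensorAlgebra.ι k (M := V.carrier)) ^ (n + 2)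

/-- The largest such ideal, as a subspace of `T(V)`. -/
def nicholsSub : Submodule k V.T := sSup {I | V.IsNicholsIdeal I}

variable {V}

theorem IsNicholsIdeal.le {I : Submodule k V.T} (hI : V.IsNicholsIdeal I) : I ≤ V.nicholsSub :=
  le_sSup hI

theorem range_lTensor_mono {A B : Type*} [AddCommGroup A] [Module k A] [AddCommGroup B]
    [Module k B] {P Q : Submodule k A} (h : P ≤ Q) :
    LinearMap.range (P.subtype.lTensor B) ≤ LinearMap.range (Q.subtype.lTensor B) := by
  rw [← Submodule.subtype_comp_inclusion P Q h, LinearMap.lTensor_comp]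
  exact LinearMap.range_comp_le_range _ _

theorem range_rTensor_mono {A B : Type*} [AddCommGroup A] [Module k A] [AddCommGroup B]
    [Module k B] {P Q : Submodule k A} (h : P ≤ Q) :
    LinearMap.range (P.subtype.rTensor B) ≤ LinearMap.range (Q.subtype.rTensor B) := by
  rw [← Submodule.subtype_comp_inclusion P Q h, LinearMap.rTensor_comp]
  exact LinearMap.range_comp_le_range _ _

variable (V)

theorem isNicholsIdeal_nicholsSub : V.IsNicholsIdeal V.nicholsSub where
  mul_left x := sSup_le fun _ hI =>
    ((hI : V.IsNicholsIdeal _).mul_left x).trans (Submodule.comap_mono hI.le)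
  mul_right x := sSup_le fun _ hI =>
    ((hI : V.IsNicholsIdeal _).mul_right x).trans (Submodule.comap_mono hI.le)
  act h := sSup_le fun _ hI =>
    ((hI : V.IsNicholsIdeal _).act h).trans (Submodule.comap_mono hI.le)
  coact := sSup_le fun _ hI =>
    (hI : V.IsNicholsIdeal _).coact.trans (Submodule.comap_mono (range_lTensor_mono hI.le))
  comul := sSup_le fun _ hI =>
    (hI : V.IsNicholsIdeal _).comul.trans
      (Submodule.comap_mono (sup_le_sup (range_rTensor_mono hI.le) (range_lTensor_mono hI.le)))
  graded := sSup_le fun _ hI =>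
    (hI : V.IsNicholsIdeal _).graded.trans (iSup_mono fun _ => inf_le_inf_right _ hI.le)

/-- The ideal of relations of the Nichols algebra. -/
def nicholsIdeal : Ideal V.T where
  carrier := V.nicholsSub
  add_mem' := V.nicholsSub.add_mem
  zero_mem' := V.nicholsSub.zero_mem
  smul_mem' x _ hy := V.isNicholsIdeal_nicholsSub.mul_left x hy

instance : V.nicholsIdeal.IsTwoSided :=
  ⟨fun b ha => V.isNicholsIdeal_nicholsSub.mul_right b ha⟩

/-- The Nichols algebra of `V`. -/
def Nichols : Type (max u v) := V.T ⧸ V.nicholsIdeal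

instance : Ring V.Nichols := inferInstanceAs (Ring (V.T ⧸ V.nicholsIdeal))

instance : Algebra k V.Nichols := inferInstanceAs (Algebra k (V.T ⧸ V.nicholsIdeal))

/-- The canonical projection from the tensor algebra to the Nichols algebra. -/
def nmk : V.T →ₐ[k] V.Nichols := Ideal.Quotient.mkₐ k V.nicholsIdeal

theorem nmk_surjective : Function.Surjective V.nmk := Ideal.Quotient.mkₐ_surjective k _

theorem nmk_eq_zero {x : V.T} : V.nmk x = 0 ↔ x ∈ V.nicholsSub :=
  Ideal.Quotient.eq_zero_iff_mem

theorem ker_nmk : LinearMap.ker V.nmk.toLinearMap = V.nicholsSub := by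
  ext x
  exact V.nmk_eq_zero

/-- The canonical embedding of `V` in its Nichols algebra. -/
def nι : V →ₗ[k] V.Nichols := V.nmk.toLinearMap ∘ₗ TensorAlgebra.ι k

/-- The action of `H` on the Nichols algebra, as a linear map `x ↦ (h ↦ h · x)`. -/
def nActFlip : V.Nichols →ₗ[k] H →ₗ[k] V.Nichols :=
  descend V.nmk.toLinearMap V.nmk_surjective
    (LinearMap.llcomp k H V.T V.Nichols V.nmk.toLinearMap ∘ₗ V.tAct.toLinearMap.flip)
    (by
      rw [ker_nmk]
      intro x hx
      ext h
      exact V.nmk_eq_zero.2 (V.isNicholsIdeal_nicholsSub.act h hx))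

theorem nActFlip_nmk (x : V.T) (h : H) : V.nActFlip (V.nmk x) h = V.nmk (V.tAct h x) :=
  LinearMap.congr_fun (descend_apply V.nmk.toLinearMap V.nmk_surjective _ _ x) h

/-- The action of `H` on the Nichols algebra. -/
def nAct : H →ₐ[k] Module.End k V.Nichols :=
  AlgHom.ofLinearMap V.nActFlip.flip
    (by
      refine LinearMap.ext fun x => ?_
      obtain ⟨x, rfl⟩ := V.nmk_surjective x
      rw [LinearMap.flip_apply, nActFlip_nmk, map_one]
      rfl)
    (fun g h => by
      refine LinearMap.ext fun x => ?_
      obtain ⟨x, rfl⟩ := V.nmk_surjective x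
      rw [Module.End.mul_apply, LinearMap.flip_apply, LinearMap.flip_apply, LinearMap.flip_apply,
        nActFlip_nmk, nActFlip_nmk, nActFlip_nmk, map_mul]
      rfl)

theorem nAct_nmk (h : H) (x : V.T) : V.nAct h (V.nmk x) = V.nmk (V.tAct h x) :=
  V.nActFlip_nmk x h

/-- The coaction of `H` on the Nichols algebra. -/
def nCoact : V.Nichols →ₐ[k] H ⊗[k] V.Nichols :=
  Ideal.Quotient.liftₐ V.nicholsIdeal
    ((Algebra.TensorProduct.map (AlgHom.id k H) V.nmk).comp V.tCoact)
    (by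
      intro x hx
      obtain ⟨y, hy⟩ := V.isNicholsIdeal_nicholsSub.coact hx
      have : (V.nmk.toLinearMap.lTensor H) (V.tCoact x) = 0 := by
        rw [← AlgHom.toLinearMap_apply, ← hy, ← LinearMap.lTensor_comp_apply,
          show V.nmk.toLinearMap ∘ₗ V.nicholsSub.subtype = 0 from
            LinearMap.ext fun z => V.nmk_eq_zero.2 z.2]
        simp
      exact this)

theorem nCoact_nmk (x : V.T) :
    V.nCoact (V.nmk x) = V.nmk.toLinearMap.lTensor H (V.tCoact x) := rfl

/-- The Nichols algebra as a Yetter-Drinfeld module. -/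
def nichols : YDMod.{u, w, max u v} k H where
  carrier := V.Nichols
  act := V.nAct
  coact := V.nCoact.toLinearMap
  ydAt x := by
    obtain ⟨x, rfl⟩ := V.nmk_surjective x
    exact (V.tYDAt x).map (f := V.nmk.toLinearMap)
      ⟨fun h x => (V.nAct_nmk h x).symm, fun x => V.nCoact_nmk x⟩

/-- The comultiplication of the Nichols algebra. -/
def nComul : V.Nichols →ₗ[k] V.Nichols ⊗[k] V.Nichols :=
  descend V.nmk.toLinearMap V.nmk_surjective
    (TensorProduct.map V.nmk.toLinearMap V.nmk.toLinearMap ∘ₗ V.tComul)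
    (by
      rw [LinearMap.ker_comp, ker_nmk]
      refine V.isNicholsIdeal_nicholsSub.comul.trans (Submodule.comap_mono ?_)
      have h0 : V.nmk.toLinearMap ∘ₗ V.nicholsSub.subtype = 0 :=
        LinearMap.ext fun z => V.nmk_eq_zero.2 z.2
      refine sup_le ?_ ?_ <;> rw [LinearMap.range_le_ker_iff]
      · rw [LinearMap.map_comp_rTensor, h0, TensorProduct.map_zero_left]
      · rw [LinearMap.map_comp_lTensor, h0, TensorProduct.map_zero_right])

theorem nComul_nmk (x : V.T) : V.nComul (V.nmk x) =
    TensorProduct.map V.nmk.toLinearMap V.nmk.toLinearMap (V.tComul x) :=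
  descend_apply V.nmk.toLinearMap _ _ _ _

end YDMod

namespace YDMod

variable {V : YDMod.{u, w, v} k H} {W : YDMod k H}

/-! ### Functoriality for surjective morphisms -/

/-- The algebra map `T(f) : T(V) → T(W)`. -/
def tMap (f : V →ₗ[k] W) : V.T →ₐ[k] W.T := TensorAlgebra.lift k (TensorAlgebra.ι k ∘ₗ f)

@[simp] theorem tMap_ι (f : V →ₗ[k] W) (v : V) :
    tMap f (TensorAlgebra.ι k v) = TensorAlgebra.ι k (f v) := by simp [tMap]

theorem tMap_surjective {f : V →ₗ[k] W} (hs : Function.Surjective f) :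
    Function.Surjective (tMap f) := by
  intro y
  induction y using TensorAlgebra.induction with
  | algebraMap r => exact ⟨algebraMap k _ r, by simp⟩
  | ι w =>
    obtain ⟨v, rfl⟩ := hs w
    exact ⟨TensorAlgebra.ι k v, tMap_ι f v⟩
  | add x y hx hy =>
    obtain ⟨x, rfl⟩ := hx
    obtain ⟨y, rfl⟩ := hy
    exact ⟨x + y, map_add _ _ _⟩
  | mul x y hx hy =>
    obtain ⟨x, rfl⟩ := hx
    obtain ⟨y, rfl⟩ := hy
    exact ⟨x * y, map_mul _ _ _⟩

theorem tMap_tAct {f : V →ₗ[k] W} (hf : IsHom f) (h : H) (x : V.T) :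
    tMap f (V.tAct h x) = W.tAct h (tMap f x) := by
  induction x using TensorAlgebra.induction generalizing h with
  | algebraMap r => simp only [tAct_algebraMap, AlgHom.commutes]
  | ι v => simp only [tAct_ι, tMap_ι, hf.map_act]
  | add x y hx hy => simp only [map_add, hx, hy]
  | mul x y hx hy =>
    rw [V.tAct_mul x y h, map_mul (tMap f) x y, W.tAct_mul _ _ h]
    generalize comul (R := k) h = t
    induction t with
    | zero => simp
    | add s t hs ht => simp only [map_add, hs, ht]
    | tmul a b => simp [hx, hy]

theorem tMap_tCoact {f : V →ₗ[k] W} (hf : IsHom f) (x : V.T) :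
    W.tCoact (tMap f x) = (tMap f).toLinearMap.lTensor H (V.tCoact x) := by
  have : W.tCoact.comp (tMap f) =
      (Algebra.TensorProduct.map (AlgHom.id k H) (tMap f)).comp V.tCoact := by
    ext v
    have e : ∀ t, (Algebra.TensorProduct.map (AlgHom.id k H) (tMap f)) t =
      (tMap f).toLinearMap.lTensor H t := fun t => rfl
    simp only [LinearMap.comp_apply, AlgHom.toLinearMap_apply, AlgHom.comp_apply, tMap_ι,
      tCoact_ι, hf.map_coact, e]
    rw [← LinearMap.lTensor_comp_apply, ← LinearMap.lTensor_comp_apply]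
    congr 2
    ext v
    simp
  exact DFunLike.congr_fun this x

theorem tMap_tComul {f : V →ₗ[k] W} (hf : IsHom f) (x : V.T) :
    W.tComul (tMap f x) =
      TensorProduct.map (tMap f).toLinearMap (tMap f).toLinearMap (V.tComul x) := by
  have key : ∀ (x : V.T) (t : V.T ⊗[k] V.T),
      TensorAlgebra.lift k W.tComulLeft (tMap f x)
        (TensorProduct.map (tMap f).toLinearMap (tMap f).toLinearMap t) =
      TensorProduct.map (tMap f).toLinearMap (tMap f).toLinearMap
        (TensorAlgebra.lift k V.tComulLeft x t) := by
    intro x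
    induction x using TensorAlgebra.induction with
    | algebraMap r => intro t; simp [Algebra.algebraMap_eq_smul_one]
    | add x y hx hy => intro t; simp only [map_add, LinearMap.add_apply, hx, hy]
    | mul x y hx hy => intro t; simp only [map_mul, Module.End.mul_apply, hx, hy]
    | ι v =>
      intro t
      rw [tMap_ι, TensorAlgebra.lift_ι_apply, TensorAlgebra.lift_ι_apply, tComulLeft_apply,
        tComulLeft_apply, hf.map_coact, map_add]
      congr 1
      · induction t with
        | zero => simp
        | add s t hs ht => simp only [map_add, hs, ht]
        | tmul a b => simp
      · generalize V.coact v = s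
        induction s with
        | zero => simp
        | add r s hr hs => simp only [map_add, LinearMap.add_apply, hr, hs]
        | tmul h w =>
          induction t with
          | zero => simp
          | add s t hs ht => simp only [map_add, hs, ht]
          | tmul a b => simp [tMap_tAct hf]
  simpa [tComul] using key x (1 ⊗ₜ 1)

theorem isNicholsIdeal_map {f : V →ₗ[k] W} (hf : IsHom f) (hs : Function.Surjective f) :
    W.IsNicholsIdeal (V.nicholsSub.map (tMap f).toLinearMap) where
  mul_left y := by
    obtain ⟨x, rfl⟩ := tMap_surjective hs y
    rintro _ ⟨z, hz, rfl⟩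
    exact ⟨x * z, V.isNicholsIdeal_nicholsSub.mul_left x hz, map_mul (tMap f) _ _⟩
  mul_right y := by
    obtain ⟨x, rfl⟩ := tMap_surjective hs y
    rintro _ ⟨z, hz, rfl⟩
    exact ⟨z * x, V.isNicholsIdeal_nicholsSub.mul_right x hz, map_mul (tMap f) _ _⟩
  act h := by
    rintro _ ⟨z, hz, rfl⟩
    exact ⟨V.tAct h z, V.isNicholsIdeal_nicholsSub.act h hz, tMap_tAct hf h z⟩
  coact := by
    rintro _ ⟨z, hz, rfl⟩
    obtain ⟨t, ht⟩ := V.isNicholsIdeal_nicholsSub.coact hz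
    refine ⟨((tMap f).toLinearMap.submoduleMap V.nicholsSub).lTensor H t, ?_⟩
    rw [AlgHom.toLinearMap_apply, AlgHom.toLinearMap_apply, tMap_tCoact hf,
      ← AlgHom.toLinearMap_apply V.tCoact, ← ht, ← LinearMap.lTensor_comp_apply,
      ← LinearMap.lTensor_comp_apply]
    rfl
  comul := by
    rintro _ ⟨z, hz, rfl⟩
    rw [Submodule.mem_comap, AlgHom.toLinearMap_apply, tMap_tComul hf]
    have hm := Submodule.mem_map_of_mem
      (f := TensorProduct.map (tMap f).toLinearMap (tMap f).toLinearMap)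
      (Submodule.mem_comap.1 (V.isNicholsIdeal_nicholsSub.comul hz))
    refine (?_ : Submodule.map _ _ ≤ _) hm
    rw [Submodule.map_sup]
    refine sup_le_sup ?_ ?_
    · rintro _ ⟨_, ⟨t, rfl⟩, rfl⟩
      refine ⟨TensorProduct.map ((tMap f).toLinearMap.submoduleMap V.nicholsSub)
        (tMap f).toLinearMap t, ?_⟩
      induction t with
      | zero => simp
      | add s t hs ht => simp only [map_add, hs, ht]
      | tmul a b => rfl
    · rintro _ ⟨_, ⟨t, rfl⟩, rfl⟩
      refine ⟨TensorProduct.map (tMap f).toLinearMap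
        ((tMap f).toLinearMap.submoduleMap V.nicholsSub) t, ?_⟩
      induction t with
      | zero => simp
      | add s t hs ht => simp only [map_add, hs, ht]
      | tmul a b => rfl
  graded := by
    refine (Submodule.map_mono V.isNicholsIdeal_nicholsSub.graded).trans ?_
    rw [Submodule.map_iSup]
    refine iSup_mono fun n => (Submodule.map_inf_le _).trans (inf_le_inf_left _ ?_)
    rw [Submodule.map_pow]
    refine pow_le_pow_left' ?_ _
    rintro _ ⟨_, ⟨v, rfl⟩, rfl⟩
    exact ⟨f v, (tMap_ι f v).symm⟩

/-- The algebra map `B(V) → B(W)` induced by a surjective morphism `V → W`. -/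
def nMap (f : V →ₗ[k] W) (hf : IsHom f) (hs : Function.Surjective f) : V.Nichols →ₐ[k] W.Nichols :=
  Ideal.Quotient.liftₐ V.nicholsIdeal (W.nmk.comp (tMap f)) (fun x hx =>
    W.nmk_eq_zero.2 ((isNicholsIdeal_map hf hs).le ⟨x, hx, rfl⟩))

end YDMod

namespace YDMod

/-! ### Finite direct sums -/

theorem ydAt_zero (V : YDMod.{u, w, v} k H) : YDAt V.act V.coact 0 := V.ydAt 0

section Pi

variable {ι : Type} [Fintype ι] [DecidableEq ι] (M : ι → YDMod.{u, w, v} k H)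

/-- The componentwise action on a direct sum. -/
def piAct : H →ₐ[k] Module.End k (∀ j, M j) :=
  AlgHom.ofLinearMap
    { toFun := fun h => LinearMap.pi fun j => (M j).act h ∘ₗ LinearMap.proj j
      map_add' := fun g h => by ext; simp
      map_smul' := fun c h => by ext; simp }
    (by ext; simp) (fun g h => by ext; simp)

/-- The componentwise coaction on a direct sum. -/
def piCoact : (∀ j, M j) →ₗ[k] H ⊗[k] (∀ j, M j) :=
  ∑ j, (LinearMap.single k (fun j => (M j).carrier) j).lTensor H ∘ₗ (M j).coact ∘ₗ
    LinearMap.proj j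

theorem single_isYDMap (j : ι) : IsYDMap (M j).act (M j).coact (piAct M) (piCoact M)
    (LinearMap.single k (fun j => (M j).carrier) j) where
  map_act h v := by
    ext i
    by_cases hij : i = j
    · subst hij
      simp [piAct]
    · simp [piAct, Pi.single_eq_of_ne hij]
  map_coact v := by
    simp only [piCoact, LinearMap.sum_apply, LinearMap.comp_apply]
    rw [Finset.sum_eq_single j]
    · simp
    · intro i _ hij
      simp [Pi.single_eq_of_ne hij]
    · simp

/-- The direct sum of a finite family of Yetter-Drinfeld modules. -/
def pi : YDMod.{u, w, v} k H where
  carrier := ∀ j, M j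
  act := piAct M
  coact := piCoact M
  ydAt x := by
    rw [← Finset.univ_sum_single x]
    refine Finset.sum_induction _ (YDAt (piAct M) (piCoact M)) (fun _ _ => YDAt.add) ?_ ?_
    · refine ⟨by simp, by simp, fun h => ?_⟩
      have := ydRight_smul (piAct M) (piCoact M) 0 0 (comul h)
      rw [zero_smul, zero_smul] at this
      rw [this]
      simp
    · intro j _
      exact ((M j).ydAt (x j)).map (single_isYDMap M j)

instance [∀ j, FiniteDimensional k (M j)] : FiniteDimensional k (pi M) :=
  inferInstanceAs (FiniteDimensional k (∀ j, M j))

/-- The inclusion of a summand. -/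
def single (j : ι) : M j →ₗ[k] pi M := LinearMap.single k (fun j => (M j).carrier) j

/-- The projection to a summand. -/
def proj (j : ι) : pi M →ₗ[k] M j := LinearMap.proj (φ := fun j => (M j).carrier) j

theorem single_isHom (j : ι) : IsHom (single M j) := single_isYDMap M j

theorem proj_surjective (j : ι) : Function.Surjective (proj M j) :=
  LinearMap.proj_surjective j

theorem proj_isHom (j : ι) : IsHom (proj M j) where
  map_act h x := rfl
  map_coact x := by
    have e : ∀ y : ∀ i, M i, (M j).coact (y j) =
        (LinearMap.proj (R := k) (φ := fun j => (M j).carrier) j).lTensor H (piCoact M y) := by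
      intro y
      simp only [piCoact, LinearMap.sum_apply, LinearMap.comp_apply, LinearMap.proj_apply, map_sum]
      rw [Finset.sum_eq_single j]
      · rw [← LinearMap.lTensor_comp_apply, LinearMap.proj_comp_single_same, LinearMap.lTensor_id]
        rfl
      · intro i _ hij
        rw [← LinearMap.lTensor_comp_apply, LinearMap.proj_comp_single_ne k _ j i hij.symm]
        simp
      · simp
    exact e x

end Pi

/-! ### Duals -/

section Dual

variable (V : YDMod.{u, w, v} k H)

/-- The action `⟨h · f, v⟩ = ⟨f, S(h) · v⟩` on the dual space. -/
def dualAct : H →ₐ[k] Module.End k (Module.Dual k V) :=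
  AlgHom.ofLinearMap (Module.Dual.transpose (R := k) ∘ₗ V.act.toLinearMap ∘ₗ antipode k)
    (by
      refine LinearMap.ext fun f => LinearMap.ext fun v => ?_
      change f (V.act (antipode k 1) v) = f v
      rw [antipode_one, map_one]
      rfl)
    (fun g h => by
      refine LinearMap.ext fun f => LinearMap.ext fun v => ?_
      change f (V.act (antipode k (g * h)) v) = f (V.act (antipode k h) (V.act (antipode k g) v))
      rw [antipode_mul_antidistrib, map_mul]
      rfl)

theorem dualAct_apply (h : H) (f : Module.Dual k V) (v : V) :
    V.dualAct h f v = f (V.act (antipode k h) v) := rfl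

variable [FiniteDimensional k V]

theorem dual_tensor_apply {X : Type*} [AddCommGroup X] [Module k X]
    (t : X ⊗[k] Module.Dual k V) (v : V) :
    lTensorHomEquivHomLTensor k V.carrier X k t v = (Module.Dual.eval k V v).lTensor X t := by
  rw [lTensorHomEquivHomLTensor_apply]
  induction t with
  | zero => simp
  | add s t hs ht => simp only [map_add, LinearMap.add_apply, hs, ht]
  | tmul a b => simp

theorem dual_tensor_ext {X : Type*} [AddCommGroup X] [Module k X]
    {s t : X ⊗[k] Module.Dual k V}
    (h : ∀ v : V, (Module.Dual.eval k V v).lTensor X s = (Module.Dual.eval k V v).lTensor X t) :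
    s = t := by
  apply (lTensorHomEquivHomLTensor k V.carrier X k).injective
  ext v
  rw [dual_tensor_apply, dual_tensor_apply, h]

variable [BijectiveAntipode k H]

/-- The coaction on the dual space, determined by
`f₍₋₁₎ ⟨f₍₀₎, v⟩ = S⁻¹(v₍₋₁₎) ⟨f, v₍₀₎⟩`. -/
def dualCoact : Module.Dual k V →ₗ[k] H ⊗[k] Module.Dual k V :=
  (lTensorHomEquivHomLTensor k V.carrier H k).symm.toLinearMap ∘ₗ
    LinearMap.lcomp k (H ⊗[k] k) ((antipodeInv k).rTensor V ∘ₗ V.coact) ∘ₗ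
    LinearMap.lTensorHom H

theorem dualCoact_spec (f : Module.Dual k V) (v : V) :
    (Module.Dual.eval k V v).lTensor H (V.dualCoact f) =
      f.lTensor H ((antipodeInv k).rTensor V (V.coact v)) := by
  rw [← dual_tensor_apply]
  simp [dualCoact]

theorem dual_ydAt (f : Module.Dual k V) : YDAt V.dualAct V.dualCoact f where
  counit_coact := by
    refine V.dual_tensor_ext fun v => ?_
    rw [← LinearMap.comp_apply, LinearMap.lTensor_comp_rTensor, ← LinearMap.rTensor_comp_lTensor,
      LinearMap.comp_apply, dualCoact_spec, ← LinearMap.comp_apply,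
      LinearMap.rTensor_comp_lTensor, ← LinearMap.lTensor_comp_rTensor, LinearMap.comp_apply,
      ← LinearMap.rTensor_comp_apply,
      show counit ∘ₗ antipodeInv k = (counit : H →ₗ[k] k) from
        LinearMap.ext (counit_antipodeInv k), (V.ydAt v).counit_coact]
    rfl
  coassoc := by
    rw [← LinearEquiv.eq_symm_apply]
    refine V.dual_tensor_ext fun v => ?_
    let N : H ⊗[k] (H ⊗[k] V) →ₗ[k] (H ⊗[k] H) ⊗[k] k :=
      TensorProduct.map ((TensorProduct.comm k H H).toLinearMap ∘ₗ
        TensorProduct.map (antipodeInv k) (antipodeInv k)) f ∘ₗ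
        (TensorProduct.assoc k H H V).symm.toLinearMap
    have hL : (Module.Dual.eval k V v).lTensor (H ⊗[k] H)
        ((comul (R := k) (A := H)).rTensor (Module.Dual k V) (V.dualCoact f)) =
        N (TensorProduct.assoc k H H V ((comul (R := k) (A := H)).rTensor V (V.coact v))) := by
      rw [← LinearMap.comp_apply, LinearMap.lTensor_comp_rTensor,
        ← LinearMap.rTensor_comp_lTensor, LinearMap.comp_apply, dualCoact_spec]
      generalize V.coact v = s
      induction s with
      | zero => simp
      | add s t hs ht => simp only [map_add, hs, ht]
      | tmul a w => simp [N, comul_antipodeInv_eq]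
    let P : H ⊗[k] (H ⊗[k] k) →ₗ[k] (H ⊗[k] H) ⊗[k] k :=
      (TensorProduct.comm k H H).toLinearMap.rTensor k ∘ₗ
        (TensorProduct.assoc k H H k).symm.toLinearMap
    have h1 : ∀ (s : H ⊗[k] V) (t : H ⊗[k] Module.Dual k V),
        (TensorProduct.assoc k H H k).symm
          ((LinearMap.lTensorHom H).flip s |>.lTensor H t) =
        P (((lTensorHomEquivHomLTensor k V.carrier H k) t).lTensor H s) := by
      intro s t
      induction s with
      | zero => simp
      | add r s hr hs => simp only [map_add, LinearMap.lTensor_add, LinearMap.add_apply, hr, hs]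
      | tmul a w =>
        induction t with
        | zero => simp
        | add r s hr hs =>
          simp only [map_add, hr, hs, LinearMap.lTensor_add, LinearMap.add_apply]
        | tmul b g => simp [P]
    have hR : (Module.Dual.eval k V v).lTensor (H ⊗[k] H) ((TensorProduct.assoc k H H _).symm
        (V.dualCoact.lTensor H (V.dualCoact f))) = N (V.coact.lTensor H (V.coact v)) := by
      have e1 : ∀ t : H ⊗[k] (H ⊗[k] Module.Dual k V),
          (Module.Dual.eval k V v).lTensor (H ⊗[k] H) ((TensorProduct.assoc k H H _).symm t) =
          (TensorProduct.assoc k H H k).symm (((Module.Dual.eval k V v).lTensor H).lTensor H t) := by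
        intro t
        rw [LinearMap.lTensor_tensor]
        simp
      have e2 : (Module.Dual.eval k V v).lTensor H ∘ₗ V.dualCoact =
          (LinearMap.lTensorHom H).flip ((antipodeInv k).rTensor V (V.coact v)) :=
        LinearMap.ext fun g => V.dualCoact_spec g v
      have e3 : (lTensorHomEquivHomLTensor k V.carrier H k) (V.dualCoact f) =
          f.lTensor H ∘ₗ (antipodeInv k).rTensor V ∘ₗ V.coact := by
        ext w
        rw [dual_tensor_apply, dualCoact_spec]
        rfl
      rw [e1, ← LinearMap.lTensor_comp_apply, e2, h1, e3]
      generalize V.coact v = s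
      induction s with
      | zero => simp
      | add s t hs ht => simp only [map_add, hs, ht]
      | tmul a w =>
        simp only [LinearMap.rTensor_tmul, LinearMap.lTensor_tmul, LinearMap.comp_apply]
        generalize V.coact w = s
        induction s with
        | zero => simp
        | add s t hs ht => simp only [tmul_add, map_add, hs, ht]
        | tmul b w => simp [N, P]
    rw [hL, hR, (V.ydAt v).coassoc]
  compat h := by
    refine V.dual_tensor_ext fun v => ?_
    let Q : H ⊗[k] V →ₗ[k] H ⊗[k] k := TensorProduct.map (antipodeInv k) f
    have hL : ∀ t : H ⊗[k] H, (Module.Dual.eval k V v).lTensor H (ydLeft V.dualAct t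
        (V.dualCoact f)) = Q (ydRight V.act V.coact v (TensorProduct.comm k H H
          (TensorProduct.map (antipode k) (antipode k) t))) := by
      intro t
      induction t with
      | zero => simp
      | add s t hs ht => simp only [map_add, LinearMap.add_apply, hs, ht]
      | tmul a b =>
        have e : ∀ s : H ⊗[k] Module.Dual k V, (Module.Dual.eval k V v).lTensor H
            (ydLeft V.dualAct (a ⊗ₜ b) s) = (LinearMap.mulLeft k a).rTensor k
            ((Module.Dual.eval k V (V.act (antipode k b) v)).lTensor H s) := by
          intro s
          induction s with
          | zero => simp
          | add s t hs ht => simp only [map_add, hs, ht]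
          | tmul x y => simp [dualAct_apply]
        rw [e, dualCoact_spec]
        simp only [map_tmul, comm_tmul, ydRight_tmul]
        generalize V.coact (V.act (antipode k b) v) = s
        induction s with
        | zero => simp
        | add s t hs ht => simp only [map_add, hs, ht]
        | tmul x y => simp [Q, antipodeInv_mul, antipodeInv_antipode]
    have hR : ∀ t : H ⊗[k] H, (Module.Dual.eval k V v).lTensor H (ydRight V.dualAct
        V.dualCoact f t) = Q (ydLeft V.act (TensorProduct.comm k H H
          (TensorProduct.map (antipode k) (antipode k) t)) (V.coact v)) := by
      intro t
      induction t with
      | zero => simp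
      | add s t hs ht => simp only [map_add, LinearMap.add_apply, hs, ht]
      | tmul a b =>
        rw [ydRight_tmul, ← LinearMap.comp_apply, LinearMap.lTensor_comp_rTensor,
          ← LinearMap.rTensor_comp_lTensor, LinearMap.comp_apply, dualCoact_spec]
        simp only [map_tmul, comm_tmul]
        generalize V.coact v = s
        induction s with
        | zero => simp
        | add s t hs ht => simp only [map_add, hs, ht]
        | tmul x y => simp [Q, antipodeInv_mul, antipodeInv_antipode, dualAct_apply]
    rw [hL, hR, ← comul_antipode_eq, (V.ydAt v).compat]

/-- The (left) dual `V*` of a finite-dimensional Yetter-Drinfeld module. -/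
def dual : YDMod.{u, w, max u v} k H where
  carrier := Module.Dual k V
  act := V.dualAct
  coact := V.dualCoact
  ydAt := V.dual_ydAt

instance : FiniteDimensional k V.dual :=
  inferInstanceAs (FiniteDimensional k (Module.Dual k V))

end Dual

end YDMod

namespace YDMod

/-! ### Skew derivations -/

section Counit

variable (V : YDMod.{u, w, v} k H)

theorem t_induction {S : Submodule k V.T} (h1 : (1 : V.T) ∈ S)
    (hm : ∀ v, ∀ x ∈ S, TensorAlgebra.ι k v * x ∈ S) (x : V.T) : x ∈ S := by
  have key : ∀ x : V.T, ∀ y ∈ S, x * y ∈ S := by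
    intro x
    induction x using TensorAlgebra.induction with
    | algebraMap r => intro y hy; rw [← Algebra.smul_def]; exact S.smul_mem r hy
    | ι v => exact hm v
    | add a b ha hb => intro y hy; rw [add_mul]; exact S.add_mem (ha y hy) (hb y hy)
    | mul a b ha hb => intro y hy; rw [mul_assoc]; exact ha _ (hb y hy)
  simpa using key x 1 h1

/-- The counit of `T(V)`. -/
def tCounit : V.T →ₐ[k] k := TensorAlgebra.algebraMapInv

@[simp] theorem tCounit_ι (v : V) : V.tCounit (TensorAlgebra.ι k v) = 0 := by
  simp [tCounit, TensorAlgebra.algebraMapInv]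

/-- The projection of `T(V)` to its component `V` of degree `1`. -/
def tPr : V.T →ₗ[k] V := TensorAlgebra.ιInv

theorem tPr_ι (v : V) : V.tPr (TensorAlgebra.ι k v) = v := TensorAlgebra.ι_leftInverse v

theorem tPr_one : V.tPr 1 = 0 := by
  let _ : Module kᵐᵒᵖ V := Module.compHom _ ((RingHom.id k).fromOpposite mul_comm)
  have _ : IsCentralScalar k V := ⟨fun r m => rfl⟩
  change (TensorAlgebra.toTrivSqZeroExt (R := k) (M := V.carrier) 1).snd = 0
  rw [map_one]
  rfl

theorem tPr_ι_mul (v : V) (x : V.T) :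
    V.tPr (TensorAlgebra.ι k v * x) = V.tCounit x • v := by
  let _ : Module kᵐᵒᵖ V := Module.compHom _ ((RingHom.id k).fromOpposite mul_comm)
  have _ : IsCentralScalar k V := ⟨fun r m => rfl⟩
  have e : (TrivSqZeroExt.fstHom k k V).comp (TensorAlgebra.toTrivSqZeroExt (R := k)) =
      V.tCounit := by
    ext v
    simp [tCounit_ι]
  rw [← e]
  simp [tPr, TensorAlgebra.ιInv]

theorem tCounit_tAct (h : H) (x : V.T) :
    V.tCounit (V.tAct h x) = counit (R := k) h * V.tCounit x := by
  induction x using TensorAlgebra.induction generalizing h with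
  | algebraMap r => rw [tAct_algebraMap, AlgHom.commutes, AlgHom.commutes]; simp [mul_comm]
  | ι v => rw [tAct_ι]; simp
  | add x y hx hy => simp only [map_add, hx, hy, mul_add]
  | mul x y hx hy =>
    rw [V.tAct_mul x y h]
    have : ∀ t : H ⊗[k] H, V.tCounit (LinearMap.mul' k V.T
        (TensorProduct.map (V.tAct.toLinearMap.flip x) (V.tAct.toLinearMap.flip y) t)) =
        counit (R := k) (TensorProduct.lid k H (counit.rTensor H t)) *
          (V.tCounit x * V.tCounit y) := by
      intro t
      induction t with
      | zero => simp
      | add s t hs ht => simp only [map_add, hs, ht, add_mul]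
      | tmul a b => simp [hx, hy]; ring
    rw [this]
    simp

theorem tPr_tAct (h : H) (x : V.T) : V.tPr (V.tAct h x) = V.act h (V.tPr x) := by
  let S : Submodule k V.T :=
    ⨅ h : H, LinearMap.eqLocus (V.tPr ∘ₗ V.tAct h) (V.act h ∘ₗ V.tPr)
  suffices x ∈ S from (Submodule.mem_iInf _).1 this h
  refine V.t_induction ?_ ?_ x
  · refine (Submodule.mem_iInf _).2 fun h => ?_
    have := V.tAct_algebraMap h 1
    rw [map_one, one_mul] at this
    change V.tPr (V.tAct h 1) = V.act h (V.tPr 1)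
    rw [this, Algebra.algebraMap_eq_smul_one, map_smul, tPr_one]
    simp
  · intro v x _
    refine (Submodule.mem_iInf _).2 fun h => ?_
    change V.tPr (V.tAct h (TensorAlgebra.ι k v * x)) = V.act h (V.tPr (TensorAlgebra.ι k v * x))
    rw [V.tAct_mul _ _ h, tPr_ι_mul]
    have : ∀ t : H ⊗[k] H, V.tPr (LinearMap.mul' k V.T
        (TensorProduct.map (V.tAct.toLinearMap.flip (TensorAlgebra.ι k v))
          (V.tAct.toLinearMap.flip x) t)) =
        V.tCounit x • V.act (TensorProduct.rid k H (counit.lTensor H t)) v := by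
      intro t
      induction t with
      | zero => simp
      | add s t hs ht => simp only [map_add, hs, ht, LinearMap.add_apply, smul_add]
      | tmul a b => simp [tAct_ι, tPr_ι_mul, tCounit_tAct, smul_smul, mul_comm]
    rw [this]
    simp

/-- `ε(x⁽¹⁾) x⁽²⁾ = x`. -/
theorem counit_tComul (x : V.T) :
    TensorProduct.lid k V.T (V.tCounit.toLinearMap.rTensor V.T (V.tComul x)) = x := by
  let F : V.T ⊗[k] V.T →ₗ[k] V.T :=
    (TensorProduct.lid k V.T).toLinearMap ∘ₗ V.tCounit.toLinearMap.rTensor V.T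
  suffices x ∈ LinearMap.eqLocus (F ∘ₗ V.tComul) LinearMap.id from this
  refine V.t_induction ?_ ?_ x
  · simp [LinearMap.mem_eqLocus, tComul_one, F]
  · intro v x hx
    replace hx : F (V.tComul x) = x := hx
    change F (V.tComul (TensorAlgebra.ι k v * x)) = TensorAlgebra.ι k v * x
    have h1 : ∀ t, F ((LinearMap.mulLeft k (TensorAlgebra.ι k v)).rTensor V.T t) = 0 := by
      intro t
      induction t with
      | zero => simp
      | add s t hs ht => simp only [map_add, hs, ht, add_zero]
      | tmul a b => simp [F]
    have h2 : ∀ s t, F (V.tBraidMul s t) =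
        TensorAlgebra.ι k (TensorProduct.lid k V (counit.rTensor V s)) * F t := by
      intro s t
      induction s with
      | zero => simp
      | add r s hr hs => simp only [map_add, LinearMap.add_apply, hr, hs, add_mul]
      | tmul h w =>
        induction t with
        | zero => simp
        | add s t hs ht => simp only [map_add, hs, ht, mul_add]
        | tmul a b => simp [F, tCounit_tAct, smul_smul, mul_comm]
    rw [tComul_ι_mul, tComulLeft_apply, map_add, h1, h2, hx, (V.ydAt v).counit_coact]
    simp

/-- `x⁽¹⁾ ε(x⁽²⁾) = x`. -/
theorem tComul_counit (x : V.T) :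
    TensorProduct.rid k V.T (V.tCounit.toLinearMap.lTensor V.T (V.tComul x)) = x := by
  let F : V.T ⊗[k] V.T →ₗ[k] V.T :=
    (TensorProduct.rid k V.T).toLinearMap ∘ₗ V.tCounit.toLinearMap.lTensor V.T
  suffices x ∈ LinearMap.eqLocus (F ∘ₗ V.tComul) LinearMap.id from this
  refine V.t_induction ?_ ?_ x
  · simp [LinearMap.mem_eqLocus, tComul_one, F]
  · intro v x hx
    replace hx : F (V.tComul x) = x := hx
    change F (V.tComul (TensorAlgebra.ι k v * x)) = TensorAlgebra.ι k v * x
    have h1 : ∀ t, F ((LinearMap.mulLeft k (TensorAlgebra.ι k v)).rTensor V.T t) =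
        TensorAlgebra.ι k v * F t := by
      intro t
      induction t with
      | zero => simp
      | add s t hs ht => simp only [map_add, hs, ht, mul_add]
      | tmul a b => simp [F]
    have h2 : ∀ s t, F (V.tBraidMul s t) = 0 := by
      intro s t
      induction s with
      | zero => simp
      | add r s hr hs => simp only [map_add, LinearMap.add_apply, hr, hs, add_zero]
      | tmul h w =>
        induction t with
        | zero => simp
        | add s t hs ht => simp only [map_add, hs, ht, add_zero]
        | tmul a b => simp [F]
    rw [tComul_ι_mul, tComulLeft_apply, map_add, h1, h2, hx, add_zero]

theorem graded_le : V.nicholsSub ≤ LinearMap.ker V.tPr ⊓ LinearMap.ker V.tCounit.toLinearMap := by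
  refine V.isNicholsIdeal_nicholsSub.graded.trans (iSup_le fun n => inf_le_right.trans ?_)
  rw [pow_succ', Submodule.mul_le]
  rintro _ ⟨v, rfl⟩ y hy
  have hy0 : V.tCounit y = 0 := by
    rw [pow_succ'] at hy
    refine Submodule.mul_induction_on hy ?_ ?_
    · rintro _ ⟨w, rfl⟩ z _
      simp
    · intro a b ha hb
      rw [map_add, ha, hb, add_zero]
  constructor
  · change V.tPr _ = 0
    rw [tPr_ι_mul, hy0, zero_smul]
  · simp

end Counit

end YDMod

namespace YDMod

section Derivation

variable {V W : YDMod.{u, w, v} k H} [FiniteDimensional k V] [BijectiveAntipode k H]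

/-- An element of `V*` as a linear form on `V`. -/
def dualForm : V.dual →ₗ[k] (V →ₗ[k] k) := (LinearMap.id : Module.Dual k V →ₗ[k] Module.Dual k V)

/-- The evaluation of elements of `V*` at a vector of `V`. -/
def dualEval (v : V) : V.dual →ₗ[k] k := dualForm.flip v

theorem dualEval_apply (v : V) (f : V.dual) : dualEval v f = dualForm f v := rfl

theorem dualForm_act (f : V.dual) (h : H) (v : V) :
    dualForm f (V.act h v) = dualForm (V.dual.act (antipodeInv k h) f) v := by
  change _ = dualForm f (V.act (antipode k (antipodeInv k h)) v)
  rw [antipode_antipodeInv]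

theorem dual_coact_eval (f : V.dual) (v : V) :
    (dualEval v).lTensor H (V.dual.coact f) =
      (dualForm f).lTensor H ((antipodeInv k).rTensor V (V.coact v)) :=
  V.dualCoact_spec f v

/-- For `f ∈ V*` and a linear map `p : W → V` the map `x ↦ ⟨f, p(x⁽¹⁾)⟩ x⁽²⁾` on `T(W)`, where
`f ∘ p` is extended by zero to the components of `T(W)` of degree other than `1`. -/
def tDer (p : W →ₗ[k] V) : V.dual →ₗ[k] Module.End k W.T where
  toFun f := (TensorProduct.lid k W.T).toLinearMap ∘ₗ
    (dualForm f ∘ₗ p ∘ₗ W.tPr).rTensor W.T ∘ₗ W.tComul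
  map_add' f g := by
    refine LinearMap.ext fun x => ?_
    simp only [map_add, LinearMap.add_comp, LinearMap.comp_add, LinearMap.rTensor_add]
  map_smul' c f := by
    refine LinearMap.ext fun x => ?_
    simp only [map_smul, LinearMap.smul_comp, LinearMap.comp_smul, LinearMap.rTensor_smul,
      RingHom.id_apply]

theorem tDer_apply (p : W →ₗ[k] V) (f : V.dual) (x : W.T) : tDer p f x =
    TensorProduct.lid k W.T ((dualForm f ∘ₗ p ∘ₗ W.tPr).rTensor W.T (W.tComul x)) := rfl

theorem tDer_one (p : W →ₗ[k] V) (f : V.dual) : tDer p f 1 = 0 := by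
  rw [tDer_apply, tComul_one]
  simp [tPr_one]

theorem tDer_ι_mul {p : W →ₗ[k] V} (hp : IsHom p) (f : V.dual) (y : W) (c : W.T) :
    tDer p f (TensorAlgebra.ι k y * c) = dualEval (p y) f • c +
      LinearMap.mul' k W.T (TensorProduct.comm k W.T W.T (TensorProduct.map
        ((tDer p).flip c ∘ₗ V.dual.act.toLinearMap.flip f ∘ₗ antipodeInv k) (TensorAlgebra.ι k)
          (W.coact y))) := by
  rw [tDer_apply, tComul_ι_mul, tComulLeft_apply, map_add, map_add]
  congr 1
  · have e : ∀ t : W.T ⊗[k] W.T, TensorProduct.lid k W.T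
        ((dualForm f ∘ₗ p ∘ₗ W.tPr).rTensor W.T
          ((LinearMap.mulLeft k (TensorAlgebra.ι k y)).rTensor W.T t)) =
        dualEval (p y) f • TensorProduct.lid k W.T (W.tCounit.toLinearMap.rTensor W.T t) := by
      intro t
      induction t with
      | zero => simp
      | add s t hs ht => simp only [map_add, hs, ht, smul_add]
      | tmul a b =>
        simp only [LinearMap.rTensor_tmul, LinearMap.comp_apply, LinearMap.mulLeft_apply,
          tPr_ι_mul, map_smul, TensorProduct.lid_tmul, AlgHom.toLinearMap_apply, smul_smul]
        rw [mul_comm, smul_eq_mul]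
        rfl
    rw [e, counit_tComul]
  · generalize W.coact y = s
    induction s with
    | zero => simp
    | add r s hr hs => simp only [map_add, LinearMap.add_apply, hr, hs]
    | tmul h z =>
      have e : ∀ t : W.T ⊗[k] W.T, TensorProduct.lid k W.T
          ((dualForm f ∘ₗ p ∘ₗ W.tPr).rTensor W.T (W.tBraidMul (h ⊗ₜ z) t)) =
          TensorAlgebra.ι k z * TensorProduct.lid k W.T
            ((dualForm (V.dual.act (antipodeInv k h) f) ∘ₗ p ∘ₗ W.tPr).rTensor W.T
              t) := by
        intro t
        induction t with
        | zero => simp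
        | add s t hs ht => simp only [map_add, hs, ht, mul_add]
        | tmul a b =>
          simp only [tBraidMul_tmul, LinearMap.rTensor_tmul, LinearMap.comp_apply,
            TensorProduct.lid_tmul, tPr_tAct, hp.map_act, mul_smul_comm]
          congr 1
          exact dualForm_act f h _
      rw [e]
      rfl

/-- The algebra map `T(V*) → End(T(W))` extending `tDer`. -/
def tDerHom (p : W →ₗ[k] V) : V.dual.T →ₐ[k] Module.End k W.T := TensorAlgebra.lift k (tDer p)

theorem tDerHom_ι_mul (p : W →ₗ[k] V) (f : V.dual) (ξ : V.dual.T) (c : W.T) :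
    tDerHom p (TensorAlgebra.ι k f * ξ) c = tDer p f (tDerHom p ξ c) := by
  simp [tDerHom]

theorem tDerHom_one_right (p : W →ₗ[k] V) (ξ : V.dual.T) :
    tDerHom p ξ 1 = V.dual.tCounit ξ • (1 : W.T) := by
  suffices ξ ∈ LinearMap.eqLocus ((tDerHom p).toLinearMap.flip 1)
    (V.dual.tCounit.toLinearMap.smulRight (1 : W.T)) from this
  refine V.dual.t_induction ?_ ?_ ξ
  · simp [LinearMap.mem_eqLocus]
  · intro f η hη
    replace hη : tDerHom p η 1 = V.dual.tCounit η • (1 : W.T) := hη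
    change tDerHom p (TensorAlgebra.ι k f * η) 1 = V.dual.tCounit (TensorAlgebra.ι k f * η) • 1
    rw [tDerHom_ι_mul, hη, map_smul, tDer_one]
    simp

/-- `h ⊗ y ↦ y ∂_{S⁻¹(h) · ξ}(c)`. -/
def leib (p : W →ₗ[k] V) (c : W.T) (ξ : V.dual.T) : H ⊗[k] W →ₗ[k] W.T :=
  LinearMap.mul' k W.T ∘ₗ (TensorProduct.comm k W.T W.T).toLinearMap ∘ₗ TensorProduct.map
    ((tDerHom p).toLinearMap.flip c ∘ₗ V.dual.tAct.toLinearMap.flip ξ ∘ₗ antipodeInv k)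
    (TensorAlgebra.ι k)

theorem leib_tmul (p : W →ₗ[k] V) (c : W.T) (ξ : V.dual.T) (h : H) (y : W) :
    leib p c ξ (h ⊗ₜ y) =
      TensorAlgebra.ι k y * tDerHom p (V.dual.tAct (antipodeInv k h) ξ) c := rfl

/-- `a ⊗ b ↦ ⟨b, p(y)⟩ ∂_a(c)`. -/
def leibEval (p : W →ₗ[k] V) (c : W.T) (y : W) : V.dual.T ⊗[k] V.dual.T →ₗ[k] W.T :=
  (TensorProduct.rid k W.T).toLinearMap ∘ₗ TensorProduct.map ((tDerHom p).toLinearMap.flip c)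
    (dualEval (p y) ∘ₗ V.dual.tPr)

theorem leibEval_tmul (p : W →ₗ[k] V) (c : W.T) (y : W) (a b : V.dual.T) :
    leibEval p c y (a ⊗ₜ b) = dualEval (p y) (V.dual.tPr b) • tDerHom p a c := rfl

theorem tDer_ι_mul' {p : W →ₗ[k] V} (hp : IsHom p) (f : V.dual) (y : W) (c : W.T) :
    tDer p f (TensorAlgebra.ι k y * c) =
      dualEval (p y) f • c + leib p c (TensorAlgebra.ι k f) (W.coact y) := by
  rw [tDer_ι_mul hp]
  congr 1
  generalize W.coact y = s
  induction s with
  | zero => simp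
  | add r s hr hs => simp only [map_add, hr, hs]
  | tmul h z => simp [leib_tmul, tAct_ι, tDerHom]

/-- `(h ⊗ g) ⊗ y ↦ y ∂_{(S⁻¹(g) · f) (S⁻¹(h) · η)}(c)`. -/
def leibMul (p : W →ₗ[k] V) (c : W.T) (f : V.dual) (η : V.dual.T) :
    (H ⊗[k] H) ⊗[k] W →ₗ[k] W.T :=
  LinearMap.mul' k W.T ∘ₗ (TensorProduct.comm k W.T W.T).toLinearMap ∘ₗ TensorProduct.map
    ((tDerHom p).toLinearMap.flip c ∘ₗ LinearMap.mul' k V.dual.T ∘ₗ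
      (TensorProduct.comm k V.dual.T V.dual.T).toLinearMap ∘ₗ
      TensorProduct.map (V.dual.tAct.toLinearMap.flip η ∘ₗ antipodeInv k)
        (V.dual.tAct.toLinearMap.flip (TensorAlgebra.ι k f) ∘ₗ antipodeInv k))
    (TensorAlgebra.ι k)

theorem leibMul_tmul (p : W →ₗ[k] V) (c : W.T) (f : V.dual) (η : V.dual.T) (h g : H) (y : W) :
    leibMul p c f η ((h ⊗ₜ g) ⊗ₜ y) = TensorAlgebra.ι k y * tDerHom p
      (V.dual.tAct (antipodeInv k g) (TensorAlgebra.ι k f) * V.dual.tAct (antipodeInv k h) η) c :=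
  rfl

theorem leibMul_comul (p : W →ₗ[k] V) (c : W.T) (f : V.dual) (η : V.dual.T) (s : H ⊗[k] W) :
    leibMul p c f η (comul.rTensor W s) = leib p c (TensorAlgebra.ι k f * η) s := by
  induction s with
  | zero => simp
  | add r s hr hs => simp only [map_add, hr, hs]
  | tmul h z =>
    rw [leib_tmul, V.dual.tAct_mul _ _ (antipodeInv k h), comul_antipodeInv_eq,
      LinearMap.rTensor_tmul]
    generalize comul (R := k) h = s
    induction s with
    | zero => simp
    | add r s hr hs =>
      simp only [map_add, add_tmul, hr, hs, mul_add, LinearMap.add_apply]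
    | tmul a b =>
      rw [leibMul_tmul]
      rfl

/-- `∂_ξ(y c) = y₍₀₎ ∂_{S⁻¹(y₍₋₁₎) · ξ}(c) + ⟨ξ⁽²⁾, p(y)⟩ ∂_{ξ⁽¹⁾}(c)`. -/
theorem tDerHom_leibniz {p : W →ₗ[k] V} (hp : IsHom p) (ξ : V.dual.T) : ∀ (y : W) (c : W.T),
    tDerHom p ξ (TensorAlgebra.ι k y * c) =
      leib p c ξ (W.coact y) + leibEval p c y (V.dual.tComul ξ) := by
  let S : Submodule k V.dual.T :=
    { carrier := {ξ | ∀ (y : W) (c : W.T), tDerHom p ξ (TensorAlgebra.ι k y * c) =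
        leib p c ξ (W.coact y) + leibEval p c y (V.dual.tComul ξ)}
      zero_mem' := by
        intro y c
        simp [leib]
      add_mem' := by
        intro a b ha hb y c
        have : leib p c (a + b) = leib p c a + leib p c b := by
          ext h z
          simp [leib, mul_add]
        rw [this, map_add, map_add, map_add, LinearMap.add_apply, LinearMap.add_apply, ha, hb]
        abel
      smul_mem' := by
        intro r a ha y c
        have : leib p c (r • a) = r • leib p c a := by
          ext h z
          simp [leib]
        rw [this, map_smul, map_smul, map_smul, LinearMap.smul_apply, LinearMap.smul_apply, ha,
          smul_add] }
  suffices ξ ∈ S from this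
  refine V.dual.t_induction ?_ ?_ ξ
  · intro y c
    have e : ∀ s : H ⊗[k] W, leib p c 1 s =
        TensorAlgebra.ι k (TensorProduct.lid k W (counit.rTensor W s)) * c := by
      intro s
      induction s with
      | zero => simp
      | add r s hr hs => simp only [map_add, hr, hs, add_mul]
      | tmul h z =>
        have := V.dual.tAct_algebraMap (antipodeInv k h) 1
        rw [map_one, one_mul, counit_antipodeInv] at this
        rw [leib_tmul, this, AlgHom.commutes]
        simp
    rw [e, (W.ydAt y).counit_coact, tComul_one, leibEval_tmul, tPr_one]
    simp
  · intro f η hη y c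
    replace hη : ∀ (y : W) (c : W.T), tDerHom p η (TensorAlgebra.ι k y * c) =
      leib p c η (W.coact y) + leibEval p c y (V.dual.tComul η) := hη
    let G1 : H ⊗[k] W →ₗ[k] W.T := (TensorProduct.rid k W.T).toLinearMap ∘ₗ TensorProduct.map
      ((tDerHom p).toLinearMap.flip c ∘ₗ V.dual.tAct.toLinearMap.flip η ∘ₗ antipodeInv k)
      (dualForm f ∘ₗ p)
    have hG1 : ∀ h z, G1 (h ⊗ₜ z) =
        dualEval (p z) f • tDerHom p (V.dual.tAct (antipodeInv k h) η) c := fun _ _ => rfl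
    have h1 : ∀ s : H ⊗[k] W, tDer p f (leib p c η s) = G1 s + leibMul p c f η
        ((TensorProduct.assoc k H H W).symm (W.coact.lTensor H s)) := by
      intro s
      induction s with
      | zero => simp
      | add r s hr hs => simp only [map_add, hr, hs]; abel
      | tmul h z =>
        rw [leib_tmul, tDer_ι_mul' hp, hG1, LinearMap.lTensor_tmul]
        congr 1
        generalize W.coact z = s
        induction s with
        | zero => simp
        | add r s hr hs => simp only [map_add, tmul_add, hr, hs]
        | tmul g z =>
          rw [leib_tmul, TensorProduct.assoc_symm_tmul, leibMul_tmul, tAct_ι, tDerHom_ι_mul]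
          simp [tDerHom]
    have h2 : ∀ t, tDer p f (leibEval p c y t) =
        leibEval p c y ((LinearMap.mulLeft k (TensorAlgebra.ι k f)).rTensor V.dual.T t) := by
      intro t
      induction t with
      | zero => simp
      | add s t hs ht => simp only [map_add, hs, ht]
      | tmul a b =>
        rw [LinearMap.rTensor_tmul, leibEval_tmul, leibEval_tmul, map_smul,
          LinearMap.mulLeft_apply, tDerHom_ι_mul]
    have h3 : ∀ s t, leibEval p c y (V.dual.tBraidMul s t) =
        tDerHom p (V.dual.tAct (TensorProduct.rid k H ((dualEval (p y)).lTensor H s))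
          (TensorProduct.rid k V.dual.T (V.dual.tCounit.toLinearMap.lTensor V.dual.T t))) c := by
      intro s t
      induction s with
      | zero => simp
      | add r s hr hs => simp only [map_add, LinearMap.add_apply, hr, hs]
      | tmul g f' =>
        induction t with
        | zero => simp
        | add s t hs ht => simp only [map_add, LinearMap.add_apply, hs, ht]
        | tmul a b =>
          rw [tBraidMul_tmul, leibEval_tmul, tPr_ι_mul]
          simp [smul_smul, mul_comm]
    have h4 : leibEval p c y (V.dual.tBraidMul (V.dual.coact f) (V.dual.tComul η)) =
        G1 (W.coact y) := by
      rw [h3, tComul_counit, dual_coact_eval, hp.map_coact]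
      generalize W.coact y = s
      induction s with
      | zero => simp
      | add r s hr hs => simp only [map_add, LinearMap.add_apply, hr, hs]
      | tmul h z =>
        rw [hG1, LinearMap.lTensor_tmul, LinearMap.rTensor_tmul, LinearMap.lTensor_tmul,
          TensorProduct.rid_tmul, map_smul, LinearMap.smul_apply, map_smul, LinearMap.smul_apply,
          dualEval_apply]
    rw [tDerHom_ι_mul, hη, map_add, h1, h2, ← (W.ydAt y).coassoc, LinearEquiv.symm_apply_apply,
      tComul_ι_mul, tComulLeft_apply, map_add, h4]
    rw [leibMul_comul]
    abel

theorem tDerHom_eq_zero {p : W →ₗ[k] V} (hp : IsHom p) (c : W.T) :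
    ∀ ξ ∈ V.dual.nicholsSub, tDerHom p ξ c = 0 := by
  let S : Submodule k W.T := ⨅ ξ : V.dual.nicholsSub, LinearMap.ker (tDerHom p ξ.1)
  suffices c ∈ S from fun ξ hξ => (Submodule.mem_iInf _).1 this ⟨ξ, hξ⟩
  refine W.t_induction ?_ ?_ c
  · refine (Submodule.mem_iInf _).2 fun ξ => ?_
    change tDerHom p ξ.1 1 = 0
    rw [tDerHom_one_right, show V.dual.tCounit ξ.1 = 0 from (V.dual.graded_le ξ.2).2, zero_smul]
  · intro y c hc
    replace hc : ∀ ξ ∈ V.dual.nicholsSub, tDerHom p ξ c = 0 :=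
      fun ξ hξ => (Submodule.mem_iInf _).1 hc ⟨ξ, hξ⟩
    refine (Submodule.mem_iInf _).2 fun ⟨ξ, hξ⟩ => ?_
    change tDerHom p ξ _ = 0
    rw [tDerHom_leibniz hp]
    have h1 : ∀ s, leib p c ξ s = 0 := by
      intro s
      induction s with
      | zero => simp
      | add r s hr hs => rw [map_add, hr, hs, add_zero]
      | tmul h z =>
        rw [leib_tmul, hc _ (V.dual.isNicholsIdeal_nicholsSub.act _ hξ), mul_zero]
    have h2 : leibEval p c y (V.dual.tComul ξ) = 0 := by
      refine (sup_le ?_ ?_ : _ ≤ LinearMap.ker (leibEval p c y))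
        (V.dual.isNicholsIdeal_nicholsSub.comul hξ)
      · rintro _ ⟨t, rfl⟩
        change leibEval p c y _ = 0
        induction t with
        | zero => simp
        | add r s hr hs => rw [map_add, map_add, hr, hs, add_zero]
        | tmul a b =>
          rw [LinearMap.rTensor_tmul, leibEval_tmul, Submodule.subtype_apply, hc _ a.2, smul_zero]
      · rintro _ ⟨t, rfl⟩
        change leibEval p c y _ = 0
        induction t with
        | zero => simp
        | add r s hr hs => rw [map_add, map_add, hr, hs, add_zero]
        | tmul a b =>
          rw [LinearMap.lTensor_tmul, leibEval_tmul, Submodule.subtype_apply,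
            show V.dual.tPr b = 0 from (V.dual.graded_le b.2).1, map_zero, zero_smul]
    rw [h1, h2, add_zero]

theorem tDer_mem (p : W →ₗ[k] V) (f : V.dual) {x : W.T} (hx : x ∈ W.nicholsSub) :
    tDer p f x ∈ W.nicholsSub := by
  let F : W.T ⊗[k] W.T →ₗ[k] W.T := (TensorProduct.lid k W.T).toLinearMap ∘ₗ
    (dualForm f ∘ₗ p ∘ₗ W.tPr).rTensor W.T
  have hF : ∀ a b, F (a ⊗ₜ b) = dualForm f (p (W.tPr a)) • b := fun _ _ => rfl
  refine (sup_le ?_ ?_ : _ ≤ W.nicholsSub.comap F) (W.isNicholsIdeal_nicholsSub.comul hx)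
  · rintro _ ⟨t, rfl⟩
    rw [Submodule.mem_comap]
    induction t with
    | zero => simp
    | add r s hr hs => rw [map_add, map_add]; exact add_mem hr hs
    | tmul a b =>
      rw [LinearMap.rTensor_tmul, hF, Submodule.subtype_apply,
        show W.tPr a = 0 from (W.graded_le a.2).1, map_zero]
      simp
  · rintro _ ⟨t, rfl⟩
    rw [Submodule.mem_comap]
    induction t with
    | zero => simp
    | add r s hr hs => rw [map_add, map_add]; exact add_mem hr hs
    | tmul a b =>
      rw [LinearMap.lTensor_tmul, hF]
      exact Submodule.smul_mem _ _ b.2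

/-- For `f ∈ V*` and a linear map `p : W → V` the map `x ↦ ⟨f, p(x⁽¹⁾)⟩ x⁽²⁾` on `B(W)`. -/
def nDerFun (p : W →ₗ[k] V) (f : V.dual) : Module.End k W.Nichols :=
  descend W.nmk.toLinearMap W.nmk_surjective (W.nmk.toLinearMap ∘ₗ tDer p f) (by
    rw [ker_nmk]
    intro x hx
    exact W.nmk_eq_zero.2 (tDer_mem p f hx))

theorem nDerFun_nmk (p : W →ₗ[k] V) (f : V.dual) (x : W.T) :
    nDerFun p f (W.nmk x) = W.nmk (tDer p f x) :=
  descend_apply W.nmk.toLinearMap W.nmk_surjective _ _ x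

/-- The maps `nDerFun`, linear in `f ∈ V*`. -/
def nDer (p : W →ₗ[k] V) : V.dual →ₗ[k] Module.End k W.Nichols where
  toFun := nDerFun p
  map_add' f g := by
    refine LinearMap.ext fun x => ?_
    obtain ⟨x, rfl⟩ := W.nmk_surjective x
    simp [nDerFun_nmk]
  map_smul' c f := by
    refine LinearMap.ext fun x => ?_
    obtain ⟨x, rfl⟩ := W.nmk_surjective x
    simp [nDerFun_nmk]

theorem nDer_nmk (p : W →ₗ[k] V) (f : V.dual) (x : W.T) :
    nDer p f (W.nmk x) = W.nmk (tDer p f x) := nDerFun_nmk p f x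

/-- The algebra map `B(V*) → End(B(W))`, `ξ ↦ ∂_ξ`, with `∂_f(x) = ⟨f, p(x⁽¹⁾)⟩ x⁽²⁾` for
`f ∈ V*`, where `p : W → V` is a morphism. -/
def der (p : W →ₗ[k] V) (hp : IsHom p) : V.dual.Nichols →ₐ[k] Module.End k W.Nichols :=
  Ideal.Quotient.liftₐ V.dual.nicholsIdeal (TensorAlgebra.lift k (nDer p)) (fun ξ hξ => by
    have key : ∀ (ξ : V.dual.T) (x : W.T), TensorAlgebra.lift k (nDer p) ξ (W.nmk x) =
        W.nmk (tDerHom p ξ x) := by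
      intro ξ
      induction ξ using TensorAlgebra.induction with
      | algebraMap r => intro x; simp
      | ι f => intro x; simp [tDerHom, nDer_nmk]
      | add a b ha hb => intro x; simp [ha, hb]
      | mul a b ha hb => intro x; simp [ha, hb]
    refine LinearMap.ext fun x => ?_
    obtain ⟨x, rfl⟩ := W.nmk_surjective x
    rw [key, tDerHom_eq_zero hp x ξ hξ]
    simp)

theorem der_nι (p : W →ₗ[k] V) (hp : IsHom p) (f : V.dual) : der p hp (V.dual.nι f) = nDer p f :=
  TensorAlgebra.lift_ι_apply _ _

end Derivation

end YDMod

namespace YDMod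

/-! ### Submodules -/

section Sub

variable (V : YDMod.{u, w, v} k H)

theorem IsSub.range {U : YDMod.{u, w, v} k H} {V : YDMod k H} {f : U →ₗ[k] V} (hf : IsHom f) :
    V.IsSub (LinearMap.range f) where
  act_mem h := by
    rintro _ ⟨x, rfl⟩
    exact ⟨U.act h x, hf.map_act h x⟩
  coact_mem := by
    rintro _ ⟨x, rfl⟩
    rw [Submodule.mem_comap, hf.map_coact]
    refine ⟨f.rangeRestrict.lTensor H (U.coact x), ?_⟩
    rw [← LinearMap.lTensor_comp_apply]
    rfl

variable {V} {P : Submodule k V} (hP : V.IsSub P)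

/-- The action on a Yetter-Drinfeld submodule. -/
def subAct : H →ₐ[k] Module.End k P :=
  AlgHom.ofLinearMap
    { toFun := fun h => (V.act h).restrict (hP.act_mem h)
      map_add' := fun g h => by
        refine LinearMap.ext fun x => Subtype.ext ?_
        simp [LinearMap.restrict_apply]
      map_smul' := fun c h => by
        refine LinearMap.ext fun x => Subtype.ext ?_
        simp [LinearMap.restrict_apply] }
    (LinearMap.ext fun x => Subtype.ext (by simp [LinearMap.restrict_apply]))
    (fun g h => LinearMap.ext fun x => Subtype.ext (by simp [LinearMap.restrict_apply]))

/-- The coaction on a Yetter-Drinfeld submodule. -/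
def subCoact : P →ₗ[k] H ⊗[k] P :=
  (LinearEquiv.ofInjective (P.subtype.lTensor H)
    (Module.Flat.lTensor_preserves_injective_linearMap (M := H) P.subtype
      P.injective_subtype)).symm.toLinearMap ∘ₗ
    (V.coact ∘ₗ P.subtype).codRestrict _ (fun x => hP.coact_mem x.2)

theorem sub_isYDMap : IsYDMap (subAct hP) (subCoact hP) V.act V.coact P.subtype where
  map_act h x := rfl
  map_coact x := by
    have := LinearEquiv.apply_symm_apply (LinearEquiv.ofInjective (P.subtype.lTensor H)
      (Module.Flat.lTensor_preserves_injective_linearMap (M := H) P.subtype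
        P.injective_subtype)) ((V.coact ∘ₗ P.subtype).codRestrict _ (fun x => hP.coact_mem x.2) x)
    exact (congrArg Subtype.val this).symm

/-- A Yetter-Drinfeld submodule as a Yetter-Drinfeld module. -/
def sub : YDMod.{u, w, v} k H where
  carrier := P
  act := subAct hP
  coact := subCoact hP
  ydAt x := YDAt.of_injective (sub_isYDMap hP) P.injective_subtype (V.ydAt x.1)

/-- The inclusion of a Yetter-Drinfeld submodule. -/
def subIncl : sub hP →ₗ[k] V := P.subtype

end Sub

/-! ### The braided adjoint action -/

end YDMod

theorem IsYDMap.comp {A B C : Type*} [AddCommGroup A] [Module k A] [AddCommGroup B] [Module k B]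
    [AddCommGroup C] [Module k C] {actA : H →ₐ[k] Module.End k A} {coactA : A →ₗ[k] H ⊗[k] A}
    {actB : H →ₐ[k] Module.End k B} {coactB : B →ₗ[k] H ⊗[k] B} {actC : H →ₐ[k] Module.End k C}
    {coactC : C →ₗ[k] H ⊗[k] C} {f : A →ₗ[k] B} {g : B →ₗ[k] C}
    (hf : IsYDMap actA coactA actB coactB f) (hg : IsYDMap actB coactB actC coactC g) :
    IsYDMap actA coactA actC coactC (g ∘ₗ f) where
  map_act h x := by rw [LinearMap.comp_apply, hf.map_act, hg.map_act]; rfl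
  map_coact x := by
    rw [LinearMap.comp_apply, hg.map_coact, hf.map_coact, LinearMap.lTensor_comp_apply]

section Adjoint

variable {R : Type*} [Ring R] [Algebra k R]

/-- `h ⊗ x ↦ (y ↦ (h · y) x)`. -/
def swapMul (act : H →ₐ[k] Module.End k R) : H ⊗[k] R →ₗ[k] R →ₗ[k] R :=
  TensorProduct.lift (LinearMap.mk₂ k (fun h x => (LinearMap.mul k R).flip x ∘ₗ act h)
    (fun a b x => by rw [map_add, LinearMap.comp_add])
    (fun c a x => by rw [map_smul, LinearMap.comp_smul])
    (fun a x y => by rw [map_add, LinearMap.add_comp])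
    (fun c a x => by rw [map_smul, LinearMap.smul_comp]))

theorem swapMul_tmul (act : H →ₐ[k] Module.End k R) (h : H) (x y : R) :
    swapMul act (h ⊗ₜ x) y = act h y * x := rfl

/-- The braided commutator `ad_c x (y) = x y - (x₍₋₁₎ · y) x₍₀₎`. -/
def braidedAd (act : H →ₐ[k] Module.End k R) (coact : R →ₐ[k] H ⊗[k] R) : R →ₗ[k] R →ₗ[k] R :=
  LinearMap.mul k R - swapMul act ∘ₗ coact.toLinearMap

variable {act : H →ₐ[k] Module.End k R} {coact : R →ₐ[k] H ⊗[k] R}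

theorem braidedAd_apply (x y : R) :
    braidedAd act coact x y = x * y - swapMul act (coact x) y := rfl

theorem act_braidedAd (hm : ∀ x y, ActMul act x y) (x y : R)
    (hx : YDAt act coact.toLinearMap x) (h : H) : act h (braidedAd act coact x y) =
    TensorProduct.lift (LinearMap.compl₁₂ (braidedAd act coact) (act.toLinearMap.flip x)
      (act.toLinearMap.flip y)) (comul h) := by
  have h1 : ∀ s, act h (swapMul act s y) = swapMul act (ydLeft act (comul h) s) y := by
    intro s
    induction s with
    | zero => simp
    | add r s hr hs => simp only [map_add, LinearMap.add_apply, hr, hs]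
    | tmul g z =>
      rw [swapMul_tmul, hm _ _ h]
      generalize comul (R := k) h = t
      induction t with
      | zero => simp
      | add s t hs ht => simp only [map_add, LinearMap.add_apply, hs, ht]
      | tmul a b => simp [swapMul_tmul]
  have h2 : ydLeft act (comul h) (coact x) = ydRight act coact.toLinearMap x (comul h) :=
    hx.compat h
  rw [braidedAd_apply, map_sub, h1, h2, hm x y h]
  generalize comul (R := k) h = t
  induction t with
  | zero => simp
  | add s t hs ht =>
    simp only [map_add, LinearMap.add_apply, ← hs, ← ht]
    abel
  | tmul a b =>
    have h3 : ∀ s, swapMul act ((LinearMap.mulRight k b).rTensor R s) y =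
        swapMul act s (act b y) := by
      intro s
      induction s with
      | zero => simp
      | add r s hr hs => simp only [map_add, LinearMap.add_apply, hr, hs]
      | tmul g z => simp [swapMul_tmul]
    rw [ydRight_tmul, h3]
    simp [braidedAd_apply]

theorem coact_swapMul (x y : R) (hx : YDAt act coact.toLinearMap x)
    (hy : YDAt act coact.toLinearMap y) : coact (swapMul act (coact x) y) =
    TensorProduct.map₂ (LinearMap.mul k H) (swapMul act ∘ₗ coact.toLinearMap)
      (coact x) (coact y) := by
  let F : H ⊗[k] (H ⊗[k] R) →ₗ[k] H ⊗[k] R :=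
    TensorProduct.lift (LinearMap.mul k (H ⊗[k] R) ∘ₗ coact.toLinearMap ∘ₗ act.toLinearMap.flip y)
  have hF : ∀ g t, F (g ⊗ₜ t) = coact (act g y) * t := fun _ _ => rfl
  have h1 : ∀ s, coact (swapMul act s y) = F (coact.toLinearMap.lTensor H s) := by
    intro s
    induction s with
    | zero => simp
    | add r s hr hs => simp only [map_add, LinearMap.add_apply, hr, hs]
    | tmul g z => rw [swapMul_tmul, map_mul, LinearMap.lTensor_tmul, hF]; rfl
  have h2 : ∀ (s : H ⊗[k] R) (t : H ⊗[k] H) (z : R),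
      TensorProduct.map₂ (LinearMap.mul k H) (swapMul act)
        (TensorProduct.assoc k H H R (t ⊗ₜ z)) s = ydLeft act t s * (1 ⊗ₜ z) := by
    intro s t z
    induction t with
    | zero => simp
    | add r t hr ht => simp only [add_tmul, map_add, LinearMap.add_apply, hr, ht, add_mul]
    | tmul a b =>
      induction s with
      | zero => simp
      | add r s hr hs => simp only [map_add, hr, hs, add_mul]
      | tmul c u => simp [swapMul_tmul, TensorProduct.map₂_apply_tmul]
  have h3 : ∀ (t : H ⊗[k] H) (z : R), F (TensorProduct.assoc k H H R (t ⊗ₜ z)) =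
      ydRight act coact.toLinearMap y t * (1 ⊗ₜ z) := by
    intro t z
    induction t with
    | zero => simp
    | add r t hr ht => simp only [add_tmul, map_add, hr, ht, add_mul]
    | tmul a b =>
      rw [TensorProduct.assoc_tmul, hF, ydRight_tmul, AlgHom.toLinearMap_apply]
      generalize coact (act a y) = s
      induction s with
      | zero => simp
      | add r s hr hs => simp only [map_add, hr, hs, add_mul]
      | tmul c u => simp
  have h4 : ∀ s : H ⊗[k] R, F (TensorProduct.assoc k H H R (comul.rTensor R s)) =
      TensorProduct.map₂ (LinearMap.mul k H) (swapMul act)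
        (TensorProduct.assoc k H H R (comul.rTensor R s)) (coact y) := by
    intro s
    induction s with
    | zero => simp
    | add r s hr hs => simp only [map_add, LinearMap.add_apply, hr, hs]
    | tmul h z =>
      rw [LinearMap.rTensor_tmul, h2, h3]
      congr 1
      exact (hy.compat h).symm
  have h5 : TensorProduct.assoc k H H R (comul.rTensor R (coact x)) =
      coact.toLinearMap.lTensor H (coact x) := hx.coassoc
  rw [h1, ← h5, h4, h5]
  generalize coact y = r
  generalize coact x = s
  induction s with
  | zero => simp
  | add a b ha hb => simp only [map_add, LinearMap.add_apply, ← ha, ← hb]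
  | tmul g z => rfl

theorem coact_braidedAd (x y : R) (hx : YDAt act coact.toLinearMap x)
    (hy : YDAt act coact.toLinearMap y) : coact (braidedAd act coact x y) =
    TensorProduct.map₂ (LinearMap.mul k H) (braidedAd act coact) (coact x) (coact y) := by
  rw [braidedAd_apply, map_sub, map_mul, coact_swapMul x y hx hy]
  generalize coact y = r
  generalize coact x = s
  induction s with
  | zero => simp
  | add a b ha hb =>
    simp only [map_add, LinearMap.add_apply, add_mul, ← ha, ← hb]
    abel
  | tmul g z =>
    induction r with
    | zero => simp
    | add a b ha hb =>
      simp only [map_add, mul_add, ← ha, ← hb]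
      abel
    | tmul c u =>
      rw [TensorProduct.map₂_apply_tmul, TensorProduct.map₂_apply_tmul, TensorProduct.map_tmul,
        TensorProduct.map_tmul, Algebra.TensorProduct.tmul_mul_tmul]
      exact (TensorProduct.tmul_sub (g * c) (z * u) (swapMul act (coact z) u)).symm

end Adjoint

namespace YDMod

section Adjoint

variable (V : YDMod.{u, w, v} k H)

theorem nι_isHom : IsHom (V := V) (W := V.nichols) V.nι where
  map_act h v := by
    change V.nmk _ = V.nAct h (V.nmk _)
    rw [nAct_nmk, tAct_ι]
  map_coact v := by
    change V.nCoact (V.nmk _) = _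
    rw [nCoact_nmk, tCoact_ι, ← LinearMap.lTensor_comp_apply]
    rfl

theorem nAct_mul (x y : V.Nichols) : ActMul V.nAct x y := by
  intro h
  obtain ⟨x, rfl⟩ := V.nmk_surjective x
  obtain ⟨y, rfl⟩ := V.nmk_surjective y
  rw [← map_mul, nAct_nmk, V.tAct_mul x y h]
  generalize comul (R := k) h = t
  induction t with
  | zero => simp
  | add s t hs ht => simp only [map_add, hs, ht]
  | tmul a b => simp [nAct_nmk]

/-- The braided commutator `ad_c x (y) = x y - (x₍₋₁₎ · y) x₍₀₎` of the Nichols algebra. -/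
def adc : V.Nichols →ₗ[k] V.Nichols →ₗ[k] V.Nichols := braidedAd V.nAct V.nCoact

variable {V}

theorem IsSub.adc {P Q : Submodule k V.Nichols} (hP : V.nichols.IsSub P)
    (hQ : V.nichols.IsSub Q) : V.nichols.IsSub (Submodule.map₂ V.adc P Q) where
  act_mem h := by
    refine Submodule.map₂_le.2 fun x hx y hy => ?_
    change V.nAct h (V.adc x y) ∈ Submodule.map₂ V.adc P Q
    have e := act_braidedAd V.nAct_mul x y (V.nichols.ydAt x) h
    change V.nAct h (V.adc x y) = _ at e
    rw [e]
    generalize comul (R := k) h = t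
    induction t with
    | zero => simp
    | add s t hs ht => rw [map_add]; exact add_mem hs ht
    | tmul a b => exact Submodule.apply_mem_map₂ _ (hP.act_mem a hx) (hQ.act_mem b hy)
  coact_mem := by
    refine Submodule.map₂_le.2 fun x hx y hy => ?_
    change V.nCoact (V.adc x y) ∈
      LinearMap.range ((Submodule.map₂ V.adc P Q).subtype.lTensor H)
    have e : V.nCoact (V.adc x y) =
        TensorProduct.map₂ (LinearMap.mul k H) V.adc (V.nCoact x) (V.nCoact y) :=
      coact_braidedAd x y (V.nichols.ydAt x) (V.nichols.ydAt y)
    rw [e]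
    have hx' : V.nCoact x ∈ LinearMap.range (P.subtype.lTensor H) := hP.coact_mem hx
    have hy' : V.nCoact y ∈ LinearMap.range (Q.subtype.lTensor H) := hQ.coact_mem hy
    generalize V.nCoact x = a at hx'
    generalize V.nCoact y = b at hy'
    obtain ⟨s, rfl⟩ := hx'
    obtain ⟨t, rfl⟩ := hy'
    induction s with
    | zero => rw [map_zero, map_zero, LinearMap.zero_apply]; exact zero_mem _
    | add a b ha hb => rw [map_add, map_add, LinearMap.add_apply]; exact add_mem ha hb
    | tmul g z =>
      induction t with
      | zero => rw [map_zero, map_zero]; exact zero_mem _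
      | add a b ha hb => rw [map_add, map_add]; exact add_mem ha hb
      | tmul c u =>
        exact ⟨(g * c) ⊗ₜ ⟨V.adc z u, Submodule.apply_mem_map₂ _ z.2 u.2⟩, rfl⟩

end Adjoint

end YDMod

namespace YDMod

/-! ### Gradings and tensor products -/

/-- Let `V` be spanned by subspaces `P j` of degree `d j`. This is the component of degree `γ` of
`B(V)`, spanned by the products `v₁ ⋯ vₙ` with `vₘ ∈ P (jₘ)` and `d j₁ + ⋯ + d jₙ = γ`. -/
def nGrade {ι Γ : Type*} [AddCommGroup Γ] (V : YDMod.{u, w, v} k H) (P : ι → Submodule k V)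
    (d : ι → Γ) (γ : Γ) : Submodule k V.Nichols :=
  ⨆ (l : List ι) (_ : (l.map d).sum = γ), (l.map fun j => (P j).map V.nι).prod

section Tensor

variable {A B : Type*} [AddCommGroup A] [Module k A] [AddCommGroup B] [Module k B]

/-- The diagonal action `h · (a ⊗ b) = h₍₁₎ · a ⊗ h₍₂₎ · b`. -/
def diagAct (actA : H →ₐ[k] Module.End k A) (actB : H →ₐ[k] Module.End k B) :
    H →ₐ[k] Module.End k (A ⊗[k] B) :=
  ((Module.endTensorEndAlgHom (R := k) (S := k) (A := k)).comp
    (Algebra.TensorProduct.map actA actB)).comp (Bialgebra.comulAlgHom k H)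

/-- The diagonal coaction `a ⊗ b ↦ a₍₋₁₎ b₍₋₁₎ ⊗ (a₍₀₎ ⊗ b₍₀₎)`. -/
def diagCoact (coactA : A →ₗ[k] H ⊗[k] A) (coactB : B →ₗ[k] H ⊗[k] B) :
    A ⊗[k] B →ₗ[k] H ⊗[k] (A ⊗[k] B) :=
  (LinearMap.mul' k H).rTensor (A ⊗[k] B) ∘ₗ
    (TensorProduct.tensorTensorTensorComm k H A H B).toLinearMap ∘ₗ
    TensorProduct.map coactA coactB

end Tensor

/-! ### Reflections -/

section Reflection

variable {ι : Type} [Fintype ι] [DecidableEq ι] (M : ι → YDMod.{u, w, v} k H) (i j : ι)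

/-- The summand `M j` of `W = ⨁ M j`, as a subspace of `B(W)`. -/
def summand : Submodule k (pi M).Nichols := LinearMap.range ((pi M).nι ∘ₗ single M j)

/-- The span of the elements `ad_c x₁ (⋯ (ad_c xₙ (y)))` with `x₁, …, xₙ ∈ M i` and `y ∈ M j`,
for a fixed `n`. This is the component of degree `α j + n α i` of `L j = ad B(M i) (M j)`. -/
def adPow : ℕ → Submodule k (pi M).Nichols
  | 0 => summand M j
  | n + 1 => Submodule.map₂ (pi M).adc (summand M i) (adPow n)

/-- `L j = ad B(M i) (M j)`, the span of the elements `ad_c x₁ (⋯ (ad_c xₙ (y)))` with `n ≥ 0`,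
`x₁, …, xₙ ∈ M i` and `y ∈ M j`. -/
def adL : Submodule k (pi M).Nichols := ⨆ n, adPow M i j n

/-- The condition that `L j` is finite-dimensional for all `j ≠ i`. -/
def FinCond : Prop := ∀ j, j ≠ i → FiniteDimensional k (adL M i j)

/-- The largest `n` such that `L j` has a nonzero component of degree `α j + n α i`. It is only
used when the set of all such `n` is finite. -/
def topDeg : ℕ := sSup {n | adPow M i j n ≠ ⊥}

/-- The entries `a i j` of the generalized Cartan matrix. -/
def cartan : ℤ := if j = i then 2 else -(topDeg M i j : ℤ)

/-- The linear form `α j ↦ a i j` on `ℤ^ι`. -/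
def cartanForm : Module.Dual ℤ (ι → ℤ) := ∑ j, cartan M i j • LinearMap.proj j

theorem cartanForm_single : cartanForm M i (Pi.single j 1) = cartan M i j := by
  rw [cartanForm, LinearMap.sum_apply, Finset.sum_eq_single j]
  · simp
  · intro l _ hl
    simp [Pi.single_eq_of_ne hl]
  · simp

theorem cartanForm_self : cartanForm M i (Pi.single i 1) = 2 := by
  rw [cartanForm_single, cartan, if_pos rfl]

/-- The reflection `α j ↦ α j - a i j α i` of `ℤ^ι`. -/
def simpleRefl : (ι → ℤ) ≃ₗ[ℤ] (ι → ℤ) := Module.reflection (cartanForm_self M i)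

theorem simpleRefl_single :
    simpleRefl M i (Pi.single j 1) = Pi.single j 1 - cartan M i j • Pi.single i 1 := by
  rw [simpleRefl, Module.reflection_apply, cartanForm_single]

theorem summand_isSub : (pi M).nichols.IsSub (summand M j) :=
  IsSub.range (V := (pi M).nichols) ((single_isHom M j).comp (pi M).nι_isHom)

theorem adPow_isSub (n : ℕ) : (pi M).nichols.IsSub (adPow M i j n) := by
  induction n with
  | zero => exact summand_isSub M j
  | succ n ih => exact (summand_isSub M i).adc ih

/-- `L j ^ max`, the component of `L j` of the largest degree. -/
def Lmax : YDMod.{u, w, max u v} k H := sub (adPow_isSub M i j (topDeg M i j))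

section FiniteDimensional

variable [∀ j, FiniteDimensional k (M j)]

theorem adPow_fg (n : ℕ) : (adPow M i j n).FG := by
  have h : ∀ j, (summand M j).FG := fun j =>
    Module.Finite.iff_fg.1 (inferInstanceAs (Module.Finite k (LinearMap.range _)))
  induction n with
  | zero => exact h j
  | succ n ih => exact (h i).map₂ _ ih

instance : FiniteDimensional k (Lmax M i j) := by
  have h : Module.Finite k (adPow M i j (topDeg M i j)) := Module.Finite.iff_fg.2 (adPow_fg M i j _)
  exact h

variable [BijectiveAntipode k H]

/-- The `j`-th member of the reflected family, by cases on whether `j = i`. -/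
def reflectAux : Decidable (j = i) → YDMod.{u, w, max u v} k H
  | isTrue _ => (M i).dual
  | isFalse _ => Lmax M i j

/-- The reflected family `R i (M)`, whose `i`-th member is `(M i)*` and whose `j`-th member is
`L j ^ max` for `j ≠ i`. -/
def reflect : ι → YDMod.{u, w, max u v} k H := fun j => reflectAux M i j (decEq j i)

instance reflectAux_finite (d : Decidable (j = i)) :
    FiniteDimensional k (reflectAux M i j d) :=
  match d with
  | isTrue _ => inferInstanceAs (FiniteDimensional k (M i).dual)
  | isFalse _ => inferInstanceAs (FiniteDimensional k (Lmax M i j))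

instance : FiniteDimensional k (reflect M i j) := reflectAux_finite M i j _

end FiniteDimensional

/-! ### The algebra `K # B(V*)` -/

/-- The projection `B(W) → B(M i)`. -/
def nProj : (pi M).Nichols →ₐ[k] (M i).Nichols :=
  nMap (proj M i) (proj_isHom M i) (proj_surjective M i)

/-- The space `K = {x ∈ B(W) : x⁽¹⁾ ⊗ π(x⁽²⁾) = x ⊗ 1}` of right `B(M i)`-coinvariants. -/
def coinvariants : Submodule k (pi M).Nichols :=
  LinearMap.eqLocus ((nProj M i).toLinearMap.lTensor (pi M).Nichols ∘ₗ (pi M).nComul)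
    ((TensorProduct.mk k (pi M).Nichols (M i).Nichols).flip 1)

variable [∀ j, FiniteDimensional k (M j)] [BijectiveAntipode k H]

/-- The vector space `B(W) ⊗ B((M i)*)`. -/
abbrev Smash : Type (max u v) := (pi M).Nichols ⊗[k] (M i).dual.Nichols

/-- The map `B(W) ⊗ B((M i)*) → End(B(W))`, `b ⊗ ξ ↦ b ∂_ξ`, where `∂_{ξη} = ∂_ξ ∂_η` and
`∂_f(x) = ⟨f, x⁽¹⁾⟩ x⁽²⁾` for `f ∈ (M i)*`. The product of `B(W) # B((M i)*)` is defined by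
transport along this map. -/
def smashRep : Smash M i →ₗ[k] Module.End k (pi M).Nichols :=
  TensorProduct.lift ((LinearMap.mul k (Module.End k (pi M).Nichols)).compl₁₂
    (LinearMap.mul k (pi M).Nichols) (der (proj M i) (proj_isHom M i)).toLinearMap)

/-- The subspace `K # B((M i)*)` of `B(W) # B((M i)*)`. -/
def smash : Submodule k (Smash M i) :=
  LinearMap.range ((coinvariants M i).subtype.rTensor (M i).dual.Nichols)

/-- The diagonal action of `H` on `B(W) # B((M i)*)`. -/
def smashAct : H →ₐ[k] Module.End k (Smash M i) := diagAct (pi M).nAct (M i).dual.nAct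

/-- The diagonal coaction of `H` on `B(W) # B((M i)*)`. -/
def smashCoact : Smash M i →ₗ[k] H ⊗[k] Smash M i :=
  diagCoact (pi M).nCoact.toLinearMap (M i).dual.nCoact.toLinearMap

/-- The component of degree `γ` of `K # B((M i)*)`, where `M j` has degree `α j` and `(M i)*` has
degree `-α i`. -/
def smashGrade (γ : ι → ℤ) : Submodule k (Smash M i) :=
  ⨆ α : ι → ℤ, LinearMap.range (TensorProduct.map
    (coinvariants M i ⊓ nGrade (pi M) (fun j => LinearMap.range (single M j))
      (fun j => (Pi.single j 1 : ι → ℤ)) α).subtype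
    (nGrade (M i).dual (fun _ : Unit => ⊤) (fun _ => -(Pi.single i 1 : ι → ℤ)) (γ - α)).subtype)

/-- The embedding of the `j`-th member of the reflected family, by cases on whether `j = i`. -/
def reflectEmbAux : (d : Decidable (j = i)) → reflectAux M i j d →ₗ[k] Smash M i
  | isTrue _ => TensorProduct.mk k (pi M).Nichols (M i).dual.Nichols 1 ∘ₗ (M i).dual.nι
  | isFalse _ => (TensorProduct.mk k (pi M).Nichols (M i).dual.Nichols).flip 1 ∘ₗ
      subIncl (adPow_isSub M i j (topDeg M i j))

/-- The embedding of the `j`-th member of the reflected family in `K # B((M i)*)`: it is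
`f ↦ 1 ⊗ f` for `j = i` and `x ↦ x ⊗ 1` for `j ≠ i`. -/
def reflectEmb : reflect M i j →ₗ[k] Smash M i := reflectEmbAux M i j (decEq j i)

end Reflection

end YDMod

end

noncomputable section

variable {k : Type u} {H : Type w} [Field k] [Ring H] [HopfAlgebra k H]

/-! ### Comatrices -/

/-- A matrix `t` over `H` with `Δ(t a c) = ∑ b, t a b ⊗ t b c` and `ε(t a c) = δ_{a c}`. -/
structure IsComatrix {m : ℕ} (t : Fin m → Fin m → H) : Prop where
  comul_eq : ∀ a c, comul (R := k) (t a c) = ∑ b, t a b ⊗ₜ[k] t b c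
  counit_eq : ∀ a c, counit (R := k) (t a c) = if a = c then 1 else 0

/-- A finite family of vectors of a comodule whose coaction is given by a comatrix. -/
structure IsCofam {V : Type*} [AddCommGroup V] [Module k V] (coact : V →ₗ[k] H ⊗[k] V) {m : ℕ}
    (t : Fin m → Fin m → H) (e : Fin m → V) : Prop extends IsComatrix (k := k) t where
  coact_eq : ∀ a, coact (e a) = ∑ b, t a b ⊗ₜ[k] e b

theorem eq_of_sum_tmul_eq {A V ι : Type*} [AddCommGroup A] [Module k A] [AddCommGroup V]
    [Module k V] [Fintype ι] {b : ι → V} (hb : LinearIndependent k b) {x y : ι → A}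
    (hxy : ∑ c, x c ⊗ₜ[k] b c = ∑ c, y c ⊗ₜ[k] b c) : x = y := by
  classical
  funext c
  obtain ⟨f, hf⟩ := LinearMap.exists_extend ((Module.Basis.span hb).coord c)
  have hfb : ∀ d, f (b d) = if d = c then 1 else 0 := by
    intro d
    have := LinearMap.congr_fun hf (Module.Basis.span hb d)
    rw [Module.Basis.coord_apply, Module.Basis.repr_self, Finsupp.single_apply] at this
    rw [← this]
    simp [Module.Basis.span_apply]
  have h3 := congrArg (fun z => TensorProduct.rid k A (f.lTensor A z)) hxy
  simpa [map_sum, hfb] using h3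

theorem sum_ite_tmul {V ι : Type*} [AddCommGroup V] [Module k V] [Fintype ι] [DecidableEq ι]
    (a : ι) (e : ι → V) : ∑ c, (if a = c then (1 : k) else 0) ⊗ₜ[k] e c = 1 ⊗ₜ e a := by
  rw [Finset.sum_eq_single a]
  · rw [if_pos rfl]
  · intro c _ hc; rw [if_neg (Ne.symm hc), zero_tmul]
  · simp

/-- The coefficient of a tensor at a basis vector of the left factor. -/
def leftCoord {ι A : Type*} [AddCommGroup A] [Module k A] (h : Module.Basis ι k A) (X : Type*)
    [AddCommGroup X] [Module k X] (i : ι) : A ⊗[k] X →ₗ[k] X :=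
  (TensorProduct.lid k X).toLinearMap ∘ₗ (h.coord i).rTensor X

theorem leftCoord_tmul {ι A X : Type*} [AddCommGroup A] [Module k A] (h : Module.Basis ι k A)
    [AddCommGroup X] [Module k X] (i : ι) (a : A) (x : X) :
    leftCoord h X i (a ⊗ₜ x) = h.coord i a • x := rfl

theorem exists_cofam {V : Type*} [AddCommGroup V] [Module k V] {coact : V →ₗ[k] H ⊗[k] V}
    (h1 : ∀ v, (counit (R := k) (A := H)).rTensor V (coact v) = 1 ⊗ₜ v)
    (h2 : ∀ v, TensorProduct.assoc k H H V ((comul (R := k) (A := H)).rTensor V (coact v)) =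
      coact.lTensor H (coact v)) (v : V) :
    ∃ (m : ℕ) (t : Fin m → Fin m → H) (e : Fin m → V) (a : Fin m),
      IsCofam coact t e ∧ e a = v := by
  classical
  by_cases hv : v = 0
  · subst hv
    refine ⟨1, fun _ _ => 1, fun _ => 0, 0, ⟨⟨?_, ?_⟩, ?_⟩, rfl⟩
    · intro a c
      simp [Bialgebra.comul_one, Algebra.TensorProduct.one_def]
    · intro a c
      simp [Subsingleton.elim a c]
    · intro a
      simp
  let h := Module.Basis.ofVectorSpace k H
  let I := Module.Basis.ofVectorSpaceIndex k H
  obtain ⟨X, hX⟩ : ∃ X, X = Submodule.span k (Set.range fun i => leftCoord h V i (coact v)) := ⟨_, rfl⟩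
  have hfin : FiniteDimensional k X := by
    rw [hX]
    have : (Set.range fun i => leftCoord h V i (coact v)).Finite := by
      obtain ⟨s, hs⟩ : ∃ s : Finset I, ∀ i ∉ s, leftCoord h V i (coact v) = 0 := by
        generalize coact v = x
        induction x with
        | zero => exact ⟨∅, by simp⟩
        | tmul g u => 
          refine ⟨(h.repr g).support, fun i hi => ?_⟩
          simp [leftCoord_tmul, Finsupp.notMem_support_iff.1 hi]
        | add x y hx hy =>
          obtain ⟨s, hs⟩ := hx
          obtain ⟨r, hr⟩ := hy
          refine ⟨s ∪ r, fun i hi => ?_⟩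
          rw [Finset.mem_union, not_or] at hi
          rw [map_add, hs i hi.1, hr i hi.2, add_zero]
      refine ((s.finite_toSet.image fun i => leftCoord h V i (coact v)).union
        (Set.finite_singleton 0)).subset ?_
      rintro _ ⟨i, rfl⟩
      by_cases hi : i ∈ s
      · exact Or.inl ⟨i, hi, rfl⟩
      · exact Or.inr (hs i hi)
    exact FiniteDimensional.span_of_finite k this
  have hmem : ∀ (Y : Submodule k V) (x : H ⊗[k] V), (∀ i, leftCoord h V i x ∈ Y) →
      x ∈ LinearMap.range (Y.subtype.lTensor H) := by
    intro Y x hx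
    have : x ∈ LinearMap.ker (Y.mkQ.lTensor H) := by
      rw [LinearMap.mem_ker]
      have h0 : ∀ y : H ⊗[k] (V ⧸ Y), (∀ i, leftCoord h _ i y = 0) → y = 0 := by
        intro y hy
        apply (TensorProduct.equivFinsuppOfBasisLeft h (N := V ⧸ Y)).injective
        ext i
        rw [map_zero]
        rw [TensorProduct.equivFinsuppOfBasisLeft_apply]
        exact hy i
      refine h0 _ fun i => ?_
      have : leftCoord h _ i (Y.mkQ.lTensor H x) = Y.mkQ (leftCoord h V i x) := by
        generalize x = z
        induction z with
        | zero => simp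
        | tmul g u => simp [leftCoord_tmul]
        | add x y hx hy => simp only [map_add, hx, hy]
      rw [this]
      simpa using hx i
    have e := lTensor_exact (R := k) H (f := Y.subtype) (g := Y.mkQ)
      (by rw [LinearMap.exact_iff]; simp) Y.mkQ_surjective
    exact (e x).1 this
  have hcoX : ∀ x ∈ X, coact x ∈ LinearMap.range (X.subtype.lTensor H) := by
    intro x hx
    rw [hX] at hx
    induction hx using Submodule.span_induction with
    | zero => simp
    | add x y _ _ hx hy => rw [map_add]; exact add_mem hx hy
    | smul c x _ hx => rw [map_smul]; exact Submodule.smul_mem _ _ hx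
    | mem x hx =>
      obtain ⟨i, rfl⟩ := hx
      have e1 : coact (leftCoord h V i (coact v)) = leftCoord h _ i (coact.lTensor H (coact v)) := by
        generalize coact v = z
        induction z with
        | zero => simp
        | tmul g u => simp [leftCoord_tmul]
        | add x y hx hy => simp only [map_add, hx, hy]
      dsimp only
      rw [e1, ← h2]
      have hc := hmem X (coact v) (fun i => by
        rw [hX]; exact Submodule.subset_span ⟨i, rfl⟩)
      generalize coact v = z at hc
      obtain ⟨z, rfl⟩ := hc
      induction z with
      | zero => simp
      | add x y hx hy => simp only [map_add] at *; exact add_mem hx hy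
      | tmul g u =>
        simp only [LinearMap.lTensor_tmul, LinearMap.rTensor_tmul]
        generalize comul (R := k) g = s
        induction s with
        | zero => simp
        | add x y hx hy => rw [add_tmul, map_add, map_add]; exact add_mem hx hy
        | tmul a b =>
          refine ⟨h.coord i a • b ⊗ₜ u, ?_⟩
          simp [leftCoord_tmul, smul_tmul']
  have hvX : v ∈ X := by
    have hc := hmem X (coact v) (fun i => by
        rw [hX]; exact Submodule.subset_span ⟨i, rfl⟩)
    have hv : v = TensorProduct.lid k V ((counit (R := k) (A := H)).rTensor V (coact v)) := by
      rw [h1]; simp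
    rw [hv]
    generalize coact v = z at hc
    obtain ⟨z, rfl⟩ := hc
    induction z with
    | zero => simp
    | add x y hx hy => simp only [map_add] at *; exact add_mem hx hy
    | tmul g u => simpa using X.smul_mem _ u.2
  -- a basis of `X` containing `v`
  have hli : LinearIndepOn k id ({(⟨v, hvX⟩ : X)} : Set X) := by
    refine LinearIndepOn.singleton ?_
    simpa [Subtype.ext_iff] using hv
  let b0 := Module.Basis.extend hli
  have hf0 : Finite (hli.extend (Set.subset_univ _)) := Module.Finite.finite_basis b0
  let eq0 := Finite.equivFin (hli.extend (Set.subset_univ _))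
  let b := b0.reindex eq0
  have hcx : ∀ a, ∃ z : H ⊗[k] X, X.subtype.lTensor H z = coact (b a) := fun a => hcoX _ (b a).2
  choose z hz using hcx
  let t : Fin _ → Fin _ → H := fun a c => TensorProduct.rid k H ((b.coord c).lTensor H (z a))
  have hz' : ∀ a, z a = ∑ c, t a c ⊗ₜ b c := by
    intro a
    simp only [t]
    generalize z a = y
    induction y with
    | zero => simp
    | add x y hx hy =>
      simp only [map_add, add_tmul, Finset.sum_add_distrib, ← hx, ← hy]
    | tmul g u =>
      simp only [LinearMap.lTensor_tmul, TensorProduct.rid_tmul]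
      conv_lhs => rw [← b.sum_repr u, tmul_sum]
      refine Finset.sum_congr rfl fun c _ => ?_
      rw [smul_tmul]
      rfl
  have hco : ∀ a, coact (b a) = ∑ c, t a c ⊗ₜ[k] (b c : V) := by
    intro a
    rw [← hz, hz', map_sum]
    rfl
  have hli' : LinearIndependent k fun a => (b a : V) :=
    b.linearIndependent.map' X.subtype (Submodule.ker_subtype _)
  have hvb : (⟨v, hvX⟩ : X) ∈ hli.extend (Set.subset_univ _) :=
    hli.subset_extend (Set.subset_univ _) (Set.mem_singleton _)
  refine ⟨_, t, fun a => b a, eq0 ⟨⟨v, hvX⟩, hvb⟩, ⟨⟨?_, ?_⟩, hco⟩, ?_⟩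
  · intro a
    have h3 := h2 (b a)
    rw [hco] at h3
    simp only [map_sum, LinearMap.rTensor_tmul, LinearMap.lTensor_tmul, hco, tmul_sum] at h3
    have h4 := congrArg (TensorProduct.assoc k H H V).symm h3
    simp only [map_sum, LinearEquiv.symm_apply_apply, TensorProduct.assoc_symm_tmul] at h4
    rw [Finset.sum_comm] at h4
    simp only [← sum_tmul] at h4
    exact congrFun (eq_of_sum_tmul_eq hli' h4)
  · intro a
    have h3 := h1 (b a)
    rw [hco] at h3
    simp only [map_sum, LinearMap.rTensor_tmul] at h3
    rw [← sum_ite_tmul a (fun c => (b c : V))] at h3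
    exact congrFun (eq_of_sum_tmul_eq hli' h3)
  · change ((b0.reindex eq0 (eq0 ⟨_, hvb⟩) : X) : V) = v
    rw [Module.Basis.reindex_apply, Equiv.symm_apply_apply, Module.Basis.extend_apply_self]

theorem comatrix_induction {p : H → Prop} (h0 : p 0) (hadd : ∀ x y, p x → p y → p (x + y))
    (hsmul : ∀ (c : k) x, p x → p (c • x))
    (ht : ∀ (m : ℕ) (t : Fin m → Fin m → H), IsComatrix (k := k) t → ∀ a b, p (t a b)) (h : H) :
    p h := by
  obtain ⟨m, t, e, a, hC, rfl⟩ := exists_cofam (k := k) (coact := comul (R := k) (A := H))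
    (fun v => by simp) (fun v => by simp) h
  have h1 := Coalgebra.lTensor_counit_comul (R := k) (e a)
  rw [hC.coact_eq] at h1
  have h2 := congrArg (TensorProduct.rid k H) h1
  simp only [map_sum, LinearMap.lTensor_tmul, TensorProduct.rid_tmul, one_smul] at h2
  rw [← h2]
  exact Finset.sum_induction _ p hadd h0 fun b _ => hsmul _ _ (ht m t hC.toIsComatrix a b)

namespace IsComatrix

variable {m : ℕ} {t : Fin m → Fin m → H} (ht : IsComatrix (k := k) t)
include ht

theorem antipode_mul (a c : Fin m) :
    ∑ b, antipode k (t a b) * t b c = if a = c then 1 else 0 := by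
  have h := mul_antipode_rTensor_comul_apply (R := k) (t a c)
  rw [ht.comul_eq, ht.counit_eq] at h
  simpa [map_sum, apply_ite] using h

theorem mul_antipode (a c : Fin m) :
    ∑ b, t a b * antipode k (t b c) = if a = c then 1 else 0 := by
  have h := mul_antipode_lTensor_comul_apply (R := k) (t a c)
  rw [ht.comul_eq, ht.counit_eq] at h
  simpa [map_sum, apply_ite] using h

theorem comul_antipode (a c : Fin m) : comul (R := k) (antipode k (t a c)) =
    ∑ b, antipode k (t b c) ⊗ₜ[k] antipode k (t a b) := by
  rw [comul_antipode_eq, ht.comul_eq]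
  simp [map_sum]

variable [BijectiveAntipode k H]

theorem antipodeInv_mul' (a c : Fin m) :
    ∑ b, antipodeInv k (t b c) * t a b = if a = c then 1 else 0 := by
  apply (BijectiveAntipode.bijective (k := k) (H := H)).1
  rw [map_sum]
  simp only [antipode_mul_antidistrib, antipode_antipodeInv]
  rw [ht.antipode_mul, apply_ite (antipode k), antipode_one, map_zero]

theorem mul_antipodeInv (a c : Fin m) :
    ∑ b, t b c * antipodeInv k (t a b) = if a = c then 1 else 0 := by
  apply (BijectiveAntipode.bijective (k := k) (H := H)).1
  rw [map_sum]
  simp only [antipode_mul_antidistrib, antipode_antipodeInv]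
  rw [ht.mul_antipode, apply_ite (antipode k), antipode_one, map_zero]

end IsComatrix

theorem YDAt.compat_comatrix {V : Type*} [AddCommGroup V] [Module k V]
    {act : H →ₐ[k] Module.End k V} {coact : V →ₗ[k] H ⊗[k] V} {m n : ℕ}
    {T : Fin m → Fin m → H} (hT : IsComatrix (k := k) T) {t : Fin n → Fin n → H} {e : Fin n → V}
    (he : IsCofam coact t e) (a : Fin n) (h : YDAt act coact (e a)) (p q : Fin m) :
    ∑ r, (LinearMap.mulRight k (T r q)).rTensor V (coact (act (T p r) (e a))) =
      ∑ r, ∑ b, (T p r * t a b) ⊗ₜ[k] act (T r q) (e b) := by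
  have := h.compat (T p q)
  rw [hT.comul_eq, he.coact_eq] at this
  simp only [map_sum, LinearMap.sum_apply, ydLeft_tmul, ydRight_tmul] at this
  rw [← this, Finset.sum_comm]

theorem IsCofam.map {V V' : Type*} [AddCommGroup V] [Module k V] [AddCommGroup V'] [Module k V']
    {coact : V →ₗ[k] H ⊗[k] V} {coact' : V' →ₗ[k] H ⊗[k] V'} {m : ℕ} {t : Fin m → Fin m → H}
    {e : Fin m → V} (he : IsCofam coact t e) {f : V →ₗ[k] V'}
    (hf : ∀ v, coact' (f v) = f.lTensor H (coact v)) :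
    IsCofam coact' t (fun a => f (e a)) where
  toIsComatrix := he.toIsComatrix
  coact_eq a := by rw [hf, he.coact_eq]; simp

theorem YDMod.exists_cofam (V : YDMod.{u, w, v} k H) (x : V) :
    ∃ (m : ℕ) (t : Fin m → Fin m → H) (e : Fin m → V) (a : Fin m),
      IsCofam V.coact t e ∧ e a = x :=
  _root_.exists_cofam (fun x => (V.ydAt x).counit_coact) (fun x => (V.ydAt x).coassoc) x

theorem ActMul.comatrix {R : Type*} [Ring R] [Algebra k R] {act : H →ₐ[k] Module.End k R} {x y : R}
    (h : ActMul act x y) {m : ℕ} {t : Fin m → Fin m → H} (ht : IsComatrix (k := k) t)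
    (a c : Fin m) : act (t a c) (x * y) = ∑ b, act (t a b) x * act (t b c) y := by
  rw [h, ht.comul_eq]
  simp [map_sum]

theorem YDMod.diagAct_comatrix {A B : Type*} [AddCommGroup A] [Module k A] [AddCommGroup B]
    [Module k B] (actA : H →ₐ[k] Module.End k A) (actB : H →ₐ[k] Module.End k B) {m : ℕ}
    {t : Fin m → Fin m → H} (ht : IsComatrix (k := k) t) (a c : Fin m) (x : A) (y : B) :
    YDMod.diagAct actA actB (t a c) (x ⊗ₜ y) = ∑ b, actA (t a b) x ⊗ₜ[k] actB (t b c) y := by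
  change Module.endTensorEndAlgHom (Algebra.TensorProduct.map actA actB (comul (R := k) (t a c)))
    (x ⊗ₜ y) = _
  rw [ht.comul_eq]
  simp [map_sum, LinearMap.sum_apply]
  rfl

theorem YDMod.diagCoact_tmul {A B : Type*} [AddCommGroup A] [Module k A] [AddCommGroup B]
    [Module k B] {coactA : A →ₗ[k] H ⊗[k] A} {coactB : B →ₗ[k] H ⊗[k] B} {m n : ℕ}
    {t : Fin m → Fin m → H} {e : Fin m → A} (he : IsCofam coactA t e)
    {s : Fin n → Fin n → H} {f : Fin n → B} (hf : IsCofam coactB s f) (a : Fin m) (b : Fin n) :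
    YDMod.diagCoact coactA coactB (e a ⊗ₜ f b) =
      ∑ c, ∑ d, (t a c * s b d) ⊗ₜ[k] (e c ⊗ₜ f d) := by
  rw [YDMod.diagCoact, LinearMap.comp_apply, LinearMap.comp_apply, TensorProduct.map_tmul,
    he.coact_eq, hf.coact_eq]
  simp only [sum_tmul, tmul_sum, map_sum, LinearEquiv.coe_coe,
    TensorProduct.tensorTensorTensorComm_tmul, LinearMap.rTensor_tmul, LinearMap.mul'_apply]
  rw [Finset.sum_comm]

theorem sum_reverse₃ {A α β γ : Type*} [AddCommMonoid A] [Fintype α] [Fintype β] [Fintype γ]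
    (f : α → β → γ → A) : ∑ a, ∑ b, ∑ c, f a b c = ∑ c, ∑ b, ∑ a, f a b c := by
  rw [Finset.sum_comm]
  simp_rw [Finset.sum_comm (s := (Finset.univ : Finset α))]
  rw [Finset.sum_comm]

/-! ### The braided tensor square of a Yetter-Drinfeld algebra -/

section BraidedSquare

variable {R : Type*} [Ring R] [Algebra k R]

/-- An algebra whose action and coaction make it an algebra in the category of
Yetter-Drinfeld modules. -/
structure IsYDAlg (act : H →ₐ[k] Module.End k R) (coact : R →ₐ[k] H ⊗[k] R) : Prop where
  actMul : ∀ x y, ActMul act x y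
  act_one : ∀ h, act h 1 = counit (R := k) h • (1 : R)
  ydAt : ∀ x, YDAt act coact.toLinearMap x

variable (act : H →ₐ[k] Module.End k R) (coact : R →ₐ[k] H ⊗[k] R)

/-- `h ⊗ b ↦ (c ⊗ d ↦ h · c ⊗ b d)`. -/
def braidR : H ⊗[k] R →ₗ[k] Module.End k (R ⊗[k] R) :=
  (Module.endTensorEndAlgHom (R := k) (S := k) (A := k)).toLinearMap ∘ₗ
    TensorProduct.map act.toLinearMap (LinearMap.mul k R)

/-- The product `(a ⊗ b) (c ⊗ d) = a (b₍₋₁₎ · c) ⊗ b₍₀₎ d` of the braided tensor square. -/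
def bmul : R ⊗[k] R →ₗ[k] R ⊗[k] R →ₗ[k] R ⊗[k] R :=
  TensorProduct.lift ((LinearMap.mul k (Module.End k (R ⊗[k] R))).compl₁₂
    (LinearMap.rTensorHom R ∘ₗ LinearMap.mul k R) (braidR act ∘ₗ coact.toLinearMap))

variable {act coact}

@[simp] theorem braidR_tmul (h : H) (b c d : R) :
    braidR act (h ⊗ₜ b) (c ⊗ₜ d) = act h c ⊗ₜ (b * d) := rfl

theorem bmul_tmul_apply (a b : R) (z : R ⊗[k] R) : bmul act coact (a ⊗ₜ b) z =
    (LinearMap.mulLeft k a).rTensor R (braidR act (coact b) z) := rfl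

theorem bmul_tmul {m : ℕ} {t : Fin m → Fin m → H} {e : Fin m → R}
    (he : IsCofam coact.toLinearMap t e) (p : Fin m) (a c d : R) :
    bmul act coact (a ⊗ₜ e p) (c ⊗ₜ d) = ∑ q, (a * act (t p q) c) ⊗ₜ[k] (e q * d) := by
  have h := he.coact_eq p
  rw [AlgHom.toLinearMap_apply] at h
  rw [bmul_tmul_apply, h]
  simp [map_sum, LinearMap.sum_apply]

theorem bmul_one_tmul {m : ℕ} {t : Fin m → Fin m → H} {e : Fin m → R}
    (he : IsCofam coact.toLinearMap t e) (p : Fin m) (c d : R) :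
    bmul act coact (1 ⊗ₜ e p) (c ⊗ₜ d) = ∑ q, act (t p q) c ⊗ₜ[k] (e q * d) := by
  simp [bmul_tmul he]

theorem bmul_tmul_one (a : R) (z : R ⊗[k] R) :
    bmul act coact (a ⊗ₜ 1) z = (LinearMap.mulLeft k a).rTensor R z := by
  rw [bmul_tmul_apply, map_one, Algebra.TensorProduct.one_def]
  congr 1
  induction z with
  | zero => simp
  | add x y hx hy => rw [map_add, hx, hy]
  | tmul c d => simp

theorem one_bmul (z : R ⊗[k] R) : bmul act coact (1 ⊗ₜ 1) z = z := by
  rw [bmul_tmul_one]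
  simp

theorem IsYDAlg.exists_cofam (hR : IsYDAlg act coact) (x : R) :
    ∃ (m : ℕ) (t : Fin m → Fin m → H) (e : Fin m → R) (a : Fin m),
      IsCofam coact.toLinearMap t e ∧ e a = x :=
  _root_.exists_cofam (fun x => (hR.ydAt x).counit_coact) (fun x => (hR.ydAt x).coassoc) x

variable (hR : IsYDAlg act coact)
include hR

theorem act_one_comatrix {m : ℕ} {t : Fin m → Fin m → H} (ht : IsComatrix (k := k) t)
    (p q : Fin m) : act (t p q) 1 = if p = q then 1 else 0 := by
  rw [hR.act_one, ht.counit_eq]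
  split_ifs <;> simp

theorem bmul_one (z : R ⊗[k] R) : bmul act coact z (1 ⊗ₜ 1) = z := by
  induction z with
  | zero => simp
  | add x y hx hy => rw [map_add, LinearMap.add_apply, hx, hy]
  | tmul a b =>
    obtain ⟨m, t, e, p, he, rfl⟩ := hR.exists_cofam b
    rw [bmul_tmul he, Finset.sum_eq_single p]
    · simp [act_one_comatrix hR he.toIsComatrix]
    · intro q _ hq
      simp [act_one_comatrix hR he.toIsComatrix, Ne.symm hq]
    · simp

theorem bmul_assoc (s t z : R ⊗[k] R) :
    bmul act coact (bmul act coact s t) z = bmul act coact s (bmul act coact t z) := by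
  induction s with
  | zero => simp
  | add x y hx hy => simp only [map_add, LinearMap.add_apply, hx, hy]
  | tmul a b =>
  induction t with
  | zero => simp
  | add x y hx hy => simp only [map_add, LinearMap.add_apply, hx, hy]
  | tmul c d =>
  induction z with
  | zero => simp
  | add x y hx hy => simp only [map_add, hx, hy]
  | tmul x y =>
  obtain ⟨m, t, e, p, he, rfl⟩ := hR.exists_cofam b
  obtain ⟨n, s, f, u, hf, rfl⟩ := hR.exists_cofam d
  have h1 := he.coact_eq
  have h2 := hf.coact_eq
  simp only [AlgHom.toLinearMap_apply] at h1 h2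
  rw [bmul_tmul he, bmul_tmul hf, map_sum, map_sum, LinearMap.sum_apply]
  simp only [bmul_tmul_apply _ (_ * _), map_mul, h1, h2, bmul_tmul he,
    (hR.actMul _ _).comatrix he.toIsComatrix]
  simp only [Finset.sum_mul, Algebra.TensorProduct.tmul_mul_tmul, map_sum,
    LinearMap.sum_apply, braidR_tmul, LinearMap.rTensor_tmul, LinearMap.mulLeft_apply,
    map_mul, Module.End.mul_apply, Finset.mul_sum, sum_tmul, mul_assoc]
  simp only [← Fintype.sum_prod_type']
  exact Fintype.sum_equiv ⟨fun x => (x.2.1, x.2.2, x.1),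
      fun x => (x.2.2, x.1, x.2.1), fun _ => rfl, fun _ => rfl⟩ _ _ fun _ => rfl

theorem diagAct_bmul {m : ℕ} {T : Fin m → Fin m → H} (hT : IsComatrix (k := k) T) (p q : Fin m)
    (s z : R ⊗[k] R) : YDMod.diagAct act act (T p q) (bmul act coact s z) =
      ∑ r, bmul act coact (YDMod.diagAct act act (T p r) s) (YDMod.diagAct act act (T r q) z) := by
  induction s with
  | zero => simp
  | add x y hx hy => simp only [map_add, LinearMap.add_apply, hx, hy, Finset.sum_add_distrib]
  | tmul a b =>
  induction z with
  | zero => simp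
  | add x y hx hy => simp only [map_add, hx, hy, Finset.sum_add_distrib]
  | tmul c d =>
  obtain ⟨n, t, e, i, he, rfl⟩ := hR.exists_cofam b
  have key : ∀ σ u d, ∑ r, braidR act (coact (act (T σ r) (e i))) (act (T r u) c ⊗ₜ d) =
      ∑ r, ∑ j, act (T σ r * t i j) c ⊗ₜ[k] (act (T r u) (e j) * d) := by
    intro σ u d
    have h1 : ∀ (g : H) (τ : H ⊗[k] R), braidR act τ (act g c ⊗ₜ d) =
        braidR act ((LinearMap.mulRight k g).rTensor R τ) (c ⊗ₜ d) := by
      intro g τ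
      induction τ with
      | zero => simp
      | add x y hx hy => simp only [map_add, LinearMap.add_apply, hx, hy]
      | tmul h x => simp
    have h2 := (hR.ydAt (e i)).compat_comatrix hT he i σ u
    simp only [h1, ← LinearMap.sum_apply, ← map_sum]
    simp only [AlgHom.toLinearMap_apply] at h2
    rw [h2]
    simp [map_sum, LinearMap.sum_apply]
  simp only [bmul_tmul he, map_sum, YDMod.diagAct_comatrix act act hT,
    (hR.actMul _ _).comatrix hT, LinearMap.sum_apply, bmul_tmul_apply]
  trans ∑ v, ∑ u, (LinearMap.mulLeft k (act (T p v) a)).rTensor R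
    (∑ r, ∑ j, act (T v r * t i j) c ⊗ₜ[k] (act (T r u) (e j) * act (T u q) d))
  · simp only [map_sum, LinearMap.rTensor_tmul, LinearMap.mulLeft_apply, sum_tmul, tmul_sum,
      map_mul, Module.End.mul_apply, ← Fintype.sum_prod_type']
    exact Fintype.sum_equiv ⟨fun x => (x.2.2.2, x.2.2.1, x.2.1, x.1),
      fun x => (x.2.2.2, x.2.2.1, x.2.1, x.1), fun _ => rfl, fun _ => rfl⟩ _ _ fun _ => rfl
  · simp only [← key]
    simp only [map_sum]
    exact sum_reverse₃ _


theorem diagCoact_bmul (s z : R ⊗[k] R) :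
    YDMod.diagCoact coact.toLinearMap coact.toLinearMap (bmul act coact s z) =
      TensorProduct.map₂ (LinearMap.mul k H) (bmul act coact)
        (YDMod.diagCoact coact.toLinearMap coact.toLinearMap s)
        (YDMod.diagCoact coact.toLinearMap coact.toLinearMap z) := by
  induction s with
  | zero => simp
  | add x y hx hy => simp only [map_add, LinearMap.add_apply, hx, hy]
  | tmul a b =>
  induction z with
  | zero => simp
  | add x y hx hy => simp only [map_add, hx, hy]
  | tmul c d =>
  obtain ⟨m, t, e, p, he, rfl⟩ := hR.exists_cofam b
  obtain ⟨m₁, t₁, e₁, p₁, he₁, rfl⟩ := hR.exists_cofam a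
  obtain ⟨m₂, t₂, e₂, p₂, he₂, rfl⟩ := hR.exists_cofam c
  obtain ⟨m₃, t₃, e₃, p₃, he₃, rfl⟩ := hR.exists_cofam d
  let M : (H ⊗[k] R) ⊗[k] (H ⊗[k] R) →ₗ[k] H ⊗[k] (R ⊗[k] R) :=
    (LinearMap.mul' k H).rTensor (R ⊗[k] R) ∘ₗ
    (TensorProduct.tensorTensorTensorComm k H R H R).toLinearMap
  have hM : ∀ x y, YDMod.diagCoact coact.toLinearMap coact.toLinearMap (x ⊗ₜ[k] y) =
    M (coact x ⊗ₜ coact y) := fun _ _ => rfl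
  have hM' : ∀ (σ τ : H ⊗[k] R) (g : H) (x : R), M (σ ⊗ₜ ((g ⊗ₜ x) * τ)) =
      M ((LinearMap.mulRight k g).rTensor R σ ⊗ₜ (((1 : H) ⊗ₜ x) * τ)) := by
    intro σ τ g x
    induction σ with
    | zero => simp
    | add x y hx hy => simp only [map_add, add_tmul, hx, hy]
    | tmul h y =>
      induction τ with
      | zero => simp
      | add x y hx hy => simp only [map_add, tmul_add, mul_add, hx, hy]
      | tmul h' y' => simp [M, mul_assoc]
  have hc := fun j => he.coact_eq j
  have hc₁ := fun j => he₁.coact_eq j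
  have hc₂ := fun j => he₂.coact_eq j
  have hc₃ := fun j => he₃.coact_eq j
  simp only [AlgHom.toLinearMap_apply] at hc hc₁ hc₂ hc₃
  have h2 := fun j => (hR.ydAt (e₂ p₂)).compat_comatrix he.toIsComatrix he₂ p₂ p j
  simp only [AlgHom.toLinearMap_apply] at h2
  have h4 : ∀ (g : H) (σ τ : H ⊗[k] R), (LinearMap.mulRight k g).rTensor R (σ * τ) =
      σ * (LinearMap.mulRight k g).rTensor R τ := by
    intro g σ τ
    induction σ with
    | zero => simp
    | add x y hx hy => simp only [map_add, add_mul, hx, hy]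
    | tmul h y =>
      induction τ with
      | zero => simp
      | add x y hx hy => simp only [map_add, mul_add, hx, hy]
      | tmul h' y' => simp [mul_assoc]
  trans M (∑ q, (coact (e₁ p₁) * ∑ r, (LinearMap.mulRight k (t r q)).rTensor R
      (coact (act (t p r) (e₂ p₂)))) ⊗ₜ (((1 : H) ⊗ₜ e q) * coact (e₃ p₃)))
  · simp only [bmul_tmul he, map_sum, hM, map_mul, hc, tmul_sum, Finset.sum_mul, Finset.mul_sum,
      sum_tmul]
    rw [Finset.sum_comm]
    refine Finset.sum_congr rfl fun _ _ => Finset.sum_congr rfl fun _ _ => ?_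
    rw [hM', h4]
  · simp only [h2, YDMod.diagCoact_tmul he₁ he, YDMod.diagCoact_tmul he₂ he₃, hc₁, hc₃,
      Finset.mul_sum, Finset.sum_mul, tmul_sum, sum_tmul, map_sum, LinearMap.sum_apply,
      TensorProduct.map₂_apply_tmul, TensorProduct.map_tmul, bmul_tmul he, Algebra.TensorProduct.tmul_mul_tmul, M,
      LinearMap.comp_apply, LinearEquiv.coe_coe, TensorProduct.tensorTensorTensorComm_tmul,
      LinearMap.rTensor_tmul, LinearMap.mul'_apply, LinearMap.mul_apply', one_mul]
    simp only [TensorProduct.map_tmul, LinearMap.mul_apply', bmul_tmul he, tmul_sum, ← Fintype.sum_prod_type']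
    refine Fintype.sum_equiv ⟨fun x => (x.2.2.2.1, x.2.1, x.2.2.2.2, x.2.2.1, x.1),
      fun x => (x.2.2.2.2, x.2.1, x.2.2.2.1, x.1, x.2.2.1), fun _ => rfl, fun _ => rfl⟩ _ _
      fun _ => ?_
    simp only [Equiv.coe_fn_mk, mul_assoc]

end BraidedSquare

/-! ### Braided bialgebras generated by primitive elements -/

section Pre

variable {R : Type*} [Ring R] [Algebra k R]

/-- The tensor `ι v ⊗ 1 + 1 ⊗ ι v`. -/
def primTensor {U : Type*} [AddCommGroup U] [Module k U] (ι : U →ₗ[k] R) (v : U) : R ⊗[k] R :=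
  ι v ⊗ₜ 1 + 1 ⊗ₜ ι v

/-- `R` is an algebra in the category of Yetter-Drinfeld modules that is generated by the image
of `ι : U → R`, with a comultiplication for which the elements of this image are primitive, and
with a projection `pr` to the component of degree one. -/
structure IsPre (U : YDMod.{u, w, v} k H) (ι : U →ₗ[k] R) (act : H →ₐ[k] Module.End k R)
    (coact : R →ₐ[k] H ⊗[k] R) (Δ : R →ₗ[k] R ⊗[k] R) (ε : R →ₐ[k] k) (pr : R →ₗ[k] U) : Prop
    extends IsYDAlg act coact where
  act_ι : ∀ h v, act h (ι v) = ι (U.act h v)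
  coact_ι : ∀ v, coact (ι v) = ι.lTensor H (U.coact v)
  comul_one : Δ 1 = 1 ⊗ₜ 1
  comul_ι_mul : ∀ v x, Δ (ι v * x) = bmul act coact (primTensor ι v) (Δ x)
  counit_ι : ∀ v, ε (ι v) = 0
  pr_one : pr 1 = 0
  pr_ι_mul : ∀ v x, pr (ι v * x) = ε x • v
  ind : ∀ p : R → Prop, p 1 → (∀ x y, p x → p y → p (x + y)) → (∀ (c : k) x, p x → p (c • x)) →
    (∀ v x, p x → p (ι v * x)) → ∀ x, p x

namespace IsPre

variable {U : YDMod.{u, w, v} k H} {ι : U →ₗ[k] R} {act : H →ₐ[k] Module.End k R}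
    {coact : R →ₐ[k] H ⊗[k] R} {Δ : R →ₗ[k] R ⊗[k] R} {ε : R →ₐ[k] k} {pr : R →ₗ[k] U}
    (hR : IsPre U ι act coact Δ ε pr)
include hR

theorem cofam {m : ℕ} {t : Fin m → Fin m → H} {e : Fin m → U} (he : IsCofam U.coact t e) :
    IsCofam coact.toLinearMap t (fun a => ι (e a)) := he.map hR.coact_ι

theorem bmul_prim {m : ℕ} {t : Fin m → Fin m → H} {e : Fin m → U} (he : IsCofam U.coact t e)
    (a : Fin m) (c d : R) : bmul act coact (primTensor ι (e a)) (c ⊗ₜ d) =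
      (ι (e a) * c) ⊗ₜ[k] d + ∑ b, act (t a b) c ⊗ₜ[k] (ι (e b) * d) := by
  rw [primTensor, map_add, LinearMap.add_apply, bmul_tmul_one, bmul_one_tmul (hR.cofam he)]
  rfl

theorem comul_ι (v : U) : Δ (ι v) = primTensor ι v := by
  rw [← mul_one (ι v), hR.comul_ι_mul, hR.comul_one, bmul_one hR.toIsYDAlg]

theorem pr_ι (v : U) : pr (ι v) = v := by
  rw [← mul_one (ι v), hR.pr_ι_mul, map_one, one_smul]

theorem counit_act (h : H) (x : R) : ε (act h x) = counit (R := k) h * ε x := by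
  revert h
  refine hR.ind (fun x => ∀ h, ε (act h x) = counit (R := k) h * ε x) ?_ ?_ ?_ ?_ x
  · intro h; rw [hR.act_one, map_smul]; simp
  · intro x y hx hy h; simp only [map_add, hx, hy, mul_add]
  · intro c x hx h; simp only [map_smul, hx, smul_eq_mul]; ring
  · intro v x hx h
    refine comatrix_induction (k := k) (p := fun h => ε (act h (ι v * x)) =
      counit (R := k) h * ε (ι v * x)) (by simp) ?_ ?_ ?_ h
    · intro x y hx hy; simp only [map_add, LinearMap.add_apply, hx, hy, add_mul]
    · intro c x hx; simp only [map_smul, LinearMap.smul_apply, hx, smul_eq_mul]; ring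
    · intro m t ht a b
      rw [(hR.actMul _ _).comatrix ht]
      simp [hR.act_ι, hR.counit_ι]

theorem counit_comul (x : R) : TensorProduct.lid k R (ε.toLinearMap.rTensor R (Δ x)) = x := by
  refine hR.ind (fun x => TensorProduct.lid k R (ε.toLinearMap.rTensor R (Δ x)) = x) ?_ ?_ ?_ ?_ x
  · simp [hR.comul_one]
  · intro x y hx hy; simp only [map_add, hx, hy]
  · intro c x hx; simp only [map_smul, hx]
  · intro v x hx
    obtain ⟨m, t, e, a, he, rfl⟩ := U.exists_cofam v
    have key : ∀ z, TensorProduct.lid k R (ε.toLinearMap.rTensor R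
        (bmul act coact (primTensor ι (e a)) z)) =
        ι (e a) * TensorProduct.lid k R (ε.toLinearMap.rTensor R z) := by
      intro z
      induction z with
      | zero => simp
      | add x y hx hy => simp only [map_add, hx, hy, mul_add]
      | tmul c d =>
        rw [hR.bmul_prim he]
        simp [map_sum, hR.counit_ι, hR.counit_act, he.counit_eq]
    rw [hR.comul_ι_mul, key, hx]

theorem comul_counit (x : R) : TensorProduct.rid k R (ε.toLinearMap.lTensor R (Δ x)) = x := by
  refine hR.ind (fun x => TensorProduct.rid k R (ε.toLinearMap.lTensor R (Δ x)) = x) ?_ ?_ ?_ ?_ x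
  · simp [hR.comul_one]
  · intro x y hx hy; simp only [map_add, hx, hy]
  · intro c x hx; simp only [map_smul, hx]
  · intro v x hx
    obtain ⟨m, t, e, a, he, rfl⟩ := U.exists_cofam v
    have key : ∀ z, TensorProduct.rid k R (ε.toLinearMap.lTensor R
        (bmul act coact (primTensor ι (e a)) z)) =
        ι (e a) * TensorProduct.rid k R (ε.toLinearMap.lTensor R z) := by
      intro z
      induction z with
      | zero => simp
      | add x y hx hy => simp only [map_add, hx, hy, mul_add]
      | tmul c d =>
        rw [hR.bmul_prim he]
        simp [map_sum, hR.counit_ι]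
    rw [hR.comul_ι_mul, key, hx]

theorem counit_coact (x : R) : ε.toLinearMap.lTensor H (coact x) = 1 ⊗ₜ ε x := by
  refine hR.ind (fun x => ε.toLinearMap.lTensor H (coact x) = 1 ⊗ₜ ε x) ?_ ?_ ?_ ?_ x
  · simp [Algebra.TensorProduct.one_def]
  · intro x y hx hy; simp only [map_add, hx, hy, tmul_add]
  · intro c x hx; simp only [map_smul, hx, tmul_smul]
  · intro v x hx
    obtain ⟨m, t, e, a, he, rfl⟩ := U.exists_cofam v
    have h := (hR.cofam he).coact_eq a
    rw [AlgHom.toLinearMap_apply] at h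
    have key : ∀ (g : H) (u : U) (z : H ⊗[k] R),
        ε.toLinearMap.lTensor H ((g ⊗ₜ ι u) * z) = 0 := by
      intro g u z
      induction z with
      | zero => simp
      | add x y hx hy => simp only [map_add, hx, hy, mul_add, add_zero]
      | tmul c d => simp [hR.counit_ι]
    rw [map_mul, h, Finset.sum_mul, map_sum]
    simp [key, hR.counit_ι]

theorem pr_act (h : H) (x : R) : pr (act h x) = U.act h (pr x) := by
  revert h
  refine hR.ind (fun x => ∀ h, pr (act h x) = U.act h (pr x)) ?_ ?_ ?_ ?_ x
  · intro h; rw [hR.act_one, map_smul]; simp [hR.pr_one]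
  · intro x y hx hy h; simp only [map_add, hx, hy]
  · intro c x hx h; simp only [map_smul, hx]
  · intro v x hx h
    refine comatrix_induction (k := k) (p := fun h => pr (act h (ι v * x)) =
      U.act h (pr (ι v * x))) (by simp) ?_ ?_ ?_ h
    · intro x y hx hy; simp only [map_add, LinearMap.add_apply, hx, hy]
    · intro c x hx; simp only [map_smul, LinearMap.smul_apply, hx]
    · intro m t ht a b
      rw [(hR.actMul _ _).comatrix ht]
      simp [hR.act_ι, hR.pr_ι_mul, hR.counit_act, ht.counit_eq]

theorem pr_coact (x : R) : U.coact (pr x) = pr.lTensor H (coact x) := by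
  refine hR.ind (fun x => U.coact (pr x) = pr.lTensor H (coact x)) ?_ ?_ ?_ ?_ x
  · simp [Algebra.TensorProduct.one_def, hR.pr_one]
  · intro x y hx hy; simp only [map_add, hx, hy]
  · intro c x hx; simp only [map_smul, hx]
  · intro v x hx
    obtain ⟨m, t, e, a, he, rfl⟩ := U.exists_cofam v
    have h := (hR.cofam he).coact_eq a
    rw [AlgHom.toLinearMap_apply] at h
    have key : ∀ (g : H) (u : U) (z : H ⊗[k] R),
        pr.lTensor H ((g ⊗ₜ ι u) * z) = TensorProduct.map (LinearMap.mulLeft k g)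
          ((LinearMap.toSpanSingleton k U u)) (ε.toLinearMap.lTensor H z) := by
      intro g u z
      induction z with
      | zero => simp
      | add x y hx hy => simp only [map_add, hx, hy, mul_add]
      | tmul c d => simp [hR.pr_ι_mul]
    rw [map_mul coact, h, Finset.sum_mul, map_sum]
    simp [key, hR.counit_coact, hR.pr_ι_mul, he.coact_eq, Finset.smul_sum]

theorem comul_mul (x y : R) : Δ (x * y) = bmul act coact (Δ x) (Δ y) := by
  refine hR.ind (fun x => Δ (x * y) = bmul act coact (Δ x) (Δ y)) ?_ ?_ ?_ ?_ x
  · rw [hR.comul_one, one_bmul, one_mul]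
  · intro x y hx hy; simp only [add_mul, map_add, LinearMap.add_apply, hx, hy]
  · intro c x hx; simp only [smul_mul_assoc, map_smul, LinearMap.smul_apply, hx]
  · intro v x hx
    rw [mul_assoc, hR.comul_ι_mul, hx, hR.comul_ι_mul, bmul_assoc hR.toIsYDAlg]

theorem pr_mul (x y : R) : pr (x * y) = ε y • pr x + ε x • pr y := by
  refine hR.ind (fun x => pr (x * y) = ε y • pr x + ε x • pr y) ?_ ?_ ?_ ?_ x
  · simp [hR.pr_one]
  · intro x y hx hy; simp only [add_mul, map_add, hx, hy, smul_add, add_smul]; abel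
  · intro c x hx
    simp only [smul_mul_assoc, map_smul, hx, smul_add, smul_smul, smul_eq_mul, mul_comm]
  · intro v x hx
    rw [mul_assoc, hR.pr_ι_mul, hR.pr_ι_mul, map_mul, map_mul, hR.counit_ι, zero_mul, zero_smul,
      add_zero, smul_smul, mul_comm]

theorem diagAct_prim (h : H) (v : U) :
    YDMod.diagAct act act h (primTensor ι v) = primTensor ι (U.act h v) := by
  refine comatrix_induction (k := k) (p := fun h => YDMod.diagAct act act h (primTensor ι v) =
      primTensor ι (U.act h v)) (by simp [primTensor]) ?_ ?_ ?_ h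
  · intro x y hx hy
    simp only [map_add, LinearMap.add_apply, hx, hy]
    simp only [primTensor, map_add, add_tmul, tmul_add]; abel
  · intro c x hx
    simp only [map_smul, LinearMap.smul_apply, hx]
    simp only [primTensor, map_smul, ← smul_tmul', tmul_smul, smul_add]
  · intro m t ht a c
    rw [primTensor, primTensor, map_add, YDMod.diagAct_comatrix _ _ ht,
      YDMod.diagAct_comatrix _ _ ht]
    simp only [hR.act_one, ht.counit_eq, ite_smul, one_smul, zero_smul]
    rw [Finset.sum_eq_single c, Finset.sum_eq_single a]
    · simp [hR.act_ι]
    · intro d _ hd; simp [Ne.symm hd]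
    · simp
    · intro d _ hd; simp [hd]
    · simp

theorem comul_act (h : H) (x : R) : Δ (act h x) = YDMod.diagAct act act h (Δ x) := by
  revert h
  refine hR.ind (fun x => ∀ h, Δ (act h x) = YDMod.diagAct act act h (Δ x)) ?_ ?_ ?_ ?_ x
  · intro h
    refine comatrix_induction (k := k) (p := fun h => Δ (act h 1) =
      YDMod.diagAct act act h (Δ 1)) (by simp) ?_ ?_ ?_ h
    · intro x y hx hy; simp only [map_add, LinearMap.add_apply, hx, hy]
    · intro c x hx; simp only [map_smul, LinearMap.smul_apply, hx]
    · intro m t ht a b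
      rw [hR.comul_one, YDMod.diagAct_comatrix _ _ ht]
      simp only [hR.act_one, ht.counit_eq, ite_smul, one_smul, zero_smul]
      split_ifs with hab
      · subst hab
        rw [hR.comul_one, Finset.sum_eq_single a]
        · simp
        · intro c _ hc; simp [Ne.symm hc]
        · simp
      · rw [map_zero, Finset.sum_eq_zero]
        intro c _
        by_cases hac : a = c
        · subst hac; simp [hab]
        · simp [hac]
  · intro x y hx hy h; simp only [map_add, hx, hy]
  · intro c x hx h; simp only [map_smul, hx]
  · intro v x hx h
    refine comatrix_induction (k := k) (p := fun h => Δ (act h (ι v * x)) =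
      YDMod.diagAct act act h (Δ (ι v * x))) (by simp) ?_ ?_ ?_ h
    · intro x y hx hy; simp only [map_add, LinearMap.add_apply, hx, hy]
    · intro c x hx; simp only [map_smul, LinearMap.smul_apply, hx]
    · intro m t ht a b
      rw [(hR.actMul _ _).comatrix ht, map_sum, hR.comul_ι_mul, diagAct_bmul hR.toIsYDAlg ht]
      refine Finset.sum_congr rfl fun c _ => ?_
      rw [hR.act_ι, hR.comul_ι_mul, hx, hR.diagAct_prim]

theorem comul_coact (x : R) : Δ.lTensor H (coact x) =
    YDMod.diagCoact coact.toLinearMap coact.toLinearMap (Δ x) := by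
  let D := YDMod.diagCoact coact.toLinearMap coact.toLinearMap
  have hD : ∀ x y, D (x ⊗ₜ y) = (LinearMap.mul' k H).rTensor (R ⊗[k] R)
    (TensorProduct.tensorTensorTensorComm k H R H R (coact x ⊗ₜ coact y)) := fun _ _ => rfl
  change _ = D (Δ x)
  refine hR.ind (fun x => Δ.lTensor H (coact x) = D (Δ x)) ?_ ?_ ?_ ?_ x
  · rw [hR.comul_one, hD]
    simp [Algebra.TensorProduct.one_def, hR.comul_one]
  · intro x y hx hy; simp only [map_add, hx, hy]
  · intro c x hx; simp only [map_smul, hx]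
  · intro v x hx
    obtain ⟨m, t, e, a, he, rfl⟩ := U.exists_cofam v
    have h := (hR.cofam he).coact_eq a
    rw [AlgHom.toLinearMap_apply] at h
    have key : ∀ (g : H) (u : U) (z : H ⊗[k] R),
        Δ.lTensor H ((g ⊗ₜ ι u) * z) = TensorProduct.map₂ (LinearMap.mul k H) (bmul act coact)
          (g ⊗ₜ (primTensor ι u)) (Δ.lTensor H z) := by
      intro g u z
      induction z with
      | zero => simp
      | add x y hx hy => simp only [map_add, hx, hy, mul_add]
      | tmul c d =>
        simp only [LinearMap.lTensor_tmul, TensorProduct.map₂_apply_tmul, TensorProduct.map_tmul,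
          Algebra.TensorProduct.tmul_mul_tmul, hR.comul_ι_mul]
        rfl
    have h1 : D (primTensor ι (e a)) =
        ∑ b, t a b ⊗ₜ primTensor ι (e b) := by
      rw [primTensor, map_add, hD, hD, h, map_one, Algebra.TensorProduct.one_def]
      simp [primTensor, sum_tmul, tmul_sum, tmul_add, map_sum, Finset.sum_add_distrib]
    rw [map_mul coact, h, Finset.sum_mul, map_sum, hR.comul_ι_mul]
    change _ = YDMod.diagCoact coact.toLinearMap coact.toLinearMap _
    rw [diagCoact_bmul hR.toIsYDAlg]
    change _ = TensorProduct.map₂ (LinearMap.mul k H) (bmul act coact) (D _) (D _)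
    rw [h1, ← hx]
    simp only [key, map_sum, LinearMap.sum_apply]

theorem coassoc (x : R) : TensorProduct.assoc k R R R (Δ.rTensor R (Δ x)) = Δ.lTensor R (Δ x) := by
  refine hR.ind (fun x => TensorProduct.assoc k R R R (Δ.rTensor R (Δ x)) =
    Δ.lTensor R (Δ x)) ?_ ?_ ?_ ?_ x
  · simp [hR.comul_one]
  · intro x y hx hy; simp only [map_add, hx, hy]
  · intro c x hx; simp only [map_smul, hx]
  · intro v x hx
    obtain ⟨m, t, e, a, he, rfl⟩ := U.exists_cofam v
    let op : R ⊗[k] (R ⊗[k] R) →ₗ[k] R ⊗[k] (R ⊗[k] R) :=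
      (LinearMap.mulLeft k (ι (e a))).rTensor _ +
      ∑ b, TensorProduct.map (act (t a b)) (bmul act coact (primTensor ι (e b)))
    have hL : ∀ z, TensorProduct.assoc k R R R (Δ.rTensor R
        (bmul act coact (primTensor ι (e a)) z)) =
        op (TensorProduct.assoc k R R R (Δ.rTensor R z)) := by
      intro z
      induction z with
      | zero => simp
      | add x y hx hy => simp only [map_add, hx, hy]
      | tmul c d =>
        rw [hR.bmul_prim he]
        simp only [map_add, map_sum, LinearMap.rTensor_tmul, hR.comul_act, hR.comul_ι_mul]
        generalize Δ c = y
        induction y with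
        | zero => simp
        | add x y hx hy =>
          simp only [map_add, add_tmul, Finset.sum_add_distrib] at *
          rw [← hx, ← hy]
          abel
        | tmul p q =>
          simp only [op, LinearMap.add_apply, LinearMap.sum_apply, TensorProduct.assoc_tmul,
            LinearMap.rTensor_tmul, TensorProduct.map_tmul, LinearMap.mulLeft_apply]
          rw [hR.bmul_prim he]
          simp only [YDMod.diagAct_comatrix _ _ he.toIsComatrix, sum_tmul, add_tmul, map_add,
            map_sum, TensorProduct.assoc_tmul]
          rw [add_assoc]
          congr 1
          simp only [hR.bmul_prim he, tmul_add, tmul_sum, Finset.sum_add_distrib]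
          congr 1
          rw [Finset.sum_comm]
    have hRt : ∀ z, Δ.lTensor R (bmul act coact (primTensor ι (e a)) z) =
        op (Δ.lTensor R z) := by
      intro z
      induction z with
      | zero => simp
      | add x y hx hy => simp only [map_add, hx, hy]
      | tmul c d =>
        rw [hR.bmul_prim he]
        simp only [map_add, map_sum, LinearMap.lTensor_tmul, hR.comul_ι_mul, op,
          LinearMap.add_apply, LinearMap.sum_apply, LinearMap.rTensor_tmul, TensorProduct.map_tmul,
          LinearMap.mulLeft_apply]
    rw [hR.comul_ι_mul, hL, hx, hRt]

end IsPre

end Pre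

namespace YDMod

variable (V : YDMod.{u, w, v} k H)

theorem t_isPre : IsPre V (TensorAlgebra.ι k) V.tAct V.tCoact V.tComul V.tCounit V.tPr where
  actMul := V.tAct_mul
  act_one h := by
    have := V.tAct_algebraMap h 1
    rw [map_one, one_mul] at this
    rw [this, Algebra.algebraMap_eq_smul_one]
  ydAt := V.tYDAt
  act_ι := V.tAct_ι
  coact_ι := V.tCoact_ι
  comul_one := V.tComul_one
  comul_ι_mul v x := by
    rw [tComul_ι_mul, tComulLeft_apply, primTensor, map_add, LinearMap.add_apply, bmul_tmul_one]
    congr 1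
    rw [bmul_tmul_apply, tCoact_ι]
    have : ∀ t z, V.tBraidMul t z = (LinearMap.mulLeft k 1).rTensor V.T
        (braidR V.tAct ((TensorAlgebra.ι k).lTensor H t) z) := by
      intro t z
      induction t with
      | zero => simp
      | add x y hx hy => simp only [map_add, LinearMap.add_apply, hx, hy]
      | tmul h u =>
        induction z with
        | zero => simp
        | add x y hx hy => simp only [map_add, hx, hy]
        | tmul c d => simp
    exact this _ _
  counit_ι := V.tCounit_ι
  pr_one := V.tPr_one
  pr_ι_mul := V.tPr_ι_mul
  ind p h1 ha hs hm x := by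
    let S : Submodule k V.T :=
      { carrier := {x | p x}
        add_mem' := fun hx hy => ha _ _ hx hy
        zero_mem' := by simpa using hs 0 1 h1
        smul_mem' := fun c x hx => hs c x hx }
    exact V.t_induction (S := S) h1 hm x

/-- The counit of the Nichols algebra. -/
def nCounit : V.Nichols →ₐ[k] k :=
  Ideal.Quotient.liftₐ V.nicholsIdeal V.tCounit fun _ hx => (V.graded_le hx).2

/-- The projection of the Nichols algebra to its component of degree one. -/
def nPr : V.Nichols →ₗ[k] V :=
  descend V.nmk.toLinearMap V.nmk_surjective V.tPr (by
    rw [ker_nmk]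
    exact fun _ hx => (V.graded_le hx).1)

theorem nCounit_nmk (x : V.T) : V.nCounit (V.nmk x) = V.tCounit x := rfl

theorem nPr_nmk (x : V.T) : V.nPr (V.nmk x) = V.tPr x :=
  descend_apply V.nmk.toLinearMap V.nmk_surjective _ _ x

theorem nComul_bmul (s t : V.T ⊗[k] V.T) :
    TensorProduct.map V.nmk.toLinearMap V.nmk.toLinearMap (bmul V.tAct V.tCoact s t) =
      bmul V.nAct V.nCoact (TensorProduct.map V.nmk.toLinearMap V.nmk.toLinearMap s)
        (TensorProduct.map V.nmk.toLinearMap V.nmk.toLinearMap t) := by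
  induction s with
  | zero => simp
  | add x y hx hy => simp only [map_add, LinearMap.add_apply, hx, hy]
  | tmul a b =>
    induction t with
    | zero => simp
    | add x y hx hy => simp only [map_add, hx, hy]
    | tmul c d =>
      obtain ⟨m, t, e, i, he, rfl⟩ := V.t_isPre.toIsYDAlg.exists_cofam b
      have he' : IsCofam V.nCoact.toLinearMap t fun a => V.nmk (e a) :=
        he.map (f := V.nmk.toLinearMap) V.nCoact_nmk
      rw [bmul_tmul he]
      simp only [map_sum, TensorProduct.map_tmul, AlgHom.toLinearMap_apply, map_mul,
        bmul_tmul he', nAct_nmk]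

theorem n_isPre : IsPre V V.nι V.nAct V.nCoact V.nComul V.nCounit V.nPr where
  actMul := V.nAct_mul
  act_one h := by
    have := V.t_isPre.act_one h
    rw [← map_one V.nmk, nAct_nmk, this, map_smul]
  ydAt := V.nichols.ydAt
  act_ι := fun h v => (V.nι_isHom.map_act h v).symm
  coact_ι := V.nι_isHom.map_coact
  comul_one := by
    rw [← map_one V.nmk, nComul_nmk, tComul_one]
    simp
  comul_ι_mul v x := by
    obtain ⟨x, rfl⟩ := V.nmk_surjective x
    change V.nComul (V.nmk (TensorAlgebra.ι k v) * V.nmk x) = _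
    rw [← map_mul, nComul_nmk, V.t_isPre.comul_ι_mul, nComul_bmul, nComul_nmk, primTensor, map_add]
    simp only [TensorProduct.map_tmul, AlgHom.toLinearMap_apply, map_one]
    rfl
  counit_ι := V.tCounit_ι
  pr_one := by rw [← map_one V.nmk, nPr_nmk, tPr_one]
  pr_ι_mul v x := by
    obtain ⟨x, rfl⟩ := V.nmk_surjective x
    change V.nPr (V.nmk (TensorAlgebra.ι k v) * V.nmk x) = _
    rw [← map_mul, nPr_nmk, tPr_ι_mul]
    rfl
  ind p h1 ha hs hm x := by
    obtain ⟨x, rfl⟩ := V.nmk_surjective x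
    refine V.t_isPre.ind (fun x => p (V.nmk x)) (by simpa using h1) ?_ ?_ ?_ x
    · intro x y hx hy
      rw [map_add]
      exact ha _ _ hx hy
    · intro c x hx
      rw [map_smul]
      exact hs _ _ hx
    · intro v x hx
      rw [map_mul]
      exact hm v _ hx

end YDMod

/-! ### Slices of tensors -/

section Slices

variable {A B C D : Type*} [AddCommGroup A] [Module k A] [AddCommGroup B] [Module k B]
  [AddCommGroup C] [Module k C] [AddCommGroup D] [Module k D]

/-- The slice `a ⊗ b ↦ φ(b) a`. -/
def rslice (φ : B →ₗ[k] k) : A ⊗[k] B →ₗ[k] A := (TensorProduct.rid k A).toLinearMap ∘ₗ φ.lTensor A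

/-- The slice `a ⊗ b ↦ φ(a) b`. -/
def lslice (φ : A →ₗ[k] k) : A ⊗[k] B →ₗ[k] B := (TensorProduct.lid k B).toLinearMap ∘ₗ φ.rTensor B

@[simp] theorem rslice_tmul (φ : B →ₗ[k] k) (a : A) (b : B) : rslice φ (a ⊗ₜ b) = φ b • a := rfl

@[simp] theorem lslice_tmul (φ : A →ₗ[k] k) (a : A) (b : B) : lslice φ (a ⊗ₜ b) = φ a • b := rfl

theorem rslice_map (φ : D →ₗ[k] k) (f : A →ₗ[k] C) (g : B →ₗ[k] D) (z : A ⊗[k] B) :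
    rslice φ (TensorProduct.map f g z) = f (rslice (φ ∘ₗ g) z) := by
  induction z with
  | zero => simp
  | add x y hx hy => simp only [map_add, hx, hy]
  | tmul a b => simp

theorem lslice_map (φ : C →ₗ[k] k) (f : A →ₗ[k] C) (g : B →ₗ[k] D) (z : A ⊗[k] B) :
    lslice φ (TensorProduct.map f g z) = g (lslice (φ ∘ₗ f) z) := by
  induction z with
  | zero => simp
  | add x y hx hy => simp only [map_add, hx, hy]
  | tmul a b => simp

theorem rslice_comm (φ : A →ₗ[k] k) (z : A ⊗[k] B) :
    rslice φ (TensorProduct.comm k A B z) = lslice φ z := by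
  induction z with
  | zero => simp
  | add x y hx hy => simp only [map_add, hx, hy]
  | tmul a b => simp

theorem exists_rep_right (z : A ⊗[k] B) : ∃ (n : ℕ) (b : Fin n → B) (a : Fin n → A),
    LinearIndependent k b ∧ z = ∑ c, a c ⊗ₜ b c := by
  classical
  let β := Module.Basis.ofVectorSpace k B
  obtain ⟨f, rfl⟩ := TensorProduct.eq_repr_basis_right β z
  let e := f.support.equivFin
  refine ⟨f.support.card, fun c => β (e.symm c), fun c => f (e.symm c), ?_, ?_⟩
  · exact β.linearIndependent.comp _ (Subtype.val_injective.comp e.symm.injective)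
  · rw [Finsupp.sum, ← Finset.sum_coe_sort]
    exact (Equiv.sum_comp e.symm fun i : f.support => f i ⊗ₜ[k] β i).symm

theorem exists_dual_family {n : ℕ} {b : Fin n → B} (hb : LinearIndependent k b) :
    ∃ φ : Fin n → B →ₗ[k] k, ∀ c d, φ c (b d) = if c = d then 1 else 0 := by
  classical
  obtain ⟨g, hg⟩ := LinearMap.exists_leftInverse_of_injective
    (Finsupp.linearCombination k b) (LinearMap.ker_eq_bot.2 hb)
  refine ⟨fun c => Finsupp.lapply c ∘ₗ g, fun c d => ?_⟩
  have h := LinearMap.congr_fun hg (Finsupp.single d 1)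
  rw [LinearMap.comp_apply, Finsupp.linearCombination_single, one_smul] at h
  rw [LinearMap.comp_apply, h]
  simp [Finsupp.single_apply, eq_comm]

theorem exists_rep_right_mem {P : Submodule k A} {z : A ⊗[k] B}
    (h : ∀ φ : B →ₗ[k] k, rslice φ z ∈ P) : ∃ (n : ℕ) (b : Fin n → B) (a : Fin n → A),
    LinearIndependent k b ∧ (∀ c, a c ∈ P) ∧ z = ∑ c, a c ⊗ₜ b c := by
  obtain ⟨n, b, a, hb, rfl⟩ := exists_rep_right z
  refine ⟨n, b, a, hb, fun c => ?_, rfl⟩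
  obtain ⟨φ, hφ⟩ := exists_dual_family hb
  have := h (φ c)
  simpa [map_sum, hφ] using this

theorem exists_rep_left_mem {P : Submodule k B} {z : A ⊗[k] B}
    (h : ∀ φ : A →ₗ[k] k, lslice φ z ∈ P) : ∃ (n : ℕ) (a : Fin n → A) (b : Fin n → B),
    LinearIndependent k a ∧ (∀ c, b c ∈ P) ∧ z = ∑ c, a c ⊗ₜ b c := by
  obtain ⟨n, a, b, ha, hb, e⟩ := exists_rep_right_mem (P := P) (z := TensorProduct.comm k A B z)
    (fun φ => by rw [rslice_comm]; exact h φ)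
  refine ⟨n, a, b, ha, hb, ?_⟩
  apply (TensorProduct.comm k A B).injective
  rw [e]
  simp [map_sum]

theorem eq_zero_of_rslice {z : A ⊗[k] B} (h : ∀ φ : B →ₗ[k] k, rslice φ z = 0) : z = 0 := by
  obtain ⟨n, b, a, -, ha, rfl⟩ := exists_rep_right_mem (P := ⊥) h
  exact Finset.sum_eq_zero fun c _ => by rw [(Submodule.mem_bot k).1 (ha c), zero_tmul]

theorem eq_zero_of_lslice {z : A ⊗[k] B} (h : ∀ φ : A →ₗ[k] k, lslice φ z = 0) : z = 0 := by
  obtain ⟨n, a, b, -, hb, rfl⟩ := exists_rep_left_mem (P := ⊥) h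
  exact Finset.sum_eq_zero fun c _ => by rw [(Submodule.mem_bot k).1 (hb c), tmul_zero]

theorem mem_range_lTensor {P : Submodule k B} {z : A ⊗[k] B}
    (h : ∀ φ : A →ₗ[k] k, lslice φ z ∈ P) : z ∈ LinearMap.range (P.subtype.lTensor A) := by
  obtain ⟨n, a, b, -, hb, rfl⟩ := exists_rep_left_mem h
  exact ⟨∑ c, a c ⊗ₜ ⟨b c, hb c⟩, by simp [map_sum]⟩

theorem rslice_mem {P : Submodule k A} {z : A ⊗[k] B} (h : z ∈ LinearMap.range (P.subtype.rTensor B))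
    (φ : B →ₗ[k] k) : rslice φ z ∈ P := by
  obtain ⟨w, rfl⟩ := h
  rw [LinearMap.rTensor, rslice_map]
  exact Subtype.property _

theorem lslice_mem {P : Submodule k B} {z : A ⊗[k] B} (h : z ∈ LinearMap.range (P.subtype.lTensor A))
    (φ : A →ₗ[k] k) : lslice φ z ∈ P := by
  obtain ⟨w, rfl⟩ := h
  rw [LinearMap.lTensor, lslice_map]
  exact Subtype.property _

end Slices

/-! ### Skew derivations -/

section Pre

variable {R : Type*} [Ring R] [Algebra k R]

/-- The map `x ↦ x⁽¹⁾ χ(x⁽²⁾)`. -/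
def rhit (Δ : R →ₗ[k] R ⊗[k] R) (χ : R →ₗ[k] k) : R →ₗ[k] R := rslice χ ∘ₗ Δ

/-- The map `x ↦ χ(x⁽¹⁾) x⁽²⁾`. -/
def lhit (Δ : R →ₗ[k] R ⊗[k] R) (χ : R →ₗ[k] k) : R →ₗ[k] R := lslice χ ∘ₗ Δ

/-- The map `a ⊗ u ↦ a (u₍₋₁₎ φ(u₍₀₎) · y)`. -/
def rightSkew {U : YDMod.{u, w, v} k H} (act : H →ₐ[k] Module.End k R) (φ : U →ₗ[k] k) (y : R) :
    R ⊗[k] U →ₗ[k] R :=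
  TensorProduct.lift ((LinearMap.mul k R).compl₂
    (act.toLinearMap.flip y ∘ₗ rslice φ ∘ₗ U.coact))

/-- The map `a ⊗ u ↦ χ(a₍₋₁₎ u₍₋₁₎) φ(u₍₀₎) a₍₀₎`. -/
def coactSkew {U : YDMod.{u, w, v} k H} (coact : R →ₐ[k] H ⊗[k] R) (φ : U →ₗ[k] k) (χ : H →ₗ[k] k) :
    R ⊗[k] U →ₗ[k] R :=
  TensorProduct.lift (LinearMap.mk₂ k
    (fun a u => lslice (χ ∘ₗ (LinearMap.mul k H).flip (rslice φ (U.coact u))) (coact a))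
    (fun a b u => by simp only [map_add])
    (fun c a u => by simp only [map_smul])
    (fun a u v => by
      generalize coact a = z
      induction z with
      | zero => simp
      | add x y hx hy => simp only [map_add] at *; rw [hx, hy]; abel
      | tmul x y => simp [mul_add, add_smul])
    (fun c a u => by
      generalize coact a = z
      induction z with
      | zero => simp
      | add x y hx hy => simp only [map_add] at *; rw [hx, hy, smul_add]
      | tmul x y => simp [smul_smul]))

namespace IsPre

variable {U : YDMod.{u, w, v} k H} {ι : U →ₗ[k] R} {act : H →ₐ[k] Module.End k R}
    {coact : R →ₐ[k] H ⊗[k] R} {Δ : R →ₗ[k] R ⊗[k] R} {ε : R →ₐ[k] k} {pr : R →ₗ[k] U}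
    (hR : IsPre U ι act coact Δ ε pr)
include hR

theorem comul_rhit (χ : R →ₗ[k] k) (x : R) : Δ (rhit Δ χ x) = (rhit Δ χ).lTensor R (Δ x) := by
  have h1 : ∀ z, Δ (rslice χ z) = rslice χ (Δ.rTensor R z) := by
    intro z
    induction z with
    | zero => simp
    | add x y hx hy => simp only [map_add, hx, hy]
    | tmul a b => simp
  have h2 : ∀ z : (R ⊗[k] R) ⊗[k] R, rslice χ z =
      (rslice χ).lTensor R (TensorProduct.assoc k R R R z) := by
    intro z
    induction z with
    | zero => simp
    | add x y hx hy => simp only [map_add, hx, hy]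
    | tmul a b =>
      induction a with
      | zero => simp
      | add x y hx hy => simp only [map_add, add_tmul, hx, hy]
      | tmul c d => simp
  change Δ (rslice χ (Δ x)) = _
  rw [h1, h2, hR.coassoc, ← LinearMap.lTensor_comp_apply]
  rfl

theorem comul_lhit (χ : R →ₗ[k] k) (x : R) : Δ (lhit Δ χ x) = (lhit Δ χ).rTensor R (Δ x) := by
  have h1 : ∀ z, Δ (lslice χ z) = lslice χ (Δ.lTensor R z) := by
    intro z
    induction z with
    | zero => simp
    | add x y hx hy => simp only [map_add, hx, hy]
    | tmul a b => simp
  have h2 : ∀ z : (R ⊗[k] R) ⊗[k] R, lslice χ (TensorProduct.assoc k R R R z) =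
      (lslice χ).rTensor R z := by
    intro z
    induction z with
    | zero => simp
    | add x y hx hy => simp only [map_add, hx, hy]
    | tmul a b =>
      induction a with
      | zero => simp
      | add x y hx hy => simp only [map_add, add_tmul, hx, hy]
      | tmul c d => simp [smul_tmul']
  change Δ (lslice χ (Δ x)) = _
  rw [h1, ← hR.coassoc, h2, ← LinearMap.rTensor_comp_apply]
  rfl

theorem counit_rhit (χ : R →ₗ[k] k) (x : R) : ε (rhit Δ χ x) = χ x := by
  have h1 : ∀ z : R ⊗[k] R, ε (rslice χ z) =
      χ (TensorProduct.lid k R (ε.toLinearMap.rTensor R z)) := by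
    intro z
    induction z with
    | zero => simp
    | add x y hx hy => simp only [map_add, hx, hy]
    | tmul a b => simp [mul_comm]
  change ε (rslice χ (Δ x)) = _
  rw [h1, hR.counit_comul]

theorem counit_lhit (χ : R →ₗ[k] k) (x : R) : ε (lhit Δ χ x) = χ x := by
  have h1 : ∀ z : R ⊗[k] R, ε (lslice χ z) =
      χ (TensorProduct.rid k R (ε.toLinearMap.lTensor R z)) := by
    intro z
    induction z with
    | zero => simp
    | add x y hx hy => simp only [map_add, hx, hy]
    | tmul a b => simp [mul_comm]
  change ε (lslice χ (Δ x)) = _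
  rw [h1, hR.comul_counit]

theorem lhit_rhit (χ ψ : R →ₗ[k] k) (x : R) :
    lhit Δ χ (rhit Δ ψ x) = rhit Δ ψ (lhit Δ χ x) := by
  change lslice χ (Δ (rhit Δ ψ x)) = _
  rw [hR.comul_rhit, LinearMap.lTensor, lslice_map]
  rfl

theorem rder_one (φ : U →ₗ[k] k) : rhit Δ (φ ∘ₗ pr) 1 = 0 := by
  simp [rhit, hR.comul_one, hR.pr_one]

theorem lder_one (φ : U →ₗ[k] k) : lhit Δ (φ ∘ₗ pr) 1 = 0 := by
  simp [lhit, hR.comul_one, hR.pr_one]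

theorem rder_ι_mul {m : ℕ} {t : Fin m → Fin m → H} {e : Fin m → U} (he : IsCofam U.coact t e)
    (a : Fin m) (φ : U →ₗ[k] k) (x : R) : rhit Δ (φ ∘ₗ pr) (ι (e a) * x) =
      ι (e a) * rhit Δ (φ ∘ₗ pr) x + ∑ b, φ (e b) • act (t a b) x := by
  have key : ∀ z, rslice (φ ∘ₗ pr) (bmul act coact (primTensor ι (e a)) z) =
      ι (e a) * rslice (φ ∘ₗ pr) z +
        ∑ b, φ (e b) • act (t a b) (TensorProduct.rid k R (ε.toLinearMap.lTensor R z)) := by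
    intro z
    induction z with
    | zero => simp
    | add x y hx hy =>
      simp only [map_add, hx, hy, mul_add, smul_add, Finset.sum_add_distrib]; abel
    | tmul c d =>
      rw [hR.bmul_prim he]
      simp [map_sum, hR.pr_ι_mul, smul_smul, mul_comm]
  change rslice _ (Δ (ι (e a) * x)) = _
  rw [hR.comul_ι_mul, key, hR.comul_counit]
  rfl

theorem lder_ι_mul {m : ℕ} {t : Fin m → Fin m → H} {e : Fin m → U} (he : IsCofam U.coact t e)
    (a : Fin m) (φ : U →ₗ[k] k) (x : R) : lhit Δ (φ ∘ₗ pr) (ι (e a) * x) =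
      φ (e a) • x + ∑ b, ι (e b) * lhit Δ ((φ ∘ₗ U.act (t a b)) ∘ₗ pr) x := by
  have key : ∀ z, lslice (φ ∘ₗ pr) (bmul act coact (primTensor ι (e a)) z) =
      φ (e a) • TensorProduct.lid k R (ε.toLinearMap.rTensor R z) +
        ∑ b, ι (e b) * lslice ((φ ∘ₗ U.act (t a b)) ∘ₗ pr) z := by
    intro z
    induction z with
    | zero => simp
    | add x y hx hy =>
      simp only [map_add, hx, hy, mul_add, smul_add, Finset.sum_add_distrib]; abel
    | tmul c d =>
      rw [hR.bmul_prim he]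
      simp [map_sum, hR.pr_ι_mul, hR.pr_act, smul_smul, mul_comm]
  change lslice _ (Δ (ι (e a) * x)) = _
  rw [hR.comul_ι_mul, key, hR.counit_comul]
  rfl

theorem rhit_act {m : ℕ} {t : Fin m → Fin m → H} (ht : IsComatrix (k := k) t) (a b : Fin m)
    (χ : R →ₗ[k] k) (x : R) :
    rhit Δ χ (act (t a b) x) = ∑ c, act (t a c) (rhit Δ (χ ∘ₗ act (t c b)) x) := by
  change rslice _ (Δ _) = ∑ c, act (t a c) (rslice _ (Δ x))
  rw [hR.comul_act]
  induction Δ x with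
  | zero => simp
  | add x y hx hy => simp only [map_add, hx, hy, Finset.sum_add_distrib]
  | tmul y z =>
    rw [YDMod.diagAct_comatrix _ _ ht]
    simp [map_sum]

theorem rder_act {m : ℕ} {t : Fin m → Fin m → H} (ht : IsComatrix (k := k) t) (a b : Fin m)
    (φ : U →ₗ[k] k) (x : R) : rhit Δ (φ ∘ₗ pr) (act (t a b) x) =
      ∑ c, act (t a c) (rhit Δ ((φ ∘ₗ U.act (t c b)) ∘ₗ pr) x) := by
  rw [hR.rhit_act ht]
  refine Finset.sum_congr rfl fun c _ => ?_
  congr 3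
  ext y
  simp [hR.pr_act]

theorem rder_mul (φ : U →ₗ[k] k) (x y : R) : rhit Δ (φ ∘ₗ pr) (x * y) =
    x * rhit Δ (φ ∘ₗ pr) y + rightSkew act φ y (pr.lTensor R (Δ x)) := by
  have key : ∀ s z, rslice (φ ∘ₗ pr) (bmul act coact s z) =
      TensorProduct.rid k R (ε.toLinearMap.lTensor R s) * rslice (φ ∘ₗ pr) z +
        rightSkew act φ (TensorProduct.rid k R (ε.toLinearMap.lTensor R z)) (pr.lTensor R s) := by
    intro s z
    induction s with
    | zero => simp
    | add x y hx hy =>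
      simp only [map_add, LinearMap.add_apply, hx, hy, add_mul]; abel
    | tmul a b =>
      obtain ⟨m, t, e, p, he, rfl⟩ := hR.toIsYDAlg.exists_cofam b
      have he' : IsCofam U.coact t fun i => pr (e i) := he.map hR.pr_coact
      have hc : ε (e p) • (1 : H) = ∑ q, ε (e q) • t p q := by
        have := hR.counit_coact (e p)
        have h2 := he.coact_eq p
        rw [AlgHom.toLinearMap_apply] at h2
        rw [h2] at this
        have := congrArg (TensorProduct.rid k H) this
        simpa [map_sum] using this.symm
      induction z with
      | zero => simp [rightSkew]
      | add x y hx hy =>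
        have : ∀ y₁ y₂ w, rightSkew act φ (y₁ + y₂) w =
            rightSkew act φ y₁ w + rightSkew act φ y₂ w := by
          intro y₁ y₂ w
          induction w with
          | zero => simp
          | add x y hx hy => simp only [map_add, hx, hy]; abel
          | tmul a u => simp [rightSkew, mul_add]
        simp only [map_add, hx, hy, mul_add, this]
        abel
      | tmul c d =>
        rw [bmul_tmul he]
        have h3 : ∑ q, ε (e q) • act (t p q) c = ε (e p) • c := by
          have := congrArg (fun h => act h c) hc
          simpa [map_sum] using this.symm
        simp only [map_sum, rslice_tmul, LinearMap.comp_apply, hR.pr_mul, map_add, map_smul,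
          add_smul, Finset.sum_add_distrib, LinearMap.lTensor_tmul, TensorProduct.rid_tmul,
          AlgHom.toLinearMap_apply, rightSkew, TensorProduct.lift.tmul, LinearMap.compl₂_apply,
          LinearMap.mul_apply', he'.coact_eq, LinearMap.flip_apply, LinearMap.sum_apply,
          LinearMap.smul_apply, Finset.mul_sum, mul_smul_comm, smul_mul_assoc, smul_eq_mul]
        rw [add_comm]
        congr 1
        · rw [← mul_smul_comm, ← h3]
          simp only [Finset.smul_sum, Finset.mul_sum, mul_smul_comm, smul_smul, mul_comm]
        · simp only [smul_smul, mul_comm]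
  change rslice _ (Δ (x * y)) = _
  rw [hR.comul_mul, key, hR.comul_counit, hR.comul_counit]
  rfl

theorem rder_coact (φ : U →ₗ[k] k) (χ : H →ₗ[k] k) (x : R) :
    rhit Δ (φ ∘ₗ pr) (lslice χ (coact x)) = coactSkew coact φ χ (pr.lTensor R (Δ x)) := by
  have h1 : ∀ z : H ⊗[k] R, rhit Δ (φ ∘ₗ pr) (lslice χ z) =
      lslice χ ((rslice (φ ∘ₗ pr)).lTensor H (Δ.lTensor H z)) := by
    intro z
    induction z with
    | zero => simp
    | add x y hx hy => simp only [map_add, hx, hy]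
    | tmul a b => simp [rhit]
  rw [h1, hR.comul_coact]
  induction Δ x with
  | zero => simp
  | add x y hx hy => simp only [map_add, hx, hy]
  | tmul y z =>
    obtain ⟨m, t, e, p, he, rfl⟩ := hR.toIsYDAlg.exists_cofam y
    obtain ⟨n, s, f, q, hf, rfl⟩ := hR.toIsYDAlg.exists_cofam z
    have hf' : IsCofam U.coact s fun i => pr (f i) := hf.map hR.pr_coact
    have h2 := he.coact_eq p
    rw [AlgHom.toLinearMap_apply] at h2
    rw [YDMod.diagCoact_tmul he hf]
    simp only [map_sum, coactSkew, LinearMap.lTensor_tmul, TensorProduct.lift.tmul,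
      LinearMap.mk₂_apply, hf'.coact_eq, h2, rslice_tmul, lslice_tmul, LinearMap.comp_apply,
      LinearMap.flip_apply, LinearMap.mul_apply', Finset.mul_sum, mul_smul_comm, map_smul,
      smul_smul, Finset.sum_smul, smul_eq_mul, mul_comm, map_sum, LinearMap.sum_apply,
      LinearMap.smul_apply]

end IsPre

end Pre

/-! ### Gradings -/

/-- `U` is the direct sum of the images of the orthogonal idempotents `q j`. -/
structure YDMod.IsDec (U : YDMod.{u, w, v} k H) {J : Type*} [Fintype J] (q : J → U →ₗ[k] U) :
    Prop where
  sum_eq : ∀ v, ∑ j, q j v = v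
  idem : ∀ j v, q j (q j v) = q j v
  orth : ∀ j l v, j ≠ l → q j (q l v) = 0
  hom : ∀ j, YDMod.IsHom (q j)

section Pre

variable {R : Type*} [Ring R] [Algebra k R] {J Γ : Type*} [Fintype J] [AddCommGroup Γ]
  [DecidableEq Γ]

/-- The maps `c γ` are the projections to the components of the grading for which `ι (q j v)` has
degree `d j`. -/
structure IsGr {U : YDMod.{u, w, v} k H} (ι : U →ₗ[k] R) (q : J → U →ₗ[k] U) (d : J → Γ)
    (c : Γ → R →ₗ[k] R) : Prop where
  comp_one : ∀ γ, c γ 1 = if γ = 0 then 1 else 0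
  comp_ι_mul : ∀ γ v x, c γ (ι v * x) = ∑ j, ι (q j v) * c (γ - d j) x

namespace IsPre

variable {U : YDMod.{u, w, v} k H} {ι : U →ₗ[k] R} {act : H →ₐ[k] Module.End k R}
    {coact : R →ₐ[k] H ⊗[k] R} {Δ : R →ₗ[k] R ⊗[k] R} {ε : R →ₐ[k] k} {pr : R →ₗ[k] U}
    (hR : IsPre U ι act coact Δ ε pr) {q : J → U →ₗ[k] U} (hq : U.IsDec q) {d : J → Γ}
    {c : Γ → R →ₗ[k] R} (hc : IsGr ι q d c)

theorem ind' {p : R → Prop} (hR : IsPre U ι act coact Δ ε pr) (h1 : p 1)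
    (ha : ∀ x y, p x → p y → p (x + y)) (hs : ∀ (c : k) x, p x → p (c • x))
    (hm : ∀ (m : ℕ) (t : Fin m → Fin m → H) (e : Fin m → U), IsCofam U.coact t e →
      ∀ a x, p x → p (ι (e a) * x)) (x : R) : p x := by
  refine hR.ind p h1 ha hs (fun v x hx => ?_) x
  obtain ⟨m, t, e, a, he, rfl⟩ := U.exists_cofam v
  exact hm m t e he a x hx

include hR hc

theorem exists_finset (hq : U.IsDec q) (x : R) :
    ∃ s : Finset Γ, ∀ s', s ⊆ s' → ∑ γ ∈ s', c γ x = x := by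
  classical
  refine hR.ind (fun x => ∃ s : Finset Γ, ∀ s', s ⊆ s' → ∑ γ ∈ s', c γ x = x) ?_ ?_ ?_ ?_ x
  · refine ⟨{0}, fun s' hs => ?_⟩
    simp only [hc.comp_one]
    rw [Finset.sum_ite_eq', if_pos (Finset.singleton_subset_iff.1 hs)]
  · rintro x y ⟨s, hs⟩ ⟨s', hs'⟩
    refine ⟨s ∪ s', fun r hr => ?_⟩
    simp only [map_add, Finset.sum_add_distrib]
    rw [hs _ (Finset.union_subset_left hr), hs' _ (Finset.union_subset_right hr)]
  · rintro a x ⟨s, hs⟩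
    refine ⟨s, fun r hr => ?_⟩
    simp only [map_smul, ← Finset.smul_sum, hs r hr]
  · rintro v x ⟨s, hs⟩
    refine ⟨Finset.univ.biUnion fun j => s.image (· + d j), fun r hr => ?_⟩
    simp only [hc.comp_ι_mul]
    rw [Finset.sum_comm]
    have h : ∀ j, ∑ γ ∈ r, c (γ - d j) x = x := by
      intro j
      have := hs (r.image (· - d j)) fun γ hγ => Finset.mem_image.2 ⟨γ + d j, hr
        (Finset.mem_biUnion.2 ⟨j, Finset.mem_univ j, Finset.mem_image_of_mem _ hγ⟩), by simp⟩
      rw [Finset.sum_image (fun a _ b _ hab => by simpa using hab)] at this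
      exact this
    simp only [← Finset.mul_sum, h]
    rw [← Finset.sum_mul, ← map_sum, hq.sum_eq]

theorem eq_zero_of_comp (hq : U.IsDec q) {x : R} (h : ∀ γ, c γ x = 0) : x = 0 := by
  obtain ⟨s, hs⟩ := hR.exists_finset hc hq x
  rw [← hs s subset_rfl]
  exact Finset.sum_eq_zero fun γ _ => h γ

include hq

omit hR in
theorem comp_q_mul (γ : Γ) (j : J) (v : U) (x : R) :
    c γ (ι (q j v) * x) = ι (q j v) * c (γ - d j) x := by
  rw [hc.comp_ι_mul, Finset.sum_eq_single j]
  · rw [hq.idem]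
  · intro l _ hl
    rw [hq.orth l j v hl, map_zero, zero_mul]
  · simp

theorem comp_comp (γ δ : Γ) (x : R) : c γ (c δ x) = if γ = δ then c γ x else 0 := by
  revert γ δ
  refine hR.ind (fun x => ∀ γ δ : Γ, c γ (c δ x) = if γ = δ then c γ x else 0) ?_ ?_ ?_ ?_ x
  · intro γ δ
    rw [hc.comp_one]
    split_ifs with h1 h2 h2
    · rfl
    · rw [hc.comp_one, if_neg]; rintro rfl; exact h2 h1.symm
    · subst h2; rw [map_zero, hc.comp_one, if_neg h1]
    · exact map_zero _
  · intro x y hx hy γ δ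
    simp only [map_add, hx, hy]; split_ifs <;> simp
  · intro a x hx γ δ
    simp only [map_smul, hx]; split_ifs <;> simp
  · intro v x hx γ δ
    rw [hc.comp_ι_mul δ, map_sum]
    simp only [comp_q_mul hq hc, hx, sub_left_inj]
    split_ifs
    · rw [hc.comp_ι_mul]
    · simp

theorem comp_self (γ : Γ) (x : R) : c γ (c γ x) = c γ x := by
  rw [hR.comp_comp hq hc, if_pos rfl]

theorem comp_act (γ : Γ) (h : H) (x : R) : c γ (act h x) = act h (c γ x) := by
  revert γ h
  refine hR.ind (fun x => ∀ γ h, c γ (act h x) = act h (c γ x)) ?_ ?_ ?_ ?_ x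
  · intro γ h
    rw [hR.act_one, map_smul, hc.comp_one]
    split_ifs
    · rw [hR.act_one]
    · simp
  · intro x y hx hy γ h; simp only [map_add, hx, hy]
  · intro a x hx γ h; simp only [map_smul, hx]
  · intro v x hx γ h
    refine comatrix_induction (k := k) (p := fun h => c γ (act h (ι v * x)) = act h (c γ (ι v * x)))
      (by simp) ?_ ?_ ?_ h
    · intro x y hx hy; simp only [map_add, LinearMap.add_apply, hx, hy]
    · intro c x hx; simp only [map_smul, LinearMap.smul_apply, hx]
    · intro m t ht a b
      rw [(hR.actMul _ _).comatrix ht, hc.comp_ι_mul, map_sum, map_sum]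
      simp only [hR.act_ι, hc.comp_ι_mul, (hR.actMul _ _).comatrix ht, hx, (hq.hom _).map_act]
      exact Finset.sum_comm

theorem comp_coact (γ : Γ) (x : R) : coact (c γ x) = (c γ).lTensor H (coact x) := by
  revert γ
  refine hR.ind' (p := fun x => ∀ γ, coact (c γ x) = (c γ).lTensor H (coact x)) ?_ ?_ ?_ ?_ x
  · intro γ
    rw [map_one coact, hc.comp_one, Algebra.TensorProduct.one_def, LinearMap.lTensor_tmul, hc.comp_one]
    split_ifs
    · rw [map_one, Algebra.TensorProduct.one_def]
    · simp
  · intro x y hx hy γ; simp only [map_add, hx, hy]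
  · intro a x hx γ; simp only [map_smul, hx]
  · intro m t e he a x hx γ
    have h := (hR.cofam he).coact_eq a
    rw [AlgHom.toLinearMap_apply] at h
    have h' : ∀ j, coact (ι (q j (e a))) = ∑ b, t a b ⊗ₜ ι (q j (e b)) := fun j =>
      (hR.cofam (he.map (f := q j) (hq.hom j).map_coact)).coact_eq a
    rw [hc.comp_ι_mul, map_sum, map_mul, h, Finset.sum_mul, map_sum]
    have key : ∀ (g : H) (v : U) (z : H ⊗[k] R), (c γ).lTensor H ((g ⊗ₜ ι v) * z) =
        ∑ j, (g ⊗ₜ ι (q j v)) * (c (γ - d j)).lTensor H z := by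
      intro g v z
      induction z with
      | zero => simp
      | add x y hx hy => simp only [map_add, mul_add, hx, hy, Finset.sum_add_distrib]
      | tmul a b => simp [hc.comp_ι_mul, tmul_sum]
    simp only [key, map_mul, hx, h', Finset.sum_mul]
    exact Finset.sum_comm

theorem comp_hom (γ : Γ) : IsYDMap act coact.toLinearMap act coact.toLinearMap (c γ) :=
  ⟨fun h x => hR.comp_act hq hc γ h x, fun x => hR.comp_coact hq hc γ x⟩

theorem comul_comp (α β γ : Γ) (x : R) : TensorProduct.map (c α) (c β) (Δ (c γ x)) =
    if α + β = γ then TensorProduct.map (c α) (c β) (Δ x) else 0 := by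
  revert α β γ
  refine hR.ind' (p := fun x => ∀ α β γ, TensorProduct.map (c α) (c β) (Δ (c γ x)) =
    if α + β = γ then TensorProduct.map (c α) (c β) (Δ x) else 0) ?_ ?_ ?_ ?_ x
  · intro α β γ
    rw [hc.comp_one]
    by_cases h1 : γ = 0
    · rw [if_pos h1, hR.comul_one, TensorProduct.map_tmul, hc.comp_one, hc.comp_one]
      by_cases h2 : α = 0
      · by_cases h3 : β = 0
        · simp [h1, h2, h3]
        · simp [h3]
      · simp [h2]
    · rw [if_neg h1, map_zero, map_zero, hR.comul_one, TensorProduct.map_tmul, hc.comp_one,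
        hc.comp_one]
      by_cases h2 : α = 0
      · by_cases h3 : β = 0
        · simp [Ne.symm h1, h2, h3]
        · simp [h3]
      · simp [h2]
  · intro x y hx hy α β γ; simp only [map_add, hx, hy]; split_ifs <;> simp
  · intro a x hx α β γ; simp only [map_smul, hx]; split_ifs <;> simp
  · intro m t e he a x hx α β γ
    have key : ∀ (α β : Γ) (j : J) (z : R ⊗[k] R),
        TensorProduct.map (c α) (c β) (bmul act coact (primTensor ι (q j (e a))) z) =
        (LinearMap.mulLeft k (ι (q j (e a)))).rTensor R
          (TensorProduct.map (c (α - d j)) (c β) z) +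
        ∑ b, TensorProduct.map (act (t a b)) (LinearMap.mulLeft k (ι (q j (e b))))
          (TensorProduct.map (c α) (c (β - d j)) z) := by
      intro α β j z
      induction z with
      | zero => simp
      | add x y hx hy => simp only [map_add, hx, hy, Finset.sum_add_distrib]; abel
      | tmul y z =>
        rw [hR.bmul_prim (he.map (f := q j) (hq.hom j).map_coact)]
        simp [comp_q_mul hq hc, map_sum, hR.comp_act hq hc]
    have h1 : Δ (ι (e a) * x) = ∑ j, bmul act coact (primTensor ι (q j (e a))) (Δ x) := by
      conv_lhs => rw [← hq.sum_eq (e a), map_sum, Finset.sum_mul, map_sum]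
      simp only [hR.comul_ι_mul]
    rw [hc.comp_ι_mul, map_sum, map_sum, h1, map_sum]
    simp only [hR.comul_ι_mul, key, hx]
    have e1 : ∀ j, (α - d j + β = γ - d j) = (α + β = γ) := fun j => by
      rw [sub_add_eq_add_sub, sub_left_inj]
    have e2 : ∀ j, (α + (β - d j) = γ - d j) = (α + β = γ) := fun j => by
      rw [← add_sub_assoc, sub_left_inj]
    simp only [e1, e2]
    split_ifs <;> simp

theorem counit_comp (γ : Γ) (x : R) : ε (c γ x) = if γ = 0 then ε x else 0 := by
  refine hR.ind (fun x => ε (c γ x) = if γ = 0 then ε x else 0) ?_ ?_ ?_ ?_ x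
  · rw [hc.comp_one]; split_ifs <;> simp
  · intro x y hx hy; simp only [map_add, hx, hy]; split_ifs <;> simp
  · intro a x hx; simp only [map_smul, hx]; split_ifs <;> simp
  · intro v x hx
    rw [hc.comp_ι_mul, map_sum]
    simp [hR.counit_ι]

theorem pr_comp (γ : Γ) (x : R) : pr (c γ x) = ∑ j, if γ = d j then q j (pr x) else 0 := by
  refine hR.ind (fun x => pr (c γ x) = ∑ j, if γ = d j then q j (pr x) else 0) ?_ ?_ ?_ ?_ x
  · rw [hc.comp_one]; split_ifs <;> simp [hR.pr_one]
  · intro x y hx hy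
    simp only [map_add, hx, hy, ← Finset.sum_add_distrib]
    refine Finset.sum_congr rfl fun j _ => ?_
    split_ifs <;> simp
  · intro a x hx; simp only [map_smul, hx, Finset.smul_sum, smul_ite, smul_zero]
  · intro v x hx
    rw [hc.comp_ι_mul, map_sum]
    refine Finset.sum_congr rfl fun j _ => ?_
    rw [hR.pr_ι_mul, hR.pr_ι_mul, hR.counit_comp hq hc]
    simp only [sub_eq_zero]
    split_ifs <;> simp

theorem rder_comp (γ : Γ) (φ : U →ₗ[k] k) (x : R) : rhit Δ (φ ∘ₗ pr) (c γ x) =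
    ∑ j, c (γ - d j) (rhit Δ ((φ ∘ₗ q j) ∘ₗ pr) x) := by
  revert γ φ
  refine hR.ind' (p := fun x => ∀ γ (φ : U →ₗ[k] k), rhit Δ (φ ∘ₗ pr) (c γ x) =
    ∑ j, c (γ - d j) (rhit Δ ((φ ∘ₗ q j) ∘ₗ pr) x)) ?_ ?_ ?_ ?_ x
  · intro γ φ
    rw [hc.comp_one]
    split_ifs <;> simp [hR.rder_one]
  · intro x y hx hy γ φ; simp only [map_add, hx, hy, Finset.sum_add_distrib]
  · intro a x hx γ φ; simp only [map_smul, hx, Finset.smul_sum]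
  · intro m t e he a x hx γ φ
    rw [hc.comp_ι_mul, map_sum]
    have he' := fun j => he.map (f := q j) (hq.hom j).map_coact
    have h1 : ∀ j y, rhit Δ (φ ∘ₗ pr) (ι (q j (e a)) * y) = ι (q j (e a)) * rhit Δ (φ ∘ₗ pr) y +
        ∑ b, φ (q j (e b)) • act (t a b) y := fun j y => hR.rder_ι_mul (he' j) a φ y
    simp only [h1, hR.rder_ι_mul he, map_add, hc.comp_ι_mul, hx, map_sum, map_smul,
      hR.comp_act hq hc, Finset.sum_add_distrib, Finset.mul_sum, LinearMap.comp_apply]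
    congr 1
    rw [Finset.sum_comm]
    simp only [sub_right_comm]

theorem lder_comp (γ : Γ) (φ : U →ₗ[k] k) (x : R) : lhit Δ (φ ∘ₗ pr) (c γ x) =
    ∑ j, c (γ - d j) (lhit Δ ((φ ∘ₗ q j) ∘ₗ pr) x) := by
  revert γ φ
  refine hR.ind' (p := fun x => ∀ γ (φ : U →ₗ[k] k), lhit Δ (φ ∘ₗ pr) (c γ x) =
    ∑ j, c (γ - d j) (lhit Δ ((φ ∘ₗ q j) ∘ₗ pr) x)) ?_ ?_ ?_ ?_ x
  · intro γ φ
    rw [hc.comp_one]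
    split_ifs <;> simp [hR.lder_one]
  · intro x y hx hy γ φ; simp only [map_add, hx, hy, Finset.sum_add_distrib]
  · intro a x hx γ φ; simp only [map_smul, hx, Finset.smul_sum]
  · intro m t e he a x hx γ φ
    rw [hc.comp_ι_mul, map_sum]
    have he' := fun j => he.map (f := q j) (hq.hom j).map_coact
    have h1 : ∀ j y, lhit Δ (φ ∘ₗ pr) (ι (q j (e a)) * y) = φ (q j (e a)) • y +
        ∑ b, ι (q j (e b)) * lhit Δ ((φ ∘ₗ U.act (t a b)) ∘ₗ pr) y :=
      fun j y => hR.lder_ι_mul (he' j) a φ y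
    have h2 : ∀ j h, (φ ∘ₗ q j) ∘ₗ U.act h = (φ ∘ₗ U.act h) ∘ₗ q j := fun j h => by
      ext v; simp [(hq.hom j).map_act]
    simp only [h1, hR.lder_ι_mul he, map_add, hc.comp_ι_mul, hx, map_sum, map_smul,
      Finset.sum_add_distrib, Finset.mul_sum, LinearMap.comp_apply, h2]
    congr 1
    rw [sum_reverse₃]
    refine Finset.sum_congr rfl fun j _ => ?_
    rw [Finset.sum_comm]
    simp only [sub_right_comm]
    exact Finset.sum_comm

theorem comp_mul (α γ : Γ) (x y : R) : c γ (c α x * y) = c α x * c (γ - α) y := by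
  revert α γ
  refine hR.ind (fun x => ∀ α γ : Γ, c γ (c α x * y) = c α x * c (γ - α) y) ?_ ?_ ?_ ?_ x
  · intro α γ
    rw [hc.comp_one]
    split_ifs with h
    · simp [h]
    · simp
  · intro x y hx hy α γ; simp only [map_add, add_mul, hx, hy]
  · intro a x hx α γ; simp only [map_smul, smul_mul_assoc, hx]
  · intro v x hx α γ
    rw [hc.comp_ι_mul, Finset.sum_mul, Finset.sum_mul, map_sum]
    refine Finset.sum_congr rfl fun j _ => ?_
    rw [mul_assoc, comp_q_mul hq hc, hx, mul_assoc, sub_sub_sub_cancel_right]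

theorem comp_mul_of_eq {α : Γ} {x : R} (hx : c α x = x) (γ : Γ) (y : R) :
    c γ (x * y) = x * c (γ - α) y := by
  rw [← hx, hR.comp_mul hq hc]

theorem comp_eq_zero {α : Γ} {x : R} (hx : c α x = x) {γ : Γ} (h : γ ≠ α) : c γ x = 0 := by
  rw [← hx, hR.comp_comp hq hc, if_neg h]

end IsPre

end Pre

namespace YDMod

variable {J Γ : Type*} [Fintype J] [AddCommGroup Γ] [DecidableEq Γ] (U : YDMod.{u, w, v} k H)

/-- The algebra map from `T(U)` to the group algebra of `Γ` over `T(U)` that is determined by the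
degrees of the elements of `U`. -/
def tGradHom (q : J → U →ₗ[k] U) (d : J → Γ) : U.T →ₐ[k] AddMonoidAlgebra U.T Γ :=
  TensorAlgebra.lift k (∑ j, AddMonoidAlgebra.lsingle (R := k) (d j) ∘ₗ TensorAlgebra.ι k ∘ₗ q j)

/-- The projections of the tensor algebra to the components of a grading. -/
def tComp (q : J → U →ₗ[k] U) (d : J → Γ) (γ : Γ) : U.T →ₗ[k] U.T where
  toFun x := (U.tGradHom q d x).coeff γ
  map_add' x y := by simp
  map_smul' c x := by simp

theorem t_isGr (q : J → U →ₗ[k] U) (d : J → Γ) : IsGr (TensorAlgebra.ι k) q d (U.tComp q d) where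
  comp_one γ := by
    change (U.tGradHom q d 1).coeff γ = _
    rw [map_one, AddMonoidAlgebra.one_def]
    simp [Finsupp.single_apply, eq_comm]
  comp_ι_mul γ v x := by
    change (U.tGradHom q d (TensorAlgebra.ι k v * x)).coeff γ = _
    rw [map_mul, tGradHom, TensorAlgebra.lift_ι_apply]
    simp [Finset.sum_mul, tComp, tGradHom, sub_eq_neg_add]

end YDMod

/-! ### Nondegeneracy of Nichols algebras -/

section Pre

variable {R : Type*} [Ring R] [Algebra k R] {U : YDMod.{u, w, v} k H}

/-- `P` is contained in the kernel of the counit and is stable under the right skew derivations. -/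
def IsRightStable (Δ : R →ₗ[k] R ⊗[k] R) (ε : R →ₐ[k] k) (pr : R →ₗ[k] U) (P : Submodule k R) :
    Prop := ∀ x ∈ P, ε x = 0 ∧ ∀ φ : U →ₗ[k] k, rhit Δ (φ ∘ₗ pr) x ∈ P

theorem isRightStable_span {Δ : R →ₗ[k] R ⊗[k] R} {ε : R →ₐ[k] k} {pr : R →ₗ[k] U} {S : Set R}
    (h : ∀ x ∈ S, ε x = 0 ∧ ∀ φ : U →ₗ[k] k, rhit Δ (φ ∘ₗ pr) x ∈ Submodule.span k S) :
    IsRightStable Δ ε pr (Submodule.span k S) := by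
  intro x hx
  induction hx using Submodule.span_induction with
  | mem x hx => exact h x hx
  | zero => simp
  | add x y _ _ hx hy =>
    refine ⟨by rw [map_add, hx.1, hy.1, add_zero], fun φ => ?_⟩
    rw [map_add]; exact add_mem (hx.2 φ) (hy.2 φ)
  | smul a x _ hx =>
    refine ⟨by rw [map_smul, hx.1, smul_zero], fun φ => ?_⟩
    rw [map_smul]; exact Submodule.smul_mem _ _ (hx.2 φ)

variable {ι : U →ₗ[k] R} {act : H →ₐ[k] Module.End k R}
    {coact : R →ₐ[k] H ⊗[k] R} {Δ : R →ₗ[k] R ⊗[k] R} {ε : R →ₐ[k] k} {pr : R →ₗ[k] U}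

/-- The largest subspace that is stable under the right skew derivations and contained in the
kernel of the counit. -/
def rightRad (Δ : R →ₗ[k] R ⊗[k] R) (ε : R →ₐ[k] k) (pr : R →ₗ[k] U) : Submodule k R :=
  sSup {P | IsRightStable Δ ε pr P}

theorem le_rightRad {P : Submodule k R} (h : IsRightStable Δ ε pr P) : P ≤ rightRad Δ ε pr :=
  le_sSup h

theorem rightRad_stable : IsRightStable Δ ε pr (rightRad Δ ε pr) := by
  intro x hx
  have h1 : rightRad Δ ε pr ≤ LinearMap.ker ε.toLinearMap :=
    sSup_le fun P hP x hx => (hP x hx).1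
  have h2 : ∀ φ : U →ₗ[k] k, rightRad Δ ε pr ≤ (rightRad Δ ε pr).comap (rhit Δ (φ ∘ₗ pr)) :=
    fun φ => sSup_le fun P hP x hx => le_rightRad hP ((hP x hx).2 φ)
  exact ⟨h1 hx, fun φ => h2 φ hx⟩

theorem mem_rightRad {x : R} (h0 : ε x = 0)
    (h : ∀ φ : U →ₗ[k] k, rhit Δ (φ ∘ₗ pr) x ∈ rightRad Δ ε pr) : x ∈ rightRad Δ ε pr := by
  refine le_rightRad (P := Submodule.span k (insert x (rightRad Δ ε pr)))
    (isRightStable_span ?_) (Submodule.subset_span (Set.mem_insert _ _))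
  rintro y (rfl | hy)
  · exact ⟨h0, fun φ => Submodule.subset_span (Set.mem_insert_of_mem _ (h φ))⟩
  · obtain ⟨h1, h2⟩ := rightRad_stable y hy
    exact ⟨h1, fun φ => Submodule.subset_span (Set.mem_insert_of_mem _ (h2 φ))⟩

namespace IsPre

variable (hR : IsPre U ι act coact Δ ε pr)
include hR

omit hR in
theorem exists_rep_of_mem_rightRad {x : R} (hx : x ∈ rightRad Δ ε pr) :
    ∃ (n : ℕ) (b : Fin n → U) (a : Fin n → R), (∀ c, a c ∈ rightRad Δ ε pr) ∧
      pr.lTensor R (Δ x) = ∑ c, a c ⊗ₜ b c := by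
  obtain ⟨n, b, a, -, ha, e⟩ := exists_rep_right_mem (P := rightRad Δ ε pr)
    (z := pr.lTensor R (Δ x)) (fun φ => by
      rw [LinearMap.lTensor, rslice_map]
      exact (rightRad_stable x hx).2 φ)
  exact ⟨n, b, a, ha, e⟩

theorem rightRad_act (h : H) {x : R} (hx : x ∈ rightRad Δ ε pr) : act h x ∈ rightRad Δ ε pr := by
  refine le_rightRad (isRightStable_span (S := {y | ∃ h, ∃ x ∈ rightRad Δ ε pr, y = act h x}) ?_)
    (Submodule.subset_span ⟨h, x, hx, rfl⟩)
  rintro _ ⟨h, x, hx, rfl⟩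
  obtain ⟨h1, h2⟩ := rightRad_stable x hx
  refine ⟨by rw [hR.counit_act, h1, mul_zero], fun φ => ?_⟩
  refine comatrix_induction (k := k) (p := fun h => rhit Δ (φ ∘ₗ pr) (act h x) ∈ _)
    (by simp) ?_ ?_ ?_ h
  · intro x y hx hy; simp only [map_add, LinearMap.add_apply]; exact add_mem hx hy
  · intro c x hx; simp only [map_smul, LinearMap.smul_apply]; exact Submodule.smul_mem _ _ hx
  · intro m t ht a b
    rw [hR.rder_act ht]
    exact sum_mem fun c _ => Submodule.subset_span ⟨_, _, h2 _, rfl⟩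

theorem rightRad_coact (χ : H →ₗ[k] k) {x : R} (hx : x ∈ rightRad Δ ε pr) :
    lslice χ (coact x) ∈ rightRad Δ ε pr := by
  refine le_rightRad (isRightStable_span
    (S := {y | ∃ χ, ∃ x ∈ rightRad Δ ε pr, y = lslice χ (coact x)}) ?_)
    (Submodule.subset_span ⟨χ, x, hx, rfl⟩)
  rintro _ ⟨χ, x, hx, rfl⟩
  constructor
  · have h := congrArg (TensorProduct.rid k k ∘ χ.rTensor k) (hR.counit_coact x)
    have e : ∀ z : H ⊗[k] R, ε (lslice χ z) =
        TensorProduct.rid k k (χ.rTensor k (ε.toLinearMap.lTensor H z)) := by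
      intro z
      induction z with
      | zero => simp
      | add x y hx hy => simp only [map_add, hx, hy]
      | tmul a b => simp [mul_comm]
    rw [e, hR.counit_coact, (rightRad_stable x hx).1]
    simp
  · intro φ
    obtain ⟨n, b, a, ha, e⟩ := exists_rep_of_mem_rightRad hx
    rw [hR.rder_coact, e, map_sum]
    exact sum_mem fun c _ => Submodule.subset_span ⟨_, _, ha c, rfl⟩

theorem rightRad_mul (x : R) : (∀ y ∈ rightRad Δ ε pr, x * y ∈ rightRad Δ ε pr) ∧
    ∀ y ∈ rightRad Δ ε pr, y * x ∈ rightRad Δ ε pr := by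
  refine hR.ind' (p := fun x => (∀ y ∈ rightRad Δ ε pr, x * y ∈ rightRad Δ ε pr) ∧
    ∀ y ∈ rightRad Δ ε pr, y * x ∈ rightRad Δ ε pr) ?_ ?_ ?_ ?_ x
  · simp
  · rintro x y ⟨h1, h2⟩ ⟨h3, h4⟩
    refine ⟨fun z hz => ?_, fun z hz => ?_⟩
    · rw [add_mul]; exact add_mem (h1 z hz) (h3 z hz)
    · rw [mul_add]; exact add_mem (h2 z hz) (h4 z hz)
  · rintro a x ⟨h1, h2⟩
    refine ⟨fun z hz => ?_, fun z hz => ?_⟩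
    · rw [smul_mul_assoc]; exact Submodule.smul_mem _ _ (h1 z hz)
    · rw [mul_smul_comm]; exact Submodule.smul_mem _ _ (h2 z hz)
  · rintro m t e he a x ⟨h1, h2⟩
    constructor
    · intro y hy
      rw [mul_assoc]
      generalize hz : x * y = z
      replace hy : z ∈ rightRad Δ ε pr := hz ▸ h1 y hy
      refine le_rightRad (isRightStable_span (S := {y | y ∈ rightRad Δ ε pr ∨
        ∃ z ∈ rightRad Δ ε pr, y = ι (e a) * z}) ?_)
        (Submodule.subset_span (Or.inr ⟨z, hy, rfl⟩))
      rintro _ (h | ⟨z, hz, rfl⟩)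
      · exact ⟨(rightRad_stable _ h).1, fun φ =>
          Submodule.subset_span (Or.inl ((rightRad_stable _ h).2 φ))⟩
      · refine ⟨by rw [map_mul, hR.counit_ι, zero_mul], fun φ => ?_⟩
        rw [hR.rder_ι_mul he]
        exact add_mem (Submodule.subset_span (Or.inr ⟨_, (rightRad_stable z hz).2 φ, rfl⟩))
          (sum_mem fun b _ => Submodule.smul_mem _ _
            (Submodule.subset_span (Or.inl (hR.rightRad_act _ hz))))
    · intro y hy
      rw [← mul_assoc]
      refine h2 _ ?_
      refine le_rightRad (isRightStable_span (S := {y | y ∈ rightRad Δ ε pr ∨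
        ∃ z ∈ rightRad Δ ε pr, ∃ v, y = z * ι v}) ?_)
        (Submodule.subset_span (Or.inr ⟨y, hy, _, rfl⟩))
      rintro _ (h | ⟨z, hz, v, rfl⟩)
      · exact ⟨(rightRad_stable _ h).1, fun φ =>
          Submodule.subset_span (Or.inl ((rightRad_stable _ h).2 φ))⟩
      · refine ⟨by rw [map_mul, hR.counit_ι, mul_zero], fun φ => ?_⟩
        obtain ⟨n, b, a, ha, e⟩ := exists_rep_of_mem_rightRad hz
        rw [hR.rder_mul, e, map_sum]
        refine add_mem ?_ (sum_mem fun c _ => ?_)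
        · have : rhit Δ (φ ∘ₗ pr) (ι v) = φ v • 1 := by
            simp [rhit, hR.comul_ι, primTensor, hR.pr_one, hR.pr_ι]
          rw [this, mul_smul_comm, mul_one]
          exact Submodule.smul_mem _ _ (Submodule.subset_span (Or.inl hz))
        · refine Submodule.subset_span (Or.inr ⟨a c, ha c,
            U.act (rslice φ (U.coact (b c))) v, ?_⟩)
          simp [rightSkew, hR.act_ι]

end IsPre

end Pre

namespace YDMod

variable (U : YDMod.{u, w, v} k H)

theorem isDec_unit : U.IsDec (fun _ : Unit => (LinearMap.id : U →ₗ[k] U)) where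
  sum_eq v := by simp
  idem _ _ := rfl
  orth j l _ h := (h (Subsingleton.elim _ _)).elim
  hom _ := ⟨fun _ _ => rfl, fun v => by simp⟩

section

variable {R : Type*} [Ring R] [Algebra k R] {U} {ι : U →ₗ[k] R} {act : H →ₐ[k] Module.End k R}
    {coact : R →ₐ[k] H ⊗[k] R} {Δ : R →ₗ[k] R ⊗[k] R} {ε : R →ₐ[k] k} {pr : R →ₗ[k] U}
    (hR : IsPre U ι act coact Δ ε pr) {c : ℤ → R →ₗ[k] R}
    (hc : IsGr ι (fun _ : Unit => (LinearMap.id : U →ₗ[k] U)) (fun _ => (1 : ℤ)) c)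
include hR hc

theorem _root_.IsPre.comp_neg {n : ℤ} (hn : n < 0) (x : R) : c n x = 0 := by
  revert n
  refine hR.ind (fun x => ∀ {n : ℤ}, n < 0 → c n x = 0) ?_ ?_ ?_ ?_ x
  · intro n hn; rw [hc.comp_one, if_neg hn.ne]
  · intro x y hx hy n hn; rw [map_add, hx hn, hy hn, add_zero]
  · intro a x hx n hn; rw [map_smul, hx hn, smul_zero]
  · intro v x hx n hn
    rw [hc.comp_ι_mul]
    exact Finset.sum_eq_zero fun _ _ => by rw [hx (by omega), mul_zero]

theorem _root_.IsPre.comp_zero (x : R) : c 0 x = ε x • 1 := by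
  refine hR.ind (fun x => c 0 x = ε x • 1) ?_ ?_ ?_ ?_ x
  · rw [hc.comp_one, if_pos rfl, map_one, one_smul]
  · intro x y hx hy; rw [map_add, hx, hy, map_add, add_smul]
  · intro a x hx; rw [map_smul, hx, map_smul, smul_assoc]
  · intro v x hx
    rw [hc.comp_ι_mul, map_mul, hR.counit_ι, zero_mul, zero_smul]
    exact Finset.sum_eq_zero fun _ _ => by
      rw [hR.comp_neg hc (by norm_num), mul_zero]

theorem _root_.IsPre.comp_deg_one (x : R) : c 1 x = ι (pr x) := by
  refine hR.ind (fun x => c 1 x = ι (pr x)) ?_ ?_ ?_ ?_ x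
  · rw [hc.comp_one, hR.pr_one, map_zero, if_neg one_ne_zero]
  · intro x y hx hy; rw [map_add, hx, hy, map_add, map_add]
  · intro a x hx; rw [map_smul, hx, map_smul, map_smul]
  · intro v x hx
    rw [hc.comp_ι_mul, hR.pr_ι_mul]
    simp [hR.comp_zero hc]

theorem _root_.IsPre.comp_mem_pow (n : ℕ) (x : R) : c n x ∈ LinearMap.range ι ^ n := by
  revert n
  refine hR.ind (fun x => ∀ n : ℕ, c n x ∈ LinearMap.range ι ^ n) ?_ ?_ ?_ ?_ x
  · intro n
    rw [hc.comp_one]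
    split_ifs with h
    · obtain rfl : n = 0 := by exact_mod_cast h
      rw [pow_zero]; exact Submodule.one_le.1 le_rfl
    · exact zero_mem _
  · intro x y hx hy n; rw [map_add]; exact add_mem (hx n) (hy n)
  · intro a x hx n; rw [map_smul]; exact Submodule.smul_mem _ _ (hx n)
  · intro v x hx n
    rw [hc.comp_ι_mul, Fintype.sum_unique]
    rcases n with _ | n
    · rw [hR.comp_neg hc (by simp), mul_zero]; exact zero_mem _
    · rw [pow_succ']
      refine Submodule.mul_mem_mul ⟨v, rfl⟩ ?_
      have : ((n + 1 : ℕ) : ℤ) - 1 = n := by push_cast; ring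
      rw [this]
      exact hx n

end

theorem rightRad_le_nicholsSub : rightRad U.tComul U.tCounit U.tPr ≤ U.nicholsSub := by
  let hT := U.t_isPre
  let J := rightRad U.tComul U.tCounit U.tPr
  let c := U.tComp (fun _ : Unit => (LinearMap.id : U →ₗ[k] U)) (fun _ => (1 : ℤ))
  have hc : IsGr (TensorAlgebra.ι k) (fun _ : Unit => (LinearMap.id : U →ₗ[k] U))
    (fun _ => (1 : ℤ)) c := U.t_isGr _ _
  have hgr : ∀ n, ∀ x ∈ J, c n x ∈ J := by
    intro n x hx
    refine le_rightRad (isRightStable_span (S := {y | ∃ n, ∃ x ∈ J, y = c n x}) ?_)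
      (Submodule.subset_span ⟨n, x, hx, rfl⟩)
    rintro _ ⟨n, x, hx, rfl⟩
    refine ⟨?_, fun φ => ?_⟩
    · rw [hT.counit_comp U.isDec_unit hc, (rightRad_stable x hx).1, ite_self]
    · rw [hT.rder_comp U.isDec_unit hc]
      exact sum_mem fun j _ =>
        Submodule.subset_span ⟨_, _, (rightRad_stable x hx).2 _, rfl⟩
  have hcomul : ∀ (n : ℕ), ∀ x ∈ J, (∀ m : ℤ, n ≤ m → c m x = 0) →
      TensorProduct.map J.mkQ J.mkQ (U.tComul x) = 0 := by
    intro n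
    induction n with
    | zero =>
      intro x hx h
      rw [hT.eq_zero_of_comp hc U.isDec_unit (x := x), map_zero, map_zero]
      intro m
      rcases lt_or_ge m 0 with hm | hm
      · exact hT.comp_neg hc hm x
      · exact h m (by simpa using hm)
    | succ n ih =>
      intro x hx h
      refine eq_zero_of_lslice fun ψ => ?_
      rw [lslice_map]
      change J.mkQ (lhit U.tComul (ψ ∘ₗ J.mkQ) x) = 0
      rw [Submodule.mkQ_apply, Submodule.Quotient.mk_eq_zero]
      refine mem_rightRad ?_ fun φ => ?_
      · rw [hT.counit_lhit, LinearMap.comp_apply, Submodule.mkQ_apply,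
          (Submodule.Quotient.mk_eq_zero _).2 hx, map_zero]
      · rw [← hT.lhit_rhit, ← (Submodule.Quotient.mk_eq_zero (p := J)), ← Submodule.mkQ_apply]
        change J.mkQ (lslice (ψ ∘ₗ J.mkQ) (U.tComul _)) = 0
        rw [← lslice_map (g := J.mkQ), ih _ ((rightRad_stable x hx).2 φ), map_zero]
        intro m hm
        have h2 := hT.rder_comp U.isDec_unit hc (m + 1) φ x
        rw [h _ (by push_cast; omega), map_zero, Fintype.sum_unique] at h2
        simpa using h2.symm
  have hJ : U.IsNicholsIdeal J :=
    { mul_left := fun x y hy => (hT.rightRad_mul x).1 y hy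
      mul_right := fun x y hy => (hT.rightRad_mul x).2 y hy
      act := fun h x hx => hT.rightRad_act h hx
      coact := fun x hx => mem_range_lTensor fun χ => hT.rightRad_coact χ hx
      comul := by
        intro x hx
        have h : ∃ n : ℕ, ∀ m : ℤ, n ≤ m → c m x = 0 := by
          obtain ⟨s, hs⟩ := hT.exists_finset hc U.isDec_unit x
          obtain ⟨b, hb⟩ := s.bddAbove
          refine ⟨(b + 1).toNat, fun m hm => ?_⟩
          have hms : m ∉ s := fun hms => by
            have := hb hms
            omega
          have := hs (insert m s) (Finset.subset_insert _ _)
          rw [Finset.sum_insert hms, hs s subset_rfl] at this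
          simpa using this
        obtain ⟨n, hn⟩ := h
        have h0 := hcomul n x hx hn
        have he : Function.Exact J.subtype J.mkQ := by
          rw [LinearMap.exact_iff, Submodule.ker_mkQ, Submodule.range_subtype]
        have hk := TensorProduct.map_ker (f := J.subtype) (g := J.mkQ) (f' := J.subtype)
          (g' := J.mkQ) he J.mkQ_surjective he J.mkQ_surjective
        rw [Submodule.mem_comap, sup_comm, ← hk]
        exact h0
      graded := by
        intro x hx
        obtain ⟨s, hs⟩ := hT.exists_finset hc U.isDec_unit x
        rw [← hs s subset_rfl]
        refine sum_mem fun n _ => ?_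
        rcases lt_or_ge n 2 with hn | hn
        · suffices c n x = 0 by rw [this]; exact zero_mem _
          rcases lt_or_ge n 0 with hn' | hn'
          · exact hT.comp_neg hc hn' x
          · obtain rfl | rfl : n = 0 ∨ n = 1 := by omega
            · rw [hT.comp_zero hc, (rightRad_stable x hx).1, zero_smul]
            · rw [hT.comp_deg_one hc, (Module.forall_dual_apply_eq_zero_iff k (U.tPr x)).1, map_zero]
              intro φ
              have := (rightRad_stable _ ((rightRad_stable x hx).2 φ)).1
              rwa [hT.counit_rhit] at this
        · obtain ⟨m, rfl⟩ : ∃ m : ℕ, n = ((m + 2 : ℕ) : ℤ) := ⟨(n - 2).toNat, by omega⟩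
          exact Submodule.mem_iSup_of_mem m ⟨hgr _ x hx, hT.comp_mem_pow hc _ x⟩ }
  exact hJ.le

theorem nRhit_nmk (φ : U →ₗ[k] k) (x : U.T) :
    rhit U.nComul (φ ∘ₗ U.nPr) (U.nmk x) = U.nmk (rhit U.tComul (φ ∘ₗ U.tPr) x) := by
  change rslice _ (U.nComul (U.nmk x)) = _
  rw [nComul_nmk, rslice_map, show (φ ∘ₗ U.nPr) ∘ₗ U.nmk.toLinearMap = φ ∘ₗ U.tPr from
    LinearMap.ext fun y => congrArg φ (U.nPr_nmk y)]
  rfl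

theorem nicholsSub_eq_rightRad : U.nicholsSub = rightRad U.tComul U.tCounit U.tPr := by
  refine le_antisymm (le_rightRad fun x hx => ⟨(U.graded_le hx).2, fun φ => ?_⟩)
    U.rightRad_le_nicholsSub
  rw [← nmk_eq_zero] at hx ⊢
  rw [← nRhit_nmk, hx, map_zero]

theorem eq_bot_of_isRightStable {P : Submodule k U.Nichols}
    (h : IsRightStable U.nComul U.nCounit U.nPr P) : P = ⊥ := by
  refine (Submodule.eq_bot_iff P).2 fun x hx => ?_
  obtain ⟨x, rfl⟩ := U.nmk_surjective x
  rw [nmk_eq_zero, nicholsSub_eq_rightRad]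
  refine le_rightRad (P := P.comap U.nmk.toLinearMap) (fun y hy => ?_) hx
  obtain ⟨h1, h2⟩ := h _ hy
  refine ⟨h1, fun φ => ?_⟩
  rw [Submodule.mem_comap, AlgHom.toLinearMap_apply, ← nRhit_nmk]
  exact h2 φ

/-- An element of the augmentation ideal of a Nichols algebra that is killed by all right skew
derivations is zero. -/
theorem eq_zero_of_rder {x : U.Nichols} (h0 : U.nCounit x = 0)
    (h : ∀ φ : U →ₗ[k] k, rhit U.nComul (φ ∘ₗ U.nPr) x = 0) : x = 0 := by
  have := U.eq_bot_of_isRightStable (P := Submodule.span k {x}) (isRightStable_span (by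
    rintro _ rfl
    exact ⟨h0, fun φ => by rw [h]; exact zero_mem _⟩))
  rwa [Submodule.span_singleton_eq_bot] at this

/-- An element of the augmentation ideal of a Nichols algebra that is killed by all left skew
derivations is zero. -/
theorem eq_zero_of_lder {x : U.Nichols} (h0 : U.nCounit x = 0)
    (h : ∀ φ : U →ₗ[k] k, lhit U.nComul (φ ∘ₗ U.nPr) x = 0) : x = 0 := by
  let P : Submodule k U.Nichols := LinearMap.ker U.nCounit.toLinearMap ⊓
    ⨅ φ : U →ₗ[k] k, LinearMap.ker (lhit U.nComul (φ ∘ₗ U.nPr))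
  have hP : ∀ x, x ∈ P ↔ U.nCounit x = 0 ∧ ∀ φ : U →ₗ[k] k, lhit U.nComul (φ ∘ₗ U.nPr) x = 0 := by
    intro x; simp [P]
  have := U.eq_bot_of_isRightStable (P := P) (fun y hy => by
    obtain ⟨h1, h2⟩ := (hP y).1 hy
    refine ⟨h1, fun ψ => (hP _).2 ⟨?_, fun φ => ?_⟩⟩
    · rw [U.n_isPre.counit_rhit, LinearMap.comp_apply,
        (Module.forall_dual_apply_eq_zero_iff k (U.nPr y)).1, map_zero]
      intro φ
      have := U.n_isPre.counit_lhit (φ ∘ₗ U.nPr) y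
      rw [h2, map_zero] at this
      exact this.symm
    · rw [U.n_isPre.lhit_rhit, h2, map_zero])
  exact (Submodule.eq_bot_iff P).1 this x ((hP x).2 ⟨h0, h⟩)

/-! ### Functoriality and gradings of Nichols algebras -/

theorem tCounit_tMap {U' : YDMod k H} {f : U →ₗ[k] U'} (x : U.T) :
    U'.tCounit (tMap f x) = U.tCounit x := by
  have : U'.tCounit.comp (tMap f) = U.tCounit := by ext v; simp
  exact DFunLike.congr_fun this x

theorem tPr_tMap {U' : YDMod k H} {f : U →ₗ[k] U'} (x : U.T) :
    U'.tPr (tMap f x) = f (U.tPr x) := by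
  refine U.t_isPre.ind (fun x => U'.tPr (tMap f x) = f (U.tPr x)) ?_ ?_ ?_ ?_ x
  · simp [tPr_one]
  · intro x y hx hy; simp only [map_add, hx, hy]
  · intro a x hx; simp only [map_smul, hx]
  · intro v x hx
    rw [map_mul, tMap_ι, tPr_ι_mul, tPr_ι_mul, tCounit_tMap, map_smul]

variable {U}

theorem tMap_nicholsSub {U' : YDMod k H} {f : U →ₗ[k] U'} (hf : IsHom f) {x : U.T}
    (hx : x ∈ U.nicholsSub) : tMap f x ∈ U'.nicholsSub := by
  rw [nicholsSub_eq_rightRad] at hx ⊢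
  refine le_rightRad (P := (rightRad U.tComul U.tCounit U.tPr).map (tMap f).toLinearMap) ?_
    ⟨x, hx, rfl⟩
  rintro _ ⟨y, hy, rfl⟩
  obtain ⟨h1, h2⟩ := rightRad_stable y hy
  refine ⟨by rw [AlgHom.toLinearMap_apply, tCounit_tMap, h1], fun φ => ?_⟩
  refine ⟨_, h2 (φ ∘ₗ f), ?_⟩
  change _ = rslice _ (U'.tComul (tMap f y))
  rw [tMap_tComul hf, rslice_map]
  have : (φ ∘ₗ U'.tPr) ∘ₗ (tMap f).toLinearMap = (φ ∘ₗ f) ∘ₗ U.tPr := by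
    ext z; simp [tPr_tMap]
  rw [this]
  rfl

/-- The algebra map `B(f) : B(U) → B(U')` induced by a morphism `f`. -/
def nHom {U' : YDMod k H} (f : U →ₗ[k] U') (hf : IsHom f) : U.Nichols →ₐ[k] U'.Nichols :=
  Ideal.Quotient.liftₐ U.nicholsIdeal (U'.nmk.comp (tMap f)) fun _ hx =>
    U'.nmk_eq_zero.2 (tMap_nicholsSub hf hx)

section nHom

variable {U' : YDMod k H} {f : U →ₗ[k] U'} (hf : IsHom f)

theorem nHom_nmk (x : U.T) : nHom f hf (U.nmk x) = U'.nmk (tMap f x) := rfl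

theorem nHom_ι (v : U) : nHom f hf (U.nι v) = U'.nι (f v) := by
  change U'.nmk (tMap f (TensorAlgebra.ι k v)) = _
  rw [tMap_ι]
  rfl

theorem nHom_hom : IsYDMap U.nAct U.nCoact.toLinearMap U'.nAct U'.nCoact.toLinearMap
    (nHom f hf).toLinearMap where
  map_act h x := by
    obtain ⟨x, rfl⟩ := U.nmk_surjective x
    simp only [AlgHom.toLinearMap_apply, nAct_nmk, nHom_nmk, tMap_tAct hf]
  map_coact x := by
    obtain ⟨x, rfl⟩ := U.nmk_surjective x
    simp only [AlgHom.toLinearMap_apply, nCoact_nmk, nHom_nmk, tMap_tCoact hf,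
      ← LinearMap.lTensor_comp_apply]
    rfl

theorem nHom_comul (x : U.Nichols) : U'.nComul (nHom f hf x) =
    TensorProduct.map (nHom f hf).toLinearMap (nHom f hf).toLinearMap (U.nComul x) := by
  obtain ⟨x, rfl⟩ := U.nmk_surjective x
  rw [nHom_nmk, nComul_nmk, nComul_nmk, tMap_tComul hf]
  generalize U.tComul x = z
  induction z with
  | zero => simp
  | add x y hx hy => simp only [map_add, hx, hy]
  | tmul a b => simp [nHom_nmk]

end nHom

section Grading

variable {J Γ : Type*} [Fintype J] [AddCommGroup Γ] [DecidableEq Γ] {q : J → U →ₗ[k] U}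
    (hq : U.IsDec q) (d : J → Γ)

/-- The projections of the Nichols algebra to the components of a grading. -/
def nComp (γ : Γ) : U.Nichols →ₗ[k] U.Nichols :=
  descend U.nmk.toLinearMap U.nmk_surjective (U.nmk.toLinearMap ∘ₗ U.tComp q d γ) (by
    rw [ker_nmk]
    intro x hx
    rw [LinearMap.mem_ker, LinearMap.comp_apply, AlgHom.toLinearMap_apply, nmk_eq_zero]
    rw [nicholsSub_eq_rightRad] at hx ⊢
    refine le_rightRad (isRightStable_span
      (S := {y | ∃ γ, ∃ x ∈ rightRad U.tComul U.tCounit U.tPr, y = U.tComp q d γ x}) ?_)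
      (Submodule.subset_span ⟨γ, x, hx, rfl⟩)
    rintro _ ⟨n, x, hx, rfl⟩
    refine ⟨?_, fun φ => ?_⟩
    · rw [U.t_isPre.counit_comp hq (U.t_isGr q d), (rightRad_stable x hx).1, ite_self]
    · rw [U.t_isPre.rder_comp hq (U.t_isGr q d)]
      exact sum_mem fun j _ => Submodule.subset_span ⟨_, _, (rightRad_stable x hx).2 _, rfl⟩)

theorem nComp_nmk (γ : Γ) (x : U.T) : nComp hq d γ (U.nmk x) = U.nmk (U.tComp q d γ x) :=
  descend_apply U.nmk.toLinearMap U.nmk_surjective _ _ x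

theorem n_isGr : IsGr U.nι q d (nComp hq d) where
  comp_one γ := by
    rw [← map_one U.nmk, nComp_nmk, (U.t_isGr q d).comp_one]
    split_ifs <;> simp
  comp_ι_mul γ v x := by
    obtain ⟨x, rfl⟩ := U.nmk_surjective x
    change nComp hq d γ (U.nmk (TensorAlgebra.ι k v) * U.nmk x) = _
    rw [← map_mul, nComp_nmk, (U.t_isGr q d).comp_ι_mul, map_sum]
    simp only [map_mul, nComp_nmk]
    rfl

theorem mem_nGrade {P : J → Submodule k U} (hP : ∀ j, P j = LinearMap.range (q j)) (γ : Γ)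
    (x : U.Nichols) : x ∈ U.nGrade P d γ ↔ nComp hq d γ x = x := by
  have hg := n_isGr hq d
  constructor
  · suffices U.nGrade P d γ ≤ LinearMap.range (nComp hq d γ) by
      intro hx
      obtain ⟨y, rfl⟩ := this hx
      exact U.n_isPre.comp_self hq hg γ y
    refine iSup₂_le fun l hl => ?_
    subst hl
    induction l with
    | nil =>
      simp only [List.map_nil, List.prod_nil, List.sum_nil]
      rw [Submodule.one_le]
      exact ⟨1, by rw [hg.comp_one, if_pos rfl]⟩
    | cons j l ih =>
      simp only [List.map_cons, List.prod_cons, List.sum_cons]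
      rw [Submodule.mul_le]
      rintro _ ⟨v, hv, rfl⟩ y hy
      obtain ⟨y, rfl⟩ := ih hy
      rw [hP] at hv
      obtain ⟨v, rfl⟩ := hv
      refine ⟨U.nι (q j v) * nComp hq d (l.map d).sum y, ?_⟩
      rw [IsPre.comp_q_mul hq hg, add_sub_cancel_left, U.n_isPre.comp_self hq hg]
  · intro hx
    rw [← hx]
    clear hx
    revert γ
    refine U.n_isPre.ind (fun x => ∀ γ, nComp hq d γ x ∈ U.nGrade P d γ) ?_ ?_ ?_ ?_ x
    · intro γ
      rw [hg.comp_one]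
      split_ifs with h
      · subst h
        refine Submodule.mem_iSup_of_mem [] (Submodule.mem_iSup_of_mem rfl ?_)
        rw [List.map_nil, List.prod_nil]
        exact Submodule.one_le.1 le_rfl
      · exact zero_mem _
    · intro x y hx hy γ; rw [map_add]; exact add_mem (hx γ) (hy γ)
    · intro a x hx γ; rw [map_smul]; exact Submodule.smul_mem _ _ (hx γ)
    · intro v x hx γ
      rw [hg.comp_ι_mul]
      refine sum_mem fun j _ => ?_
      have h1 : ∀ y ∈ U.nGrade P d (γ - d j), U.nι (q j v) * y ∈ U.nGrade P d γ := by
        intro y hy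
        have : U.nGrade P d (γ - d j) ≤ (U.nGrade P d γ).comap (LinearMap.mulLeft k (U.nι (q j v))) := by
          refine iSup₂_le fun l hl y hy => ?_
          refine Submodule.mem_iSup_of_mem (j :: l) (Submodule.mem_iSup_of_mem ?_ ?_)
          · rw [List.map_cons, List.sum_cons, hl]; abel
          · rw [List.map_cons, List.prod_cons]
            exact Submodule.mul_mem_mul ⟨q j v, by rw [hP]; exact ⟨v, rfl⟩, rfl⟩ hy
        exact this hy
      exact h1 _ (hx _)

end Grading

end YDMod

section Pre

variable {R : Type*} [Ring R] [Algebra k R]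

namespace IsPre

variable {U : YDMod.{u, w, v} k H} {ι : U →ₗ[k] R} {act : H →ₐ[k] Module.End k R}
    {coact : R →ₐ[k] H ⊗[k] R} {Δ : R →ₗ[k] R ⊗[k] R} {ε : R →ₐ[k] k} {pr : R →ₗ[k] U}
    (hR : IsPre U ι act coact Δ ε pr)
include hR

theorem lhit_act {m : ℕ} {t : Fin m → Fin m → H} (ht : IsComatrix (k := k) t) (a b : Fin m)
    (χ : R →ₗ[k] k) (x : R) :
    lhit Δ χ (act (t a b) x) = ∑ c, act (t c b) (lhit Δ (χ ∘ₗ act (t a c)) x) := by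
  change lslice _ (Δ _) = ∑ c, act (t c b) (lslice _ (Δ x))
  rw [hR.comul_act]
  induction Δ x with
  | zero => simp
  | add x y hx hy => simp only [map_add, hx, hy, Finset.sum_add_distrib]
  | tmul y z =>
    rw [YDMod.diagAct_comatrix _ _ ht]
    simp [map_sum]

theorem lder_act {m : ℕ} {t : Fin m → Fin m → H} (ht : IsComatrix (k := k) t) (a b : Fin m)
    (φ : U →ₗ[k] k) (x : R) : lhit Δ (φ ∘ₗ pr) (act (t a b) x) =
      ∑ c, act (t c b) (lhit Δ ((φ ∘ₗ U.act (t a c)) ∘ₗ pr) x) := by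
  rw [hR.lhit_act ht]
  refine Finset.sum_congr rfl fun c _ => ?_
  congr 3
  ext y
  simp [hR.pr_act]

theorem lder_mul {m : ℕ} {t : Fin m → Fin m → H} {e : Fin m → R}
    (he : IsCofam coact.toLinearMap t e) (a : Fin m) (φ : U →ₗ[k] k) (y : R) :
    lhit Δ (φ ∘ₗ pr) (e a * y) = lhit Δ (φ ∘ₗ pr) (e a) * y +
      ∑ b, e b * lhit Δ ((φ ∘ₗ U.act (t a b)) ∘ₗ pr) y := by
  let Θ : H ⊗[k] R →ₗ[k] R ⊗[k] R →ₗ[k] R := TensorProduct.lift (LinearMap.mk₂ k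
    (fun h r => LinearMap.mulLeft k r ∘ₗ lslice ((φ ∘ₗ U.act h) ∘ₗ pr))
    (fun a b r => by ext; simp [add_smul, mul_add])
    (fun a b r => by ext; simp [smul_smul])
    (fun a b r => by ext; simp [add_mul])
    (fun a b r => by ext; simp [smul_comm a]))
  have hΘ : ∀ h r z, Θ (h ⊗ₜ r) z = r * lslice ((φ ∘ₗ U.act h) ∘ₗ pr) z := fun _ _ _ => rfl
  have key : ∀ s z, lslice (φ ∘ₗ pr) (bmul act coact s z) =
      lslice (φ ∘ₗ pr) s * TensorProduct.lid k R (ε.toLinearMap.rTensor R z) +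
        Θ (coact (TensorProduct.lid k R (ε.toLinearMap.rTensor R s))) z := by
    intro s z
    induction s with
    | zero => simp
    | add x y hx hy => simp only [map_add, LinearMap.add_apply, hx, hy, add_mul]; abel
    | tmul a b =>
      obtain ⟨m, t, e, p, he, rfl⟩ := hR.toIsYDAlg.exists_cofam b
      have h2 := he.coact_eq p
      rw [AlgHom.toLinearMap_apply] at h2
      have hc : ∀ x : R, ε x • e p = ∑ q, ε (act (t p q) x) • e q := by
        intro x
        simp only [hR.counit_act, he.counit_eq, ite_mul, one_mul, zero_mul, ite_smul, zero_smul]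
        simp
      induction z with
      | zero => simp
      | add x y hx hy => simp only [map_add, hx, hy, mul_add]; abel
      | tmul c d =>
        rw [bmul_tmul he]
        have h3 := congrArg (· * d) (hc c)
        simp only [Finset.sum_mul, smul_mul_assoc] at h3
        simp only [LinearMap.rTensor_tmul, AlgHom.toLinearMap_apply, TensorProduct.lid_tmul,
          map_smul, h2, LinearMap.smul_apply, map_sum, LinearMap.sum_apply, hΘ, lslice_tmul,
          LinearMap.comp_apply, hR.pr_mul, map_add, add_smul, Finset.sum_add_distrib, hR.pr_act,
          mul_smul_comm, smul_mul_assoc, smul_eq_mul, Finset.smul_sum, smul_smul]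
        congr 1
        · rw [mul_comm, mul_smul, h3, Finset.smul_sum]
          simp only [smul_smul, mul_comm]
  have h2 := he.coact_eq a
  rw [AlgHom.toLinearMap_apply] at h2
  change lslice _ (Δ (e a * y)) = _
  rw [hR.comul_mul, key, hR.counit_comul, hR.counit_comul, h2, map_sum, LinearMap.sum_apply]
  rfl

end IsPre

end Pre

section Graded

variable {R : Type*} [Ring R] [Algebra k R] {J Γ : Type*} [Fintype J] [AddCommGroup Γ]
  [DecidableEq Γ] {U : YDMod.{u, w, v} k H} {ι : U →ₗ[k] R} {act : H →ₐ[k] Module.End k R}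
    {coact : R →ₐ[k] H ⊗[k] R} {Δ : R →ₗ[k] R ⊗[k] R} {ε : R →ₐ[k] k} {pr : R →ₗ[k] U}
    (hR : IsPre U ι act coact Δ ε pr) {q : J → U →ₗ[k] U} (hq : U.IsDec q) {d : J → Γ}
    {c : Γ → R →ₗ[k] R} (hc : IsGr ι q d c)

include hR hq hc

theorem IsPre.comp_mul_right {β : Γ} {y : R} (hy : c β y = y) (γ : Γ) (x : R) :
    c γ (x * y) = c (γ - β) x * y := by
  revert γ
  refine hR.ind (fun x => ∀ γ, c γ (x * y) = c (γ - β) x * y) ?_ ?_ ?_ ?_ x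
  · intro γ
    rw [one_mul, ← hy, hR.comp_comp hq hc, hy, hc.comp_one]
    simp only [sub_eq_zero]
    split_ifs with h
    · rw [one_mul, h, hy]
    · simp
  · intro x y hx hy γ; simp only [map_add, add_mul, hx, hy]
  · intro a x hx γ; simp only [map_smul, smul_mul_assoc, hx]
  · intro v x hx γ
    rw [mul_assoc, hc.comp_ι_mul, hc.comp_ι_mul, Finset.sum_mul]
    simp only [hx, mul_assoc, sub_right_comm]

theorem IsPre.eq_zero_of_comp_right {A : Type*} [AddCommGroup A] [Module k A] {z : A ⊗[k] R}
    (h : ∀ γ, (c γ).lTensor A z = 0) : z = 0 := by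
  refine eq_zero_of_lslice fun φ => hR.eq_zero_of_comp hc hq fun γ => ?_
  have := lslice_map φ LinearMap.id (c γ) z
  rw [← LinearMap.lTensor, h, map_zero] at this
  exact this.symm

theorem IsPre.eq_zero_of_comp_left {A : Type*} [AddCommGroup A] [Module k A] {z : R ⊗[k] A}
    (h : ∀ γ, (c γ).rTensor A z = 0) : z = 0 := by
  refine eq_zero_of_rslice fun φ => hR.eq_zero_of_comp hc hq fun γ => ?_
  have := rslice_map φ (c γ) LinearMap.id z
  rw [← LinearMap.rTensor, h, map_zero] at this
  exact this.symm

theorem IsPre.eq_of_comp_comp {z z' : R ⊗[k] R}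
    (h : ∀ α β, TensorProduct.map (c α) (c β) z = TensorProduct.map (c α) (c β) z') : z = z' := by
  rw [← sub_eq_zero]
  refine hR.eq_zero_of_comp_left hq hc fun α => hR.eq_zero_of_comp_right hq hc fun β => ?_
  rw [← LinearMap.comp_apply, LinearMap.lTensor_comp_rTensor, map_sub, h, sub_self]

theorem IsPre.exists_finset_right {A : Type*} [AddCommGroup A] [Module k A] (z : A ⊗[k] R) :
    ∃ s : Finset Γ, ∀ s', s ⊆ s' → ∑ γ ∈ s', (c γ).lTensor A z = z := by
  induction z with
  | zero => exact ⟨∅, by simp⟩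
  | add x y hx hy =>
    obtain ⟨s, hs⟩ := hx
    obtain ⟨s', hs'⟩ := hy
    refine ⟨s ∪ s', fun r hr => ?_⟩
    simp only [map_add, Finset.sum_add_distrib]
    rw [hs _ (Finset.union_subset_left hr), hs' _ (Finset.union_subset_right hr)]
  | tmul a x =>
    obtain ⟨s, hs⟩ := hR.exists_finset hc hq x
    refine ⟨s, fun r hr => ?_⟩
    simp only [LinearMap.lTensor_tmul, ← tmul_sum, hs r hr]

end Graded

namespace YDMod

/-! ### Yetter-Drinfeld submodules -/

section IsSub

variable {X : YDMod.{u, w, v} k H} {A : Type*} [AddCommGroup A] [Module k A]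

theorem IsSub.mk' {P : Submodule k X} (h1 : ∀ h, ∀ x ∈ P, X.act h x ∈ P)
    (h2 : ∀ (χ : H →ₗ[k] k), ∀ x ∈ P, lslice χ (X.coact x) ∈ P) : X.IsSub P :=
  ⟨fun h x hx => h1 h x hx, fun x hx => mem_range_lTensor fun χ => h2 χ x hx⟩

theorem IsSub.lslice_mem {P : Submodule k X} (hP : X.IsSub P) (χ : H →ₗ[k] k) {x : X}
    (hx : x ∈ P) : lslice χ (X.coact x) ∈ P := _root_.lslice_mem (hP.coact_mem hx) χ

theorem IsSub.eqLocus {actA : H →ₐ[k] Module.End k A} {coactA : A →ₗ[k] H ⊗[k] A}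
    {f g : X →ₗ[k] A} (hf : IsYDMap X.act X.coact actA coactA f)
    (hg : IsYDMap X.act X.coact actA coactA g) : X.IsSub (LinearMap.eqLocus f g) := by
  refine IsSub.mk' (fun h x hx => ?_) (fun χ x hx => ?_)
  · rw [LinearMap.mem_eqLocus] at *
    rw [hf.map_act, hg.map_act, hx]
  · rw [LinearMap.mem_eqLocus] at *
    have e : ∀ f : X →ₗ[k] A, f (lslice χ (X.coact x)) = lslice χ (f.lTensor H (X.coact x)) := by
      intro f
      rw [LinearMap.lTensor, lslice_map]
      rfl
    rw [e, e, ← hf.map_coact, ← hg.map_coact, hx]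

theorem IsSub.inf {P Q : Submodule k X} (hP : X.IsSub P) (hQ : X.IsSub Q) : X.IsSub (P ⊓ Q) :=
  IsSub.mk' (fun h _ hx => ⟨hP.act_mem h hx.1, hQ.act_mem h hx.2⟩)
    fun χ _ hx => ⟨hP.lslice_mem χ hx.1, hQ.lslice_mem χ hx.2⟩

theorem IsSub.map {Y : YDMod k H} {f : X →ₗ[k] Y} (hf : IsHom f) {P : Submodule k X}
    (hP : X.IsSub P) : Y.IsSub (P.map f) := by
  refine IsSub.mk' ?_ ?_
  · rintro h _ ⟨x, hx, rfl⟩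
    exact ⟨_, hP.act_mem h hx, hf.map_act h x⟩
  · rintro χ _ ⟨x, hx, rfl⟩
    refine ⟨_, hP.lslice_mem χ hx, ?_⟩
    rw [hf.map_coact, LinearMap.lTensor, lslice_map]
    rfl

theorem IsSub.comap {Y : YDMod k H} {f : X →ₗ[k] Y} (hf : IsHom f) {P : Submodule k Y}
    (hP : Y.IsSub P) : X.IsSub (P.comap f) := by
  refine IsSub.mk' (fun h x hx => ?_) (fun χ x hx => ?_)
  · rw [Submodule.mem_comap, hf.map_act]
    exact hP.act_mem h hx
  · have := hP.lslice_mem χ hx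
    rw [hf.map_coact, LinearMap.lTensor, lslice_map] at this
    exact this

end IsSub

/-! ### Direct sums -/

section Pi

variable {ι : Type} [Fintype ι] [DecidableEq ι] (M : ι → YDMod.{u, w, v} k H) (i j : ι)

theorem proj_single (x : M j) : proj M j (single M j x) = x :=
  Pi.single_eq_same (M := fun j => (M j).carrier) j x

theorem proj_single_of_ne {i j : ι} (h : i ≠ j) (x : M j) : proj M i (single M j x) = 0 :=
  Pi.single_eq_of_ne (M := fun j => (M j).carrier) h x

/-- The projection of a direct sum to a summand, as an endomorphism. -/
def piQ : pi M →ₗ[k] pi M := single M j ∘ₗ proj M j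

theorem piQ_hom : IsHom (piQ M j) := (proj_isHom M j).comp (single_isHom M j)

theorem isDec_pi : (pi M).IsDec (piQ M) where
  sum_eq v := by
    change ∑ j, Pi.single j (v j) = v
    exact Finset.univ_sum_single v
  idem j v := by simp [piQ, proj_single]
  orth j l v h := by simp [piQ, proj_single_of_ne M h]
  hom := piQ_hom M

theorem piQ_single (x : M j) : piQ M j (single M j x) = single M j x := by
  simp [piQ, proj_single]

theorem piQ_single_of_ne {i j : ι} (h : i ≠ j) (x : M j) : piQ M i (single M j x) = 0 := by
  simp [piQ, proj_single_of_ne M h]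

/-- The embedding of `M j` in the Nichols algebra of the direct sum. -/
def inc : M j →ₗ[k] (pi M).Nichols := (pi M).nι ∘ₗ single M j

theorem inc_hom : IsYDMap (M j).act (M j).coact (pi M).nAct (pi M).nCoact.toLinearMap (inc M j) :=
  (single_isHom M j).comp (pi M).nι_isHom

theorem mem_summand {x : (pi M).Nichols} : x ∈ summand M j ↔ ∃ u, inc M j u = x := Iff.rfl

theorem inc_mem (x : M j) : inc M j x ∈ summand M j := ⟨x, rfl⟩

theorem nι_eq_sum (v : pi M) : (pi M).nι v = ∑ j, inc M j (proj M j v) := by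
  conv_lhs => rw [← (isDec_pi M).sum_eq v, map_sum]
  rfl

theorem pi_ind {p : (pi M).Nichols → Prop} (h1 : p 1)
    (ha : ∀ x y, p x → p y → p (x + y)) (hs : ∀ (c : k) x, p x → p (c • x))
    (hm : ∀ j (u : M j) x, p x → p (inc M j u * x)) (x : (pi M).Nichols) : p x := by
  refine (pi M).n_isPre.ind p h1 ha hs (fun v x hx => ?_) x
  rw [nι_eq_sum, Finset.sum_mul]
  refine Finset.sum_induction _ p (fun a b => ha a b) ?_ fun j _ => hm j _ _ hx
  simpa using hs 0 1 h1

/-- The projections to the components of the `ℤ^ι`-grading of `B(⨁ M j)`. -/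
def gr (γ : ι → ℤ) : (pi M).Nichols →ₗ[k] (pi M).Nichols :=
  nComp (isDec_pi M) (fun j => (Pi.single j 1 : ι → ℤ)) γ

theorem gr_isGr : IsGr (pi M).nι (piQ M) (fun j => (Pi.single j 1 : ι → ℤ)) (gr M) :=
  n_isGr (isDec_pi M) _

theorem gr_inc_mul (γ : ι → ℤ) (u : M j) (x : (pi M).Nichols) :
    gr M γ (inc M j u * x) = inc M j u * gr M (γ - Pi.single j 1) x := by
  have := IsPre.comp_q_mul (isDec_pi M) (gr_isGr M) γ j (single M j u) x
  rwa [piQ_single] at this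

theorem gr_inc (u : M j) : gr M (Pi.single j 1) (inc M j u) = inc M j u := by
  rw [← mul_one (inc M j u), gr_inc_mul, (gr_isGr M).comp_one, if_pos (sub_self _)]

theorem gr_neg {γ : ι → ℤ} (l : ι) (h : γ l < 0) (x : (pi M).Nichols) : gr M γ x = 0 := by
  revert γ
  refine pi_ind M (p := fun x => ∀ {γ : ι → ℤ}, γ l < 0 → gr M γ x = 0) ?_ ?_ ?_ ?_ x
  · intro γ h
    rw [(gr_isGr M).comp_one, if_neg]
    rintro rfl
    exact lt_irrefl _ h
  · intro x y hx hy γ h; rw [map_add, hx h, hy h, add_zero]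
  · intro c x hx γ h; rw [map_smul, hx h, smul_zero]
  · intro j u x hx γ h
    rw [gr_inc_mul, hx, mul_zero]
    by_cases hj : l = j
    · subst hj; simp; omega
    · simpa [hj] using h

theorem gr_zero (x : (pi M).Nichols) : gr M 0 x = (pi M).nCounit x • 1 := by
  refine pi_ind M (p := fun x => gr M 0 x = (pi M).nCounit x • 1) ?_ ?_ ?_ ?_ x
  · rw [(gr_isGr M).comp_one, if_pos rfl, map_one, one_smul]
  · intro x y hx hy; rw [map_add, hx, hy, map_add, add_smul]
  · intro c x hx; rw [map_smul, hx, map_smul, smul_assoc]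
  · intro j u x hx
    rw [gr_inc_mul, gr_neg M j (by simp), mul_zero, map_mul]
    change 0 = ((pi M).nCounit ((pi M).nι _) * _) • (1 : (pi M).Nichols)
    rw [(pi M).n_isPre.counit_ι, zero_mul, zero_smul]

/-! ### The projection to `B(M i)` -/

/-- The projection `B(⨁ M j) → B(M i)`, as an endomorphism of `B(⨁ M j)`. -/
def nIdem : (pi M).Nichols →ₐ[k] (pi M).Nichols := nHom (piQ M i) (piQ_hom M i)

theorem nIdem_inc (v : M i) : nIdem M i (inc M i v) = inc M i v := by
  change nHom _ _ ((pi M).nι _) = _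
  rw [nHom_ι, piQ_single]
  rfl

theorem nIdem_inc_of_ne {i j : ι} (h : j ≠ i) (v : M j) : nIdem M i (inc M j v) = 0 := by
  change nHom _ _ ((pi M).nι _) = _
  rw [nHom_ι, piQ_single_of_ne M h.symm, map_zero]

theorem nIdem_nIdem (x : (pi M).Nichols) : nIdem M i (nIdem M i x) = nIdem M i x := by
  refine pi_ind M (p := fun x => nIdem M i (nIdem M i x) = nIdem M i x) ?_ ?_ ?_ ?_ x
  · simp
  · intro x y hx hy; simp only [map_add, hx, hy]
  · intro c x hx; simp only [map_smul, hx]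
  · intro j u x hx
    by_cases h : j = i
    · subst h; simp only [map_mul, nIdem_inc, hx]
    · simp only [map_mul, nIdem_inc_of_ne M h, zero_mul, map_zero]

theorem nIdem_gr (γ : ι → ℤ) (x : (pi M).Nichols) : nIdem M i (gr M γ x) = gr M γ (nIdem M i x) := by
  revert γ
  refine pi_ind M (p := fun x => ∀ γ, nIdem M i (gr M γ x) = gr M γ (nIdem M i x)) ?_ ?_ ?_ ?_ x
  · intro γ
    rw [map_one (nIdem M i), (gr_isGr M).comp_one]
    split_ifs <;> simp
  · intro x y hx hy γ; simp only [map_add, hx, hy]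
  · intro c x hx γ; simp only [map_smul, hx]
  · intro j u x hx γ
    by_cases h : j = i
    · subst h; simp only [gr_inc_mul, map_mul, nIdem_inc, hx]
    · simp only [gr_inc_mul, map_mul, nIdem_inc_of_ne M h, zero_mul, map_zero]

theorem nIdem_gr_of_height_eq_zero {γ : ι → ℤ} (h : ∀ l, l ≠ i → γ l = 0) (x : (pi M).Nichols) :
    nIdem M i (gr M γ x) = gr M γ x := by
  revert γ
  refine pi_ind M (p := fun x => ∀ {γ : ι → ℤ}, (∀ l, l ≠ i → γ l = 0) →
    nIdem M i (gr M γ x) = gr M γ x) ?_ ?_ ?_ ?_ x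
  · intro γ h
    rw [(gr_isGr M).comp_one]
    split_ifs <;> simp
  · intro x y hx hy γ h; simp only [map_add, hx h, hy h]
  · intro c x hx γ h; simp only [map_smul, hx h]
  · intro j u x hx γ h
    rw [gr_inc_mul, map_mul]
    by_cases hj : j = i
    · subst hj
      rw [nIdem_inc, hx fun l hl => by simp [h l hl, hl]]
    · rw [gr_neg M j (by simp [h j hj]), map_zero, mul_zero, mul_zero]

/-- The map `x ↦ x⁽¹⁾ ⊗ π(x⁽²⁾)`. -/
def rho : (pi M).Nichols →ₗ[k] (pi M).Nichols ⊗[k] (pi M).Nichols :=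
  (nIdem M i).toLinearMap.lTensor _ ∘ₗ (pi M).nComul

theorem rho_mul (x y : (pi M).Nichols) :
    rho M i (x * y) = bmul (pi M).nAct (pi M).nCoact (rho M i x) (rho M i y) := by
  have key : ∀ s z, (nIdem M i).toLinearMap.lTensor _ (bmul (pi M).nAct (pi M).nCoact s z) =
      bmul (pi M).nAct (pi M).nCoact ((nIdem M i).toLinearMap.lTensor _ s)
        ((nIdem M i).toLinearMap.lTensor _ z) := by
    intro s z
    induction s with
    | zero => simp
    | add x y hx hy => simp only [map_add, LinearMap.add_apply, hx, hy]
    | tmul a b =>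
      induction z with
      | zero => simp
      | add x y hx hy => simp only [map_add, hx, hy]
      | tmul c d =>
        obtain ⟨m, t, e, p, he, rfl⟩ := (pi M).n_isPre.toIsYDAlg.exists_cofam b
        have he' : IsCofam (pi M).nCoact.toLinearMap t fun a => nIdem M i (e a) :=
          he.map (f := (nIdem M i).toLinearMap) (nHom_hom (piQ_hom M i)).map_coact
        rw [bmul_tmul he]
        simp only [map_sum, LinearMap.lTensor_tmul, AlgHom.toLinearMap_apply, map_mul,
          bmul_tmul he']
  change (nIdem M i).toLinearMap.lTensor _ ((pi M).nComul (x * y)) = _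
  rw [(pi M).n_isPre.comul_mul, key]
  rfl

theorem rho_inc (v : M i) : rho M i (inc M i v) = primTensor (pi M).nι (single M i v) := by
  change (nIdem M i).toLinearMap.lTensor _ ((pi M).nComul ((pi M).nι _)) = _
  rw [(pi M).n_isPre.comul_ι, primTensor, map_add]
  simp only [LinearMap.lTensor_tmul, AlgHom.toLinearMap_apply, map_one]
  have := nIdem_inc M i v
  rw [inc, LinearMap.comp_apply] at this
  rw [this]

theorem rho_inc_of_ne {i j : ι} (h : j ≠ i) (v : M j) : rho M i (inc M j v) = inc M j v ⊗ₜ 1 := by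
  change (nIdem M i).toLinearMap.lTensor _ ((pi M).nComul ((pi M).nι _)) = _
  rw [(pi M).n_isPre.comul_ι, primTensor, map_add]
  simp only [LinearMap.lTensor_tmul, AlgHom.toLinearMap_apply, map_one]
  have := nIdem_inc_of_ne M h v
  rw [inc, LinearMap.comp_apply] at this
  rw [this, tmul_zero, add_zero]
  rfl

theorem rho_one : rho M i 1 = 1 ⊗ₜ 1 := by
  change (nIdem M i).toLinearMap.lTensor _ ((pi M).nComul 1) = _
  rw [(pi M).n_isPre.comul_one]
  simp

theorem rho_nIdem (x : (pi M).Nichols) : rho M i (nIdem M i x) = (pi M).nComul (nIdem M i x) := by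
  change (nIdem M i).toLinearMap.lTensor _ ((pi M).nComul (nIdem M i x)) = _
  have h : (pi M).nComul (nIdem M i x) =
    TensorProduct.map (nIdem M i).toLinearMap (nIdem M i).toLinearMap ((pi M).nComul x) :=
      nHom_comul (piQ_hom M i) x
  rw [h]
  generalize (pi M).nComul x = z
  induction z with
  | zero => simp
  | add x y hx hy => simp only [map_add, hx, hy]
  | tmul a b => simp [nIdem_nIdem]

theorem mem_coinvariants {x : (pi M).Nichols} :
    x ∈ coinvariants M i ↔ rho M i x = x ⊗ₜ 1 := by
  have h1 : ∀ y, nIdem M i y = nHom (single M i) (single_isHom M i) (nProj M i y) := by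
    intro y
    refine pi_ind M (p := fun y => nIdem M i y =
      nHom (single M i) (single_isHom M i) (nProj M i y)) ?_ ?_ ?_ ?_ y
    · simp
    · intro x y hx hy; simp only [map_add, hx, hy]
    · intro c x hx; simp only [map_smul, hx]
    · intro j u x hx
      have h2 : nProj M i (inc M j u) = (M i).nι (proj M i (single M j u)) :=
        nHom_ι (proj_isHom M i) (single M j u)
      rw [map_mul, map_mul, map_mul, hx, h2, nHom_ι]
      congr 1
      change nHom (piQ M i) _ ((pi M).nι (single M j u)) = _
      rw [nHom_ι]
      rfl
  have h2 : ∀ y, nProj M i y = nProj M i (nIdem M i y) := by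
    intro y
    refine pi_ind M (p := fun y => nProj M i y = nProj M i (nIdem M i y)) ?_ ?_ ?_ ?_ y
    · simp
    · intro x y hx hy; simp only [map_add, ← hx, ← hy]
    · intro c x hx; simp only [map_smul, ← hx]
    · intro j u x hx
      rw [map_mul, map_mul, map_mul, ← hx]
      congr 1
      by_cases h : j = i
      · subst h; rw [nIdem_inc]
      · rw [nIdem_inc_of_ne M h, map_zero]
        change nHom (proj M i) (proj_isHom M i) ((pi M).nι (single M j u)) = 0
        rw [nHom_ι, proj_single_of_ne M (Ne.symm h), map_zero]
  change (nProj M i).toLinearMap.lTensor _ ((pi M).nComul x) = x ⊗ₜ 1 ↔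
    (nIdem M i).toLinearMap.lTensor _ ((pi M).nComul x) = x ⊗ₜ 1
  constructor
  · intro h
    rw [show (nIdem M i).toLinearMap = (nHom (single M i) (single_isHom M i)).toLinearMap ∘ₗ
      (nProj M i).toLinearMap from LinearMap.ext h1, LinearMap.lTensor_comp_apply, h]
    simp
  · intro h
    rw [show (nProj M i).toLinearMap = (nProj M i).toLinearMap ∘ₗ (nIdem M i).toLinearMap from
      LinearMap.ext h2, LinearMap.lTensor_comp_apply, h]
    simp

end Pi

end YDMod

theorem IsYDMap.tensor {A B C D : Type*} [AddCommGroup A] [Module k A] [AddCommGroup B] [Module k B]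
    [AddCommGroup C] [Module k C] [AddCommGroup D] [Module k D]
    {actA : H →ₐ[k] Module.End k A} {coactA : A →ₗ[k] H ⊗[k] A}
    {actB : H →ₐ[k] Module.End k B} {coactB : B →ₗ[k] H ⊗[k] B}
    {actC : H →ₐ[k] Module.End k C} {coactC : C →ₗ[k] H ⊗[k] C}
    {actD : H →ₐ[k] Module.End k D} {coactD : D →ₗ[k] H ⊗[k] D} {f : A →ₗ[k] C} {g : B →ₗ[k] D}
    (hf : IsYDMap actA coactA actC coactC f) (hg : IsYDMap actB coactB actD coactD g) :
    IsYDMap (YDMod.diagAct actA actB) (YDMod.diagCoact coactA coactB)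
      (YDMod.diagAct actC actD) (YDMod.diagCoact coactC coactD) (TensorProduct.map f g) where
  map_act h z := by
    refine comatrix_induction (k := k) (p := fun h => TensorProduct.map f g
      (YDMod.diagAct actA actB h z) = YDMod.diagAct actC actD h (TensorProduct.map f g z))
      (by simp) ?_ ?_ ?_ h
    · intro x y hx hy; simp only [map_add, LinearMap.add_apply, hx, hy]
    · intro c x hx; simp only [map_smul, LinearMap.smul_apply, hx]
    · intro m t ht a b
      induction z with
      | zero => simp
      | add x y hx hy => simp only [map_add, hx, hy]
      | tmul x y =>
        rw [TensorProduct.map_tmul, YDMod.diagAct_comatrix _ _ ht, YDMod.diagAct_comatrix _ _ ht]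
        simp [map_sum, hf.map_act, hg.map_act]
  map_coact z := by
    induction z with
    | zero => simp
    | add x y hx hy => simp only [map_add, hx, hy]
    | tmul x y =>
      have h : ∀ (a : H ⊗[k] A) (b : H ⊗[k] B),
          TensorProduct.tensorTensorTensorComm k H C H D (f.lTensor H a ⊗ₜ g.lTensor H b) =
          (TensorProduct.map f g).lTensor (H ⊗[k] H)
            (TensorProduct.tensorTensorTensorComm k H A H B (a ⊗ₜ b)) := by
        intro a b
        induction a with
        | zero => simp
        | add x y hx hy => simp only [map_add, add_tmul, hx, hy]
        | tmul p q =>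
          induction b with
          | zero => simp
          | add x y hx hy => simp only [map_add, tmul_add, hx, hy]
          | tmul r s => simp
      simp only [TensorProduct.map_tmul, YDMod.diagCoact, LinearMap.comp_apply, hf.map_coact,
        hg.map_coact, LinearEquiv.coe_coe, h]
      rw [← LinearMap.comp_apply, LinearMap.rTensor_comp_lTensor, ← LinearMap.lTensor_comp_rTensor,
        LinearMap.comp_apply]

theorem IsYDMap.id' {A : Type*} [AddCommGroup A] [Module k A] (actA : H →ₐ[k] Module.End k A)
    (coactA : A →ₗ[k] H ⊗[k] A) : IsYDMap actA coactA actA coactA LinearMap.id :=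
  ⟨fun _ _ => rfl, fun v => by simp⟩

section Pre

variable {R : Type*} [Ring R] [Algebra k R] {U : YDMod.{u, w, v} k H} {ι : U →ₗ[k] R}
    {act : H →ₐ[k] Module.End k R}
    {coact : R →ₐ[k] H ⊗[k] R} {Δ : R →ₗ[k] R ⊗[k] R} {ε : R →ₐ[k] k} {pr : R →ₗ[k] U}
    (hR : IsPre U ι act coact Δ ε pr)
include hR

theorem IsPre.comul_hom : IsYDMap act coact.toLinearMap (YDMod.diagAct act act)
    (YDMod.diagCoact coact.toLinearMap coact.toLinearMap) Δ :=
  ⟨hR.comul_act, fun x => (hR.comul_coact x).symm⟩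

theorem IsPre.tmul_one_hom : IsYDMap act coact.toLinearMap (YDMod.diagAct act act)
    (YDMod.diagCoact coact.toLinearMap coact.toLinearMap) ((TensorProduct.mk k R R).flip 1) where
  map_act h x := by
    refine comatrix_induction (k := k) (p := fun h => (TensorProduct.mk k R R).flip 1 (act h x) =
      YDMod.diagAct act act h ((TensorProduct.mk k R R).flip 1 x)) (by simp) ?_ ?_ ?_ h
    · intro x y hx hy; simp only [map_add, LinearMap.add_apply, hx, hy]
    · intro c x hx; simp only [map_smul, LinearMap.smul_apply, hx]
    · intro m t ht a b
      rw [LinearMap.flip_apply, LinearMap.flip_apply, TensorProduct.mk_apply,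
        TensorProduct.mk_apply, YDMod.diagAct_comatrix _ _ ht]
      simp only [act_one_comatrix hR.toIsYDAlg ht]
      simp [tmul_ite]
  map_coact x := by
    simp only [LinearMap.flip_apply, TensorProduct.mk_apply, YDMod.diagCoact, LinearMap.comp_apply,
      TensorProduct.map_tmul, AlgHom.toLinearMap_apply, map_one]
    generalize coact x = z
    induction z with
    | zero => simp
    | add x y hx hy => simp only [add_tmul, map_add, hx, hy]
    | tmul a b => simp [Algebra.TensorProduct.one_def]

end Pre

namespace YDMod

variable {ι : Type} [Fintype ι] [DecidableEq ι] (M : ι → YDMod.{u, w, v} k H) (i : ι)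

section Coinvariants

theorem coinv_isSub : (pi M).nichols.IsSub (coinvariants M i) := by
  have h : coinvariants M i = LinearMap.eqLocus (rho M i)
      ((TensorProduct.mk k (pi M).Nichols (pi M).Nichols).flip 1) := by
    ext x
    rw [mem_coinvariants, LinearMap.mem_eqLocus]
    rfl
  rw [h]
  exact IsSub.eqLocus (X := (pi M).nichols)
    ((pi M).n_isPre.comul_hom.comp ((IsYDMap.id' _ _).tensor (nHom_hom (piQ_hom M i))))
    (pi M).n_isPre.tmul_one_hom

variable {M i}

theorem coinv_act {x : (pi M).Nichols} (hx : x ∈ coinvariants M i) (h : H) :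
    (pi M).nAct h x ∈ coinvariants M i := (coinv_isSub M i).act_mem h hx

theorem coinv_one : (1 : (pi M).Nichols) ∈ coinvariants M i :=
  (mem_coinvariants M i).2 (rho_one M i)

theorem rho_coinv_mul {x : (pi M).Nichols} (hx : x ∈ coinvariants M i) (y : (pi M).Nichols) :
    rho M i (x * y) = (LinearMap.mulLeft k x).rTensor _ (rho M i y) := by
  rw [rho_mul, (mem_coinvariants M i).1 hx, bmul_tmul_one]

theorem coinv_mul {x y : (pi M).Nichols} (hx : x ∈ coinvariants M i) (hy : y ∈ coinvariants M i) :
    x * y ∈ coinvariants M i := by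
  rw [mem_coinvariants, rho_coinv_mul hx, (mem_coinvariants M i).1 hy]
  rfl

theorem coinv_inc {j : ι} (h : j ≠ i) (v : M j) : inc M j v ∈ coinvariants M i :=
  (mem_coinvariants M i).2 (rho_inc_of_ne M h v)

theorem coinv_lhit {x : (pi M).Nichols} (hx : x ∈ coinvariants M i)
    (χ : (pi M).Nichols →ₗ[k] k) : lhit (pi M).nComul χ x ∈ coinvariants M i := by
  rw [mem_coinvariants] at *
  change (nIdem M i).toLinearMap.lTensor _ ((pi M).nComul _) = _
  rw [(pi M).n_isPre.comul_lhit, ← LinearMap.comp_apply, LinearMap.lTensor_comp_rTensor,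
    ← LinearMap.rTensor_comp_lTensor]
  change (lhit _ χ).rTensor _ (rho M i x) = _
  rw [hx]
  rfl

theorem coinv_gr {x : (pi M).Nichols} (hx : x ∈ coinvariants M i) (γ : ι → ℤ) :
    gr M γ x ∈ coinvariants M i := by
  have hB := (pi M).n_isPre
  rw [mem_coinvariants] at *
  refine hB.eq_of_comp_comp (isDec_pi M) (gr_isGr M) fun α β => ?_
  have h1 : ∀ z, TensorProduct.map (gr M α) (gr M β) ((nIdem M i).toLinearMap.lTensor _ z) =
      (nIdem M i).toLinearMap.lTensor _ (TensorProduct.map (gr M α) (gr M β) z) := by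
    intro z
    induction z with
    | zero => simp
    | add x y hx hy => simp only [map_add, hx, hy]
    | tmul a b => simp [nIdem_gr]
  change TensorProduct.map (gr M α) (gr M β) ((nIdem M i).toLinearMap.lTensor _
    ((pi M).nComul (gr M γ x))) = _
  rw [h1, hB.comul_comp (isDec_pi M) (gr_isGr M), apply_ite ((nIdem M i).toLinearMap.lTensor _),
    ← h1, map_zero]
  change (if _ then TensorProduct.map (gr M α) (gr M β) (rho M i x) else 0) = _
  rw [hx, TensorProduct.map_tmul, TensorProduct.map_tmul, (gr_isGr M).comp_one,
    hB.comp_comp (isDec_pi M) (gr_isGr M)]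
  by_cases hβ : β = 0
  · subst hβ
    rw [add_zero]
    split_ifs <;> simp
  · simp [hβ]

theorem coinv_height_zero {x : (pi M).Nichols} (hx : x ∈ coinvariants M i)
    (h : nIdem M i x = x) : x = (pi M).nCounit x • 1 := by
  have h1 := rho_nIdem M i x
  rw [h, (mem_coinvariants M i).1 hx] at h1
  have h2 := (pi M).n_isPre.counit_comul x
  rw [← h1] at h2
  simpa using h2.symm

theorem inc_cofam {j : ι} {m : ℕ} {t : Fin m → Fin m → H} {e : Fin m → M j}
    (he : IsCofam (M j).coact t e) :
    IsCofam (pi M).nCoact.toLinearMap t (fun a => inc M j (e a)) := he.map (inc_hom M j).map_coact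

theorem adc_cofam {m : ℕ} {t : Fin m → Fin m → H} {e : Fin m → (pi M).Nichols}
    (he : IsCofam (pi M).nCoact.toLinearMap t e) (a : Fin m) (x : (pi M).Nichols) :
    (pi M).adc (e a) x = e a * x - ∑ b, (pi M).nAct (t a b) x * e b := by
  have h := he.coact_eq a
  rw [AlgHom.toLinearMap_apply] at h
  rw [adc, braidedAd_apply, h, map_sum, LinearMap.sum_apply]
  simp only [swapMul_tmul]

theorem adc_one (v : M i) : (pi M).adc (inc M i v) 1 = 0 := by
  obtain ⟨m, t, e, a, he, rfl⟩ := (M i).exists_cofam v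
  rw [adc_cofam (inc_cofam he)]
  simp only [act_one_comatrix (pi M).n_isPre.toIsYDAlg he.toIsComatrix]
  simp

theorem adc_mul {m : ℕ} {t : Fin m → Fin m → H} {e : Fin m → (pi M).Nichols}
    (he : IsCofam (pi M).nCoact.toLinearMap t e) (a : Fin m) (x y : (pi M).Nichols) :
    (pi M).adc (e a) (x * y) = (pi M).adc (e a) x * y +
      ∑ b, (pi M).nAct (t a b) x * (pi M).adc (e b) y := by
  simp only [adc_cofam he, ((pi M).n_isPre.actMul x y).comatrix he.toIsComatrix, mul_sub,
    Finset.sum_sub_distrib, sub_mul, Finset.sum_mul, Finset.mul_sum, mul_assoc]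
  rw [Finset.sum_comm (f := fun i j => (pi M).nAct (t a j) x * ((pi M).nAct (t j i) y * e i))]
  abel

theorem coinv_ad {x : (pi M).Nichols} (hx : x ∈ coinvariants M i) (v : M i) :
    (pi M).adc (inc M i v) x ∈ coinvariants M i := by
  obtain ⟨m, t, e, a, he, rfl⟩ := (M i).exists_cofam v
  have he' : IsCofam (pi M).coact t fun a => single M i (e a) := he.map (single_isHom M i).map_coact
  rw [mem_coinvariants, adc_cofam (inc_cofam he), map_sub, map_sum, rho_mul, rho_inc,
    (mem_coinvariants M i).1 hx]
  simp only [rho_coinv_mul (coinv_act hx _), rho_inc]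
  rw [(pi M).n_isPre.bmul_prim he']
  simp only [primTensor, map_add, LinearMap.rTensor_tmul, LinearMap.mulLeft_apply, mul_one, Finset.sum_add_distrib]
  rw [add_sub_add_right_eq_sub, sub_tmul, sum_tmul]
  rfl

theorem adc_gr {γ : ι → ℤ} {x : (pi M).Nichols} (hx : gr M γ x = x) (v : M i) :
    gr M (γ + Pi.single i 1) ((pi M).adc (inc M i v) x) = (pi M).adc (inc M i v) x := by
  have hB := (pi M).n_isPre
  obtain ⟨m, t, e, a, he, rfl⟩ := (M i).exists_cofam v
  rw [adc_cofam (inc_cofam he), map_sub, map_sum, gr_inc_mul, add_sub_cancel_right, hx]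
  congr 1
  refine Finset.sum_congr rfl fun b _ => ?_
  rw [hB.comp_mul_right (isDec_pi M) (gr_isGr M) (gr_inc M i (e b)), add_sub_cancel_right,
    hB.comp_act (isDec_pi M) (gr_isGr M), hx]

/-- If `K'` is stable under the action of `H`, under `ad_c V` and under left multiplication by
`M j` for `j ≠ i`, then `B(W) = K' B(V)`. -/
theorem mul_range_eq_top {K' : Submodule k (pi M).Nichols} (h1 : (1 : (pi M).Nichols) ∈ K')
    (hm : ∀ j, j ≠ i → ∀ (u : M j), ∀ x ∈ K', inc M j u * x ∈ K')
    (ha : ∀ v : M i, ∀ x ∈ K', (pi M).adc (inc M i v) x ∈ K')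
    (hH : ∀ h, ∀ x ∈ K', (pi M).nAct h x ∈ K') (x : (pi M).Nichols) :
    x ∈ K' * LinearMap.range (nIdem M i).toLinearMap := by
  refine pi_ind M (p := fun x => x ∈ K' * LinearMap.range (nIdem M i).toLinearMap) ?_ ?_ ?_ ?_ x
  · have h2 : (1 : (pi M).Nichols) ∈ LinearMap.range (nIdem M i).toLinearMap :=
      ⟨1, map_one (nIdem M i)⟩
    have := Submodule.mul_mem_mul h1 h2
    rwa [mul_one] at this
  · exact fun x y hx hy => add_mem hx hy
  · exact fun c x hx => Submodule.smul_mem _ _ hx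
  · intro j u x hx
    suffices K' * LinearMap.range (nIdem M i).toLinearMap ≤
        (K' * LinearMap.range (nIdem M i).toLinearMap).comap (LinearMap.mulLeft k (inc M j u)) from
      this hx
    rw [Submodule.mul_le]
    intro y hy z hz
    rw [Submodule.mem_comap, LinearMap.mulLeft_apply, ← mul_assoc]
    by_cases hj : j = i
    · subst hj
      obtain ⟨m, t, e, a, he, rfl⟩ := (M j).exists_cofam u
      have h2 := adc_cofam (inc_cofam he) a y
      rw [eq_sub_iff_add_eq] at h2
      rw [← h2, add_mul, Finset.sum_mul]
      refine add_mem (Submodule.mul_mem_mul (ha _ _ hy) hz) (sum_mem fun b _ => ?_)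
      rw [mul_assoc]
      refine Submodule.mul_mem_mul (hH _ _ hy) ?_
      obtain ⟨z, rfl⟩ := hz
      exact ⟨inc M j (e b) * z, by simp [nIdem_inc]⟩
    · exact Submodule.mul_mem_mul (hm j hj u y hy) hz

variable (M i)

/-- The augmentation ideal of `B(V) ⊂ B(W)`. -/
def augIdem : Submodule k (pi M).Nichols :=
  LinearMap.range (nIdem M i).toLinearMap ⊓ LinearMap.ker (pi M).nCounit.toLinearMap

theorem range_nIdem_eq : LinearMap.range (nIdem M i).toLinearMap =
    Submodule.span k {1} ⊔ augIdem M i := by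
  apply le_antisymm
  · rintro _ ⟨x, rfl⟩
    refine Submodule.mem_sup.2 ⟨(pi M).nCounit (nIdem M i x) • 1,
      Submodule.smul_mem _ _ (Submodule.mem_span_singleton_self _),
      nIdem M i (x - (pi M).nCounit (nIdem M i x) • 1), ⟨⟨_, rfl⟩, ?_⟩, ?_⟩
    · simp
    · simp
  · refine sup_le ?_ inf_le_left
    rw [Submodule.span_singleton_le_iff_mem]
    exact ⟨1, map_one (nIdem M i)⟩

/-- The complement `B(W) V` of the space of coinvariants. -/
def coinvCompl : Submodule k (pi M).Nichols := coinvariants M i * augIdem M i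

theorem coinv_disjoint : Disjoint (coinvariants M i) (coinvCompl M i) := by
  have hB := (pi M).n_isPre
  rw [Submodule.disjoint_def]
  intro x hx hx'
  let c := nComp (pi M).isDec_unit (fun _ : Unit => (1 : ℤ))
  have hc : IsGr (pi M).nι _ (fun _ : Unit => (1 : ℤ)) c := n_isGr (pi M).isDec_unit _
  have h1 : coinvCompl M i ≤ (LinearMap.range (TensorProduct.map (coinvariants M i).subtype
      (augIdem M i).subtype)).map (LinearMap.mul' k (pi M).Nichols) := by
    refine Submodule.mul_le.2 fun y hy z hz => ⟨y ⊗ₜ z, ⟨⟨y, hy⟩ ⊗ₜ ⟨z, hz⟩, rfl⟩, rfl⟩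
  obtain ⟨_, ⟨w, rfl⟩, hw⟩ := h1 hx'
  let z := TensorProduct.map (coinvariants M i).subtype (augIdem M i).subtype w
  let Θ : (pi M).Nichols ⊗[k] (pi M).Nichols →ₗ[k] (pi M).Nichols ⊗[k] (pi M).Nichols :=
    TensorProduct.lift (LinearMap.mk₂ k
      (fun a b => (LinearMap.mulLeft k a).rTensor _ ((pi M).nComul b))
      (fun a b c => by
        generalize (pi M).nComul c = z
        induction z with
        | zero => simp
        | add x y hx hy => simp only [map_add, hx, hy]; abel
        | tmul p q => simp [add_mul, add_tmul])
      (fun r b c => by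
        generalize (pi M).nComul c = z
        induction z with
        | zero => simp
        | add x y hx hy => simp only [map_add, hx, hy, smul_add]
        | tmul p q => simp [smul_tmul'])
      (fun a b c => by simp only [map_add])
      (fun r b c => by simp only [map_smul]))
  have hΘ : ∀ a b, Θ (a ⊗ₜ b) = (LinearMap.mulLeft k a).rTensor _ ((pi M).nComul b) :=
    fun _ _ => rfl
  have h2 : Θ z = x ⊗ₜ 1 := by
    rw [← (mem_coinvariants M i).1 hx, ← hw]
    change Θ (TensorProduct.map _ _ w) = _
    clear_value Θ
    clear hw z
    induction w with
    | zero => simp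
    | add x y hx hy => simp only [map_add, hx, hy]
    | tmul a b =>
      obtain ⟨b, ⟨b', rfl⟩, hb⟩ := b
      rw [TensorProduct.map_tmul, hΘ, LinearMap.mul'_apply]
      simp only [Submodule.subtype_apply]
      rw [rho_coinv_mul a.2, AlgHom.toLinearMap_apply, rho_nIdem]
  have h3 : ∀ N : ℤ, 0 ≤ N → ∀ m, m ≤ N → ∀ z, (c N).lTensor _ (Θ ((c m).lTensor _ z)) =
      if m = N then (c N).lTensor _ z else 0 := by
    intro N hN m hm z
    induction z with
    | zero => simp
    | add x y hx hy => simp only [map_add, hx, hy]; split_ifs <;> simp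
    | tmul a b =>
      rw [LinearMap.lTensor_tmul, hΘ, ← LinearMap.comp_apply, LinearMap.lTensor_comp_rTensor,
        ← LinearMap.rTensor_comp_lTensor, LinearMap.comp_apply]
      have h4 : (c N).lTensor _ ((pi M).nComul (c m b)) = if m = N then 1 ⊗ₜ c N b else 0 := by
        rw [← sub_eq_zero]
        refine hB.eq_zero_of_comp_left (pi M).isDec_unit hc fun α => ?_
        rw [map_sub, ← LinearMap.comp_apply, LinearMap.rTensor_comp_lTensor,
          hB.comul_comp (pi M).isDec_unit hc, sub_eq_zero,
          apply_ite ((c α).rTensor _), LinearMap.rTensor_tmul, hc.comp_one, map_zero]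
        rcases lt_trichotomy α 0 with hα | rfl | hα
        · have : c α = 0 := LinearMap.ext fun x => hB.comp_neg hc hα x
          rw [this, if_neg hα.ne]
          simp
        · rw [zero_add]
          by_cases hmN : m = N
          · subst hmN
            have h5 : c 0 = (LinearMap.toSpanSingleton k (pi M).Nichols 1) ∘ₗ
              (pi M).nCounit.toLinearMap := LinearMap.ext fun x => hB.comp_zero hc x
            have h6 := hB.counit_comul b
            rw [if_pos rfl, if_pos rfl, if_pos rfl, h5]
            have h7 : ∀ z : (pi M).Nichols ⊗[k] (pi M).Nichols,
                TensorProduct.map (LinearMap.toSpanSingleton k (pi M).Nichols 1 ∘ₗ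
                (pi M).nCounit.toLinearMap) (c m) z = 1 ⊗ₜ c m
                (TensorProduct.lid k _ ((pi M).nCounit.toLinearMap.rTensor _ z)) := by
              intro z
              induction z with
              | zero => simp
              | add x y hx hy => simp only [map_add, hx, hy, tmul_add]
              | tmul p q => simp [smul_tmul]
            rw [h7, h6]
          · rw [if_neg hmN, if_neg (Ne.symm hmN)]
        · rw [if_neg (by omega), if_neg hα.ne']
          simp
      rw [h4]
      split_ifs <;> simp
  obtain ⟨s, hs⟩ := hB.exists_finset_right (pi M).isDec_unit hc z
  have h0 : ∀ N : ℤ, 0 ≤ N → (∀ m, N < m → (c m).lTensor _ z = 0) → (c N).lTensor _ z = 0 := by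
    intro N hN hm
    rcases hN.eq_or_lt with rfl | hN'
    · have h5 : c 0 = (LinearMap.toSpanSingleton k (pi M).Nichols 1) ∘ₗ
        (pi M).nCounit.toLinearMap := LinearMap.ext fun x => hB.comp_zero hc x
      have h6 : (c 0) ∘ₗ (augIdem M i).subtype = 0 := by
        ext y
        rw [h5]
        have : (pi M).nCounit y.1 = 0 := y.2.2
        simp [this]
      change (c 0).lTensor _ (TensorProduct.map _ _ w) = 0
      rw [← LinearMap.comp_apply, LinearMap.lTensor_comp_map, h6, TensorProduct.map_zero_right]
      rfl
    · have h5 := congrArg ((c N).lTensor (pi M).Nichols) h2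
      rw [LinearMap.lTensor_tmul, hc.comp_one, if_neg hN'.ne', tmul_zero,
        ← hs (insert N s) (Finset.subset_insert _ _), map_sum, map_sum,
        Finset.sum_eq_single N] at h5
      · rwa [h3 N hN N le_rfl, if_pos rfl] at h5
      · intro m _ hmN
        rcases lt_or_gt_of_ne hmN with h | h
        · rw [h3 N hN m h.le, if_neg hmN]
        · rw [hm m h, map_zero, map_zero]
      · intro h; exact (h (Finset.mem_insert_self _ _)).elim
  have hz : z = 0 := by
    obtain ⟨b, hb⟩ := s.bddAbove
    have hbd : ∀ n : ℕ, ∀ m, b - n < m → (c m).lTensor _ z = 0 := by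
      intro n
      induction n with
      | zero =>
        intro m hm
        have hms : m ∉ s := fun hms => by
          have := hb hms
          simp at hm
          omega
        have := hs (insert m s) (Finset.subset_insert _ _)
        rw [Finset.sum_insert hms, hs s subset_rfl] at this
        simpa using this
      | succ n ih =>
        intro m hm
        rcases lt_or_ge m 0 with h | h
        · have : c m = 0 := LinearMap.ext fun x => hB.comp_neg hc h x
          rw [this, LinearMap.lTensor_zero, LinearMap.zero_apply]
        · refine h0 m h fun m' hm' => ih m' ?_
          push_cast at hm
          omega
    refine hB.eq_zero_of_comp_right (pi M).isDec_unit hc fun m => hbd (b - m + 1).toNat m ?_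
    omega
  rw [← hw]
  change LinearMap.mul' k _ z = 0
  rw [hz, map_zero]

theorem coinv_sup_compl : coinvariants M i ⊔ coinvCompl M i = ⊤ := by
  rw [eq_top_iff]
  intro x _
  have := mul_range_eq_top (K' := coinvariants M i) coinv_one
    (fun j hj u x hx => coinv_mul (coinv_inc hj u) hx) (fun v x hx => coinv_ad hx v)
    (fun h x hx => coinv_act hx h) x
  rw [range_nIdem_eq, Submodule.mul_sup] at this
  refine sup_le_sup_right ?_ (coinvCompl M i) this
  rw [Submodule.mul_le]
  intro y hy z hz
  obtain ⟨c, rfl⟩ := Submodule.mem_span_singleton.1 hz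
  rw [mul_smul_comm, mul_one]
  exact Submodule.smul_mem _ _ hy

theorem coinv_isCompl : IsCompl (coinvariants M i) (coinvCompl M i) :=
  ⟨coinv_disjoint M i, codisjoint_iff.2 (coinv_sup_compl M i)⟩

variable {M i}

/-- An induction principle for the coinvariants. -/
theorem coinv_le {K' : Submodule k (pi M).Nichols} (h0 : K' ≤ coinvariants M i)
    (h1 : (1 : (pi M).Nichols) ∈ K')
    (hm : ∀ j, j ≠ i → ∀ (u : M j), ∀ x ∈ K', inc M j u * x ∈ K')
    (ha : ∀ v : M i, ∀ x ∈ K', (pi M).adc (inc M i v) x ∈ K')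
    (hH : ∀ h, ∀ x ∈ K', (pi M).nAct h x ∈ K') : coinvariants M i ≤ K' := by
  intro x hx
  have := mul_range_eq_top h1 hm ha hH x
  rw [range_nIdem_eq, Submodule.mul_sup] at this
  obtain ⟨y, hy, z, hz, rfl⟩ := Submodule.mem_sup.1 this
  have hy' : y ∈ K' := by
    refine (Submodule.mul_le.2 ?_ : K' * Submodule.span k {1} ≤ K') hy
    intro y hy z hz
    obtain ⟨c, rfl⟩ := Submodule.mem_span_singleton.1 hz
    rw [mul_smul_comm, mul_one]
    exact Submodule.smul_mem _ _ hy
  have hz' : z = 0 := by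
    refine (Submodule.disjoint_def.1 (coinv_disjoint M i)) z ?_ ((Submodule.mul_le.2 fun y hy z hz =>
      Submodule.mul_mem_mul (h0 hy) hz : K' * augIdem M i ≤ coinvCompl M i) hz)
    have := sub_mem hx (h0 hy')
    rwa [add_sub_cancel_left] at this
  rw [hz', add_zero]
  exact hy'

end Coinvariants

end YDMod

namespace YDMod

variable {ι : Type} [Fintype ι] [DecidableEq ι] (M : ι → YDMod.{u, w, v} k H) (i : ι)

/-! ### The left skew derivations of `B(W)` -/

section Derivation

/-- The skew derivation `x ↦ φ(x⁽¹⁾) x⁽²⁾` of `B(W)` for a linear form `φ` on `M i`. -/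
def pder : (M i →ₗ[k] k) →ₗ[k] Module.End k (pi M).Nichols where
  toFun φ := lhit (pi M).nComul ((φ ∘ₗ proj M i) ∘ₗ (pi M).nPr)
  map_add' φ ψ := by
    ext x
    simp only [lhit, LinearMap.comp_apply, LinearMap.add_apply]
    generalize (pi M).nComul x = z
    induction z with
    | zero => simp
    | add x y hx hy => simp only [map_add, hx, hy]; abel
    | tmul a b => simp [add_smul]
  map_smul' c φ := by
    ext x
    simp only [lhit, LinearMap.comp_apply, LinearMap.smul_apply, RingHom.id_apply]
    generalize (pi M).nComul x = z
    induction z with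
    | zero => simp
    | add x y hx hy => simp only [map_add, hx, hy, smul_add]
    | tmul a b => simp [smul_smul]

theorem pder_apply (φ : M i →ₗ[k] k) : pder M i φ =
    lhit (pi M).nComul ((φ ∘ₗ proj M i) ∘ₗ (pi M).nPr) := rfl

variable {M i}

theorem comp_proj_act (φ : M i →ₗ[k] k) (h : H) :
    (φ ∘ₗ proj M i) ∘ₗ (pi M).act h = (φ ∘ₗ (M i).act h) ∘ₗ proj M i := by
  ext v
  simp [(proj_isHom M i).map_act]

theorem pder_coinv {x : (pi M).Nichols} (hx : x ∈ coinvariants M i) (φ : M i →ₗ[k] k) :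
    pder M i φ x ∈ coinvariants M i := coinv_lhit hx _

theorem pder_gr (γ : ι → ℤ) (x : (pi M).Nichols) (φ : M i →ₗ[k] k) :
    pder M i φ (gr M γ x) = gr M (γ - Pi.single i 1) (pder M i φ x) := by
  rw [pder_apply, (pi M).n_isPre.lder_comp (isDec_pi M) (gr_isGr M), Finset.sum_eq_single i]
  · congr 4
    ext v
    simp [piQ, proj_single]
  · intro j _ hj
    have : (φ ∘ₗ proj M i) ∘ₗ piQ M j = 0 := by
      ext v
      simp [piQ, proj_single_of_ne M (Ne.symm hj)]
    rw [this, LinearMap.zero_comp]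
    simp [lhit, lslice]
  · simp

theorem pder_inc_mul {m : ℕ} {t : Fin m → Fin m → H} {e : Fin m → M i}
    (he : IsCofam (M i).coact t e) (a : Fin m) (φ : M i →ₗ[k] k) (x : (pi M).Nichols) :
    pder M i φ (inc M i (e a) * x) =
      φ (e a) • x + ∑ b, inc M i (e b) * pder M i (φ ∘ₗ (M i).act (t a b)) x := by
  have he' : IsCofam (pi M).coact t fun a => single M i (e a) := he.map (single_isHom M i).map_coact
  have := (pi M).n_isPre.lder_ι_mul he' a (φ ∘ₗ proj M i) x
  simp only [comp_proj_act, LinearMap.comp_apply, proj_single] at this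
  exact this

theorem pder_mul {m : ℕ} {t : Fin m → Fin m → H} {e : Fin m → (pi M).Nichols}
    (he : IsCofam (pi M).nCoact.toLinearMap t e) (a : Fin m) (φ : M i →ₗ[k] k)
    (y : (pi M).Nichols) : pder M i φ (e a * y) = pder M i φ (e a) * y +
      ∑ b, e b * pder M i (φ ∘ₗ (M i).act (t a b)) y := by
  have := (pi M).n_isPre.lder_mul he a (φ ∘ₗ proj M i) y
  simp only [comp_proj_act] at this
  exact this

theorem pder_one (φ : M i →ₗ[k] k) : pder M i φ 1 = 0 := (pi M).n_isPre.lder_one _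

theorem pder_inc (φ : M i →ₗ[k] k) (v : M i) : pder M i φ (inc M i v) = φ v • 1 := by
  obtain ⟨m, t, e, a, he, rfl⟩ := (M i).exists_cofam v
  rw [← mul_one (inc M i (e a)), pder_inc_mul he]
  simp [pder_one]

theorem pder_act {m : ℕ} {t : Fin m → Fin m → H} (ht : IsComatrix (k := k) t) (a b : Fin m)
    (φ : M i →ₗ[k] k) (x : (pi M).Nichols) : pder M i φ ((pi M).nAct (t a b) x) =
      ∑ c, (pi M).nAct (t c b) (pder M i (φ ∘ₗ (M i).act (t a c)) x) := by
  have := (pi M).n_isPre.lder_act ht a b (φ ∘ₗ proj M i) x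
  simp only [comp_proj_act] at this
  exact this

/-- The linear form `h ↦ φ(h · v)`. -/
def actForm (φ : M i →ₗ[k] k) (v : M i) : H →ₗ[k] k := φ ∘ₗ (M i).act.toLinearMap.flip v

theorem pder_mul_inc (φ : M i →ₗ[k] k) (x : (pi M).Nichols) (v : M i) :
    pder M i φ (x * inc M i v) = pder M i φ x * inc M i v +
      lslice (actForm φ v) ((pi M).nCoact x) := by
  obtain ⟨m, t, e, a, he, rfl⟩ := (pi M).n_isPre.toIsYDAlg.exists_cofam x
  have h := he.coact_eq a
  rw [AlgHom.toLinearMap_apply] at h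
  rw [pder_mul he, h]
  simp [pder_inc, map_sum, actForm]

theorem pder_ad {m : ℕ} {t : Fin m → Fin m → H} {e : Fin m → M i}
    (he : IsCofam (M i).coact t e) (a : Fin m) (φ : M i →ₗ[k] k) (x : (pi M).Nichols) :
    pder M i φ ((pi M).adc (inc M i (e a)) x) = φ (e a) • x -
      ∑ b, lslice (actForm φ (e b)) ((pi M).nCoact ((pi M).nAct (t a b) x)) +
      ∑ c, (pi M).adc (inc M i (e c)) (pder M i (φ ∘ₗ (M i).act (t a c)) x) := by
  simp only [adc_cofam (inc_cofam he), map_sub, map_sum, pder_inc_mul he, pder_mul_inc,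
    pder_act he.toIsComatrix, Finset.sum_add_distrib, Finset.sum_sub_distrib, Finset.sum_mul]
  rw [Finset.sum_comm (f := fun x_1 i_1 => (pi M).nAct (t i_1 x_1)
    (pder M i (φ ∘ₗ (M i).act (t a i_1)) x) * inc M i (e x_1))]
  abel

theorem sum_antipode_comp {m : ℕ} {t : Fin m → Fin m → H} (ht : IsComatrix (k := k) t)
    (p c : Fin m) (φ : M i →ₗ[k] k) :
    ∑ a, (φ ∘ₗ (M i).act (antipode k (t p a))) ∘ₗ (M i).act (t a c) = if p = c then φ else 0 := by
  ext v
  have h := congrArg (fun h => φ ((M i).act h v)) (ht.antipode_mul p c)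
  simp only [map_sum, map_mul, LinearMap.sum_apply, Module.End.mul_apply] at h
  rw [LinearMap.sum_apply]
  refine h.trans ?_
  split_ifs <;> simp

/-- The span of the images of the elements of `X` under the skew derivations. -/
def dspan (X : Submodule k (pi M).Nichols) : Submodule k (pi M).Nichols :=
  Submodule.span k {y | ∃ φ : M i →ₗ[k] k, ∃ x ∈ X, y = pder M i φ x}

theorem pder_mem_dspan {X : Submodule k (pi M).Nichols} {x : (pi M).Nichols} (hx : x ∈ X)
    (φ : M i →ₗ[k] k) : pder M i φ x ∈ dspan (i := i) X := Submodule.subset_span ⟨φ, x, hx, rfl⟩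

theorem dspan_le {X Y : Submodule k (pi M).Nichols}
    (h : ∀ φ : M i →ₗ[k] k, ∀ x ∈ X, pder M i φ x ∈ Y) : dspan (i := i) X ≤ Y := by
  refine Submodule.span_le.2 ?_
  rintro _ ⟨φ, x, hx, rfl⟩
  exact h φ x hx

theorem ad_dspan {X Y : Submodule k (pi M).Nichols} (hX : (pi M).nichols.IsSub X)
    (hY : ∀ v : M i, ∀ x ∈ X, (pi M).adc (inc M i v) x ∈ Y) (v : M i)
    {y : (pi M).Nichols} (hy : y ∈ dspan (i := i) X) :
    (pi M).adc (inc M i v) y ∈ dspan (i := i) Y ⊔ X := by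
  have : dspan (i := i) X ≤ (dspan (i := i) Y ⊔ X).comap ((pi M).adc (inc M i v)) := by
    refine dspan_le fun φ x hx => ?_
    obtain ⟨m, t, e, p, he, rfl⟩ := (M i).exists_cofam v
    rw [Submodule.mem_comap]
    have h : (pi M).adc (inc M i (e p)) (pder M i φ x) =
        ∑ a, (pder M i (φ ∘ₗ (M i).act (antipode k (t p a))) ((pi M).adc (inc M i (e a)) x) -
          ((φ ∘ₗ (M i).act (antipode k (t p a))) (e a) • x -
          ∑ b, lslice (actForm (φ ∘ₗ (M i).act (antipode k (t p a))) (e b))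
            ((pi M).nCoact ((pi M).nAct (t a b) x)))) := by
      simp only [pder_ad he, add_sub_cancel_left]
      rw [Finset.sum_comm]
      simp only [← map_sum, ← LinearMap.sum_apply, sum_antipode_comp he.toIsComatrix]
      rw [Finset.sum_eq_single p]
      · rw [if_pos rfl]
      · intro c _ hc; rw [if_neg (Ne.symm hc)]; simp
      · simp
    rw [h]
    refine sum_mem fun a _ => sub_mem (Submodule.mem_sup_left (pder_mem_dspan (hY _ _ hx) _))
      (Submodule.mem_sup_right (sub_mem (Submodule.smul_mem _ _ hx) (sum_mem fun b _ => ?_)))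
    exact hX.lslice_mem _ (hX.act_mem _ hx)
  exact this hy

theorem adc_act {m : ℕ} {t : Fin m → Fin m → H} (ht : IsComatrix (k := k) t) (a c : Fin m)
    (v : M i) (x : (pi M).Nichols) : (pi M).nAct (t a c) ((pi M).adc (inc M i v) x) =
      ∑ b, (pi M).adc (inc M i ((M i).act (t a b) v)) ((pi M).nAct (t b c) x) := by
  have := act_braidedAd (pi M).nAct_mul (inc M i v) x ((pi M).nichols.ydAt _) (t a c)
  rw [adc, this, ht.comul_eq, map_sum]
  refine Finset.sum_congr rfl fun b _ => ?_
  rw [(inc_hom M i).map_act]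
  rfl

theorem coact_adc {m : ℕ} {t : Fin m → Fin m → H} {e : Fin m → M i}
    (he : IsCofam (M i).coact t e) (a : Fin m) (x : (pi M).Nichols) :
    (pi M).nCoact ((pi M).adc (inc M i (e a)) x) =
      ∑ b, TensorProduct.map (LinearMap.mulLeft k (t a b)) ((pi M).adc (inc M i (e b)))
        ((pi M).nCoact x) := by
  have h := (inc_cofam he).coact_eq a
  rw [AlgHom.toLinearMap_apply] at h
  have := coact_braidedAd (act := (pi M).nAct) (inc M i (e a)) x ((pi M).nichols.ydAt _)
    ((pi M).nichols.ydAt x)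
  rw [adc, this, h, map_sum, LinearMap.sum_apply]
  rfl

/-- The kernel of `ad_c V`. -/
def adKer (M : ι → YDMod.{u, w, v} k H) (i : ι) : Submodule k (pi M).Nichols :=
  ⨅ v : M i, LinearMap.ker ((pi M).adc (inc M i v))

theorem mem_adKer {x : (pi M).Nichols} :
    x ∈ adKer M i ↔ ∀ v : M i, (pi M).adc (inc M i v) x = 0 := by simp [adKer]

variable [BijectiveAntipode k H]

theorem adKer_isSub : (pi M).nichols.IsSub (adKer M i) := by
  refine IsSub.mk' (X := (pi M).nichols) (fun h (x : (pi M).Nichols) hx => ?_)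
    (fun χ (x : (pi M).Nichols) hx => ?_)
  · change (pi M).nAct h x ∈ adKer M i
    refine comatrix_induction (k := k) (p := fun h => (pi M).nAct h x ∈ adKer M i)
      (by rw [map_zero]; exact zero_mem _) ?_ ?_ ?_ h
    · intro x y hx hy; rw [map_add]; exact add_mem hx hy
    · intro c x hx; rw [map_smul]; exact Submodule.smul_mem _ _ hx
    · intro m t ht p c
      rw [mem_adKer] at *
      intro v
      have h1 : (pi M).adc (inc M i v) ((pi M).nAct (t p c) x) = ∑ a, (pi M).nAct (t a c)
          ((pi M).adc (inc M i ((M i).act (antipodeInv k (t p a)) v)) x) := by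
        simp only [adc_act ht]
        rw [Finset.sum_comm]
        have h2 : ∀ b, ∑ a, (M i).act (t a b) ((M i).act (antipodeInv k (t p a)) v) =
            if p = b then v else 0 := by
          intro b
          have h := congrArg (fun h => (M i).act h v) (ht.mul_antipodeInv p b)
          simp only [map_sum, map_mul, LinearMap.sum_apply, Module.End.mul_apply] at h
          refine h.trans ?_
          split_ifs <;> simp
        simp only [← map_sum, ← LinearMap.sum_apply, h2]
        rw [Finset.sum_eq_single p]
        · rw [if_pos rfl]
        · intro b _ hb; rw [if_neg (Ne.symm hb)]; simp
        · simp
      rw [h1]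
      exact Finset.sum_eq_zero fun a _ => by
        rw [mem_adKer.1 hx, map_zero]
  · change lslice χ ((pi M).nCoact x) ∈ adKer M i
    rw [mem_adKer] at *
    intro v
    obtain ⟨m, t, e, p, he, rfl⟩ := (M i).exists_cofam v
    have h1 : ∀ b, TensorProduct.map (∑ a, LinearMap.mulLeft k (antipode k (t p a)) ∘ₗ
        LinearMap.mulLeft k (t a b)) ((pi M).adc (inc M i (e b))) =
        if p = b then ((pi M).adc (inc M i (e b))).lTensor H else 0 := by
      intro b
      have : ∑ a, LinearMap.mulLeft k (antipode k (t p a)) ∘ₗ LinearMap.mulLeft k (t a b) =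
          if p = b then LinearMap.id else 0 := by
        ext h
        have h2 := congrArg (· * h) (he.antipode_mul p b)
        simp only [Finset.sum_mul, mul_assoc] at h2
        simp only [LinearMap.sum_apply, LinearMap.comp_apply, LinearMap.mulLeft_apply, h2]
        split_ifs <;> simp
      rw [this]
      split_ifs
      · rfl
      · exact TensorProduct.map_zero_left _
    have hsum : ∀ b, ∑ a, TensorProduct.map (LinearMap.mulLeft k (antipode k (t p a)) ∘ₗ
        LinearMap.mulLeft k (t a b)) ((pi M).adc (inc M i (e b))) = TensorProduct.map (∑ a,
          LinearMap.mulLeft k (antipode k (t p a)) ∘ₗ LinearMap.mulLeft k (t a b))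
            ((pi M).adc (inc M i (e b))) := fun b =>
      (map_sum ((TensorProduct.mapBilinear _ H _ H _).flip ((pi M).adc (inc M i (e b)))) _ _).symm
    have h3 : ((pi M).adc (inc M i (e p))).lTensor H ((pi M).nCoact x) =
        ∑ a, (LinearMap.mulLeft k (antipode k (t p a))).rTensor _
          ((pi M).nCoact ((pi M).adc (inc M i (e a)) x)) := by
      simp only [coact_adc he, map_sum]
      rw [Finset.sum_comm]
      simp only [← LinearMap.comp_apply, ← LinearMap.sum_apply, LinearMap.rTensor_comp_map]
      rw [Finset.sum_eq_single p]
      · exact (congrArg (· ((pi M).nCoact x)) ((hsum p).trans <| (h1 p).trans (if_pos rfl))).symm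
      · intro b _ hb
        exact (hsum b).trans ((h1 b).trans (if_neg (Ne.symm hb)))
      · simp
    have h4 : ((pi M).adc (inc M i (e p))).lTensor H ((pi M).nCoact x) = 0 := by
      rw [h3]
      exact Finset.sum_eq_zero fun a _ => by
        rw [mem_adKer.1 hx, map_zero, map_zero]
    have h5 := lslice_map χ LinearMap.id ((pi M).adc (inc M i (e p))) ((pi M).nCoact x)
    rw [← LinearMap.lTensor, h4, map_zero] at h5
    exact h5.symm

theorem act_pder {m : ℕ} {t : Fin m → Fin m → H} (ht : IsComatrix (k := k) t) (p b : Fin m)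
    (φ : M i →ₗ[k] k) (x : (pi M).Nichols) : (pi M).nAct (t p b) (pder M i φ x) =
      ∑ a, pder M i (φ ∘ₗ (M i).act (antipode k (t p a))) ((pi M).nAct (t a b) x) := by
  simp only [pder_act ht]
  rw [Finset.sum_comm]
  simp only [← map_sum, ← LinearMap.sum_apply, sum_antipode_comp ht]
  rw [Finset.sum_eq_single p]
  · rw [if_pos rfl]
  · intro c _ hc; rw [if_neg (Ne.symm hc)]; simp
  · simp

theorem dual_cofam_eval {V : YDMod.{u, w, v} k H} [FiniteDimensional k V] {m n : ℕ}
    {s : Fin m → Fin m → H} {F : Fin m → V.dual} (hF : IsCofam V.dual.coact s F)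
    {t : Fin n → Fin n → H} {e : Fin n → V} (he : IsCofam V.coact t e) (a : Fin m) (p : Fin n) :
    ∑ b, dualForm (F b) (e p) • s a b = ∑ q, dualForm (F a) (e q) • antipodeInv k (t p q) := by
  have h := congrArg (TensorProduct.rid k H) (dual_coact_eval (F a) (e p))
  rw [hF.coact_eq, he.coact_eq] at h
  simpa [map_sum, dualEval_apply] using h

theorem coact_pder [∀ j, FiniteDimensional k (M j)] {m : ℕ}
    {s : Fin m → Fin m → H} {F : Fin m → (M i).dual} (hF : IsCofam (M i).dual.coact s F)
    (a : Fin m) (x : (pi M).Nichols) :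
    (pi M).nCoact (pder M i (dualForm (F a)) x) = ∑ b, TensorProduct.map
      (LinearMap.mulLeft k (s a b)) (pder M i (dualForm (F b))) ((pi M).nCoact x) := by
  have hB := (pi M).n_isPre
  have h1 : ∀ (b : Fin m) (z : H ⊗[k] (pi M).Nichols), TensorProduct.map
      (LinearMap.mulLeft k (s a b)) (pder M i (dualForm (F b))) z = TensorProduct.map
      (LinearMap.mulLeft k (s a b)) (lslice ((dualForm (F b) ∘ₗ proj M i) ∘ₗ (pi M).nPr))
      ((pi M).nComul.lTensor H z) := by
    intro b z
    induction z with
    | zero => simp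
    | add x y hx hy => simp only [map_add, hx, hy]
    | tmul g y => rfl
  simp only [h1, hB.comul_coact]
  change (pi M).nCoact (lslice _ ((pi M).nComul x)) = _
  generalize (pi M).nComul x = z
  induction z with
  | zero => simp
  | add x y hx hy => simp only [map_add, hx, hy, Finset.sum_add_distrib]
  | tmul y z =>
    obtain ⟨n, t, e, p, he, rfl⟩ := hB.toIsYDAlg.exists_cofam y
    obtain ⟨l, r, f, q, hf, rfl⟩ := hB.toIsYDAlg.exists_cofam z
    have he' : IsCofam (M i).coact t fun c => proj M i ((pi M).nPr (e c)) :=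
      (he.map hB.pr_coact).map (proj_isHom M i).map_coact
    have h2 := hf.coact_eq q
    rw [AlgHom.toLinearMap_apply] at h2
    have h3 : ∑ p', ∑ b, dualForm (F b) (proj M i ((pi M).nPr (e p'))) • (s a b * t p p') =
        dualForm (F a) (proj M i ((pi M).nPr (e p))) • (1 : H) := by
      have h4 : ∀ p', ∑ b, dualForm (F b) (proj M i ((pi M).nPr (e p'))) • (s a b * t p p') =
          ∑ c, dualForm (F a) (proj M i ((pi M).nPr (e c))) • (antipodeInv k (t p' c) * t p p') := by
        intro p'
        have := congrArg (· * t p p') (dual_cofam_eval hF he' a p')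
        simpa only [Finset.sum_mul, smul_mul_assoc] using this
      simp only [h4]
      rw [Finset.sum_comm]
      simp only [← Finset.smul_sum, he.antipodeInv_mul', smul_ite, smul_zero]
      simp
    rw [lslice_tmul, map_smul, h2]
    simp only [YDMod.diagCoact_tmul he hf, map_sum, TensorProduct.map_tmul, lslice_tmul,
      LinearMap.mulLeft_apply, LinearMap.comp_apply, tmul_smul, ← mul_assoc, Finset.smul_sum]
    rw [Finset.sum_comm]
    have h5 : ∀ q', dualForm (F a) (proj M i ((pi M).nPr (e p))) • r q q' ⊗ₜ[k] f q' =
        ∑ p', ∑ b, dualForm (F b) (proj M i ((pi M).nPr (e p'))) •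
          (s a b * t p p' * r q q') ⊗ₜ[k] f q' := by
      intro q'
      have := congrArg (fun h => (h * r q q') ⊗ₜ[k] f q') h3
      simp only [Finset.sum_mul, sum_tmul, smul_mul_assoc, one_mul, ← smul_tmul'] at this
      exact this.symm
    simp only [h5]
    rw [Finset.sum_comm]
    refine Finset.sum_congr rfl fun p' _ => ?_
    rw [Finset.sum_comm]

theorem dspan_isSub [∀ j, FiniteDimensional k (M j)] {X : Submodule k (pi M).Nichols}
    (hX : (pi M).nichols.IsSub X) : (pi M).nichols.IsSub (dspan (i := i) X) := by
  have h1 : ∀ h : H, dspan (i := i) X ≤ (dspan (i := i) X).comap ((pi M).nAct h) := by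
      intro h
      refine dspan_le fun φ x hx => ?_
      rw [Submodule.mem_comap]
      refine comatrix_induction (k := k)
        (p := fun h => (pi M).nAct h (pder M i φ x) ∈ dspan (i := i) X)
        (by rw [map_zero]; exact zero_mem _) ?_ ?_ ?_ h
      · intro x y hx hy; rw [map_add]; exact add_mem hx hy
      · intro c x hx; rw [map_smul]; exact Submodule.smul_mem _ _ hx
      · intro m t ht p b
        rw [act_pder ht]
        refine sum_mem fun a _ => ?_
        have hy : (pi M).nAct (t a b) x ∈ X := hX.act_mem (t a b) hx
        exact pder_mem_dspan hy _
  have h2 : ∀ χ : H →ₗ[k] k, dspan (i := i) X ≤ (dspan (i := i) X).comap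
        (lslice χ ∘ₗ (pi M).nCoact.toLinearMap) := by
      intro χ
      refine dspan_le fun φ x hx => ?_
      obtain ⟨m, s, F, a, hF, rfl⟩ := (M i).dual.exists_cofam φ
      change lslice χ ((pi M).nCoact (pder M i (dualForm (F a)) x)) ∈ dspan (i := i) X
      rw [coact_pder hF, map_sum]
      refine Submodule.sum_mem _ fun b _ => ?_
      rw [lslice_map]
      exact pder_mem_dspan (X := X) (hX.lslice_mem (χ ∘ₗ LinearMap.mulLeft k (s a b)) hx) _
  exact IsSub.mk' (X := (pi M).nichols) (fun h x hx => h1 h hx) (fun χ x hx => h2 χ hx)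

end Derivation

end YDMod

namespace YDMod

variable {ι : Type} [Fintype ι] [DecidableEq ι]

/-! ### The components of degree one of the coinvariants -/

/-- The sum of the coordinates other than the `i`-th one. -/
def height (i : ι) : (ι → ℤ) →ₗ[ℤ] ℤ := ∑ l ∈ Finset.univ.erase i, LinearMap.proj l

theorem height_apply (i : ι) (γ : ι → ℤ) : height i γ = ∑ l ∈ Finset.univ.erase i, γ l := by
  simp [height]

theorem height_single_self (i : ι) (c : ℤ) : height i (Pi.single i c) = 0 := by
  rw [height_apply]
  refine Finset.sum_eq_zero fun l hl => ?_
  rw [Pi.single_eq_of_ne (Finset.ne_of_mem_erase hl)]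

theorem height_single_of_ne {i j : ι} (h : j ≠ i) (c : ℤ) : height i (Pi.single j c) = c := by
  rw [height_apply, Finset.sum_eq_single j]
  · simp
  · intro l _ hl
    rw [Pi.single_eq_of_ne hl]
  · simp [h]

/-- The degree `α j + n α i`. -/
def adDeg (i j : ι) (n : ℕ) : ι → ℤ := Pi.single j 1 + (n : ℤ) • Pi.single i 1

theorem adDeg_zero (i j : ι) : adDeg i j 0 = Pi.single j 1 := by simp [adDeg]

theorem adDeg_succ (i j : ι) (n : ℕ) : adDeg i j (n + 1) = adDeg i j n + Pi.single i 1 := by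
  simp [adDeg, add_smul, add_assoc]

theorem adDeg_apply_self {i j : ι} (h : j ≠ i) (n : ℕ) : adDeg i j n i = n := by
  simp [adDeg, h.symm]

theorem adDeg_apply {i j : ι} (h : j ≠ i) (n : ℕ) {l : ι} (hl : l ≠ i) :
    adDeg i j n l = if l = j then 1 else 0 := by
  simp [adDeg, hl, Pi.single_apply]

theorem height_adDeg {i j : ι} (h : j ≠ i) (n : ℕ) : height i (adDeg i j n) = 1 := by
  rw [adDeg, map_add, map_smul, height_single_self, height_single_of_ne h]
  simp

theorem adDeg_ne_zero {i j : ι} (h : j ≠ i) (n : ℕ) : adDeg i j n ≠ 0 := fun h0 => by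
  have := height_adDeg h n
  rw [h0, map_zero] at this
  exact zero_ne_one this

theorem adDeg_inj {i j j' : ι} (h : j ≠ i) (h' : j' ≠ i) {n n' : ℕ}
    (e : adDeg i j n = adDeg i j' n') : j = j' ∧ n = n' := by
  constructor
  · by_contra hne
    have := congrFun e j
    rw [adDeg_apply h _ h, adDeg_apply h' _ h, if_pos rfl, if_neg hne] at this
    exact one_ne_zero this
  · have := congrFun e i
    rw [adDeg_apply_self h, adDeg_apply_self h'] at this
    exact_mod_cast this

variable {M : ι → YDMod.{u, w, v} k H} {i j : ι}

theorem coinv_gr_of_height {x : (pi M).Nichols} (hx : x ∈ coinvariants M i) {γ : ι → ℤ}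
    (h0 : γ ≠ 0) (h : height i γ ≤ 0) : gr M γ x = 0 := by
  by_cases hl : ∃ l, γ l < 0
  · obtain ⟨l, hl⟩ := hl
    exact gr_neg M l hl x
  simp only [not_exists, not_lt] at hl
  have h1 : ∀ l, l ≠ i → γ l = 0 := by
    intro l hli
    rw [height_apply] at h
    have := (Finset.sum_eq_zero_iff_of_nonneg (s := Finset.univ.erase i) (f := γ)
      fun l _ => hl l).1 (le_antisymm h (Finset.sum_nonneg fun l _ => hl l))
    exact this l (Finset.mem_erase.2 ⟨hli, Finset.mem_univ _⟩)
  rw [coinv_height_zero (coinv_gr hx γ) (nIdem_gr_of_height_eq_zero M i h1 x),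
    (pi M).n_isPre.counit_comp (isDec_pi M) (gr_isGr M), if_neg h0, zero_smul]

theorem coinv_gr_of_counit {x : (pi M).Nichols} (hx : x ∈ coinvariants M i)
    (hε : (pi M).nCounit x = 0) {γ : ι → ℤ} (h : height i γ ≤ 0) : gr M γ x = 0 := by
  by_cases h0 : γ = 0
  · rw [h0, gr_zero, hε, zero_smul]
  · exact coinv_gr_of_height hx h0 h

theorem gr_mul_of_height {x y : (pi M).Nichols} (hx : ∀ γ, height i γ ≤ 0 → gr M γ x = 0)
    (hy : ∀ γ, height i γ ≤ 0 → gr M γ y = 0) {γ : ι → ℤ} (h : height i γ ≤ 1) :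
    gr M γ (x * y) = 0 := by
  obtain ⟨s, hs⟩ := (pi M).n_isPre.exists_finset (gr_isGr M) (isDec_pi M) x
  rw [← hs s subset_rfl, Finset.sum_mul, map_sum]
  refine Finset.sum_eq_zero fun δ _ => ?_
  rw [(pi M).n_isPre.comp_mul (isDec_pi M) (gr_isGr M)]
  by_cases hδ : height i δ ≤ 0
  · rw [hx δ hδ, zero_mul]
  · rw [hy, mul_zero]
    rw [map_sub]
    omega

theorem gr_adc (γ : ι → ℤ) (v : M i) (x : (pi M).Nichols) :
    gr M γ ((pi M).adc (inc M i v) x) = (pi M).adc (inc M i v) (gr M (γ - Pi.single i 1) x) := by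
  have hB := (pi M).n_isPre
  obtain ⟨s, hs⟩ := hB.exists_finset (gr_isGr M) (isDec_pi M) x
  rw [← hs s subset_rfl]
  simp only [map_sum]
  refine Finset.sum_congr rfl fun δ _ => ?_
  have h1 := adc_gr (hB.comp_self (isDec_pi M) (gr_isGr M) δ x) v
  rw [hB.comp_comp (isDec_pi M) (gr_isGr M), ← h1, hB.comp_comp (isDec_pi M) (gr_isGr M)]
  by_cases h : γ = δ + Pi.single i 1
  · rw [if_pos h, if_pos (by rw [h, add_sub_cancel_right]), h, add_sub_cancel_right, h1]
  · rw [if_neg h, if_neg (fun h' => h (by rw [← h', sub_add_cancel])), map_zero]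

variable (M i j) in
theorem adc_mem_adPow {n : ℕ} (v : M i) {x : (pi M).Nichols} (hx : x ∈ adPow M i j n) :
    (pi M).adc (inc M i v) x ∈ adPow M i j (n + 1) :=
  Submodule.apply_mem_map₂ _ (inc_mem M i v) hx

theorem adPow_succ_le {n : ℕ} {Y : Submodule k (pi M).Nichols}
    (h : ∀ v : M i, ∀ x ∈ adPow M i j n, (pi M).adc (inc M i v) x ∈ Y) :
    adPow M i j (n + 1) ≤ Y := by
  refine Submodule.map₂_le.2 fun y hy x hx => ?_
  obtain ⟨v, rfl⟩ := (mem_summand M i).1 hy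
  exact h v x hx

theorem adPow_le_coinv (h : j ≠ i) (n : ℕ) : adPow M i j n ≤ coinvariants M i := by
  induction n with
  | zero =>
    intro x hx
    obtain ⟨u, rfl⟩ := (mem_summand M j).1 hx
    exact coinv_inc h u
  | succ n ih => exact adPow_succ_le fun v x hx => coinv_ad (ih hx) v

theorem gr_adPow {n : ℕ} {x : (pi M).Nichols} (hx : x ∈ adPow M i j n) :
    gr M (adDeg i j n) x = x := by
  induction n generalizing x with
  | zero =>
    obtain ⟨u, rfl⟩ := (mem_summand M j).1 hx
    rw [adDeg_zero, gr_inc]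
  | succ n ih =>
    have : adPow M i j (n + 1) ≤ LinearMap.eqLocus (gr M (adDeg i j (n + 1))) LinearMap.id :=
      adPow_succ_le fun v x hx => by
        rw [LinearMap.mem_eqLocus, gr_adc, adDeg_succ, add_sub_cancel_right, ih hx]
        rfl
    exact this hx

theorem counit_adPow (h : j ≠ i) {n : ℕ} {x : (pi M).Nichols} (hx : x ∈ adPow M i j n) :
    (pi M).nCounit x = 0 := by
  rw [← gr_adPow hx, (pi M).n_isPre.counit_comp (isDec_pi M) (gr_isGr M),
    if_neg (adDeg_ne_zero h n)]

variable (M i) in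
/-- The elements without components of height at most one. -/
def heightGeTwo : Submodule k (pi M).Nichols :=
  ⨅ (γ : ι → ℤ) (_ : height i γ ≤ 1), LinearMap.ker (gr M γ)

theorem mem_heightGeTwo {x : (pi M).Nichols} :
    x ∈ heightGeTwo M i ↔ ∀ γ, height i γ ≤ 1 → gr M γ x = 0 := by
  simp [heightGeTwo]

theorem coinv_le_adL : coinvariants M i ≤ Submodule.span k {1} ⊔
    (⨆ (j : ι) (_ : j ≠ i), adL M i j) ⊔ heightGeTwo M i ⊓ coinvariants M i := by
  have hB := (pi M).n_isPre
  set K' := Submodule.span k {1} ⊔ (⨆ (j : ι) (_ : j ≠ i), adL M i j) ⊔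
    heightGeTwo M i ⊓ coinvariants M i with hK'
  have l1 : (1 : (pi M).Nichols) ∈ K' :=
    Submodule.mem_sup_left (Submodule.mem_sup_left (Submodule.mem_span_singleton_self 1))
  have l2 : ∀ j, j ≠ i → ∀ n, adPow M i j n ≤ K' := fun j hj n =>
    ((le_iSup (adPow M i j) n).trans (le_iSup₂_of_le (f := fun j _ => adL M i j) j hj le_rfl)).trans
      (le_sup_right.trans le_sup_left)
  have l3 : heightGeTwo M i ⊓ coinvariants M i ≤ K' := le_sup_right
  have ind : ∀ Y : Submodule k (pi M).Nichols, (1 : (pi M).Nichols) ∈ Y →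
      (∀ j, j ≠ i → ∀ n, adPow M i j n ≤ Y) → heightGeTwo M i ⊓ coinvariants M i ≤ Y → K' ≤ Y := by
    intro Y h1 h2 h3
    refine sup_le (sup_le ?_ (iSup₂_le fun j hj => iSup_le fun n => h2 j hj n)) h3
    rwa [Submodule.span_le, Set.singleton_subset_iff]
  refine coinv_le ?_ l1 ?_ ?_ ?_
  · exact ind _ coinv_one (fun j hj n => adPow_le_coinv hj n) inf_le_right
  · intro j hj u
    have key : ∀ x ∈ coinvariants M i, (∀ γ, height i γ ≤ 0 → gr M γ x = 0) →
        inc M j u * x ∈ K' := by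
      intro x hx hγ
      refine l3 ⟨mem_heightGeTwo.2 fun γ h => ?_, coinv_mul (coinv_inc hj u) hx⟩
      exact gr_mul_of_height (fun δ hδ => coinv_gr_of_counit (coinv_inc hj u)
        (hB.counit_ι _) hδ) hγ h
    refine ind (K'.comap (LinearMap.mulLeft k (inc M j u))) ?_ ?_ ?_
    · rw [Submodule.mem_comap, LinearMap.mulLeft_apply, mul_one]
      exact l2 j hj 0 (inc_mem M j u)
    · intro l hl n x hx
      exact key x (adPow_le_coinv hl n hx) fun γ hγ =>
        coinv_gr_of_counit (adPow_le_coinv hl n hx) (counit_adPow hl hx) hγ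
    · intro x hx
      exact key x hx.2 fun γ hγ => mem_heightGeTwo.1 hx.1 γ (hγ.trans zero_le_one)
  · intro v
    refine ind (K'.comap ((pi M).adc (inc M i v))) ?_ ?_ ?_
    · rw [Submodule.mem_comap, adc_one]
      exact zero_mem _
    · intro l hl n x hx
      exact l2 l hl (n + 1) (adc_mem_adPow M i l v hx)
    · intro x hx
      refine l3 ⟨mem_heightGeTwo.2 fun γ h => ?_, coinv_ad hx.2 v⟩
      rw [gr_adc, mem_heightGeTwo.1 hx.1, map_zero]
      rw [map_sub, height_single_self, sub_zero]
      exact h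
  · intro g
    refine ind (K'.comap ((pi M).nAct g)) ?_ ?_ ?_
    · rw [Submodule.mem_comap, hB.act_one]
      exact Submodule.smul_mem _ _ l1
    · intro l hl n x hx
      exact l2 l hl n ((adPow_isSub M i l n).act_mem g hx)
    · intro x hx
      refine l3 ⟨mem_heightGeTwo.2 fun γ h => ?_, coinv_act hx.2 g⟩
      rw [hB.comp_act (isDec_pi M) (gr_isGr M)]
      rw [mem_heightGeTwo.1 hx.1 γ h, map_zero]

theorem gr_mem_adPow (h : j ≠ i) (n : ℕ) {x : (pi M).Nichols} (hx : x ∈ coinvariants M i) :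
    gr M (adDeg i j n) x ∈ adPow M i j n := by
  have hB := (pi M).n_isPre
  have : Submodule.span k {1} ⊔ (⨆ (j : ι) (_ : j ≠ i), adL M i j) ⊔
      heightGeTwo M i ⊓ coinvariants M i ≤ (adPow M i j n).comap (gr M (adDeg i j n)) := by
    refine sup_le (sup_le ?_ (iSup₂_le fun l hl => iSup_le fun m x hx => ?_)) fun x hx => ?_
    · rw [Submodule.span_le, Set.singleton_subset_iff]
      change gr M (adDeg i j n) 1 ∈ adPow M i j n
      rw [(gr_isGr M).comp_one, if_neg (adDeg_ne_zero h n)]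
      exact zero_mem _
    · rw [Submodule.mem_comap]
      by_cases e : adDeg i j n = adDeg i l m
      · obtain ⟨rfl, rfl⟩ := adDeg_inj h hl e
        rwa [gr_adPow hx]
      · rw [hB.comp_eq_zero (isDec_pi M) (gr_isGr M) (gr_adPow hx) e]
        exact zero_mem _
    · rw [Submodule.mem_comap, mem_heightGeTwo.1 hx.1 _ (height_adDeg h n).le]
      exact zero_mem _
  exact this (coinv_le_adL hx)

theorem pder_mem_adPow (h : j ≠ i) {n : ℕ} {x : (pi M).Nichols} (hx : x ∈ adPow M i j (n + 1))
    (φ : M i →ₗ[k] k) : pder M i φ x ∈ adPow M i j n := by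
  have h1 := pder_gr (adDeg i j (n + 1)) x φ
  rw [gr_adPow hx, adDeg_succ, add_sub_cancel_right] at h1
  rw [h1]
  exact gr_mem_adPow h n (pder_coinv (adPow_le_coinv h _ hx) φ)

theorem pder_adPow_zero (h : j ≠ i) {x : (pi M).Nichols} (hx : x ∈ adPow M i j 0)
    (φ : M i →ₗ[k] k) : pder M i φ x = 0 := by
  have h1 := pder_gr (adDeg i j 0) x φ
  rw [gr_adPow hx] at h1
  rw [h1]
  refine gr_neg M i ?_ _
  rw [Pi.sub_apply, adDeg_apply_self h]
  simp

theorem eq_zero_of_pder (h : j ≠ i) {n : ℕ} {x : (pi M).Nichols} (hx : x ∈ adPow M i j (n + 1))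
    (h0 : ∀ φ : M i →ₗ[k] k, pder M i φ x = 0) : x = 0 := by
  have hB := (pi M).n_isPre
  refine (pi M).eq_zero_of_lder (counit_adPow h hx) fun φ => ?_
  rw [← gr_adPow hx, hB.lder_comp (isDec_pi M) (gr_isGr M)]
  refine Finset.sum_eq_zero fun l _ => ?_
  by_cases hli : l = i
  · subst hli
    have := h0 (φ ∘ₗ single M l)
    have e : (φ ∘ₗ single M l) ∘ₗ proj M l = φ ∘ₗ piQ M l := rfl
    rw [pder_apply, e] at this
    rw [this, map_zero]
  have hK := coinv_lhit (adPow_le_coinv h _ hx) ((φ ∘ₗ piQ M l) ∘ₗ (pi M).nPr)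
  by_cases hlj : l = j
  · subst hlj
    refine coinv_gr_of_height hK (fun e => ?_) ?_
    · have := congrFun e i
      rw [Pi.sub_apply, adDeg_apply_self h, Pi.single_eq_of_ne (Ne.symm h)] at this
      simp at this
      omega
    · rw [map_sub, height_adDeg h, height_single_of_ne h, sub_self]
  · refine gr_neg M l ?_ _
    rw [Pi.sub_apply, adDeg_apply h _ hli, if_neg hlj]
    simp

theorem dspan_mono {X Y : Submodule k (pi M).Nichols} (h : X ≤ Y) :
    dspan (i := i) X ≤ dspan (i := i) Y := dspan_le fun φ _ hx => pder_mem_dspan (h hx) φ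

theorem dspan_adPow_le (h : j ≠ i) (n : ℕ) :
    dspan (i := i) (adPow M i j (n + 1)) ≤ adPow M i j n :=
  dspan_le fun φ _ hx => pder_mem_adPow h hx φ

theorem inc_injective (j : ι) : Function.Injective (inc M j) := by
  intro x y h
  have := congrArg (fun z => proj M j ((pi M).nPr z)) h
  simpa [inc, (pi M).n_isPre.pr_ι, proj_single] using this

theorem adPow_zero_irreducible (hM : (M j).IsIrreducible) {P : Submodule k (pi M).Nichols}
    (hP : (pi M).nichols.IsSub P) (hle : P ≤ adPow M i j 0) (h0 : P ≠ ⊥) : P = adPow M i j 0 := by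
  refine le_antisymm hle ?_
  have h1 := hM.2 _ (IsSub.comap (X := M j) (Y := (pi M).nichols) (f := inc M j) (inc_hom M j) hP)
  rcases h1 with h1 | h1
  · refine absurd ((Submodule.eq_bot_iff _).2 fun x hx => ?_) h0
    obtain ⟨u, rfl⟩ := (mem_summand M j).1 (hle hx)
    have : u ∈ (⊥ : Submodule k (M j)) := h1 ▸ hx
    rw [(Submodule.mem_bot k).1 this, map_zero]
  · intro x hx
    obtain ⟨u, rfl⟩ := (mem_summand M j).1 hx
    have : u ∈ (⊤ : Submodule k (M j)) := trivial
    rw [← h1] at this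
    exact this

variable [∀ j, FiniteDimensional k (M j)] [BijectiveAntipode k H]

/-- A nonzero Yetter-Drinfeld submodule of a component of `ad B(M i) (M j)` that is annihilated
by `ad (M i)` generates all components of smaller degree under the skew derivations. -/
theorem adPow_eq_dspan_iterate (h : j ≠ i) (hM : (M j).IsIrreducible) {n : ℕ}
    {P : Submodule k (pi M).Nichols} (hP : (pi M).nichols.IsSub P) (hle : P ≤ adPow M i j n)
    (h0 : P ≠ ⊥) (hk : P ≤ adKer M i) {r s : ℕ} (hrs : r + s = n) :
    adPow M i j r = (dspan (i := i))^[s] P := by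
  have q1 : ∀ s, (pi M).nichols.IsSub ((dspan (i := i))^[s] P) := by
    intro s
    induction s with
    | zero => exact hP
    | succ s ih => rw [Function.iterate_succ_apply']; exact dspan_isSub ih
  have q2 : ∀ s r, r + s = n → (dspan (i := i))^[s] P ≤ adPow M i j r ∧
      (dspan (i := i))^[s] P ≠ ⊥ := by
    intro s
    induction s with
    | zero => rintro r rfl; exact ⟨hle, h0⟩
    | succ s ih =>
      intro r hr
      obtain ⟨ih1, ih2⟩ := ih (r + 1) (by omega)
      rw [Function.iterate_succ_apply']
      refine ⟨(dspan_mono ih1).trans (dspan_adPow_le h r), fun e => ih2 ?_⟩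
      refine (Submodule.eq_bot_iff _).2 fun x hx => eq_zero_of_pder h (ih1 hx) fun φ => ?_
      have := pder_mem_dspan hx φ
      rw [e] at this
      exact (Submodule.mem_bot k).1 this
  have q3 : ∀ s, ∀ v : M i, ∀ x ∈ (dspan (i := i))^[s + 1] P,
      (pi M).adc (inc M i v) x ∈ (dspan (i := i))^[s] P := by
    intro s
    induction s with
    | zero =>
      intro v x hx
      have := ad_dspan (Y := ⊥) hP (fun v x hx => (Submodule.mem_bot k).2 (mem_adKer.1 (hk hx) v))
        v hx
      refine (sup_le ?_ le_rfl : _ ≤ P) this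
      exact (dspan_le fun φ x hx => by
        rw [(Submodule.mem_bot k).1 hx, map_zero]; exact zero_mem _)
    | succ s ih =>
      intro v x hx
      rw [Function.iterate_succ_apply'] at hx
      have := ad_dspan (q1 (s + 1)) ih v hx
      rwa [← Function.iterate_succ_apply' (dspan (i := i)), sup_idem] at this
  refine le_antisymm ?_ (q2 s r hrs).1
  induction r generalizing s with
  | zero =>
    rw [adPow_zero_irreducible hM (q1 s) (q2 s 0 hrs).1 (q2 s 0 hrs).2]
  | succ r ih =>
    exact adPow_succ_le fun v x hx => q3 s v x (ih (s := s + 1) (by omega) hx)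

omit [∀ j, FiniteDimensional k (M j)] [BijectiveAntipode k H] in
theorem adPow_eq_bot_of_le {m n : ℕ} (hmn : m ≤ n) (h : adPow M i j m = ⊥) :
    adPow M i j n = ⊥ := by
  induction n, hmn using Nat.le_induction with
  | base => exact h
  | succ n _ ih =>
    refine le_bot_iff.1 (adPow_succ_le fun v x hx => ?_)
    rw [ih] at hx
    rw [(Submodule.mem_bot k).1 hx, map_zero]
    exact zero_mem _

omit [∀ j, FiniteDimensional k (M j)] [BijectiveAntipode k H] in
theorem adPow_zero_ne_bot (hM : (M j).IsIrreducible) : adPow M i j 0 ≠ ⊥ := by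
  intro e
  obtain ⟨x, y, hxy⟩ := hM.1
  refine hxy (inc_injective j ?_)
  have h : ∀ x : M j, inc M j x = 0 := fun x => by
    have : inc M j x ∈ adPow M i j 0 := inc_mem M j x
    rwa [e, Submodule.mem_bot] at this
  rw [h, h]

omit [∀ j, FiniteDimensional k (M j)] [BijectiveAntipode k H] in
theorem exists_adPow_eq_bot (h : j ≠ i) [hfin : FiniteDimensional k (adL M i j)] :
    ∃ n, adPow M i j n = ⊥ := by
  by_contra! hne
  choose x hx hx0 using fun n => (Submodule.ne_bot_iff _).1 (hne n)
  have hli : LinearIndependent k x := by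
    rw [linearIndependent_iff']
    intro s g hg n hn
    have := congrArg (gr M (adDeg i j n)) hg
    rw [map_sum, map_zero, Finset.sum_eq_single n] at this
    · rw [map_smul, gr_adPow (hx n), smul_eq_zero] at this
      exact this.resolve_right (hx0 n)
    · intro m _ hm
      rw [map_smul, (pi M).n_isPre.comp_eq_zero (isDec_pi M) (gr_isGr M) (gr_adPow (hx m))
        (fun e => hm (adDeg_inj h h e).2.symm), smul_zero]
    · exact fun h => absurd hn h
  let y : ℕ → adL M i j := fun n => ⟨x n, le_iSup (adPow M i j) n (hx n)⟩
  have hy : LinearIndependent k y := LinearIndependent.of_comp (adL M i j).subtype hli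
  exact Set.infinite_univ.not_finite (Set.finite_univ_iff.2 hy.finite) |>.elim

omit [∀ j, FiniteDimensional k (M j)] [BijectiveAntipode k H] in
theorem adPow_ne_bot_iff (h : j ≠ i) (hM : (M j).IsIrreducible)
    [hfin : FiniteDimensional k (adL M i j)] (n : ℕ) :
    adPow M i j n ≠ ⊥ ↔ n ≤ topDeg M i j := by
  obtain ⟨N, hN⟩ := exists_adPow_eq_bot (M := M) h
  have hb : BddAbove {n | adPow M i j n ≠ ⊥} := ⟨N, fun n hn => by
    by_contra! hlt
    exact hn (adPow_eq_bot_of_le hlt.le hN)⟩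
  constructor
  · intro hn
    exact le_csSup hb hn
  · intro hn e
    have : topDeg M i j ∈ {n | adPow M i j n ≠ ⊥} := Nat.sSup_mem ⟨0, adPow_zero_ne_bot hM⟩ hb
    exact this (adPow_eq_bot_of_le hn e)

theorem topDeg_le_adKer (h : j ≠ i) (hM : (M j).IsIrreducible)
    [hfin : FiniteDimensional k (adL M i j)] :
    adPow M i j (topDeg M i j) ≤ adKer M i := by
  intro x hx
  refine mem_adKer.2 fun v => ?_
  have h1 := adc_mem_adPow M i j v hx
  have h2 : adPow M i j (topDeg M i j + 1) = ⊥ := by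
    by_contra hne
    have := (adPow_ne_bot_iff h hM _).1 hne
    omega
  rwa [h2, Submodule.mem_bot] at h1

theorem dspan_adPow (h : j ≠ i) (hM : (M j).IsIrreducible)
    [hfin : FiniteDimensional k (adL M i j)] {r : ℕ} (hr : r < topDeg M i j) :
    dspan (i := i) (adPow M i j (r + 1)) = adPow M i j r := by
  have h1 : ∀ {r s}, r + s = topDeg M i j → _ := adPow_eq_dspan_iterate h hM
    (adPow_isSub M i j _) le_rfl ((adPow_ne_bot_iff h hM _).2 le_rfl) (topDeg_le_adKer h hM)
  rw [h1 (r := r + 1) (s := topDeg M i j - (r + 1)) (by omega),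
    ← Function.iterate_succ_apply' (dspan (i := i)), h1 (r := r)]
  omega

theorem inf_adKer_eq_bot (h : j ≠ i) (hM : (M j).IsIrreducible)
    [hfin : FiniteDimensional k (adL M i j)] {r : ℕ} (hr : r < topDeg M i j) :
    adPow M i j r ⊓ adKer M i = ⊥ := by
  by_contra hne
  have h1 := adPow_eq_dspan_iterate h hM ((adPow_isSub M i j r).inf adKer_isSub)
    inf_le_left hne inf_le_right (add_zero r)
  refine (adPow_ne_bot_iff h hM (r + 1)).2 hr (le_bot_iff.1 (adPow_succ_le fun v x hx => ?_))
  rw [h1] at hx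
  rw [mem_adKer.1 hx.2 v]
  exact zero_mem _

omit [BijectiveAntipode k H] in
theorem IsSub.map_subtype {V : YDMod.{u, w, v} k H} {P : Submodule k V} (hP : V.IsSub P)
    {Q : Submodule k (sub hP)} (hQ : (sub hP).IsSub Q) : V.IsSub (Q.map (subIncl hP)) :=
  IsSub.map (X := sub hP) (Y := V) (sub_isYDMap hP) hQ

theorem Lmax_irreducible (h : j ≠ i) (hM : (M j).IsIrreducible)
    [hfin : FiniteDimensional k (adL M i j)] : (Lmax M i j).IsIrreducible := by
  have hne := (adPow_ne_bot_iff h hM (topDeg M i j)).2 le_rfl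
  have hnt : Nontrivial (adPow M i j (topDeg M i j)) := Submodule.nontrivial_iff_ne_bot.2 hne
  refine ⟨hnt, fun P hP => ?_⟩
  by_cases h0 : P = ⊥
  · exact Or.inl h0
  right
  let f : Lmax M i j →ₗ[k] (pi M).Nichols := (adPow M i j (topDeg M i j)).subtype
  let Q : Submodule k (pi M).Nichols := P.map f
  have hf : (pi M).nichols.IsSub Q :=
    IsSub.map_subtype (adPow_isSub M i j (topDeg M i j)) hP
  have hle : Q ≤ adPow M i j (topDeg M i j) := by
    rintro _ ⟨x, _, rfl⟩
    exact x.2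
  have h1 := adPow_eq_dspan_iterate h hM hf hle
    (fun e => h0 (Submodule.map_injective_of_injective (f := f) Subtype.val_injective
      (e.trans (Submodule.map_bot f).symm)))
    (hle.trans (topDeg_le_adKer h hM)) (add_zero _)
  refine eq_top_iff.2 fun x _ => ?_
  have : f x ∈ adPow M i j (topDeg M i j) := x.2
  rw [h1] at this
  obtain ⟨y, hy, e⟩ := this
  rwa [← (Subtype.val_injective e : y = x)]

end YDMod

/-- A finite-dimensional comodule has a basis that is the family of a comatrix. -/
theorem YDMod.exists_basis_cofam (V : YDMod.{u, w, v} k H) [FiniteDimensional k V] :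
    ∃ (n : ℕ) (t : Fin n → Fin n → H) (b : Module.Basis (Fin n) k V), IsCofam V.coact t b := by
  let b := Module.finBasis k V
  refine ⟨_, fun a c => rslice (b.coord c) (V.coact (b a)), b, ?_⟩
  have hb : ∀ {A : Type w} [AddCommGroup A] [Module k A] (z : A ⊗[k] V),
      z = ∑ c, rslice (b.coord c) z ⊗ₜ b c := by
    intro A _ _ z
    induction z with
    | zero => simp
    | add x y hx hy =>
      conv_lhs => rw [hx, hy]
      simp only [map_add, add_tmul, Finset.sum_add_distrib]
    | tmul x v =>
      simp only [rslice_tmul, smul_tmul, ← tmul_sum, Module.Basis.coord_apply, b.sum_repr]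
  have h1 : ∀ a, V.coact (b a) = ∑ c, rslice (b.coord c) (V.coact (b a)) ⊗ₜ b c := fun a => hb _
  refine ⟨⟨fun a c => ?_, fun a c => ?_⟩, h1⟩
  · have h2 := congrArg ((TensorProduct.assoc k H H V).symm) (V.ydAt (b a)).coassoc
    rw [LinearEquiv.symm_apply_apply, h1 a] at h2
    simp only [map_sum, LinearMap.rTensor_tmul, LinearMap.lTensor_tmul] at h2
    have h3 : ∀ d, rslice (b.coord d) (V.coact (b a)) ⊗ₜ[k] V.coact (b d) =
        ∑ c, rslice (b.coord d) (V.coact (b a)) ⊗ₜ[k]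
          (rslice (b.coord c) (V.coact (b d)) ⊗ₜ[k] b c) := by
      intro d
      rw [← tmul_sum, ← h1 d]
    simp only [h3, map_sum, TensorProduct.assoc_symm_tmul] at h2
    rw [Finset.sum_comm] at h2
    simp only [← sum_tmul] at h2
    exact congrFun (eq_of_sum_tmul_eq b.linearIndependent h2) c
  · have h2 := (V.ydAt (b a)).counit_coact
    rw [h1 a, ← sum_ite_tmul] at h2
    simp only [map_sum, LinearMap.rTensor_tmul] at h2
    exact congrFun (eq_of_sum_tmul_eq b.linearIndependent h2) c


namespace IsPre

variable {R : Type*} [Ring R] [Algebra k R] {J Γ : Type*} [Fintype J] [AddCommGroup Γ]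
  [DecidableEq Γ] {U : YDMod.{u, w, v} k H} {ι : U →ₗ[k] R} {act : H →ₐ[k] Module.End k R}
    {coact : R →ₐ[k] H ⊗[k] R} {Δ : R →ₗ[k] R ⊗[k] R} {ε : R →ₐ[k] k} {pr : R →ₗ[k] U}
    (hR : IsPre U ι act coact Δ ε pr) {q : J → U →ₗ[k] U} (hq : U.IsDec q) {d : J → Γ}
    {c : Γ → R →ₗ[k] R} (hc : IsGr ι q d c)
include hR hq hc

theorem lTensor_comul_comp (β γ : Γ) (z : R) :
    (c β).lTensor R (Δ (c γ z)) = TensorProduct.map (c (γ - β)) (c β) (Δ z) := by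
  refine sub_eq_zero.1 (hR.eq_zero_of_comp_left hq hc fun α => ?_)
  rw [map_sub, sub_eq_zero, LinearMap.rTensor, LinearMap.lTensor, TensorProduct.map_map,
    TensorProduct.map_map, LinearMap.comp_id, LinearMap.id_comp,
    hR.comul_comp hq hc]
  by_cases h : α = γ - β
  · rw [if_pos (by rw [h, sub_add_cancel]), h,
      show c (γ - β) ∘ₗ c (γ - β) = c (γ - β) from LinearMap.ext (hR.comp_self hq hc _)]
  · rw [if_neg (fun e => h (by rw [← e, add_sub_cancel_right])),
      show c α ∘ₗ c (γ - β) = 0 from LinearMap.ext fun x => by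
        rw [LinearMap.comp_apply, hR.comp_comp hq hc, if_neg h]; rfl]
    simp

end IsPre

/-- A linear map annihilated by convolution with the identity on the right is zero. -/
theorem YDMod.eq_zero_of_conv {U : YDMod.{u, w, v} k H} {E : U.Nichols →ₗ[k] U.Nichols}
    (h : ∀ z, LinearMap.mul' k U.Nichols (E.rTensor _ (U.nComul z)) = 0) : E = 0 := by
  have hB := U.n_isPre
  have hq := U.isDec_unit
  obtain ⟨c, hc⟩ : ∃ c, IsGr U.nι _ _ c := ⟨_, n_isGr hq (fun _ => (1 : ℤ))⟩
  have key : ∀ n : ℕ, ∀ z, E (c n z) = 0 := by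
    intro n
    induction n using Nat.strong_induction_on with
    | _ n ih =>
      intro z
      have h1 := h (c n z)
      have h2 : E.rTensor _ (U.nComul (c n z)) = E (c n z) ⊗ₜ 1 := by
        refine sub_eq_zero.1 (hB.eq_zero_of_comp_right hq hc fun m => ?_)
        rw [map_sub, sub_eq_zero, LinearMap.lTensor_tmul, hc.comp_one]
        have h3 : (c m).lTensor _ (E.rTensor _ (U.nComul (c n z))) = TensorProduct.map
            (E ∘ₗ c (n - m)) (c m) (U.nComul z) := by
          rw [← LinearMap.comp_apply, LinearMap.lTensor_comp_rTensor,
            ← LinearMap.rTensor_comp_lTensor, LinearMap.comp_apply, hB.lTensor_comul_comp hq hc,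
            LinearMap.rTensor, TensorProduct.map_map, LinearMap.id_comp]
        rw [h3]
        rcases lt_trichotomy m 0 with hm | rfl | hm
        · rw [if_neg hm.ne, tmul_zero, show c m = 0 from LinearMap.ext (hB.comp_neg hc hm)]
          simp
        · have h4 : ∀ s : U.Nichols ⊗[k] U.Nichols, TensorProduct.map (E ∘ₗ c n) (c 0) s =
              E (c n (TensorProduct.rid k _ (U.nCounit.toLinearMap.lTensor _ s))) ⊗ₜ 1 := by
            intro s
            induction s with
            | zero => simp
            | add x y hx hy => simp only [map_add, hx, hy, add_tmul]
            | tmul x y => simp [hB.comp_zero hc, smul_tmul']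
          rw [sub_zero, h4, hB.comul_counit, if_pos rfl]
        · rw [if_neg hm.ne', tmul_zero, show E ∘ₗ c (n - m) = 0 from LinearMap.ext fun x => ?_]
          · simp
          · rcases lt_or_ge (n - m : ℤ) 0 with h5 | h5
            · rw [LinearMap.comp_apply, hB.comp_neg hc h5, map_zero, LinearMap.zero_apply]
            · lift (n - m : ℤ) to ℕ using h5 with l hl
              exact ih l (by omega) x
      rw [h2] at h1
      simpa using h1
  ext z
  obtain ⟨s, hs⟩ := hB.exists_finset hc hq z
  rw [← hs s subset_rfl, map_sum]
  refine Finset.sum_eq_zero fun n _ => ?_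
  rcases lt_or_ge n 0 with hn | hn
  · rw [hB.comp_neg hc hn, map_zero]
  · lift n to ℕ using hn
    exact key n z

namespace YDMod

variable {ι : Type} [Fintype ι] [DecidableEq ι] (M : ι → YDMod.{u, w, v} k H) (i : ι)
  [∀ j, FiniteDimensional k (M j)] [BijectiveAntipode k H]

/-! ### The operators `∂_ξ` -/

/-- The algebra map `ξ ↦ ∂_ξ`. -/
def bder : (M i).dual.Nichols →ₐ[k] Module.End k (pi M).Nichols :=
  der (proj M i) (proj_isHom M i)

theorem smashRep_tmul (b : (pi M).Nichols) (ξ : (M i).dual.Nichols) :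
    smashRep M i (b ⊗ₜ ξ) = LinearMap.mulLeft k b ∘ₗ bder M i ξ := rfl

theorem bder_nι (f : (M i).dual) : bder M i ((M i).dual.nι f) = pder M i (dualForm f) := by
  refine LinearMap.ext fun x => ?_
  obtain ⟨x, rfl⟩ := (pi M).nmk_surjective x
  rw [bder, der_nι, nDer_nmk, pder_apply, lhit, LinearMap.comp_apply, nComul_nmk, lslice_map]
  have : ((dualForm f ∘ₗ proj M i) ∘ₗ (pi M).nPr) ∘ₗ (pi M).nmk.toLinearMap =
      (dualForm f ∘ₗ proj M i) ∘ₗ (pi M).tPr := LinearMap.ext fun x => by simp [nPr_nmk]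
  rw [this]
  rfl

theorem bder_nmk (ξ : (M i).dual.T) (x : (pi M).T) :
    bder M i ((M i).dual.nmk ξ) ((pi M).nmk x) = (pi M).nmk (tDerHom (proj M i) ξ x) := by
  have h : ∀ x, bder M i ((M i).dual.nmk ξ) ((pi M).nmk x) =
      (pi M).nmk (tDerHom (proj M i) ξ x) := by
    induction ξ using TensorAlgebra.induction with
    | algebraMap r => intro x; simp
    | ι f =>
      intro x
      have := bder_nι M i f
      rw [bder, der_nι] at this
      change bder M i ((M i).dual.nι f) _ = _
      rw [bder, der_nι, nDer_nmk]
      simp [tDerHom]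
    | add a b ha hb => intro x; simp [ha, hb]
    | mul a b ha hb => intro x; simp [ha, hb]
  exact h x

variable {M i}

theorem bder_one (ξ : (M i).dual.Nichols) :
    bder M i ξ 1 = (M i).dual.nCounit ξ • (1 : (pi M).Nichols) := by
  obtain ⟨ξ, rfl⟩ := (M i).dual.nmk_surjective ξ
  rw [← map_one (pi M).nmk, bder_nmk, tDerHom_one_right, map_smul, nCounit_nmk]

/-- The right skew derivation of `B((M i)*)` for a vector of `M i`. -/
def dualRder (x : M i) : Module.End k (M i).dual.Nichols :=
  rhit (M i).dual.nComul (dualEval x ∘ₗ (M i).dual.nPr)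

theorem counit_bder_ι_mul (ξ : (M i).dual.Nichols) (y : pi M) (c : (pi M).Nichols) :
    (pi M).nCounit (bder M i ξ ((pi M).nι y * c)) =
      (pi M).nCounit (bder M i (dualRder (proj M i y) ξ) c) := by
  obtain ⟨ξ, rfl⟩ := (M i).dual.nmk_surjective ξ
  obtain ⟨c, rfl⟩ := (pi M).nmk_surjective c
  have h1 : (pi M).nι y * (pi M).nmk c = (pi M).nmk (TensorAlgebra.ι k y * c) := by
    rw [map_mul]; rfl
  have h2 : ∀ z, leibEval (proj M i) c y z =
      tDerHom (proj M i) (rslice (dualEval (proj M i y) ∘ₗ (M i).dual.tPr) z) c := by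
    intro z
    induction z with
    | zero => simp
    | add x y hx hy => simp only [map_add, hx, hy, LinearMap.add_apply]
    | tmul a b => rw [leibEval_tmul, rslice_tmul, map_smul]; rfl
  have h3 : ∀ s, (pi M).tCounit (leib (proj M i) c ξ s) = 0 := by
    intro s
    induction s with
    | zero => simp
    | add x y hx hy => simp only [map_add, hx, hy, add_zero]
    | tmul a b => rw [leib_tmul, map_mul, (pi M).t_isPre.counit_ι, zero_mul]
  rw [h1, bder_nmk, dualRder, nRhit_nmk, bder_nmk, nCounit_nmk, nCounit_nmk,
    tDerHom_leibniz (proj_isHom M i), map_add, h3, zero_add, h2]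
  rfl

theorem exists_dualEval_eq {V : YDMod.{u, w, v} k H} [FiniteDimensional k V]
    (φ : V.dual →ₗ[k] k) : ∃ x : V, φ = dualEval x := by
  obtain ⟨x, hx⟩ := (Module.evalEquiv k V).surjective φ
  exact ⟨x, hx.symm⟩

theorem eq_zero_of_counit_bder {ξ : (M i).dual.Nichols}
    (h : ∀ z, (pi M).nCounit (bder M i ξ z) = 0) : ξ = 0 := by
  let P : Submodule k (M i).dual.Nichols := ⨅ z, LinearMap.ker
    ((pi M).nCounit.toLinearMap ∘ₗ (bder M i).toLinearMap.flip z)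
  have hP : ∀ ξ, ξ ∈ P ↔ ∀ z, (pi M).nCounit (bder M i ξ z) = 0 := by
    intro ξ
    simp [P, Submodule.mem_iInf]
  have h1 : P = ⊥ := by
    refine (M i).dual.eq_bot_of_isRightStable fun ξ hξ => ⟨?_, fun φ => ?_⟩
    · have := (hP ξ).1 hξ 1
      rwa [bder_one, map_smul, map_one, smul_eq_mul, mul_one] at this
    · obtain ⟨x, rfl⟩ := exists_dualEval_eq φ
      rw [hP]
      intro z
      have := counit_bder_ι_mul ξ (single M i x) z
      rw [proj_single, (hP ξ).1 hξ] at this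
      exact this.symm
  have : ξ ∈ P := (hP ξ).2 h
  rwa [h1, Submodule.mem_bot] at this

theorem dual_ind {p : (M i).dual.Nichols → Prop} (h1 : p 1)
    (ha : ∀ x y, p x → p y → p (x + y)) (hs : ∀ (c : k) x, p x → p (c • x))
    (hm : ∀ f x, p x → p ((M i).dual.nι f * x)) (x : (M i).dual.Nichols) : p x :=
  (M i).dual.n_isPre.ind p h1 ha hs hm x

theorem comul_bder (ξ : (M i).dual.Nichols) (z : (pi M).Nichols) :
    (pi M).nComul (bder M i ξ z) = (bder M i ξ).rTensor _ ((pi M).nComul z) := by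
  induction ξ using dual_ind with
  | h1 => rw [map_one]; exact (LinearMap.rTensor_id_apply _ _ _).symm
  | ha x y hx hy =>
    simp only [map_add, LinearMap.add_apply, hx, hy, LinearMap.rTensor_add]
  | hs c x hx => simp only [map_smul, LinearMap.smul_apply, hx, LinearMap.rTensor_smul]
  | hm f x hx =>
    rw [map_mul, Module.End.mul_apply, bder_nι, pder_apply, (pi M).n_isPre.comul_lhit, hx,
      ← LinearMap.comp_apply, ← LinearMap.rTensor_comp]
    rfl

theorem bder_eq (ξ : (M i).dual.Nichols) (z : (pi M).Nichols) : bder M i ξ z =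
    lslice ((pi M).nCounit.toLinearMap ∘ₗ bder M i ξ) ((pi M).nComul z) := by
  have := (pi M).n_isPre.counit_comul (bder M i ξ z)
  rw [comul_bder, ← LinearMap.comp_apply, ← LinearMap.rTensor_comp] at this
  exact this.symm

theorem smashRep_injective : Function.Injective (smashRep M i) := by
  rw [← LinearMap.ker_eq_bot, LinearMap.ker_eq_bot']
  intro t ht
  obtain ⟨n, ξ, x, hξ, rfl⟩ := exists_rep_right t
  have hx : ∀ c, x c = 0 := by
    let E : (pi M).Nichols →ₗ[k] (pi M).Nichols :=
      ∑ c, ((pi M).nCounit.toLinearMap ∘ₗ bder M i (ξ c)).smulRight (x c)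
    have hE : E = 0 := by
      refine eq_zero_of_conv fun z => ?_
      have h1 : ∀ s, LinearMap.mul' k (pi M).Nichols (E.rTensor _ s) =
          ∑ c, x c * lslice ((pi M).nCounit.toLinearMap ∘ₗ bder M i (ξ c)) s := by
        intro s
        induction s with
        | zero => simp
        | add a b ha hb => simp only [map_add, ha, hb, mul_add, Finset.sum_add_distrib]
        | tmul a b => simp [E, Finset.sum_mul]
      have h2 := congrArg (· z) ht
      simp only [map_sum, LinearMap.sum_apply, smashRep_tmul, LinearMap.comp_apply,
        LinearMap.mulLeft_apply, bder_eq, LinearMap.zero_apply] at h2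
      rw [h1, h2]
    intro c
    rw [← Module.forall_dual_apply_eq_zero_iff k]
    intro φ
    have h3 : ∑ c, φ (x c) • ξ c = 0 := by
      refine eq_zero_of_counit_bder (M := M) (i := i) fun z => ?_
      have h4 := congrArg (fun E => φ (E z)) hE
      simp only [E, LinearMap.sum_apply, LinearMap.smulRight_apply, map_sum, map_smul,
        LinearMap.comp_apply, AlgHom.toLinearMap_apply, LinearMap.zero_apply, map_zero] at h4
      simp only [map_sum, map_smul, LinearMap.sum_apply, LinearMap.smul_apply]
      rw [← h4]
      exact Finset.sum_congr rfl fun c _ => mul_comm _ _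
    exact Fintype.linearIndependent_iff.1 hξ _ h3 c
  simp [hx]

end YDMod

/-! ### Equivariant families of operators -/

section Equivariant

variable {R X : Type*} [AddCommGroup R] [Module k R] [AddCommGroup X] [Module k X]

/-- `h ∘ F x = F (h₍₁₎ · x) ∘ h₍₂₎`. -/
def IsEquivariant (actX : H →ₐ[k] Module.End k X) (act : H →ₐ[k] Module.End k R)
    (F : X →ₗ[k] Module.End k R) : Prop :=
  ∀ (m : ℕ) (t : Fin m → Fin m → H), IsComatrix (k := k) t → ∀ a b x,
    act (t a b) * F x = ∑ c, F (actX (t a c) x) * act (t c b)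

theorem IsComatrix.sum_mul_antipode_act {m : ℕ} {t : Fin m → Fin m → H}
    (ht : IsComatrix (k := k) t) (act : H →ₐ[k] Module.End k R) (a c : Fin m) :
    ∑ b, act (t a b) * act (antipode k (t b c)) = if a = c then 1 else 0 := by
  have := congrArg act (ht.mul_antipode a c)
  rw [map_sum] at this
  simp only [map_mul] at this
  rw [this]
  split_ifs <;> simp

theorem IsComatrix.sum_antipode_mul_act {m : ℕ} {t : Fin m → Fin m → H}
    (ht : IsComatrix (k := k) t) (act : H →ₐ[k] Module.End k R) (a c : Fin m) :
    ∑ b, act (antipode k (t a b)) * act (t b c) = if a = c then 1 else 0 := by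
  have := congrArg act (ht.antipode_mul a c)
  rw [map_sum] at this
  simp only [map_mul] at this
  rw [this]
  split_ifs <;> simp

namespace IsEquivariant

variable {actX : H →ₐ[k] Module.End k X} {act : H →ₐ[k] Module.End k R}
    {F : X →ₗ[k] Module.End k R} (hF : IsEquivariant actX act F)
    {m : ℕ} {t : Fin m → Fin m → H} (ht : IsComatrix (k := k) t)
include hF ht

theorem conj (a b : Fin m) (x : X) : F (actX (t a b) x) =
    ∑ c, act (t a c) * F x * act (antipode k (t c b)) := by
  simp only [hF m t ht, Finset.sum_mul]
  rw [Finset.sum_comm]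
  simp only [mul_assoc, ← Finset.mul_sum, ht.sum_mul_antipode_act, mul_ite, mul_one, mul_zero]
  simp

theorem mul_antipode (a b : Fin m) (x : X) : F x * act (antipode k (t a b)) =
    ∑ c, act (antipode k (t a c)) * F (actX (t c b) x) := by
  simp only [hF.conj ht, Finset.mul_sum, ← mul_assoc]
  rw [Finset.sum_comm]
  simp only [← Finset.sum_mul, ht.sum_antipode_mul_act, ite_mul, one_mul, zero_mul]
  simp

end IsEquivariant

theorem IsEquivariant.lift_mul {Y : Type*} [AddCommGroup Y] [Module k Y]
    {actX : H →ₐ[k] Module.End k X} {actY : H →ₐ[k] Module.End k Y}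
    {act : H →ₐ[k] Module.End k R}
    {F : X →ₗ[k] Module.End k R} {G : Y →ₗ[k] Module.End k R} (hF : IsEquivariant actX act F)
    (hG : IsEquivariant actY act G) : IsEquivariant (YDMod.diagAct actX actY) act
      (TensorProduct.lift ((LinearMap.mul k (Module.End k R)).compl₁₂ F G)) := by
  intro m t ht a b z
  induction z with
  | zero => simp
  | add x y hx hy => simp only [map_add, mul_add, add_mul, hx, hy, Finset.sum_add_distrib]
  | tmul x y =>
    simp only [YDMod.diagAct_comatrix actX actY ht, map_sum, TensorProduct.lift.tmul,
      LinearMap.compl₁₂_apply, LinearMap.mul_apply']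
    rw [← mul_assoc, hF m t ht, Finset.sum_mul]
    simp only [mul_assoc, hG m t ht, Finset.mul_sum, Finset.sum_mul]
    rw [Finset.sum_comm]

theorem IsYDAlg.isEquivariant_mulLeft {R : Type*} [Ring R] [Algebra k R]
    {act : H →ₐ[k] Module.End k R} {coact : R →ₐ[k] H ⊗[k] R}
    (hR : IsYDAlg act coact) : IsEquivariant act act (LinearMap.mul k R) := by
  intro m t ht a b x
  ext y
  simpa using (hR.actMul x y).comatrix ht a b

/-- An equivariant map on the generators extends to an equivariant map on the algebra. -/
theorem IsPre.isEquivariant {R A : Type*} [Ring R] [Algebra k R] [AddCommGroup A] [Module k A]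
    {U : YDMod.{u, w, v} k H}
    {ι : U →ₗ[k] R} {act : H →ₐ[k] Module.End k R} {coact : R →ₐ[k] H ⊗[k] R}
    {Δ : R →ₗ[k] R ⊗[k] R} {ε : R →ₐ[k] k} {pr : R →ₗ[k] U} (hR : IsPre U ι act coact Δ ε pr)
    {actA : H →ₐ[k] Module.End k A} {F : R →ₐ[k] Module.End k A}
    (hF : IsEquivariant U.act actA (F.toLinearMap ∘ₗ ι)) :
    IsEquivariant act actA F.toLinearMap := by
  intro m t ht a b x
  revert a b
  refine hR.ind (fun x => ∀ a b, actA (t a b) * F.toLinearMap x =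
    ∑ c, F.toLinearMap (act (t a c) x) * actA (t c b)) ?_ ?_ ?_ ?_ x
  · intro a b
    simp only [act_one_comatrix hR.toIsYDAlg ht]
    simp [AlgHom.toLinearMap_apply, apply_ite]
  · intro x y hx hy a b
    simp only [map_add, mul_add, add_mul, hx, hy, Finset.sum_add_distrib]
  · intro c x hx a b
    simp only [map_smul, mul_smul_comm, smul_mul_assoc, hx, Finset.smul_sum]
  · intro v x hx a b
    simp only [(hR.actMul _ _).comatrix ht, hR.act_ι, AlgHom.toLinearMap_apply, map_mul,
      map_sum] at hx ⊢
    have h1 := hF m t ht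
    simp only [LinearMap.comp_apply, AlgHom.toLinearMap_apply] at h1
    rw [← mul_assoc, h1, Finset.sum_mul]
    simp only [mul_assoc, hx, Finset.mul_sum, Finset.sum_mul]
    rw [Finset.sum_comm]

end Equivariant

section Commutator

variable {R A : Type*} [Ring R] [Algebra k R] [AddCommGroup A] [Module k A] {U : YDMod.{u, w, v} k H}

/-- `x ⊗ w ↦ F x ∘ (g(w₍₀₎) w₍₋₁₎)`. -/
def commOp {X U' : Type*} [AddCommGroup X] [Module k X] [AddCommGroup U'] [Module k U']
    (act : H →ₐ[k] Module.End k A) (coact : U' →ₗ[k] H ⊗[k] U') (F : X →ₗ[k] Module.End k A)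
    (g : U' →ₗ[k] k) : X ⊗[k] U' →ₗ[k] Module.End k A :=
  TensorProduct.lift ((LinearMap.mul k (Module.End k A)).compl₁₂ F
    (act.toLinearMap ∘ₗ rslice g ∘ₗ coact))

@[simp] theorem commOp_tmul {X U' : Type*} [AddCommGroup X] [Module k X] [AddCommGroup U']
    [Module k U'] (act : H →ₐ[k] Module.End k A) (coact : U' →ₗ[k] H ⊗[k] U')
    (F : X →ₗ[k] Module.End k A) (g : U' →ₗ[k] k) (x : X) (y : U') :
    commOp act coact F g (x ⊗ₜ y) = F x * act (rslice g (coact y)) := rfl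

theorem commOp_cofam {X U' : Type*} [AddCommGroup X] [Module k X] [AddCommGroup U']
    [Module k U'] (act : H →ₐ[k] Module.End k A) {coact : U' →ₗ[k] H ⊗[k] U'}
    (F : X →ₗ[k] Module.End k A) (g : U' →ₗ[k] k) {m : ℕ} {t : Fin m → Fin m → H}
    {e : Fin m → U'} (he : IsCofam coact t e) (x : X) (a : Fin m) :
    commOp act coact F g (x ⊗ₜ e a) = ∑ b, g (e b) • (F x * act (t a b)) := by
  simp [commOp_tmul, he.coact_eq, Finset.mul_sum]

theorem IsPre.lTensor_pr_comul_ι_mul {ι : U →ₗ[k] R} {act : H →ₐ[k] Module.End k R}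
    {coact : R →ₐ[k] H ⊗[k] R} {Δ : R →ₗ[k] R ⊗[k] R} {ε : R →ₐ[k] k} {pr : R →ₗ[k] U}
    (hR : IsPre U ι act coact Δ ε pr) {m : ℕ} {t : Fin m → Fin m → H} {e : Fin m → U}
    (he : IsCofam U.coact t e) (a : Fin m) (x : R) : pr.lTensor R (Δ (ι (e a) * x)) =
      (LinearMap.mulLeft k (ι (e a))).rTensor U (pr.lTensor R (Δ x)) +
        ∑ b, act (t a b) x ⊗ₜ e b := by
  have h : ∀ s, pr.lTensor R (bmul act coact (primTensor ι (e a)) s) =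
      (LinearMap.mulLeft k (ι (e a))).rTensor U (pr.lTensor R s) +
        ∑ b, act (t a b) (TensorProduct.rid k R (ε.toLinearMap.lTensor R s)) ⊗ₜ e b := by
    intro s
    induction s with
    | zero => simp
    | add x y hx hy =>
      simp only [map_add, hx, hy, add_tmul, Finset.sum_add_distrib]; abel
    | tmul c d =>
      simp [hR.bmul_prim he, hR.pr_ι_mul, smul_tmul']
  rw [hR.comul_ι_mul, h, hR.comul_counit]

/-- The commutators of an operator with an equivariant representation of a braided Hopf algebra
are determined by those with the generators. -/
theorem IsPre.commutator_eq {ι : U →ₗ[k] R} {act : H →ₐ[k] Module.End k R}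
    {coact : R →ₐ[k] H ⊗[k] R} {Δ : R →ₗ[k] R ⊗[k] R} {ε : R →ₐ[k] k} {pr : R →ₗ[k] U}
    (hR : IsPre U ι act coact Δ ε pr) {actA : H →ₐ[k] Module.End k A}
    {F : R →ₐ[k] Module.End k A} (hF : IsEquivariant act actA F.toLinearMap) {g : U →ₗ[k] k}
    {Z : Module.End k A}
    (hZ : ∀ w, Z * F (ι w) - F (ι w) * Z = actA (rslice g (U.coact w))) (x : R) :
    Z * F x - F x * Z = commOp actA U.coact F.toLinearMap g (pr.lTensor R (Δ x)) := by
  refine IsPre.ind' (p := fun x => Z * F x - F x * Z =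
    commOp actA U.coact F.toLinearMap g (pr.lTensor R (Δ x))) hR ?_ ?_ ?_ ?_ x
  · simp [hR.comul_one, hR.pr_one]
  · intro x y hx hy
    simp only [map_add, mul_add, add_mul, ← hx, ← hy]; abel
  · intro c x hx
    simp only [map_smul, ← hx, smul_sub, mul_smul_comm, smul_mul_assoc]
  · intro m t e he a x hx
    have h1 : ∀ s, commOp actA U.coact F.toLinearMap g
        ((LinearMap.mulLeft k (ι (e a))).rTensor U s) =
        F (ι (e a)) * commOp actA U.coact F.toLinearMap g s := by
      intro s
      induction s with
      | zero => simp
      | add x y hx hy => simp only [map_add, hx, hy, mul_add]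
      | tmul c d => simp [mul_assoc]
    rw [hR.lTensor_pr_comul_ι_mul he, map_add, h1, ← hx, map_mul, map_sum]
    have h2 := hZ (e a)
    rw [he.coact_eq, map_sum, map_sum] at h2
    have h3 : (Z * F (ι (e a)) - F (ι (e a)) * Z) * F x =
        ∑ b, commOp actA U.coact F.toLinearMap g (act (t a b) x ⊗ₜ e b) := by
      rw [h2, Finset.sum_mul]
      simp only [rslice_tmul, map_smul, smul_mul_assoc, commOp_cofam actA _ g he]
      have h4 := hF m t he.toIsComatrix
      simp only [AlgHom.toLinearMap_apply] at h4 ⊢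
      simp only [h4, Finset.smul_sum]
      rw [Finset.sum_comm]
    rw [← h3]
    simp only [sub_mul, mul_sub, mul_assoc]
    abel

end Commutator

namespace YDMod

/-! ### The square of the antipode -/

section Twist

variable (V : YDMod.{u, w, v} k H)

/-- The map `v ↦ S(v₍₋₁₎) · v₍₀₎`. -/
def twist : V →ₗ[k] V := TensorProduct.lift (V.act.toLinearMap ∘ₗ antipode k) ∘ₗ V.coact

variable {V}

theorem twist_cofam {m : ℕ} {t : Fin m → Fin m → H} {e : Fin m → V} (he : IsCofam V.coact t e)
    (a : Fin m) : V.twist (e a) = ∑ b, V.act (antipode k (t a b)) (e b) := by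
  simp [twist, he.coact_eq]

theorem sum_act_twist {m : ℕ} {t : Fin m → Fin m → H} {e : Fin m → V}
    (he : IsCofam V.coact t e) (a : Fin m) : ∑ b, V.act (t a b) (V.twist (e b)) = e a := by
  have h : ∀ c, ∑ b, V.act (t a b) (V.act (antipode k (t b c)) (e c)) =
      if a = c then e c else 0 := by
    intro c
    have := congrArg (· (e c)) (he.sum_mul_antipode_act V.act a c)
    simp only [LinearMap.sum_apply, Module.End.mul_apply] at this
    rw [this]
    split_ifs <;> rfl
  simp only [twist_cofam he, map_sum]
  rw [Finset.sum_comm]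
  simp [h]

theorem twist_act {m : ℕ} {t : Fin m → Fin m → H} (ht : IsComatrix (k := k) t) (p q : Fin m)
    (v : V) : V.twist (V.act (t p q) v) =
      V.act (antipode k (antipode k (t p q))) (V.twist v) := by
  obtain ⟨n, s, e, a, he, rfl⟩ := V.exists_cofam v
  let σ : H ⊗[k] V →ₗ[k] V := TensorProduct.lift (V.act.toLinearMap ∘ₗ antipode k)
  have hσ : ∀ (h : H) (z : H ⊗[k] V), σ ((LinearMap.mulRight k h).rTensor V z) =
      V.act (antipode k h) (σ z) := by
    intro h z
    induction z with
    | zero => simp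
    | add x y hx hy => simp only [map_add, hx, hy]
    | tmul g w => simp [σ, antipode_mul_antidistrib]
  have h1 : ∀ q, ∑ r, V.act (antipode k (t r q)) (V.twist (V.act (t p r) (e a))) =
      if p = q then V.twist (e a) else 0 := by
    intro q
    have := congrArg σ (YDAt.compat_comatrix ht he a (V.ydAt _) p q)
    simp only [map_sum, hσ] at this
    refine this.trans ?_
    rw [Finset.sum_comm]
    simp only [σ, TensorProduct.lift.tmul, LinearMap.comp_apply, AlgHom.toLinearMap_apply,
      antipode_mul_antidistrib, map_mul, Module.End.mul_apply, ← map_sum]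
    simp only [← Module.End.mul_apply, ← LinearMap.sum_apply, ht.sum_antipode_mul_act,
      twist_cofam he]
    split_ifs <;> simp
  have h2 : ∀ r, ∑ c, V.act (antipode k (antipode k (t c q))) (V.act (antipode k (t r c))
      (V.twist (V.act (t p r) (e a)))) = if r = q then V.twist (V.act (t p r) (e a)) else 0 := by
    intro r
    have := congrArg (fun h => V.act (antipode k h) (V.twist (V.act (t p r) (e a))))
      (ht.mul_antipode r q)
    simp only [map_sum, antipode_mul_antidistrib, map_mul, LinearMap.sum_apply,
      Module.End.mul_apply] at this
    rw [this]
    split_ifs <;> simp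
  have h3 : ∑ c, V.act (antipode k (antipode k (t c q))) (∑ r, V.act (antipode k (t r c))
      (V.twist (V.act (t p r) (e a)))) = V.twist (V.act (t p q) (e a)) := by
    simp only [map_sum]
    rw [Finset.sum_comm]
    simp [h2]
  rw [← h3]
  simp [h1, apply_ite]

theorem twist_coact {m : ℕ} {t : Fin m → Fin m → H} {e : Fin m → V} (he : IsCofam V.coact t e)
    (a : Fin m) : V.coact (V.twist (e a)) =
      ∑ b, antipode k (antipode k (t a b)) ⊗ₜ V.twist (e b) := by
  let T : Fin m → Fin m → H := fun p q => antipode k (t q p)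
  have hT : IsComatrix (k := k) T := ⟨fun p q => he.comul_antipode q p, fun p q => by
    simp only [T, counit_antipode, he.counit_eq, eq_comm]⟩
  have h1 : ∀ q, ∑ r, (LinearMap.mulRight k (T r q)).rTensor V (V.coact (V.twist (e r))) =
      1 ⊗ₜ V.twist (e q) := by
    intro q
    have h2 : ∀ b, _ := fun b => YDAt.compat_comatrix hT he b (V.ydAt _) b q
    have h3 := Finset.sum_congr (rfl : (Finset.univ : Finset (Fin m)) = Finset.univ)
      fun b _ => h2 b
    rw [Finset.sum_comm] at h3
    simp only [← map_sum] at h3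
    simp only [twist_cofam he]
    refine h3.trans ?_
    rw [Finset.sum_comm]
    have h4 : ∀ r d, ∑ b, (T b r * t b d) ⊗ₜ[k] V.act (T r q) (e d) =
        (if r = d then (1 : H) else 0) ⊗ₜ V.act (T r q) (e d) := by
      intro r d
      rw [← sum_tmul]
      exact congrArg (· ⊗ₜ[k] _) (he.antipode_mul r d)
    have h5 : ∀ r, ∑ b, ∑ d, (T b r * t b d) ⊗ₜ[k] V.act (T r q) (e d) =
        1 ⊗ₜ V.act (T r q) (e r) := by
      intro r
      rw [Finset.sum_comm]
      simp only [h4]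
      rw [Finset.sum_eq_single r]
      · rw [if_pos rfl]
      · intro d _ hd; rw [if_neg (Ne.symm hd), zero_tmul]
      · simp
    simp only [h5, tmul_sum]
    rfl
  have h6 : ∑ q, (LinearMap.mulRight k (antipode k (T q a))).rTensor V
      (∑ r, (LinearMap.mulRight k (T r q)).rTensor V (V.coact (V.twist (e r)))) =
      V.coact (V.twist (e a)) := by
    simp only [map_sum]
    rw [Finset.sum_comm]
    have h7 : ∀ r (z : H ⊗[k] V), ∑ q, (LinearMap.mulRight k (antipode k (T q a))).rTensor V
        ((LinearMap.mulRight k (T r q)).rTensor V z) = if r = a then z else 0 := by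
      intro r z
      induction z with
      | zero => simp
      | add x y hx hy => simp only [map_add, Finset.sum_add_distrib, hx, hy]; split_ifs <;> simp
      | tmul g w =>
        have := congrArg (fun h => (g * h) ⊗ₜ[k] w) (hT.mul_antipode r a)
        simp only [Finset.mul_sum, sum_tmul, ← mul_assoc] at this
        refine this.trans ?_
        split_ifs <;> simp
    simp [h7]
  rw [← h6]
  simp only [h1, LinearMap.rTensor_tmul, LinearMap.mulRight_apply, one_mul, T]

variable [FiniteDimensional k V] [BijectiveAntipode k H]

theorem twist_bijective : Function.Bijective V.twist := by
  have h : Function.Injective V.twist := by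
    rw [← LinearMap.ker_eq_bot, LinearMap.ker_eq_bot']
    intro v hv
    obtain ⟨m, t, e, a, he, rfl⟩ := V.exists_cofam v
    have h1 := twist_coact he a
    rw [hv, map_zero] at h1
    have h2 := congrArg ((antipodeInv k ∘ₗ antipodeInv k).rTensor V) h1
    simp only [map_sum, LinearMap.rTensor_tmul, LinearMap.comp_apply, antipodeInv_antipode,
      map_zero] at h2
    have h3 := congrArg (TensorProduct.lift V.act.toLinearMap) h2
    simp only [map_sum, map_zero, TensorProduct.lift.tmul, AlgHom.toLinearMap_apply,
      sum_act_twist he] at h3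
    exact h3.symm
  exact ⟨h, LinearMap.injective_iff_surjective.1 h⟩

end Twist

end YDMod

namespace YDMod

variable {ι : Type} [Fintype ι] [DecidableEq ι] {M : ι → YDMod.{u, w, v} k H} {i : ι}

/-! ### Braided commutators with the elements of `M i` -/

section AdOp

variable (M i) in
/-- The operator `y ↦ S(v₍₋₁₎) · (v₍₀₎ y)`. -/
def adOp : M i →ₗ[k] Module.End k (pi M).Nichols :=
  TensorProduct.lift ((LinearMap.mul k (Module.End k (pi M).Nichols)).compl₁₂
    ((pi M).nAct.toLinearMap ∘ₗ antipode k) (LinearMap.mul k (pi M).Nichols ∘ₗ inc M i)) ∘ₗ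
    (M i).coact

variable {m : ℕ} {t : Fin m → Fin m → H} {e : Fin m → M i}

theorem adOp_cofam (he : IsCofam (M i).coact t e) (a : Fin m) : adOp M i (e a) =
    ∑ b, (pi M).nAct (antipode k (t a b)) * LinearMap.mul k (pi M).Nichols (inc M i (e b)) := by
  simp [adOp, he.coact_eq]

theorem adOp_mulLeft (he : IsCofam (M i).coact t e) (a : Fin m) (y : (pi M).Nichols) :
    adOp M i (e a) * LinearMap.mul k (pi M).Nichols y -
      LinearMap.mul k (pi M).Nichols y * adOp M i (e a) =
    ∑ b, (pi M).nAct (antipode k (t a b)) *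
      LinearMap.mul k (pi M).Nichols ((pi M).adc (inc M i (e b)) y) := by
  have hE := (pi M).n_isPre.toIsYDAlg.isEquivariant_mulLeft
  have hm : ∀ x z : (pi M).Nichols, LinearMap.mul k (pi M).Nichols x *
      LinearMap.mul k (pi M).Nichols z = LinearMap.mul k (pi M).Nichols (x * z) := by
    intro x z; ext; simp [mul_assoc]
  simp only [adOp_cofam he, Finset.sum_mul, Finset.mul_sum, ← mul_assoc,
    hE.mul_antipode he.toIsComatrix]
  rw [Finset.sum_comm, ← Finset.sum_sub_distrib]
  refine Finset.sum_congr rfl fun b _ => ?_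
  simp only [mul_assoc, ← Finset.mul_sum, hm, ← map_sum, ← mul_sub, ← map_sub,
    adc_cofam (inc_cofam he)]

variable [BijectiveAntipode k H]

theorem adOp_pder (he : IsCofam (M i).coact t e) (a : Fin m) (φ : M i →ₗ[k] k) :
    adOp M i (e a) * pder M i φ - pder M i φ * adOp M i (e a) =
      -∑ c, φ ((M i).twist (e c)) • (pi M).nAct (antipode k (t a c)) := by
  have h1 : ∀ b : Fin m, pder M i φ * (pi M).nAct (antipode k (t a b)) =
      ∑ c, (pi M).nAct (antipode k (t a c)) *
        pder M i (φ ∘ₗ (M i).act (antipode k (t c b))) := by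
    intro b
    have h2 : ∀ c d, (pi M).nAct (t c d) * pder M i φ = ∑ p,
        pder M i (φ ∘ₗ (M i).act (antipode k (t c p))) * (pi M).nAct (t p d) := by
      intro c d; ext x; simpa using act_pder he.toIsComatrix c d φ x
    have h3 : ∀ c, pder M i (φ ∘ₗ (M i).act (antipode k (t c b))) =
        ∑ d, (pi M).nAct (t c d) * pder M i φ * (pi M).nAct (antipode k (t d b)) := by
      intro c
      simp only [h2, Finset.sum_mul]
      rw [Finset.sum_comm]
      simp only [mul_assoc, ← Finset.mul_sum, he.toIsComatrix.sum_mul_antipode_act, mul_ite,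
        mul_one, mul_zero]
      simp
    simp only [h3, Finset.mul_sum, ← mul_assoc]
    rw [Finset.sum_comm]
    simp only [← Finset.sum_mul, he.toIsComatrix.sum_antipode_mul_act, ite_mul, one_mul, zero_mul]
    simp
  have h4 : ∀ (ψ : M i →ₗ[k] k) b, pder M i ψ * LinearMap.mul k (pi M).Nichols (inc M i (e b)) =
      ψ (e b) • 1 + ∑ d, LinearMap.mul k (pi M).Nichols (inc M i (e d)) *
        pder M i (ψ ∘ₗ (M i).act (t b d)) := by
    intro ψ b; ext x; simpa using pder_inc_mul he b ψ x
  have h5 : ∀ c d, ∑ b, pder M i ((φ ∘ₗ (M i).act (antipode k (t c b))) ∘ₗ (M i).act (t b d)) =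
      if c = d then pder M i φ else 0 := by
    intro c d
    rw [← map_sum]
    have : ∑ b, (φ ∘ₗ (M i).act (antipode k (t c b))) ∘ₗ (M i).act (t b d) =
        φ ∘ₗ (∑ b, (M i).act (antipode k (t c b)) * (M i).act (t b d)) := by
      ext x; simp
    rw [this, he.toIsComatrix.sum_antipode_mul_act]
    split_ifs
    · rfl
    · simp
  simp only [adOp_cofam he, Finset.mul_sum, ← mul_assoc, h1, Finset.sum_mul]
  rw [Finset.sum_comm, ← Finset.sum_sub_distrib, ← Finset.sum_neg_distrib]
  refine Finset.sum_congr rfl fun c _ => ?_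
  simp only [mul_assoc, ← Finset.mul_sum, ← mul_sub, h4, Finset.sum_add_distrib]
  rw [Finset.sum_comm]
  simp only [← Finset.mul_sum, h5, mul_ite, mul_zero]
  simp only [Finset.sum_ite_eq, Finset.mem_univ, if_true, sub_add_cancel_right, mul_neg,
    ← Finset.sum_smul, LinearMap.comp_apply, ← map_sum, twist_cofam he]
  ext x
  simp

variable [∀ j, FiniteDimensional k (M j)]

theorem bder_isEquivariant :
    IsEquivariant (M i).dual.nAct (pi M).nAct (bder M i).toLinearMap := by
  refine (M i).dual.n_isPre.isEquivariant fun m t ht a b f => ?_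
  ext x
  simp only [Module.End.mul_apply, LinearMap.comp_apply, AlgHom.toLinearMap_apply, bder_nι,
    LinearMap.sum_apply]
  exact act_pder ht a b (dualForm f) x

variable (M i) in
theorem smashRep_isEquivariant :
    IsEquivariant (smashAct M i) (pi M).nAct (smashRep M i) :=
  (pi M).n_isPre.toIsYDAlg.isEquivariant_mulLeft.lift_mul bder_isEquivariant

theorem adOp_bder (he : IsCofam (M i).coact t e) (a : Fin m) (ξ : (M i).dual.Nichols) :
    adOp M i (e a) * bder M i ξ - bder M i ξ * adOp M i (e a) =
      -∑ c, bder M i (dualRder ((M i).twist (e c)) ξ) * (pi M).nAct (antipode k (t a c)) := by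
  have h0 : ∀ f : (M i).dual, rslice (dualEval ((M i).twist (e a))) ((M i).dual.coact f) =
      ∑ c, dualForm f ((M i).twist (e c)) • antipode k (t a c) := by
    intro f
    rw [rslice, LinearMap.comp_apply, dual_coact_eval, twist_coact he]
    simp [antipodeInv_antipode]
  have h1 := (M i).dual.n_isPre.commutator_eq (actA := (pi M).nAct) (F := bder M i)
    bder_isEquivariant (g := -dualEval ((M i).twist (e a))) (Z := adOp M i (e a)) (by
      intro f
      have : ∀ z : H ⊗[k] (M i).dual, rslice (-dualEval ((M i).twist (e a))) z =
          -rslice (dualEval ((M i).twist (e a))) z := by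
        intro z; simp [rslice, LinearMap.lTensor_neg]
      rw [bder_nι, adOp_pder he, this, h0, map_neg, map_sum]
      simp only [map_smul]) ξ
  rw [h1]
  have h2 : ∀ z : (M i).dual.Nichols ⊗[k] (M i).dual.Nichols,
      commOp (pi M).nAct (M i).dual.coact (bder M i).toLinearMap
        (-dualEval ((M i).twist (e a))) ((M i).dual.nPr.lTensor _ z) =
      -∑ c, bder M i (rslice (dualEval ((M i).twist (e c)) ∘ₗ (M i).dual.nPr) z) *
        (pi M).nAct (antipode k (t a c)) := by
    intro z
    induction z with
    | zero => simp
    | add x y hx hy =>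
      simp only [map_add, hx, hy, add_mul, Finset.sum_add_distrib]; abel
    | tmul x y =>
      have : ∀ z : H ⊗[k] (M i).dual, rslice (-dualEval ((M i).twist (e a))) z =
          -rslice (dualEval ((M i).twist (e a))) z := by
        intro z; simp [rslice, LinearMap.lTensor_neg]
      rw [LinearMap.lTensor_tmul, commOp_tmul, this, h0]
      ext z
      simp [dualEval_apply]
  exact h2 _

theorem adOp_smashRep (he : IsCofam (M i).coact t e) (a : Fin m) (s : Smash M i) :
    adOp M i (e a) * smashRep M i s - smashRep M i s * adOp M i (e a) =
      ∑ b, (pi M).nAct (antipode k (t a b)) * smashRep M i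
        (((pi M).adc (inc M i (e b))).rTensor _ s -
          ∑ d, smashAct M i (t b d) ((dualRder ((M i).twist (e d))).lTensor _ s)) := by
  have h1 : adOp M i (e a) * smashRep M i s - smashRep M i s * adOp M i (e a) =
      (∑ b, (pi M).nAct (antipode k (t a b)) * smashRep M i
        (((pi M).adc (inc M i (e b))).rTensor _ s)) -
      ∑ d, smashRep M i ((dualRder ((M i).twist (e d))).lTensor _ s) *
        (pi M).nAct (antipode k (t a d)) := by
    induction s using TensorProduct.induction_on with
    | zero => simp
    | add x y hx hy =>
      simp only [map_add, mul_add, add_mul, Finset.sum_add_distrib]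
      rw [add_sub_add_comm, hx, hy]; abel
    | tmul x ξ =>
      have e1 : ∀ (x : (pi M).Nichols) (ξ : (M i).dual.Nichols), smashRep M i (x ⊗ₜ ξ) =
        LinearMap.mul k (pi M).Nichols x * bder M i ξ := fun _ _ => rfl
      simp only [LinearMap.rTensor_tmul, LinearMap.lTensor_tmul, e1]
      have h2 := adOp_mulLeft he a x
      have h3 := adOp_bder he a ξ
      have h4 : adOp M i (e a) * (LinearMap.mul k (pi M).Nichols x * bder M i ξ) -
        (LinearMap.mul k (pi M).Nichols x * bder M i ξ) * adOp M i (e a) =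
        (adOp M i (e a) * LinearMap.mul k (pi M).Nichols x -
          LinearMap.mul k (pi M).Nichols x * adOp M i (e a)) * bder M i ξ +
        LinearMap.mul k (pi M).Nichols x *
          (adOp M i (e a) * bder M i ξ - bder M i ξ * adOp M i (e a)) := by
        simp only [sub_mul, mul_sub, mul_assoc]; abel
      have h5 : ∀ f g : Module.End k (pi M).Nichols, f * -g = -(f * g) := by
        intro f g; ext; simp
      rw [h4, h2, h3, h5, ← sub_eq_add_neg]
      simp only [Finset.sum_mul, Finset.mul_sum, mul_assoc]
  rw [h1, eq_comm]
  have h2 : ∀ b, (pi M).nAct (antipode k (t a b)) * smashRep M i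
        (((pi M).adc (inc M i (e b))).rTensor _ s -
          ∑ d, smashAct M i (t b d) ((dualRder ((M i).twist (e d))).lTensor _ s)) =
      (pi M).nAct (antipode k (t a b)) * smashRep M i
        (((pi M).adc (inc M i (e b))).rTensor _ s) - ∑ d, (pi M).nAct (antipode k (t a b)) *
          smashRep M i (smashAct M i (t b d) ((dualRder ((M i).twist (e d))).lTensor _ s)) := by
    intro b
    rw [map_sub, map_sum, mul_sub, Finset.mul_sum]
  rw [Finset.sum_congr rfl fun b _ => h2 b, Finset.sum_sub_distrib, Finset.sum_comm]
  congr 1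
  exact Finset.sum_congr rfl fun d _ =>
    ((smashRep_isEquivariant M i).mul_antipode he.toIsComatrix a d _).symm

end AdOp

end YDMod

namespace YDMod

variable {ι : Type} [Fintype ι] [DecidableEq ι] {M : ι → YDMod.{u, w, v} k H} {i : ι}

theorem IsSub.exists_cofam {V : YDMod.{u, w, v} k H} {P : Submodule k V} (hP : V.IsSub P) {x : V}
    (hx : x ∈ P) : ∃ (m : ℕ) (t : Fin m → Fin m → H) (e : Fin m → V) (a : Fin m),
      IsCofam V.coact t e ∧ (∀ b, e b ∈ P) ∧ e a = x := by
  obtain ⟨m, t, e, a, he, ha⟩ := (sub hP).exists_cofam ⟨x, hx⟩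
  exact ⟨m, t, fun a => (e a).1, a, he.map (sub_isYDMap hP).map_coact, fun b => (e b).2,
    congrArg Subtype.val ha⟩

theorem exists_nichols_cofam {U : YDMod.{u, w, v} k H} {P : Submodule k U.Nichols}
    (hP : U.nichols.IsSub P) {x : U.Nichols} (hx : x ∈ P) :
    ∃ (m : ℕ) (t : Fin m → Fin m → H) (e : Fin m → U.Nichols) (a : Fin m),
      IsCofam U.nCoact.toLinearMap t e ∧ (∀ b, e b ∈ P) ∧ e a = x :=
  IsSub.exists_cofam (V := U.nichols) hP hx

/-! ### Operators commuting with `B((M i)*)` -/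

section CoinvOp

variable (M i) in
/-- The projection onto the coinvariants along `K B(M i)⁺`. -/
def coinvProj : (pi M).Nichols →ₗ[k] (pi M).Nichols :=
  (coinvariants M i).projection (coinvCompl M i) (coinv_isCompl M i)

theorem coinvProj_mem (x : (pi M).Nichols) : coinvProj M i x ∈ coinvariants M i :=
  Submodule.projection_apply_mem _ x

theorem coinvProj_of_mem {x : (pi M).Nichols} (hx : x ∈ coinvariants M i) :
    coinvProj M i x = x := Submodule.projection_apply_of_mem_left _ hx

theorem coinvProj_eq_zero {x : (pi M).Nichols} : coinvProj M i x = 0 ↔ x ∈ coinvCompl M i :=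
  Submodule.projection_apply_eq_zero_iff _

theorem sub_coinvProj_mem (x : (pi M).Nichols) : x - coinvProj M i x ∈ coinvCompl M i := by
  rw [← coinvProj_eq_zero, map_sub, coinvProj_of_mem (coinvProj_mem x), sub_self]

theorem coinvProj_mul {x : (pi M).Nichols} (hx : x ∈ coinvariants M i) (y : (pi M).Nichols) :
    coinvProj M i (x * y) = x * coinvProj M i y := by
  have h1 : ∀ z ∈ coinvCompl M i, x * z ∈ coinvCompl M i := by
    intro z hz
    refine Submodule.mul_induction_on (C := fun z => x * z ∈ coinvCompl M i) hz ?_ ?_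
    · intro a ha b hb
      rw [← mul_assoc]
      exact Submodule.mul_mem_mul (coinv_mul hx ha) hb
    · intro a b ha hb
      rw [mul_add]; exact add_mem ha hb
  have h2 := coinvProj_eq_zero.2 (h1 _ (sub_coinvProj_mem y))
  rw [mul_sub, map_sub, sub_eq_zero] at h2
  rw [h2, coinvProj_of_mem (coinv_mul hx (coinvProj_mem y))]

theorem counit_coinvProj (x : (pi M).Nichols) :
    (pi M).nCounit (coinvProj M i x) = (pi M).nCounit x := by
  have h1 : ∀ z ∈ coinvCompl M i, (pi M).nCounit z = 0 := by
    intro z hz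
    refine Submodule.mul_induction_on (C := fun z => (pi M).nCounit z = 0) hz ?_ ?_
    · intro a _ b hb
      rw [map_mul, show (pi M).nCounit b = 0 from hb.2, mul_zero]
    · intro a b ha hb
      rw [map_add, ha, hb, add_zero]
  have h2 := h1 _ (sub_coinvProj_mem x)
  rw [map_sub, sub_eq_zero] at h2
  exact h2.symm

theorem gr_coinv_mul {x y : (pi M).Nichols} (hx : x ∈ coinvariants M i)
    (hy : y ∈ coinvariants M i) {γ : ι → ℤ} (h : height i γ = 1) :
    gr M γ (x * y) = (pi M).nCounit x • gr M γ y + (pi M).nCounit y • gr M γ x := by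
  have h0 : ∀ {x : (pi M).Nichols}, x ∈ coinvariants M i → ∀ γ, height i γ ≤ 0 →
      gr M γ (x - (pi M).nCounit x • 1) = 0 := by
    intro x hx γ hγ
    refine coinv_gr_of_counit (sub_mem hx (Submodule.smul_mem _ _ coinv_one)) ?_ hγ
    simp
  have h1 : gr M γ 1 = 0 := by
    rw [(gr_isGr M).comp_one, if_neg]
    rintro rfl
    simp at h
  have h2 := gr_mul_of_height (h0 hx) (h0 hy) h.le
  rw [sub_mul, mul_sub, mul_sub] at h2
  simp only [map_sub, smul_one_mul, mul_smul_one, map_smul, h1, smul_zero, sub_zero] at h2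
  rw [sub_sub, sub_eq_zero] at h2
  rw [h2, add_comm]

variable (M i) in
/-- The right skew derivation `x ↦ x⁽¹⁾ g(ϑ(x⁽²⁾))`, where `ϑ` is the projection to the component
of degree `γ` of the coinvariants. -/
def coinvOp (γ : ι → ℤ) (g : (pi M).Nichols →ₗ[k] k) : Module.End k (pi M).Nichols :=
  rhit (pi M).nComul (g ∘ₗ gr M γ ∘ₗ coinvProj M i)

theorem coinvOp_mulLeft {γ : ι → ℤ} (h : height i γ = 1) (g : (pi M).Nichols →ₗ[k] k)
    {x : (pi M).Nichols} (hx : x ∈ coinvariants M i) :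
    coinvOp M i γ g * LinearMap.mul k (pi M).Nichols x -
      LinearMap.mul k (pi M).Nichols x * coinvOp M i γ g =
    commOp (pi M).nAct (pi M).nCoact.toLinearMap (LinearMap.mul k (pi M).Nichols) g
      ((gr M γ).lTensor _ ((pi M).nComul x)) := by
  have hB := (pi M).n_isPre
  let G : (pi M).Nichols →ₗ[k] k := g ∘ₗ gr M γ ∘ₗ coinvProj M i
  have hG : ∀ {x : (pi M).Nichols}, x ∈ coinvariants M i → ∀ y, G (x * y) =
      (pi M).nCounit x * G y + (pi M).nCounit y * g (gr M γ x) := by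
    intro x hx y
    simp only [G, LinearMap.comp_apply, coinvProj_mul hx, gr_coinv_mul hx (coinvProj_mem y) h,
      map_add, map_smul, smul_eq_mul, counit_coinvProj]
  have key : ∀ {b : (pi M).Nichols}, b ∈ coinvariants M i → ∀ (a : (pi M).Nichols) z,
      rslice G (bmul (pi M).nAct (pi M).nCoact (a ⊗ₜ b) z) =
      (pi M).nCounit b • (a * rslice G z) +
        a * (pi M).nAct (rslice g ((pi M).nCoact (gr M γ b)))
          (TensorProduct.rid k _ ((pi M).nCounit.toLinearMap.lTensor _ z)) := by
    intro b hb a z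
    obtain ⟨m, t, e, p, he, heK, rfl⟩ := exists_nichols_cofam (coinv_isSub M i) hb
    induction z with
    | zero => simp
    | add x y hx hy =>
      simp only [map_add, hx, hy, smul_add, mul_add]; abel
    | tmul c d =>
      have h1 : (pi M).nCoact (gr M γ (e p)) = ∑ q, t p q ⊗ₜ gr M γ (e q) := by
        rw [hB.comp_coact (isDec_pi M) (gr_isGr M)]
        have := he.coact_eq p
        rw [AlgHom.toLinearMap_apply] at this
        rw [this]
        simp
      have h2 : ∑ q, (pi M).nCounit (e q) • t p q = (pi M).nCounit (e p) • (1 : H) := by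
        have h3 := hB.counit_coact (e p)
        have := he.coact_eq p
        rw [AlgHom.toLinearMap_apply] at this
        rw [this] at h3
        have h4 := congrArg (TensorProduct.rid k H) h3
        simpa using h4
      rw [bmul_tmul he, map_sum]
      simp only [rslice_tmul, hG (heK _), h1, map_sum, LinearMap.lTensor_tmul, rid_tmul,
        map_smul, add_smul, Finset.sum_add_distrib, LinearMap.sum_apply, LinearMap.smul_apply]
      congr 1
      · have h5 := congrArg (fun h => (G d) • (a * (pi M).nAct h c)) h2
        simp only [map_sum, map_smul, LinearMap.sum_apply, LinearMap.smul_apply, Finset.mul_sum,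
          Finset.smul_sum, map_one, Module.End.one_apply, mul_smul_comm, smul_smul] at h5 ⊢
        rw [mul_comm _ (G d), ← h5]
        exact Finset.sum_congr rfl fun q _ => by rw [mul_comm]
      · simp only [Finset.mul_sum, mul_smul_comm, Finset.smul_sum, smul_smul,
          AlgHom.toLinearMap_apply]
  obtain ⟨n, a, b, -, hb, hab⟩ := exists_rep_left_mem (z := (pi M).nComul x)
    (P := coinvariants M i) fun φ => coinv_lhit hx φ
  ext y
  have h1 : coinvOp M i γ g (x * y) = rslice G (bmul (pi M).nAct (pi M).nCoact
      ((pi M).nComul x) ((pi M).nComul y)) := by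
    rw [← hB.comul_mul]; rfl
  have h2 : x = ∑ c, (pi M).nCounit (b c) • a c := by
    have := hB.comul_counit x
    rw [hab] at this
    simpa using this.symm
  simp only [LinearMap.sub_apply, Module.End.mul_apply, LinearMap.mul_apply', h1]
  rw [hab]
  simp only [map_sum, LinearMap.sum_apply, key (hb _), hB.comul_counit, LinearMap.lTensor_tmul,
    commOp_tmul, Finset.sum_add_distrib, Module.End.mul_apply, LinearMap.mul_apply',
    AlgHom.toLinearMap_apply]
  have h3 : rslice G ((pi M).nComul y) = coinvOp M i γ g y := rfl
  have h4 : ∑ c, (pi M).nCounit (b c) • (a c * coinvOp M i γ g y) = x * coinvOp M i γ g y := by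
    conv_rhs => rw [h2]
    simp only [Finset.sum_mul, smul_mul_assoc]
  rw [h3, h4, add_sub_cancel_left]

theorem coinvOp_pder (γ : ι → ℤ) (g : (pi M).Nichols →ₗ[k] k) (φ : M i →ₗ[k] k) :
    coinvOp M i γ g * pder M i φ = pder M i φ * coinvOp M i γ g := by
  ext x
  exact ((pi M).n_isPre.lhit_rhit _ _ x).symm

variable [∀ j, FiniteDimensional k (M j)] [BijectiveAntipode k H]

theorem coinvOp_bder (γ : ι → ℤ) (g : (pi M).Nichols →ₗ[k] k) (ξ : (M i).dual.Nichols) :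
    coinvOp M i γ g * bder M i ξ = bder M i ξ * coinvOp M i γ g := by
  refine dual_ind (p := fun ξ => coinvOp M i γ g * bder M i ξ = bder M i ξ * coinvOp M i γ g)
    ?_ ?_ ?_ ?_ ξ
  · simp
  · intro x y hx hy
    simp only [map_add, mul_add, add_mul, hx, hy]
  · intro c x hx
    simp only [map_smul, mul_smul_comm, smul_mul_assoc, hx]
  · intro f x hx
    rw [map_mul, bder_nι, ← mul_assoc, coinvOp_pder, mul_assoc, hx, mul_assoc]

omit [∀ j, FiniteDimensional k (M j)] [BijectiveAntipode k H] in
theorem gr_lTensor_comul_adPow {j : ι} {n : ℕ} {x : (pi M).Nichols} (hx : x ∈ adPow M i j n) :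
    (gr M (adDeg i j n)).lTensor _ ((pi M).nComul x) = 1 ⊗ₜ x := by
  have hB := (pi M).n_isPre
  have h1 := hB.lTensor_comul_comp (isDec_pi M) (gr_isGr M) (adDeg i j n) (adDeg i j n) x
  rw [gr_adPow hx, sub_self] at h1
  have h2 : gr M 0 = (LinearMap.toSpanSingleton k _ 1) ∘ₗ (pi M).nCounit.toLinearMap := by
    ext x; simp [gr_zero]
  have h3 : ∀ z, TensorProduct.map (gr M 0) (gr M (adDeg i j n)) z =
      1 ⊗ₜ gr M (adDeg i j n) (TensorProduct.lid k _
        ((pi M).nCounit.toLinearMap.rTensor _ z)) := by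
    intro z
    induction z with
    | zero => simp
    | add x y hx hy => simp only [map_add, hx, hy, tmul_add]
    | tmul c d => simp [gr_zero, smul_tmul]
  rw [h1, h3, hB.counit_comul, gr_adPow hx]

omit [∀ j, FiniteDimensional k (M j)] [BijectiveAntipode k H] in
theorem gr_lTensor_comul_adPow_of_ne {j l : ι} (hj : j ≠ i) (hl : l ≠ i) (hjl : j ≠ l) {n m : ℕ}
    {x : (pi M).Nichols} (hx : x ∈ adPow M i l n) :
    (gr M (adDeg i j m)).lTensor _ ((pi M).nComul x) = 0 := by
  have h1 := (pi M).n_isPre.lTensor_comul_comp (isDec_pi M) (gr_isGr M) (adDeg i j m)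
    (adDeg i l n) x
  rw [gr_adPow hx] at h1
  have h2 : gr M (adDeg i l n - adDeg i j m) = 0 := by
    ext x
    refine gr_neg M j ?_ x
    rw [Pi.sub_apply, adDeg_apply hj m hj, adDeg_apply hl n hj]
    simp [hjl]
  rw [h1, h2]
  generalize (pi M).nComul x = z
  induction z with
  | zero => simp
  | add x y hx hy => simp only [map_add, hx, hy, add_zero]
  | tmul c d => simp

end CoinvOp

end YDMod

section Pre

variable {R : Type*} [Ring R] [Algebra k R] {act : H →ₐ[k] Module.End k R}
  {coact : R →ₐ[k] H ⊗[k] R}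

theorem IsYDAlg.bmul_one_tmul_right (hR : IsYDAlg act coact) (y : R) (z : R ⊗[k] R) :
    bmul act coact z (1 ⊗ₜ y) = (LinearMap.mulRight k y).lTensor R z := by
  induction z with
  | zero => simp
  | add x y hx hy => simp only [map_add, LinearMap.add_apply, hx, hy]
  | tmul a b =>
    obtain ⟨m, t, e, p, he, rfl⟩ := hR.exists_cofam b
    rw [bmul_tmul he]
    simp [act_one_comatrix hR he.toIsComatrix, ite_tmul]

theorem IsYDAlg.lTensor_bmul_tmul_one (hR : IsYDAlg act coact) {f : R →ₗ[k] R}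
    (hf : IsYDMap act coact.toLinearMap act coact.toLinearMap f) (c : R) (z : R ⊗[k] R) :
    f.lTensor R (bmul act coact z (c ⊗ₜ 1)) = bmul act coact (f.lTensor R z) (c ⊗ₜ 1) := by
  induction z with
  | zero => simp
  | add x y hx hy => simp only [map_add, LinearMap.add_apply, hx, hy]
  | tmul a b =>
    obtain ⟨m, t, e, p, he, rfl⟩ := hR.exists_cofam b
    have he' : IsCofam coact.toLinearMap t (fun a => f (e a)) := he.map hf.map_coact
    rw [bmul_tmul he, LinearMap.lTensor_tmul, bmul_tmul he' p]
    simp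

end Pre

namespace YDMod

variable {ι : Type} [Fintype ι] [DecidableEq ι] {M : ι → YDMod.{u, w, v} k H} {i : ι}

/-! ### Invariants of the braided commutators -/

section Invariants

variable {m : ℕ} {t : Fin m → Fin m → H} {e : Fin m → M i}

theorem comul_adc (he : IsCofam (M i).coact t e) (a : Fin m) (x : (pi M).Nichols) :
    (pi M).nComul ((pi M).adc (inc M i (e a)) x) =
      (LinearMap.mulLeft k (inc M i (e a))).rTensor _ ((pi M).nComul x) -
      ∑ b, bmul (pi M).nAct (pi M).nCoact ((pi M).nComul ((pi M).nAct (t a b) x))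
        (inc M i (e b) ⊗ₜ 1) +
      ∑ c, TensorProduct.map ((pi M).nAct (t a c)) ((pi M).adc (inc M i (e c)))
        ((pi M).nComul x) := by
  have hB := (pi M).n_isPre
  have hes : IsCofam (pi M).coact t fun a => single M i (e a) :=
    he.map (single_isHom M i).map_coact
  have h1 : ∀ z, bmul (pi M).nAct (pi M).nCoact (primTensor (pi M).nι (single M i (e a))) z =
      (LinearMap.mulLeft k (inc M i (e a))).rTensor _ z +
      ∑ b, TensorProduct.map ((pi M).nAct (t a b)) (LinearMap.mulLeft k (inc M i (e b))) z := by
    intro z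
    induction z with
    | zero => simp
    | add x y hx hy => simp only [map_add, hx, hy, Finset.sum_add_distrib]; abel
    | tmul c d =>
      rw [hB.bmul_prim hes]
      rfl
  have h2 : ∀ b, bmul (pi M).nAct (pi M).nCoact ((pi M).nComul ((pi M).nAct (t a b) x))
      ((pi M).nComul (inc M i (e b))) =
      bmul (pi M).nAct (pi M).nCoact ((pi M).nComul ((pi M).nAct (t a b) x))
        (inc M i (e b) ⊗ₜ 1) + ∑ c, TensorProduct.map ((pi M).nAct (t a c))
          (LinearMap.mulRight k (inc M i (e b)) ∘ₗ (pi M).nAct (t c b)) ((pi M).nComul x) := by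
    intro b
    rw [show (pi M).nComul (inc M i (e b)) = inc M i (e b) ⊗ₜ 1 + 1 ⊗ₜ inc M i (e b) from
      hB.comul_ι _, map_add, hB.toIsYDAlg.bmul_one_tmul_right, hB.comul_act]
    congr 1
    generalize (pi M).nComul x = z
    induction z with
    | zero => simp
    | add x y hx hy => simp only [map_add, hx, hy, Finset.sum_add_distrib]
    | tmul c d => simp [diagAct_comatrix _ _ he.toIsComatrix]
  have h3 : ∀ z : (pi M).Nichols ⊗[k] (pi M).Nichols,
      ∑ c, TensorProduct.map ((pi M).nAct (t a c)) ((pi M).adc (inc M i (e c))) z =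
      ∑ b, TensorProduct.map ((pi M).nAct (t a b)) (LinearMap.mulLeft k (inc M i (e b))) z -
      ∑ b, ∑ c, TensorProduct.map ((pi M).nAct (t a c))
        (LinearMap.mulRight k (inc M i (e b)) ∘ₗ (pi M).nAct (t c b)) z := by
    intro z
    induction z with
    | zero => simp
    | add x y hx hy => simp only [map_add, hx, hy, Finset.sum_add_distrib]; abel
    | tmul c d =>
      rw [Finset.sum_comm]
      simp [adc_cofam (inc_cofam he), tmul_sub, tmul_sum]
  rw [adc_cofam (inc_cofam he), map_sub, map_sum,
    show inc M i (e a) * x = (pi M).nι (single M i (e a)) * x from rfl, hB.comul_ι_mul, h1, h3]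
  simp only [hB.comul_mul, h2, Finset.sum_add_distrib]
  abel

variable (M i) in
/-- The elements killed by all `ad_c v`, `v ∈ M i`, and by all the operators
`x ↦ x⁽¹⁾ ⊗ p (x⁽²⁾)`, where `p` projects to a top degree component of some `L j`. -/
structure IsTopFree (x : (pi M).Nichols) : Prop where
  mem : x ∈ coinvariants M i
  ad : ∀ v : M i, (pi M).adc (inc M i v) x = 0
  top : ∀ j, j ≠ i → (gr M (adDeg i j (topDeg M i j))).lTensor _ ((pi M).nComul x) = 0

variable [∀ j, FiniteDimensional k (M j)] [BijectiveAntipode k H]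

theorem gr_lTensor_comul_eq_zero (hM : ∀ j, (M j).IsIrreducible) (hF : FinCond M i)
    {x : (pi M).Nichols} (hx : IsTopFree M i x) {j : ι} (hj : j ≠ i) {n : ℕ}
    (hn : n ≤ topDeg M i j) : (gr M (adDeg i j n)).lTensor _ ((pi M).nComul x) = 0 := by
  have := hF j hj
  have hB := (pi M).n_isPre
  induction hn using Nat.decreasingInduction with
  | self => exact hx.top j hj
  | of_succ n hn ih =>
  have h1 : ∀ v : M i, ((pi M).adc (inc M i v)).lTensor _
      ((gr M (adDeg i j n)).lTensor _ ((pi M).nComul x)) = 0 := by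
    intro v
    obtain ⟨m, t, e, p, he, rfl⟩ := (M i).exists_cofam v
    have h2 : ∀ a, ∑ c, TensorProduct.map ((pi M).nAct (t a c)) ((pi M).adc (inc M i (e c)))
        ((gr M (adDeg i j n)).lTensor _ ((pi M).nComul x)) = 0 := by
      intro a
      have h3 := congrArg ((gr M (adDeg i j (n + 1))).lTensor (pi M).Nichols) (comul_adc he a x)
      rw [hx.ad, map_zero, map_zero, map_add, map_sub, map_sum, map_sum] at h3
      have h4 : (gr M (adDeg i j (n + 1))).lTensor (pi M).Nichols
          ((LinearMap.mulLeft k (inc M i (e a))).rTensor _ ((pi M).nComul x)) = 0 := by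
        rw [← LinearMap.comp_apply, LinearMap.lTensor_comp_rTensor,
          ← LinearMap.rTensor_comp_lTensor, LinearMap.comp_apply, ih, map_zero]
      have h5 : ∀ b, (gr M (adDeg i j (n + 1))).lTensor (pi M).Nichols
          ((pi M).nComul ((pi M).nAct (t a b) x)) = 0 := by
        intro b
        have h6 : ∀ z, (gr M (adDeg i j (n + 1))).lTensor (pi M).Nichols
            (diagAct (pi M).nAct (pi M).nAct (t a b) z) = diagAct (pi M).nAct (pi M).nAct (t a b)
            ((gr M (adDeg i j (n + 1))).lTensor (pi M).Nichols z) := by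
          intro z
          induction z with
          | zero => simp
          | add x y hx hy => simp only [map_add, hx, hy]
          | tmul c d =>
            simp [diagAct_comatrix _ _ he.toIsComatrix, hB.comp_act (isDec_pi M) (gr_isGr M)]
        rw [hB.comul_act, h6, ih, map_zero]
      have h7 : ∀ c, (gr M (adDeg i j (n + 1))).lTensor (pi M).Nichols
          (TensorProduct.map ((pi M).nAct (t a c)) ((pi M).adc (inc M i (e c)))
            ((pi M).nComul x)) =
          TensorProduct.map ((pi M).nAct (t a c)) ((pi M).adc (inc M i (e c)))
        ((gr M (adDeg i j n)).lTensor _ ((pi M).nComul x)) := by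
        intro c
        generalize (pi M).nComul x = z
        induction z with
        | zero => simp
        | add x y hx hy => simp only [map_add, hx, hy]
        | tmul c d => simp [gr_adc, adDeg_succ]
      rw [h4] at h3
      simp only [hB.toIsYDAlg.lTensor_bmul_tmul_one (hB.comp_hom (isDec_pi M) (gr_isGr M) _), h5,
        h7] at h3
      simpa using h3.symm
    have h3 : ∑ a, ((pi M).nAct (antipode k (t p a))).rTensor (pi M).Nichols
        (∑ c, TensorProduct.map ((pi M).nAct (t a c)) ((pi M).adc (inc M i (e c)))
        ((gr M (adDeg i j n)).lTensor _ ((pi M).nComul x))) = 0 := by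
      simp only [h2, map_zero, Finset.sum_const_zero]
    rw [← h3]
    generalize (gr M (adDeg i j n)).lTensor _ ((pi M).nComul x) = z
    induction z with
    | zero => simp
    | add x y hx hy => simp only [map_add, hx, hy, Finset.sum_add_distrib]
    | tmul c d =>
      simp only [map_sum, LinearMap.rTensor_tmul, map_tmul, LinearMap.lTensor_tmul]
      rw [Finset.sum_comm]
      have h4 : ∀ q, ∑ a, (pi M).nAct (antipode k (t p a)) ((pi M).nAct (t a q) c) =
          if p = q then c else 0 := by
        intro q
        have := LinearMap.congr_fun (he.sum_antipode_mul_act (pi M).nAct p q) c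
        simp only [LinearMap.sum_apply, Module.End.mul_apply] at this
        rw [this]
        split_ifs <;> simp
      simp [← sum_tmul, h4, ite_tmul]
  refine eq_zero_of_lslice fun φ => ?_
  have h2 : ∀ z, lslice φ ((gr M (adDeg i j n)).lTensor _ z) =
      gr M (adDeg i j n) (lslice φ z) := fun z => by
    have := lslice_map φ LinearMap.id (gr M (adDeg i j n)) z
    simpa [LinearMap.lTensor] using this
  have h3 : ∀ v : M i, ∀ z, lslice φ (((pi M).adc (inc M i v)).lTensor (pi M).Nichols z) =
      (pi M).adc (inc M i v) (lslice φ z) := fun v z => by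
    have := lslice_map φ LinearMap.id ((pi M).adc (inc M i v)) z
    simpa [LinearMap.lTensor] using this
  have h4 : lslice φ ((gr M (adDeg i j n)).lTensor _ ((pi M).nComul x)) ∈
      adPow M i j n ⊓ adKer M i := by
    refine ⟨?_, mem_adKer.2 fun v => ?_⟩
    · rw [h2]
      exact gr_mem_adPow hj n (coinv_lhit hx.mem φ)
    · rw [← h3, h1, map_zero]
  rwa [inf_adKer_eq_bot hj (hM j) hn, Submodule.mem_bot] at h4

theorem IsTopFree.eq_smul_one (hM : ∀ j, (M j).IsIrreducible) (hF : FinCond M i)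
    {x : (pi M).Nichols} (hx : IsTopFree M i x) : x = (pi M).nCounit x • 1 := by
  have hB := (pi M).n_isPre
  rw [← sub_eq_zero]
  refine eq_zero_of_rder (U := pi M) (by simp) fun φ => ?_
  rw [map_sub, map_smul, hB.rder_one, smul_zero, sub_zero]
  have h1 : ∀ j, (gr M (Pi.single j 1)).lTensor _ ((pi M).nComul x) = 0 := by
    intro j
    by_cases hj : j = i
    · subst hj
      refine eq_zero_of_lslice fun φ => ?_
      have := lslice_map φ LinearMap.id (gr M (Pi.single j 1)) ((pi M).nComul x)
      rw [LinearMap.lTensor, this]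
      refine coinv_gr_of_height (coinv_lhit hx.mem φ) ?_ ?_
      · intro h
        have := congrFun h j
        simp at this
      · rw [height_single_self]
    · have := gr_lTensor_comul_eq_zero hM hF hx hj (Nat.zero_le _)
      rwa [adDeg_zero] at this
  have h2 : φ ∘ₗ (pi M).nPr = ∑ j, (φ ∘ₗ (pi M).nPr) ∘ₗ gr M (Pi.single j 1) := by
    ext y
    simp only [LinearMap.sum_apply, LinearMap.comp_apply]
    have h3 : ∀ j, (pi M).nPr (gr M (Pi.single j 1) y) = piQ M j ((pi M).nPr y) := by
      intro j
      rw [hB.pr_comp (isDec_pi M) (gr_isGr M), Finset.sum_eq_single j]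
      · simp
      · intro l _ hl
        rw [if_neg]
        intro h
        have := congrFun h j
        simp [Pi.single_eq_of_ne hl.symm] at this
      · simp
    simp only [h3, ← map_sum, (isDec_pi M).sum_eq]
  have h3 : ∀ χ : (pi M).Nichols →ₗ[k] k, ∀ f : (pi M).Nichols →ₗ[k] (pi M).Nichols, ∀ z,
      rslice (χ ∘ₗ f) z = rslice χ (f.lTensor (pi M).Nichols z) := by
    intro χ f z
    have := rslice_map χ LinearMap.id f z
    simpa [LinearMap.lTensor] using this.symm
  have h4 : rslice (φ ∘ₗ (pi M).nPr) ((pi M).nComul x) = 0 := by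
    rw [h2]
    have : ∀ (χ : ι → (pi M).Nichols →ₗ[k] k) (z : (pi M).Nichols ⊗[k] (pi M).Nichols),
        rslice (∑ j, χ j) z = ∑ j, rslice (χ j) z := by
      intro χ z
      induction z with
      | zero => simp
      | add x y hx hy => simp only [map_add, hx, hy, Finset.sum_add_distrib]
      | tmul a b => simp [Finset.sum_smul]
    rw [this]
    refine Finset.sum_eq_zero fun j _ => ?_
    rw [h3, h1, map_zero]
  exact h4

end Invariants

end YDMod

namespace YDMod

/-- A finite-dimensional Yetter-Drinfeld submodule has a basis that spans a family of matrix
coefficients, and the coordinates extend to linear forms on the whole module. -/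
theorem IsSub.exists_dual_cofam {V : YDMod.{u, w, v} k H} {P : Submodule k V} (hP : V.IsSub P)
    (hfg : P.FG) : ∃ (n : ℕ) (t : Fin n → Fin n → H) (e : Fin n → V)
      (χ : Fin n → V →ₗ[k] k), IsCofam V.coact t e ∧
      (∀ a b, χ a (e b) = if a = b then 1 else 0) ∧ ∀ x ∈ P, x = ∑ a, χ a x • e a := by
  have : FiniteDimensional k (sub hP) := Module.Finite.iff_fg.2 hfg
  obtain ⟨n, t, b, hb⟩ := (sub hP).exists_basis_cofam
  have hχ : ∀ a, ∃ χ : V →ₗ[k] k, χ ∘ₗ subIncl hP = b.coord a := fun a =>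
    LinearMap.exists_extend (p := P) (b.coord a)
  choose χ hχ using hχ
  have hχ' : ∀ a x, χ a (subIncl hP x) = b.coord a x := fun a x => LinearMap.congr_fun (hχ a) x
  refine ⟨n, t, fun a => subIncl hP (b a), χ, hb.map (sub_isYDMap hP).map_coact, ?_, ?_⟩
  · intro a c
    rw [hχ', Module.Basis.coord_apply, Module.Basis.repr_self, Finsupp.single_apply]
    simp only [eq_comm]
  · intro x hx
    have h1 := congrArg (subIncl hP) (b.sum_repr ⟨x, hx⟩).symm
    rw [map_sum] at h1
    refine h1.trans (Finset.sum_congr rfl fun a _ => ?_)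
    rw [map_smul]
    exact congrArg (· • subIncl hP (b a)) (hχ' a ⟨x, hx⟩).symm

variable {ι : Type} [Fintype ι] [DecidableEq ι] {M : ι → YDMod.{u, w, v} k H} {i : ι}
variable [∀ j, FiniteDimensional k (M j)] [BijectiveAntipode k H]

theorem rslice_smash {t : Smash M i} (ht : t ∈ smash M i) (ψ : (M i).dual.Nichols →ₗ[k] k) :
    rslice ψ t ∈ coinvariants M i := rslice_mem ht ψ

theorem smash_induction {p : Smash M i → Prop} (h0 : p 0) (hadd : ∀ x y, p x → p y → p (x + y))
    (ht : ∀ x ∈ coinvariants M i, ∀ ξ, p (x ⊗ₜ ξ)) {t : Smash M i} (h : t ∈ smash M i) : p t := by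
  obtain ⟨s, rfl⟩ := h
  induction s with
  | zero => simpa using h0
  | add x y hx hy => rw [map_add]; exact hadd _ _ hx hy
  | tmul x ξ => exact ht x.1 x.2 ξ

/-- An element of `K # B((M i)*)` that commutes with the operators `coinvOp`. -/
theorem gr_lTensor_comul_rslice {j : ι} (hj : j ≠ i) {n : ℕ} {t : Smash M i} (ht : t ∈ smash M i)
    (hc : ∀ g, Commute (coinvOp M i (adDeg i j n) g) (smashRep M i t))
    (ψ : (M i).dual.Nichols →ₗ[k] k) :
    (gr M (adDeg i j n)).lTensor _ ((pi M).nComul (rslice ψ t)) = 0 := by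
  obtain ⟨N, T, e, χ, he, hχ, hs⟩ : ∃ (N : ℕ) (T : Fin N → Fin N → H)
      (e : Fin N → (pi M).Nichols) (χ : Fin N → (pi M).Nichols →ₗ[k] k),
      IsCofam (pi M).nCoact.toLinearMap T e ∧ (∀ a b, χ a (e b) = if a = b then 1 else 0) ∧
      ∀ x ∈ adPow M i j n, x = ∑ a, χ a x • e a :=
    IsSub.exists_dual_cofam (V := (pi M).nichols) (adPow_isSub M i j n) (adPow_fg M i j n)
  let X : Fin N → (pi M).Nichols →ₗ[k] (pi M).Nichols := fun a =>
    rslice (χ a) ∘ₗ (gr M (adDeg i j n)).lTensor _ ∘ₗ (pi M).nComul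
  have hX : ∀ x ∈ coinvariants M i, (gr M (adDeg i j n)).lTensor _ ((pi M).nComul x) =
      ∑ a, X a x ⊗ₜ e a := by
    intro x hx
    obtain ⟨m, a, b, -, hb, hab⟩ := exists_rep_left_mem
      (z := (gr M (adDeg i j n)).lTensor (pi M).Nichols ((pi M).nComul x))
      (P := adPow M i j n) fun φ => by
        have := lslice_map φ LinearMap.id (gr M (adDeg i j n)) ((pi M).nComul x)
        rw [LinearMap.lTensor, this]
        exact gr_mem_adPow hj n (coinv_lhit hx _)
    have h1 : ∀ c, X c x = ∑ d, χ c (b d) • a d := by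
      intro c
      change rslice (χ c) ((gr M (adDeg i j n)).lTensor (pi M).Nichols ((pi M).nComul x)) = _
      rw [hab]
      simp
    rw [hab]
    simp only [h1, sum_tmul, smul_tmul]
    rw [Finset.sum_comm]
    refine Finset.sum_congr rfl fun d _ => ?_
    rw [← tmul_sum, ← hs _ (hb d)]
  have h1 : ∀ b, ∀ x ∈ coinvariants M i, coinvOp M i (adDeg i j n) (χ b) *
      LinearMap.mul k (pi M).Nichols x - LinearMap.mul k (pi M).Nichols x *
        coinvOp M i (adDeg i j n) (χ b) =
      ∑ a, LinearMap.mul k (pi M).Nichols (X a x) * (pi M).nAct (T a b) := by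
    intro b x hx
    rw [coinvOp_mulLeft (height_adDeg hj n) _ hx, hX x hx, map_sum]
    refine Finset.sum_congr rfl fun a _ => ?_
    rw [commOp_cofam _ _ _ he, Finset.sum_eq_single b]
    · rw [hχ, if_pos rfl, one_smul]
    · intro c _ hc; rw [hχ, if_neg hc.symm, zero_smul]
    · simp
  let Y : Fin N → Smash M i →ₗ[k] Smash M i := fun c =>
    ∑ a, TensorProduct.map (X a) ((M i).dual.nAct (T a c))
  have h2 : ∀ b, coinvOp M i (adDeg i j n) (χ b) * smashRep M i t -
      smashRep M i t * coinvOp M i (adDeg i j n) (χ b) =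
      ∑ c, smashRep M i (Y c t) * (pi M).nAct (T c b) := by
    intro b
    refine smash_induction (p := fun t => coinvOp M i (adDeg i j n) (χ b) * smashRep M i t -
      smashRep M i t * coinvOp M i (adDeg i j n) (χ b) =
      ∑ c, smashRep M i (Y c t) * (pi M).nAct (T c b)) ?_ ?_ ?_ ht
    · simp
    · intro x y hx hy
      simp only [map_add, mul_add, add_mul, Finset.sum_add_distrib]
      rw [add_sub_add_comm, hx, hy]
    · intro x hx ξ
      have e1 : ∀ (x : (pi M).Nichols) (ξ : (M i).dual.Nichols), smashRep M i (x ⊗ₜ ξ) =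
        LinearMap.mul k (pi M).Nichols x * bder M i ξ := fun _ _ => rfl
      have h3 : ∀ a, (pi M).nAct (T a b) * bder M i ξ =
          ∑ c, bder M i ((M i).dual.nAct (T a c) ξ) * (pi M).nAct (T c b) := fun a =>
        bder_isEquivariant N T he.toIsComatrix a b ξ
      have h4 : ∀ c, smashRep M i (Y c (x ⊗ₜ ξ)) = ∑ a, LinearMap.mul k (pi M).Nichols (X a x) *
          bder M i ((M i).dual.nAct (T a c) ξ) := by
        intro c
        simp only [Y, LinearMap.sum_apply, map_tmul, map_sum, e1]
      rw [e1, mul_assoc (LinearMap.mul k _ x), ← coinvOp_bder, ← mul_assoc, ← mul_assoc, ← sub_mul,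
        h1 b x hx,
        Finset.sum_mul]
      simp only [mul_assoc, h3, h4, Finset.mul_sum, Finset.sum_mul]
      rw [Finset.sum_comm]
  have h3 : ∀ b, ∑ c, smashRep M i (Y c t) * (pi M).nAct (T c b) = 0 := by
    intro b
    rw [← h2, (hc (χ b)).eq, sub_self]
  have h4 : ∀ d, Y d t = 0 := by
    intro d
    have h5 : ∑ b, (∑ c, smashRep M i (Y c t) * (pi M).nAct (T c b)) *
        (pi M).nAct (antipode k (T b d)) = 0 := by simp [h3]
    simp only [Finset.sum_mul, mul_assoc] at h5
    rw [Finset.sum_comm] at h5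
    simp only [← Finset.mul_sum, he.toIsComatrix.sum_mul_antipode_act, mul_ite, mul_one,
      mul_zero, Finset.sum_ite_eq', Finset.mem_univ, if_true] at h5
    exact smashRep_injective (h5.trans (map_zero _).symm)
  have h5 : ∀ c, (X c).rTensor _ t = 0 := by
    intro c
    have h6 : ∑ d, ((M i).dual.nAct (antipodeInv k (T d c))).lTensor (pi M).Nichols (Y d t) =
        0 := by simp [h4]
    rw [← h6]
    generalize t = t
    induction t using TensorProduct.induction_on with
    | zero => simp
    | add x y hx hy => simp only [map_add, hx, hy, Finset.sum_add_distrib]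
    | tmul x ξ =>
      simp only [Y, LinearMap.sum_apply, map_tmul, map_sum, LinearMap.lTensor_tmul,
        LinearMap.rTensor_tmul]
      rw [Finset.sum_comm]
      have h7 : ∀ a, ∑ d, (M i).dual.nAct (antipodeInv k (T d c)) ((M i).dual.nAct (T a d) ξ) =
          if a = c then ξ else 0 := by
        intro a
        have := congrArg (fun h => (M i).dual.nAct h ξ) (he.antipodeInv_mul' a c)
        simp only [map_sum, map_mul, LinearMap.sum_apply, Module.End.mul_apply] at this
        rw [this]
        split_ifs <;> simp
      simp [← tmul_sum, h7, tmul_ite]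
  rw [hX _ (rslice_smash ht ψ)]
  refine Finset.sum_eq_zero fun a _ => ?_
  have h6 := rslice_map ψ (X a) LinearMap.id t
  rw [LinearMap.comp_id] at h6
  have h7 : TensorProduct.map (X a) LinearMap.id t = 0 := h5 a
  rw [← h6, h7, map_zero, zero_tmul]

theorem exists_twist_span (V : YDMod.{u, w, v} k H) [FiniteDimensional k V] :
    ∃ (n : ℕ) (t : Fin n → Fin n → H) (b : Fin n → V), IsCofam V.coact t b ∧
      Submodule.span k (Set.range b) = ⊤ ∧ Submodule.span k (Set.range fun a => V.twist (b a)) = ⊤ := by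
  obtain ⟨n, t, b, hb⟩ := V.exists_basis_cofam
  refine ⟨n, t, b, hb, b.span_eq, ?_⟩
  rw [show (Set.range fun a => V.twist (b a)) = V.twist '' Set.range b from
    (Set.range_comp V.twist b), Submodule.span_image, b.span_eq, Submodule.map_top,
    LinearMap.range_eq_top]
  exact twist_bijective.2

theorem exists_dualRder_eq (η : (M i).dual.Nichols) :
    ∃ L : M i →ₗ[k] (M i).dual.Nichols, ∀ v, L v = dualRder v η :=
  ⟨(TensorProduct.rid k (M i).dual.Nichols).toLinearMap ∘ₗ
    (LinearMap.lTensorHom (M i).dual.Nichols).flip ((M i).dual.nComul η) ∘ₗ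
    LinearMap.lcomp k k (M i).dual.nPr ∘ₗ dualForm.flip, fun _ => rfl⟩

/-- An element of `K # B((M i)*)` that commutes with the operators `adOp` and `coinvOp` is a
scalar. -/
theorem eq_smul_one_of_commute (hM : ∀ j, (M j).IsIrreducible) (hF : FinCond M i)
    {t : Smash M i} (ht : t ∈ smash M i)
    (h1 : ∀ v, Commute (adOp M i v) (smashRep M i t))
    (h2 : ∀ j, j ≠ i → ∀ g, Commute (coinvOp M i (adDeg i j (topDeg M i j)) g)
      (smashRep M i t)) : ∃ c : k, t = c • (1 ⊗ₜ 1) := by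
  have hD := (M i).dual.n_isPre
  have hB := (pi M).n_isPre
  let c : ℤ → (M i).dual.Nichols →ₗ[k] (M i).dual.Nichols :=
    nComp (M i).dual.isDec_unit (fun _ => (1 : ℤ))
  have hc : IsGr (M i).dual.nι (fun _ : Unit => (LinearMap.id : (M i).dual →ₗ[k] (M i).dual))
    (fun _ => (1 : ℤ)) c := n_isGr _ _
  have hq := (M i).dual.isDec_unit
  obtain ⟨m, T, e, he, hspan', hspan⟩ := (M i).exists_twist_span
  -- the components with respect to the degree in `B((M i)*)`
  have hrel : ∀ a, ((pi M).adc (inc M i (e a))).rTensor _ t =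
      ∑ d, smashAct M i (T a d) ((dualRder ((M i).twist (e d))).lTensor _ t) := by
    intro p
    have h3 : ∀ a, ∑ b, (pi M).nAct (antipode k (T a b)) * smashRep M i
        (((pi M).adc (inc M i (e b))).rTensor _ t -
          ∑ d, smashAct M i (T b d) ((dualRder ((M i).twist (e d))).lTensor _ t)) = 0 := by
      intro a
      rw [← adOp_smashRep he, (h1 (e a)).eq, sub_self]
    have h4 : ∑ a, (pi M).nAct (T p a) * ∑ b, (pi M).nAct (antipode k (T a b)) * smashRep M i
        (((pi M).adc (inc M i (e b))).rTensor _ t -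
          ∑ d, smashAct M i (T b d) ((dualRder ((M i).twist (e d))).lTensor _ t)) = 0 := by
      simp only [h3, mul_zero, Finset.sum_const_zero]
    simp only [Finset.mul_sum, ← mul_assoc] at h4
    rw [Finset.sum_comm] at h4
    simp only [← Finset.sum_mul, he.toIsComatrix.sum_mul_antipode_act, ite_mul, one_mul,
      zero_mul, Finset.sum_ite_eq, Finset.mem_univ, if_true] at h4
    exact sub_eq_zero.1 (smashRep_injective (h4.trans (map_zero _).symm))
  have hder : ∀ (v : M i) n ξ, c n (dualRder v ξ) = dualRder v (c (n + 1) ξ) := by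
    intro v n ξ
    have := hD.rder_comp hq hc (n + 1) (dualEval v) ξ
    simpa [dualRder] using this.symm
  have hrel' : ∀ n a, ((pi M).adc (inc M i (e a))).rTensor _ ((c n).lTensor _ t) =
      ∑ d, smashAct M i (T a d)
        ((dualRder ((M i).twist (e d))).lTensor _ ((c (n + 1)).lTensor _ t)) := by
    intro n a
    have h3 := congrArg ((c n).lTensor (pi M).Nichols) (hrel a)
    rw [← LinearMap.comp_apply, LinearMap.lTensor_comp_rTensor,
      ← LinearMap.rTensor_comp_lTensor, LinearMap.comp_apply, map_sum] at h3
    rw [h3]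
    refine Finset.sum_congr rfl fun d _ => ?_
    generalize t = t
    induction t using TensorProduct.induction_on with
    | zero => simp
    | add x y hx hy => simp only [map_add, hx, hy]
    | tmul x ξ =>
      simp only [LinearMap.lTensor_tmul, smashAct, diagAct_comatrix _ _ he.toIsComatrix, map_sum,
        hD.comp_act hq hc, hder]
  have htop : ∀ n, (c (n + 1)).lTensor (pi M).Nichols t = 0 →
      ∃ η, (c n).lTensor (pi M).Nichols t = 1 ⊗ₜ η := by
    intro n hn
    refine ⟨TensorProduct.lid k _ ((pi M).nCounit.toLinearMap.rTensor _
      ((c n).lTensor (pi M).Nichols t)), ?_⟩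
    obtain ⟨r, b, a, hb, hab⟩ := exists_rep_right ((c n).lTensor (pi M).Nichols t)
    obtain ⟨φ, hφ⟩ := exists_dual_family hb
    have hslice : ∀ d, a d = rslice (φ d ∘ₗ c n) t := by
      intro d
      have h3 := rslice_map (φ d) LinearMap.id (c n) t
      change rslice (φ d) ((c n).lTensor (pi M).Nichols t) = _ at h3
      rw [hab] at h3
      simpa [hφ] using h3
    have hfree : ∀ d, IsTopFree M i (a d) := by
      intro d
      refine ⟨hslice d ▸ rslice_smash ht _, fun v => ?_, fun j hj => ?_⟩
      · have h3 : ∀ a', (pi M).adc (inc M i (e a')) (a d) = 0 := by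
          intro a'
          have h4 := rslice_map (φ d) ((pi M).adc (inc M i (e a'))) LinearMap.id
            ((c n).lTensor (pi M).Nichols t)
          change rslice (φ d) (((pi M).adc (inc M i (e a'))).rTensor _
            ((c n).lTensor (pi M).Nichols t)) = _ at h4
          rw [hrel', hn, LinearMap.comp_id, hab] at h4
          simpa [hφ] using h4.symm
        have h5 : (pi M).adc.flip (a d) ∘ₗ inc M i = 0 :=
          LinearMap.ext_on_range hspan' fun a' => by simpa using h3 a'
        exact LinearMap.congr_fun h5 v
      · rw [hslice]
        exact gr_lTensor_comul_rslice hj ht (h2 j hj) _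
    rw [hab]
    simp only [map_sum, LinearMap.rTensor_tmul, lid_tmul, tmul_sum, tmul_smul,
      AlgHom.toLinearMap_apply, smul_tmul']
    exact Finset.sum_congr rfl fun d _ => by rw [← (hfree d).eq_smul_one hM hF]
  have hpos : ∀ n : ℤ, 0 ≤ n → (c (n + 1 + 1)).lTensor (pi M).Nichols t = 0 →
      (c (n + 1)).lTensor (pi M).Nichols t = 0 := by
    intro n hn0 hn
    obtain ⟨η, hη⟩ := htop _ hn
    have hεad : ∀ (a : Fin m) x, (pi M).nCounit ((pi M).adc (inc M i (e a)) x) = 0 := by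
      intro a x
      have h4 : ∀ v, (pi M).nCounit (inc M i v) = 0 := fun v => hB.counit_ι _
      rw [adc_cofam (inc_cofam he)]
      simp [h4]
    have h4 : ∀ a, ∑ d, (M i).dual.nAct (T a d) (dualRder ((M i).twist (e d)) η) = 0 := by
      intro a
      have h5 := congrArg (fun z => TensorProduct.lid k _
        ((pi M).nCounit.toLinearMap.rTensor (M i).dual.Nichols z)) (hrel' n a)
      simp only [hη, LinearMap.lTensor_tmul, smashAct,
        diagAct_comatrix _ _ he.toIsComatrix, map_sum, LinearMap.rTensor_tmul, lid_tmul,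
        AlgHom.toLinearMap_apply, hB.counit_act, he.counit_eq, map_one, mul_one] at h5
      rw [← LinearMap.rTensor_comp_apply, show (pi M).nCounit.toLinearMap ∘ₗ
        (pi M).adc (inc M i (e a)) = 0 from LinearMap.ext fun x => hεad a x] at h5
      simpa [ite_smul] using h5.symm
    have h5 : ∀ d, dualRder ((M i).twist (e d)) η = 0 := by
      intro d
      have h6 : ∑ a, (M i).dual.nAct (antipode k (T d a))
          (∑ b, (M i).dual.nAct (T a b) (dualRder ((M i).twist (e b)) η)) = 0 := by
        simp only [h4, map_zero, Finset.sum_const_zero]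
      simp only [map_sum] at h6
      rw [Finset.sum_comm] at h6
      have h7 : ∀ b, ∑ a, (M i).dual.nAct (antipode k (T d a))
          ((M i).dual.nAct (T a b) (dualRder ((M i).twist (e b)) η)) =
          if d = b then dualRder ((M i).twist (e b)) η else 0 := by
        intro b
        have := LinearMap.congr_fun (he.toIsComatrix.sum_antipode_mul_act (M i).dual.nAct d b)
          (dualRder ((M i).twist (e b)) η)
        simp only [LinearMap.sum_apply, Module.End.mul_apply] at this
        rw [this]
        split_ifs <;> simp
      simpa [h7] using h6
    have h6 : ∀ v, dualRder (i := i) (M := M) v η = 0 := by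
      obtain ⟨L, hL⟩ := exists_dualRder_eq (M := M) (i := i) η
      have h7 : L = 0 := LinearMap.ext_on_range hspan fun a => by
        rw [hL, h5, LinearMap.zero_apply]
      intro v
      rw [← hL, h7, LinearMap.zero_apply]
    have h7 : c (n + 1) η = η := by
      have h8 := congrArg (fun z => TensorProduct.lid k _
        ((pi M).nCounit.toLinearMap.rTensor _ ((c (n + 1)).lTensor (pi M).Nichols z))) hη
      simp only [LinearMap.lTensor_tmul, LinearMap.rTensor_tmul, lid_tmul,
        AlgHom.toLinearMap_apply, map_one, one_smul] at h8
      rw [← LinearMap.lTensor_comp_apply, show c (n + 1) ∘ₗ c (n + 1) = c (n + 1) from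
        LinearMap.ext (hD.comp_self hq hc _), hη] at h8
      simpa using h8.symm
    have h8 : η = 0 := by
      refine eq_zero_of_rder (U := (M i).dual) ?_ fun φ => ?_
      · rw [← h7, hD.counit_comp hq hc, if_neg (by omega)]
      · obtain ⟨v, rfl⟩ := exists_dualEval_eq φ
        exact h6 v
    rw [hη, h8, tmul_zero]
  obtain ⟨s, hs⟩ := hD.exists_finset_right hq hc t
  have hbig : ∀ n, n ∉ s → (c n).lTensor (pi M).Nichols t = 0 := by
    intro n hn
    rw [← hs s subset_rfl, map_sum]
    refine Finset.sum_eq_zero fun γ hγ => ?_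
    rw [← LinearMap.lTensor_comp_apply, show c n ∘ₗ c γ = 0 from LinearMap.ext fun x => by
      rw [LinearMap.comp_apply, hD.comp_comp hq hc, if_neg]
      · rfl
      · rintro rfl; exact hn hγ]
    simp
  obtain ⟨N, hN⟩ := s.bddAbove
  have hvanish : ∀ (r : ℕ) (n : ℤ), 0 ≤ n → N < n + 1 + r →
      (c (n + 1)).lTensor (pi M).Nichols t = 0 := by
    intro r
    induction r with
    | zero =>
      intro n _ hn
      refine hbig _ fun h => ?_
      have := hN h
      simp at hn
      omega
    | succ r ih =>
      intro n hn0 hn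
      refine hpos n hn0 (ih (n + 1) (by omega) ?_)
      push_cast at hn
      omega
  have hzero : ∀ n, n ≠ 0 → (c n).lTensor (pi M).Nichols t = 0 := by
    intro n hn
    rcases lt_or_gt_of_ne hn with h | h
    · rw [show c n = 0 from LinearMap.ext fun x => IsPre.comp_neg hD hc h x]
      simp
    · have := hvanish N.toNat (n - 1) (by omega) (by omega)
      rwa [sub_add_cancel] at this
  have ht0 : (c 0).lTensor (pi M).Nichols t = t := by
    have h3 := hs (insert 0 s) (Finset.subset_insert _ _)
    rw [Finset.sum_eq_single 0 (fun n _ hn => hzero n hn) (by simp)] at h3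
    exact h3
  obtain ⟨η, hη⟩ := htop 0 (hzero _ (by norm_num))
  refine ⟨(M i).dual.nCounit η, ?_⟩
  rw [ht0] at hη
  rw [hη] at ht0
  rw [hη, ← ht0, LinearMap.lTensor_tmul, IsPre.comp_zero hD hc, tmul_smul]

end YDMod

theorem IsEquivariant.comp {R X Y : Type*} [AddCommGroup R] [Module k R] [AddCommGroup X]
    [Module k X] [AddCommGroup Y] [Module k Y] {actX : H →ₐ[k] Module.End k X}
    {actY : H →ₐ[k] Module.End k Y} {act : H →ₐ[k] Module.End k R} {F : X →ₗ[k] Module.End k R}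
    (hF : IsEquivariant actX act F) {f : Y →ₗ[k] X} (hf : ∀ h y, f (actY h y) = actX h (f y)) :
    IsEquivariant actY act (F ∘ₗ f) := by
  intro m t ht a b y
  simp only [LinearMap.comp_apply, hf]
  exact hF m t ht a b _

section OneHom

variable {A B : Type*} [Ring A] [Algebra k A] [AddCommGroup B] [Module k B]
  {actA : H →ₐ[k] Module.End k A} {coactA : A →ₐ[k] H ⊗[k] A}
  {actB : H →ₐ[k] Module.End k B} {coactB : B →ₗ[k] H ⊗[k] B}

theorem IsYDAlg.one_tmul_hom (hA : IsYDAlg actA coactA) : IsYDMap actB coactB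
    (YDMod.diagAct actA actB) (YDMod.diagCoact coactA.toLinearMap coactB)
    (TensorProduct.mk k A B 1) where
  map_act h b := by
    refine comatrix_induction (k := k)
      (p := fun h => TensorProduct.mk k A B 1 (actB h b) =
        YDMod.diagAct actA actB h (TensorProduct.mk k A B 1 b)) ?_ ?_ ?_ ?_ h
    · simp
    · intro x y hx hy; simp only [map_add, LinearMap.add_apply, hx, hy]
    · intro c x hx; simp only [map_smul, LinearMap.smul_apply, hx]
    · intro m t ht a b
      rw [mk_apply, mk_apply, YDMod.diagAct_comatrix _ _ ht]
      simp [act_one_comatrix hA ht, ite_tmul]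
  map_coact b := by
    have : ∀ s : H ⊗[k] B, (LinearMap.mul' k H).rTensor (A ⊗[k] B)
        (TensorProduct.tensorTensorTensorComm k H A H B ((1 ⊗ₜ 1) ⊗ₜ s)) =
        (TensorProduct.mk k A B 1).lTensor H s := by
      intro s
      induction s with
      | zero => simp
      | add x y hx hy => simp only [tmul_add, map_add, hx, hy]
      | tmul h x => simp
    simp only [YDMod.diagCoact, LinearMap.comp_apply, mk_apply, map_tmul,
      AlgHom.toLinearMap_apply, map_one, LinearEquiv.coe_coe, Algebra.TensorProduct.one_def]
    exact this _

theorem IsYDAlg.tmul_one_hom (hA : IsYDAlg actA coactA) : IsYDMap actB coactB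
    (YDMod.diagAct actB actA) (YDMod.diagCoact coactB coactA.toLinearMap)
    ((TensorProduct.mk k B A).flip 1) where
  map_act h b := by
    refine comatrix_induction (k := k)
      (p := fun h => (TensorProduct.mk k B A).flip 1 (actB h b) =
        YDMod.diagAct actB actA h ((TensorProduct.mk k B A).flip 1 b)) ?_ ?_ ?_ ?_ h
    · simp
    · intro x y hx hy; simp only [map_add, LinearMap.add_apply, hx, hy]
    · intro c x hx; simp only [map_smul, LinearMap.smul_apply, hx]
    · intro m t ht a b
      rw [LinearMap.flip_apply, LinearMap.flip_apply, mk_apply, mk_apply,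
        YDMod.diagAct_comatrix _ _ ht]
      simp [act_one_comatrix hA ht, tmul_ite]
  map_coact b := by
    have : ∀ s : H ⊗[k] B, (LinearMap.mul' k H).rTensor (B ⊗[k] A)
        (TensorProduct.tensorTensorTensorComm k H B H A (s ⊗ₜ (1 ⊗ₜ 1))) =
        ((TensorProduct.mk k B A).flip 1).lTensor H s := by
      intro s
      induction s with
      | zero => simp
      | add x y hx hy => simp only [add_tmul, map_add, hx, hy]
      | tmul h x => simp
    simp only [YDMod.diagCoact, LinearMap.comp_apply, mk_apply, map_tmul, LinearMap.flip_apply,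
      AlgHom.toLinearMap_apply, map_one, LinearEquiv.coe_coe, Algebra.TensorProduct.one_def]
    exact this _

end OneHom

namespace YDMod

variable {ι : Type} [Fintype ι] [DecidableEq ι] {M : ι → YDMod.{u, w, v} k H} {i : ι}
variable [∀ j, FiniteDimensional k (M j)] [BijectiveAntipode k H]

/-! ### The embedding of the reflected family -/

section ReflectEmb

omit [∀ j, FiniteDimensional k (M j)] [BijectiveAntipode k H] in
theorem subIncl_hom {V : YDMod.{u, w, v} k H} {P : Submodule k V} (hP : V.IsSub P) :
    IsHom (subIncl hP) := sub_isYDMap hP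

omit [∀ j, FiniteDimensional k (M j)] [BijectiveAntipode k H] in
theorem exists_extend_subIncl {V : YDMod.{u, w, v} k H} {P : Submodule k V} (hP : V.IsSub P)
    (g : sub hP →ₗ[k] k) : ∃ f : V →ₗ[k] k, f ∘ₗ subIncl hP = g :=
  LinearMap.exists_extend (p := P) g

variable (M i) in
/-- The inclusion of the top degree component of `L j`. -/
def LmaxIncl (j : ι) : Lmax M i j →ₗ[k] (pi M).Nichols :=
  subIncl (V := (pi M).nichols) (adPow_isSub M i j (topDeg M i j))

omit [∀ j, FiniteDimensional k (M j)] [BijectiveAntipode k H] in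
theorem LmaxIncl_hom (j : ι) : IsYDMap (Lmax M i j).act (Lmax M i j).coact (pi M).nAct
    (pi M).nCoact.toLinearMap (LmaxIncl M i j) :=
  subIncl_hom (V := (pi M).nichols) (adPow_isSub M i j (topDeg M i j))

omit [∀ j, FiniteDimensional k (M j)] [BijectiveAntipode k H] in
theorem LmaxIncl_mem (j : ι) (x : Lmax M i j) : LmaxIncl M i j x ∈ adPow M i j (topDeg M i j) :=
  x.2

omit [∀ j, FiniteDimensional k (M j)] [BijectiveAntipode k H] in
theorem rslice_coact_LmaxIncl (j : ι) (f : (pi M).Nichols →ₗ[k] k) (x : Lmax M i j) :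
    rslice f ((pi M).nCoact (LmaxIncl M i j x)) =
      rslice (f ∘ₗ LmaxIncl M i j) ((Lmax M i j).coact x) := by
  have := (LmaxIncl_hom (M := M) (i := i) j).map_coact x
  rw [AlgHom.toLinearMap_apply] at this
  rw [this]
  generalize (Lmax M i j).coact x = z
  induction z with
  | zero => simp
  | add x y hx hy => simp only [map_add, hx, hy]
  | tmul a b => simp

theorem reflect_elim {P : ∀ X : YDMod.{u, w, max u v} k H, (X →ₗ[k] Smash M i) → Prop} (j : ι)
    (h1 : j = i → P (M i).dual
      (TensorProduct.mk k (pi M).Nichols (M i).dual.Nichols 1 ∘ₗ (M i).dual.nι))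
    (h2 : j ≠ i → P (Lmax M i j) ((TensorProduct.mk k (pi M).Nichols (M i).dual.Nichols).flip 1 ∘ₗ
      LmaxIncl M i j)) :
    P (reflect M i j) (reflectEmb M i j) := by
  unfold reflect reflectEmb
  generalize decEq j i = d
  cases d with
  | isTrue h => exact h1 h
  | isFalse h => exact h2 h

theorem reflectEmb_hom (j : ι) : IsYDMap (reflect M i j).act (reflect M i j).coact
    (smashAct M i) (smashCoact M i) (reflectEmb M i j) := by
  refine reflect_elim (P := fun X E => IsYDMap X.act X.coact (smashAct M i) (smashCoact M i) E) j
    (fun _ => ?_) (fun _ => ?_)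
  · exact ((M i).dual.nι_isHom).comp (pi M).n_isPre.toIsYDAlg.one_tmul_hom
  · exact (LmaxIncl_hom j).comp
      (M i).dual.n_isPre.toIsYDAlg.tmul_one_hom

variable (M i) in
/-- The embedding of `W'` in `K # B((M i)*)`. -/
def reflectGen : pi (reflect M i) →ₗ[k] Smash M i := ∑ j, reflectEmb M i j ∘ₗ proj (reflect M i) j

theorem reflectGen_single (j : ι) (x : reflect M i j) :
    reflectGen M i (single (reflect M i) j x) = reflectEmb M i j x := by
  rw [reflectGen, LinearMap.sum_apply, Finset.sum_eq_single j]
  · rw [LinearMap.comp_apply, proj_single]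
  · intro l _ hl
    rw [LinearMap.comp_apply, proj_single_of_ne _ hl, map_zero]
  · simp

theorem reflectGen_hom : IsYDMap (pi (reflect M i)).act (pi (reflect M i)).coact
    (smashAct M i) (smashCoact M i) (reflectGen M i) where
  map_act h x := by
    simp only [reflectGen, LinearMap.sum_apply, map_sum]
    exact Finset.sum_congr rfl fun j _ =>
      ((proj_isHom (reflect M i) j).comp (reflectEmb_hom j)).map_act h x
  map_coact x := by
    simp only [reflectGen, LinearMap.sum_apply, map_sum]
    have h : ∀ z : H ⊗[k] pi (reflect M i), (∑ j, reflectEmb M i j ∘ₗ proj (reflect M i) j).lTensor H z =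
        ∑ j, (reflectEmb M i j ∘ₗ proj (reflect M i) j).lTensor H z := by
      intro z
      rw [← LinearMap.coe_lTensorHom, map_sum, LinearMap.sum_apply]
    rw [h]
    exact Finset.sum_congr rfl fun j _ =>
      ((proj_isHom (reflect M i) j).comp (reflectEmb_hom j)).map_coact x

variable (M i) in
/-- The representation of `T(W')` on `B(W)`. -/
def reflectRep : (pi (reflect M i)).T →ₐ[k] Module.End k (pi M).Nichols :=
  TensorAlgebra.lift k (smashRep M i ∘ₗ reflectGen M i)

theorem reflectRep_ι (w : pi (reflect M i)) :
    reflectRep M i (TensorAlgebra.ι k w) = smashRep M i (reflectGen M i w) :=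
  TensorAlgebra.lift_ι_apply _ _

theorem reflectRep_isEquivariant : IsEquivariant (pi (reflect M i)).tAct (pi M).nAct
    (reflectRep M i).toLinearMap := by
  refine (pi (reflect M i)).t_isPre.isEquivariant ?_
  have h : (reflectRep M i).toLinearMap ∘ₗ TensorAlgebra.ι k =
      smashRep M i ∘ₗ reflectGen M i := LinearMap.ext reflectRep_ι
  rw [h]
  exact (smashRep_isEquivariant M i).comp reflectGen_hom.map_act

end ReflectEmb

/-! ### Commutators with the generators -/

section Commutators

theorem rslice_neg {A B : Type*} [AddCommGroup A] [Module k A] [AddCommGroup B] [Module k B]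
    (φ : B →ₗ[k] k) (z : A ⊗[k] B) : rslice (-φ) z = -rslice φ z := by
  simp [rslice, LinearMap.lTensor_neg]

theorem smashRep_one_tmul_nι (f : (M i).dual) :
    smashRep M i (1 ⊗ₜ (M i).dual.nι f) = pder M i (dualForm f) := by
  rw [smashRep_tmul, bder_nι, LinearMap.mulLeft_one, LinearMap.id_comp]

theorem smashRep_tmul_one (x : (pi M).Nichols) :
    smashRep M i (x ⊗ₜ 1) = LinearMap.mul k (pi M).Nichols x := by
  rw [smashRep_tmul, map_one]; rfl

theorem adOp_dual (v : M i) (f : (M i).dual) :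
    adOp M i v * smashRep M i (1 ⊗ₜ (M i).dual.nι f) -
      smashRep M i (1 ⊗ₜ (M i).dual.nι f) * adOp M i v =
    (pi M).nAct (rslice (-dualEval ((M i).twist v)) ((M i).dual.coact f)) := by
  obtain ⟨m, t, e, a, he, rfl⟩ := (M i).exists_cofam v
  rw [smashRep_one_tmul_nι, adOp_pder he, rslice_neg, rslice, LinearMap.comp_apply,
    dual_coact_eval, twist_coact he, map_neg]
  simp [antipodeInv_antipode]

theorem adOp_coinv (v : M i) {x : (pi M).Nichols} (hx : x ∈ adKer M i) :
    adOp M i v * smashRep M i (x ⊗ₜ 1) - smashRep M i (x ⊗ₜ 1) * adOp M i v = 0 := by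
  obtain ⟨m, t, e, a, he, rfl⟩ := (M i).exists_cofam v
  rw [smashRep_tmul_one, adOp_mulLeft he]
  refine Finset.sum_eq_zero fun b _ => ?_
  rw [mem_adKer.1 hx, map_zero, mul_zero]

theorem coinvOp_dual (γ : ι → ℤ) (g : (pi M).Nichols →ₗ[k] k) (f : (M i).dual) :
    coinvOp M i γ g * smashRep M i (1 ⊗ₜ (M i).dual.nι f) -
      smashRep M i (1 ⊗ₜ (M i).dual.nι f) * coinvOp M i γ g = 0 := by
  rw [smashRep_one_tmul_nι, coinvOp_pder, sub_self]

omit [BijectiveAntipode k H] [∀ j, FiniteDimensional k (M j)] in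
theorem coinvOp_adPow_aux {j : ι} (hj : j ≠ i) (g : (pi M).Nichols →ₗ[k] k) {n : ℕ}
    {x : (pi M).Nichols} (hx : x ∈ adPow M i j n) :
    coinvOp M i (adDeg i j n) g * LinearMap.mul k (pi M).Nichols x -
      LinearMap.mul k (pi M).Nichols x * coinvOp M i (adDeg i j n) g =
    (pi M).nAct (rslice g ((pi M).nCoact x)) := by
  rw [coinvOp_mulLeft (height_adDeg hj n) g (adPow_le_coinv hj n hx), gr_lTensor_comul_adPow hx,
    commOp_tmul]
  ext y
  simp

theorem coinvOp_adPow {j : ι} (hj : j ≠ i) (g : (pi M).Nichols →ₗ[k] k) {n : ℕ}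
    {x : (pi M).Nichols} (hx : x ∈ adPow M i j n) :
    coinvOp M i (adDeg i j n) g * smashRep M i (x ⊗ₜ 1) -
      smashRep M i (x ⊗ₜ 1) * coinvOp M i (adDeg i j n) g =
    (pi M).nAct (rslice g ((pi M).nCoact x)) := by
  rw [smashRep_tmul_one, coinvOp_adPow_aux hj g hx]

theorem coinvOp_adPow_of_ne {j l : ι} (hj : j ≠ i) (hl : l ≠ i) (hjl : j ≠ l)
    (g : (pi M).Nichols →ₗ[k] k) {m n : ℕ} {x : (pi M).Nichols} (hx : x ∈ adPow M i l n) :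
    coinvOp M i (adDeg i j m) g * smashRep M i (x ⊗ₜ 1) -
      smashRep M i (x ⊗ₜ 1) * coinvOp M i (adDeg i j m) g = 0 := by
  rw [smashRep_tmul_one, coinvOp_mulLeft (height_adDeg hj m) g (adPow_le_coinv hl n hx),
    gr_lTensor_comul_adPow_of_ne hj hl hjl hx, map_zero]

variable (M i) in
/-- The commutators of `Z` with the generators of `T(W')` are given by the linear form `g`. -/
def IsCommForm (Z : Module.End k (pi M).Nichols) (g : pi (reflect M i) →ₗ[k] k) : Prop :=
  ∀ w, Z * reflectRep M i (TensorAlgebra.ι k w) - reflectRep M i (TensorAlgebra.ι k w) * Z =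
    (pi M).nAct (rslice g ((pi (reflect M i)).coact w))

/-- The same for a single summand. -/
def IsCommFormOn (Z : Module.End k (pi M).Nichols) {X : YDMod.{u, w, max u v} k H}
    (E : X →ₗ[k] Smash M i) (g : X →ₗ[k] k) : Prop :=
  ∀ x, Z * smashRep M i (E x) - smashRep M i (E x) * Z = (pi M).nAct (rslice g (X.coact x))

theorem isCommForm_of_on {Z : Module.End k (pi M).Nichols} {g : ∀ j, reflect M i j →ₗ[k] k}
    (h : ∀ j, IsCommFormOn Z (reflectEmb M i j) (g j)) :
    IsCommForm M i Z (∑ j, g j ∘ₗ proj (reflect M i) j) := by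
  intro w
  have hr : ∀ z : H ⊗[k] pi (reflect M i), rslice (∑ j, g j ∘ₗ proj (reflect M i) j) z =
      ∑ j, rslice (g j) ((proj (reflect M i) j).lTensor H z) := by
    intro z
    induction z with
    | zero => simp
    | add x y hx hy => simp only [map_add, hx, hy, Finset.sum_add_distrib]
    | tmul a b => simp [Finset.sum_smul]
  rw [hr, reflectRep_ι, reflectGen]
  simp only [LinearMap.sum_apply, map_sum, Finset.mul_sum, Finset.sum_mul,
    ← Finset.sum_sub_distrib, LinearMap.comp_apply, (h _ _),
    ← (proj_isHom (reflect M i) _).map_coact]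

variable (hM : ∀ j, (M j).IsIrreducible) (hF : FinCond M i)
include hM hF

theorem exists_isCommForm_adOp (v : M i) : ∃ g, IsCommForm M i (adOp M i v) g := by
  have h : ∀ j, ∃ g, IsCommFormOn (adOp M i v) (reflectEmb M i j) g := by
    intro j
    refine reflect_elim (P := fun X E => ∃ g, IsCommFormOn (adOp M i v) E g) j (fun _ => ?_)
      (fun hj => ⟨0, fun x => ?_⟩)
    · exact ⟨_, adOp_dual v⟩
    · have := hF j hj
      refine (adOp_coinv v (topDeg_le_adKer hj (hM j) x.2)).trans ?_
      simp [rslice]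
  choose g hg using h
  exact ⟨_, isCommForm_of_on hg⟩

omit hM hF in
theorem exists_isCommForm_coinvOp {j : ι} (hj : j ≠ i) (f : (pi M).Nichols →ₗ[k] k) :
    ∃ g, IsCommForm M i (coinvOp M i (adDeg i j (topDeg M i j)) f) g := by
  have h : ∀ l, ∃ g, IsCommFormOn (coinvOp M i (adDeg i j (topDeg M i j)) f)
      (reflectEmb M i l) g := by
    intro l
    refine reflect_elim (P := fun X E =>
      ∃ g, IsCommFormOn (coinvOp M i (adDeg i j (topDeg M i j)) f) E g) l
      (fun _ => ⟨0, fun x => ?_⟩) (fun hl => ?_)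
    · refine (coinvOp_dual _ _ _).trans ?_
      simp [rslice]
    · by_cases hjl : j = l
      · subst hjl
        exact ⟨f ∘ₗ LmaxIncl M i j, fun x => (coinvOp_adPow hj f (LmaxIncl_mem j x)).trans
          (congrArg _ (rslice_coact_LmaxIncl j f x))⟩
      · refine ⟨0, fun x => ?_⟩
        refine (coinvOp_adPow_of_ne hj hl hjl f x.2).trans ?_
        simp [rslice]
  choose g hg using h
  exact ⟨_, isCommForm_of_on hg⟩

theorem exists_op_on (j : ι) (g : reflect M i j →ₗ[k] k) :
    ∃ Z, IsCommFormOn Z (reflectEmb M i j) g ∧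
      ∀ l, l ≠ j → IsCommFormOn Z (reflectEmb M i l) 0 := by
  revert g
  refine reflect_elim (P := fun X E => ∀ g : X →ₗ[k] k, ∃ Z, IsCommFormOn Z E g ∧
      ∀ l, l ≠ j → IsCommFormOn Z (reflectEmb M i l) 0) j (fun hj g => ?_) (fun hj g => ?_)
  · obtain ⟨x, hx⟩ := exists_dualEval_eq g
    obtain ⟨v, hv⟩ := (twist_bijective (V := M i)).2 (-x)
    refine ⟨adOp M i v, fun f => ?_, fun l hl => ?_⟩
    · refine (adOp_dual v f).trans ?_
      rw [hv, hx]
      congr 2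
      ext f
      simp [dualEval_apply]
    · refine reflect_elim (P := fun X E => IsCommFormOn (adOp M i v) E 0) l
        (fun h => absurd (h.trans hj.symm) hl) (fun hl => fun x => ?_)
      have := hF l hl
      refine (adOp_coinv v (topDeg_le_adKer hl (hM l) x.2)).trans ?_
      simp [rslice]
  · obtain ⟨f, hf⟩ : ∃ f : (pi M).Nichols →ₗ[k] k, f ∘ₗ LmaxIncl M i j = g :=
      exists_extend_subIncl (V := (pi M).nichols) (adPow_isSub M i j (topDeg M i j)) g
    refine ⟨coinvOp M i (adDeg i j (topDeg M i j)) f, fun x => ?_, fun l hl => ?_⟩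
    · rw [← hf, ← rslice_coact_LmaxIncl]
      exact coinvOp_adPow hj f (LmaxIncl_mem j x)
    · refine reflect_elim (P := fun X E =>
        IsCommFormOn (coinvOp M i (adDeg i j (topDeg M i j)) f) E 0) l
        (fun _ => fun x => ?_) (fun hl' => fun x => ?_)
      · refine (coinvOp_dual _ _ _).trans ?_
        simp [rslice]
      · refine (coinvOp_adPow_of_ne hj hl' hl.symm f x.2).trans ?_
        simp [rslice]

theorem exists_op (g : pi (reflect M i) →ₗ[k] k) : ∃ Z, IsCommForm M i Z g := by
  have h := fun j => exists_op_on hM hF j (g ∘ₗ single (reflect M i) j)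
  choose Z hZ hZ' using h
  refine ⟨∑ j, Z j, ?_⟩
  have h1 : g = ∑ j, (g ∘ₗ single (reflect M i) j) ∘ₗ proj (reflect M i) j := by
    ext w
    have := congrArg g ((isDec_pi (reflect M i)).sum_eq w)
    rw [map_sum] at this
    rw [← this, LinearMap.sum_apply]
    rfl
  have h2 : ∀ l, IsCommFormOn (∑ j, Z j) (reflectEmb M i l) (g ∘ₗ single (reflect M i) l) := by
    intro l x
    rw [Finset.sum_mul, Finset.mul_sum, ← Finset.sum_sub_distrib, Finset.sum_eq_single l]
    · exact hZ l x
    · intro j _ hj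
      refine (hZ' j l hj.symm x).trans ?_
      simp [rslice]
    · simp
  rw [h1]
  exact isCommForm_of_on h2

end Commutators

end YDMod

/-! ### Coequivariant families of operators -/

section Coequivariant

/-- `δ(F x z) = x₍₋₁₎ z₍₋₁₎ ⊗ F x₍₀₎ z₍₀₎`. -/
def IsCoequivariant {R X : Type*} [AddCommGroup R] [Module k R] [AddCommGroup X] [Module k X]
    (coactX : X →ₗ[k] H ⊗[k] X) (coact : R →ₗ[k] H ⊗[k] R) (F : X →ₗ[k] Module.End k R) : Prop :=
  ∀ x z, coact (F x z) = TensorProduct.map₂ (LinearMap.mul k H) F (coactX x) (coact z)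

theorem isCoequivariant_mulLeft {R : Type*} [Ring R] [Algebra k R] (coact : R →ₐ[k] H ⊗[k] R) :
    IsCoequivariant coact.toLinearMap coact.toLinearMap (LinearMap.mul k R) := by
  intro x z
  have : ∀ s r : H ⊗[k] R, s * r =
      TensorProduct.map₂ (LinearMap.mul k H) (LinearMap.mul k R) s r := by
    intro s r
    induction s with
    | zero => simp
    | add x y hx hy => simp only [add_mul, map_add, LinearMap.add_apply, hx, hy]
    | tmul a b =>
      induction r with
      | zero => simp
      | add x y hx hy => simp only [mul_add, map_add, hx, hy]
      | tmul c d => simp [TensorProduct.map₂_apply_tmul]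
  simpa using this (coact x) (coact z)

variable {R X Y : Type*} [AddCommGroup R] [Module k R] [AddCommGroup X] [Module k X]
  [AddCommGroup Y] [Module k Y] {coactX : X →ₗ[k] H ⊗[k] X} {coactY : Y →ₗ[k] H ⊗[k] Y}
  {coact : R →ₗ[k] H ⊗[k] R} {F : X →ₗ[k] Module.End k R} {G : Y →ₗ[k] Module.End k R}

theorem IsCoequivariant.comp (hF : IsCoequivariant coactX coact F) {f : Y →ₗ[k] X}
    (hf : ∀ y, coactX (f y) = f.lTensor H (coactY y)) : IsCoequivariant coactY coact (F ∘ₗ f) := by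
  intro y z
  rw [LinearMap.comp_apply, hF, hf]
  generalize coactY y = s
  induction s with
  | zero => simp
  | add x y hx hy => simp only [map_add, LinearMap.add_apply, hx, hy]
  | tmul a b => simp [TensorProduct.map₂_apply_tmul]

theorem map₂_map₂ (s : H ⊗[k] X) (t : H ⊗[k] Y) (r : H ⊗[k] R) :
    TensorProduct.map₂ (LinearMap.mul k H) F s (TensorProduct.map₂ (LinearMap.mul k H) G t r) =
      TensorProduct.map₂ (LinearMap.mul k H)
        (TensorProduct.lift ((LinearMap.mul k (Module.End k R)).compl₁₂ F G))
        ((LinearMap.mul' k H).rTensor (X ⊗[k] Y)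
          (TensorProduct.tensorTensorTensorComm k H X H Y (s ⊗ₜ t))) r := by
  induction s with
  | zero => simp
  | add x y hx hy => simp only [add_tmul, map_add, LinearMap.add_apply, hx, hy]
  | tmul a b =>
    induction t with
    | zero => simp
    | add x y hx hy => simp only [tmul_add, map_add, LinearMap.add_apply, hx, hy]
    | tmul c d =>
      induction r with
      | zero => simp
      | add x y hx hy => simp only [map_add, hx, hy]
      | tmul p q => simp [TensorProduct.map₂_apply_tmul, mul_assoc]

theorem IsCoequivariant.lift_mul (hF : IsCoequivariant coactX coact F)
    (hG : IsCoequivariant coactY coact G) : IsCoequivariant (YDMod.diagCoact coactX coactY) coact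
      (TensorProduct.lift ((LinearMap.mul k (Module.End k R)).compl₁₂ F G)) := by
  intro s z
  induction s with
  | zero => simp
  | add x y hx hy => simp only [map_add, LinearMap.add_apply, hx, hy]
  | tmul x y =>
    simp only [TensorProduct.lift.tmul, LinearMap.compl₁₂_apply, LinearMap.mul_apply',
      Module.End.mul_apply]
    rw [hF, hG, map₂_map₂]
    rfl

/-- A coequivariant map on the generators extends to a coequivariant map on the algebra. -/
theorem IsPre.isCoequivariant {S A : Type*} [Ring S] [Algebra k S] [AddCommGroup A] [Module k A]
    {U : YDMod.{u, w, v} k H} {ι : U →ₗ[k] S} {act : H →ₐ[k] Module.End k S}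
    {coactS : S →ₐ[k] H ⊗[k] S} {Δ : S →ₗ[k] S ⊗[k] S} {ε : S →ₐ[k] k} {pr : S →ₗ[k] U}
    (hR : IsPre U ι act coactS Δ ε pr) {coactA : A →ₗ[k] H ⊗[k] A} {F : S →ₐ[k] Module.End k A}
    (hF : IsCoequivariant U.coact coactA (F.toLinearMap ∘ₗ ι)) :
    IsCoequivariant coactS.toLinearMap coactA F.toLinearMap := by
  intro x
  refine hR.ind (fun x => ∀ z, coactA (F.toLinearMap x z) = TensorProduct.map₂
    (LinearMap.mul k H) F.toLinearMap (coactS.toLinearMap x) (coactA z)) ?_ ?_ ?_ ?_ x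
  · intro z
    simp only [AlgHom.toLinearMap_apply, map_one, Module.End.one_apply,
      Algebra.TensorProduct.one_def, TensorProduct.map₂_apply_tmul]
    generalize coactA z = r
    induction r with
    | zero => simp
    | add x y hx hy => rw [map_add, ← hx, ← hy]
    | tmul a b => simp
  · intro x y hx hy z
    simp only [map_add, LinearMap.add_apply, hx, hy]
  · intro c x hx z
    simp only [map_smul, LinearMap.smul_apply, hx]
  · intro v x hx z
    have h1 := hF v (F x z)
    simp only [LinearMap.comp_apply, AlgHom.toLinearMap_apply] at h1 hx
    rw [AlgHom.toLinearMap_apply, map_mul, Module.End.mul_apply, h1, hx,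
      AlgHom.toLinearMap_apply, map_mul, hR.coact_ι]
    generalize U.coact v = s
    generalize coactS x = t
    generalize coactA z = r
    induction s with
    | zero => simp
    | add x y hx hy => simp only [add_mul, map_add, LinearMap.add_apply, hx, hy]
    | tmul a b =>
      induction t with
      | zero => simp
      | add x y hx hy => simp only [mul_add, map_add, LinearMap.add_apply, hx, hy]
      | tmul c d =>
        induction r with
        | zero => simp
        | add x y hx hy => simp only [map_add, hx, hy]
        | tmul p q => simp [TensorProduct.map₂_apply_tmul, mul_assoc]

variable [BijectiveAntipode k H]

/-- An injective coequivariant family determines the coaction. -/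
theorem IsCoequivariant.eq_of_map₂_eq {V : YDMod.{u, w, v} k H} {F : X →ₗ[k] Module.End k V}
    (hF : Function.Injective F) {s s' : H ⊗[k] X}
    (h : ∀ z, TensorProduct.map₂ (LinearMap.mul k H) F s (V.coact z) =
      TensorProduct.map₂ (LinearMap.mul k H) F s' (V.coact z)) : s = s' := by
  have h1 : ∀ (s : H ⊗[k] X) {m : ℕ} {t : Fin m → Fin m → H} {e : Fin m → V},
      IsCofam V.coact t e → ∀ p, ∑ b, (LinearMap.mulRight k (antipodeInv k (t p b))).rTensor V
        (TensorProduct.map₂ (LinearMap.mul k H) F s (V.coact (e b))) =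
      (F.flip (e p)).lTensor H s := by
    intro s m t e he p
    induction s with
    | zero => simp
    | add x y hx hy => simp only [map_add, LinearMap.add_apply, Finset.sum_add_distrib, hx, hy]
    | tmul a x =>
      simp only [he.coact_eq, map_sum, TensorProduct.map₂_apply_tmul, map_tmul,
        LinearMap.rTensor_tmul, LinearMap.mulRight_apply, LinearMap.mul_apply',
        LinearMap.lTensor_tmul, LinearMap.flip_apply]
      rw [Finset.sum_comm]
      have h2 : ∀ q, ∑ b, (a * t b q * antipodeInv k (t p b)) ⊗ₜ[k] F x (e q) =
          if p = q then a ⊗ₜ F x (e q) else 0 := by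
        intro q
        have := congrArg (fun h => (a * h) ⊗ₜ[k] F x (e q)) (he.mul_antipodeInv p q)
        simp only [Finset.mul_sum, sum_tmul, ← mul_assoc] at this
        rw [this]
        split_ifs <;> simp
      simp [h2]
  refine sub_eq_zero.1 (eq_zero_of_lslice fun χ => ?_)
  rw [map_sub, sub_eq_zero]
  refine hF (LinearMap.ext fun z => ?_)
  obtain ⟨m, t, e, p, he, rfl⟩ := V.exists_cofam z
  have h2 : (F.flip (e p)).lTensor H s = (F.flip (e p)).lTensor H s' := by
    rw [← h1 s he, ← h1 s' he]
    simp only [h]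
  have h3 : ∀ s, F (lslice χ s) (e p) = lslice χ ((F.flip (e p)).lTensor H s) := by
    intro s
    induction s with
    | zero => simp
    | add x y hx hy => simp only [map_add, LinearMap.add_apply, hx, hy]
    | tmul a b => simp
  rw [h3, h3, h2]

end Coequivariant

namespace YDMod

variable {ι : Type} [Fintype ι] [DecidableEq ι] {M : ι → YDMod.{u, w, v} k H} {i : ι}
variable [∀ j, FiniteDimensional k (M j)] [BijectiveAntipode k H]

variable (M i) in
theorem smashRep_isCoequivariant : IsCoequivariant (smashCoact M i) (pi M).nCoact.toLinearMap
    (smashRep M i) := by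
  refine (isCoequivariant_mulLeft (pi M).nCoact).lift_mul (G := (bder M i).toLinearMap)
    ((M i).dual.n_isPre.isCoequivariant ?_)
  intro f z
  obtain ⟨m, s, F, a, hs, rfl⟩ := (M i).dual.exists_cofam f
  simp only [LinearMap.comp_apply, AlgHom.toLinearMap_apply, bder_nι, coact_pder hs, hs.coact_eq,
    map_sum, TensorProduct.map₂_apply_tmul, LinearMap.sum_apply]
  rfl

theorem reflectRep_isCoequivariant : IsCoequivariant (pi (reflect M i)).tCoact.toLinearMap
    (pi M).nCoact.toLinearMap (reflectRep M i).toLinearMap := by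
  refine (pi (reflect M i)).t_isPre.isCoequivariant ?_
  have h : (reflectRep M i).toLinearMap ∘ₗ TensorAlgebra.ι k =
      smashRep M i ∘ₗ reflectGen M i := LinearMap.ext reflectRep_ι
  rw [h]
  exact (smashRep_isCoequivariant M i).comp reflectGen_hom.map_coact

/-! ### The kernel of the representation -/

section Kernel

theorem counit_pder_coinv {x : (pi M).Nichols} (hx : x ∈ coinvariants M i) (φ : M i →ₗ[k] k) :
    (pi M).nCounit (pder M i φ x) = 0 := by
  have h1 := gr_zero M (pder M i φ x)
  have h2 := pder_gr (Pi.single i 1) x φ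
  rw [sub_self, coinv_gr_of_height hx (by simp) (height_single_self i 1).le, map_zero, h1] at h2
  simpa using congrArg (pi M).nCounit h2.symm

theorem smashRep_reflectEmb_coinv (j : ι) (x : reflect M i j) {y : (pi M).Nichols}
    (hy : y ∈ coinvariants M i) : smashRep M i (reflectEmb M i j x) y ∈ coinvariants M i ∧
      (pi M).nCounit (smashRep M i (reflectEmb M i j x) y) = 0 := by
  revert x
  refine reflect_elim (P := fun X E => ∀ x, smashRep M i (E x) y ∈ coinvariants M i ∧
      (pi M).nCounit (smashRep M i (E x) y) = 0) j (fun _ f => ?_) (fun hj x => ?_)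
  · rw [LinearMap.comp_apply, mk_apply, smashRep_one_tmul_nι]
    exact ⟨pder_coinv hy _, counit_pder_coinv hy _⟩
  · rw [LinearMap.comp_apply, LinearMap.flip_apply, mk_apply, smashRep_tmul_one,
      LinearMap.mul_apply', map_mul, counit_adPow hj (LmaxIncl_mem j x), zero_mul]
    exact ⟨coinv_mul (adPow_le_coinv hj _ (LmaxIncl_mem j x)) hy, rfl⟩

theorem reflectRep_coinv (x : (pi (reflect M i)).T) {y : (pi M).Nichols}
    (hy : y ∈ coinvariants M i) : reflectRep M i x y ∈ coinvariants M i ∧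
      (pi M).nCounit (reflectRep M i x y) =
        (pi (reflect M i)).tCounit x * (pi M).nCounit y := by
  refine (pi (reflect M i)).t_isPre.ind (fun x => reflectRep M i x y ∈ coinvariants M i ∧
      (pi M).nCounit (reflectRep M i x y) =
        (pi (reflect M i)).tCounit x * (pi M).nCounit y) ?_ ?_ ?_ ?_ x
  · simpa using hy
  · intro a b ha hb
    simp only [map_add, LinearMap.add_apply, add_mul, ha.2, hb.2, and_true]
    exact add_mem ha.1 hb.1
  · intro c a ha
    simp only [map_smul, LinearMap.smul_apply, ha.2, smul_mul_assoc, and_true]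
    exact Submodule.smul_mem _ _ ha.1
  · intro w a ha
    have h1 : ∀ z ∈ coinvariants M i, smashRep M i (reflectGen M i w) z ∈ coinvariants M i ∧
        (pi M).nCounit (smashRep M i (reflectGen M i w) z) = 0 := by
      intro z hz
      simp only [reflectGen, LinearMap.sum_apply, map_sum, LinearMap.comp_apply]
      exact ⟨sum_mem fun j _ => (smashRep_reflectEmb_coinv j _ hz).1,
        Finset.sum_eq_zero fun j _ => (smashRep_reflectEmb_coinv j _ hz).2⟩
    rw [map_mul, Module.End.mul_apply, reflectRep_ι, map_mul,
      (pi (reflect M i)).t_isPre.counit_ι, zero_mul, zero_mul]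
    exact h1 _ ha.1

theorem counit_reflectRep_one (x : (pi (reflect M i)).T) :
    (pi M).nCounit (reflectRep M i x 1) = (pi (reflect M i)).tCounit x := by
  rw [(reflectRep_coinv x coinv_one).2, map_one, mul_one]

theorem commutator_reflectRep {Z : Module.End k (pi M).Nichols} {g : pi (reflect M i) →ₗ[k] k}
    (h : IsCommForm M i Z g) (x : (pi (reflect M i)).T) :
    Z * reflectRep M i x - reflectRep M i x * Z =
      commOp (pi M).nAct (pi (reflect M i)).coact (reflectRep M i).toLinearMap g
        ((pi (reflect M i)).tPr.lTensor _ ((pi (reflect M i)).tComul x)) :=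
  (pi (reflect M i)).t_isPre.commutator_eq reflectRep_isEquivariant h x

variable (hM : ∀ j, (M j).IsIrreducible) (hF : FinCond M i)
include hM hF

theorem ker_reflectRep_le : LinearMap.ker (reflectRep M i).toLinearMap ≤
    (pi (reflect M i)).nicholsSub := by
  refine le_trans (le_rightRad ?_) (rightRad_le_nicholsSub _)
  intro x hx
  have hx0 : reflectRep M i x = 0 := hx
  refine ⟨?_, fun φ => ?_⟩
  · rw [← counit_reflectRep_one, hx0, LinearMap.zero_apply, map_zero]
  have : FiniteDimensional k (pi (reflect M i)) :=
    inferInstanceAs (FiniteDimensional k (∀ j, reflect M i j))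
  obtain ⟨n, t, b, hb⟩ := (pi (reflect M i)).exists_basis_cofam
  set s := (pi (reflect M i)).tPr.lTensor (pi (reflect M i)).T
    ((pi (reflect M i)).tComul x) with hs
  have h1 : ∀ z : (pi (reflect M i)).T ⊗[k] pi (reflect M i),
      z = ∑ a, rslice (b.coord a) z ⊗ₜ b a := by
    intro z
    induction z with
    | zero => simp
    | add x y hx hy =>
      conv_lhs => rw [hx, hy]
      simp only [map_add, add_tmul, Finset.sum_add_distrib]
    | tmul c d =>
      conv_lhs => rw [← b.sum_repr d, tmul_sum]
      exact Finset.sum_congr rfl fun a _ => by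
        rw [rslice_tmul, smul_tmul, Module.Basis.coord_apply]
  have h2 : ∀ c, ∑ a, reflectRep M i (rslice (b.coord a) s) * (pi M).nAct (t a c) = 0 := by
    intro c
    obtain ⟨Z, hZ⟩ := exists_op hM hF (b.coord c)
    have h3 := commutator_reflectRep hZ x
    rw [hx0, mul_zero, zero_mul, sub_zero, ← hs, h1 s, map_sum] at h3
    rw [h3]
    refine Finset.sum_congr rfl fun a _ => ?_
    rw [commOp_cofam _ _ _ hb, Finset.sum_eq_single c]
    · simp
    · intro d _ hd
      simp [hd]
    · simp
  have h3 : ∀ d, reflectRep M i (rslice (b.coord d) s) = 0 := by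
    intro d
    have h5 : ∑ c, (∑ a, reflectRep M i (rslice (b.coord a) s) * (pi M).nAct (t a c)) *
        (pi M).nAct (antipode k (t c d)) = 0 := by simp only [h2, zero_mul, Finset.sum_const_zero]
    simp only [Finset.sum_mul, mul_assoc] at h5
    rw [Finset.sum_comm] at h5
    simpa only [← Finset.mul_sum, hb.toIsComatrix.sum_mul_antipode_act, mul_ite, mul_one,
      mul_zero, Finset.sum_ite_eq', Finset.mem_univ, if_true] using h5
  have h4 : rhit (pi (reflect M i)).tComul (φ ∘ₗ (pi (reflect M i)).tPr) x =
      ∑ a, φ (b a) • rslice (b.coord a) s := by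
    have h5 := rslice_map φ LinearMap.id (pi (reflect M i)).tPr ((pi (reflect M i)).tComul x)
    have h6 : rslice φ s = rslice (φ ∘ₗ (pi (reflect M i)).tPr)
      ((pi (reflect M i)).tComul x) := h5
    change rslice (φ ∘ₗ (pi (reflect M i)).tPr) ((pi (reflect M i)).tComul x) = _
    rw [← h6, h1 s, map_sum]
    simp only [rslice_tmul, ← h1 s]
  change reflectRep M i _ = 0
  rw [h4]
  simp only [map_sum, map_smul, h3, smul_zero, Finset.sum_const_zero]

end Kernel

end YDMod

namespace YDMod

variable {ι : Type} [Fintype ι] [DecidableEq ι] {M : ι → YDMod.{u, w, v} k H} {i : ι}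
variable [∀ j, FiniteDimensional k (M j)] [BijectiveAntipode k H]

/-! ### The grading of `K # B((M i)*)` -/

section Grading

variable (M i) in
/-- The projections to the components of `B((M i)*)`, where `(M i)*` has degree `-α i`. -/
def dualGr (γ : ι → ℤ) : (M i).dual.Nichols →ₗ[k] (M i).dual.Nichols :=
  nComp (M i).dual.isDec_unit (fun _ => -(Pi.single i 1 : ι → ℤ)) γ

theorem dualGr_isGr : IsGr (M i).dual.nι
    (fun _ : Unit => (LinearMap.id : (M i).dual →ₗ[k] (M i).dual))
    (fun _ => -(Pi.single i 1 : ι → ℤ)) (dualGr M i) :=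
  n_isGr (M i).dual.isDec_unit _

theorem tmul_mem_smashGrade {α β : ι → ℤ} {x : (pi M).Nichols} (hx : x ∈ coinvariants M i)
    (hα : gr M α x = x) {ξ : (M i).dual.Nichols} (hξ : dualGr M i β ξ = ξ) :
    x ⊗ₜ ξ ∈ smashGrade M i (α + β) := by
  refine Submodule.mem_iSup_of_mem α ⟨⟨x, hx, ?_⟩ ⊗ₜ ⟨ξ, ?_⟩, rfl⟩
  · refine (mem_nGrade (isDec_pi M) _ (fun j => ?_) α x).2 hα
    rw [piQ, LinearMap.range_comp, LinearMap.range_eq_top.2 (proj_surjective M j),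
      Submodule.map_top]
  · rw [add_sub_cancel_left]
    exact (mem_nGrade (M i).dual.isDec_unit _ (fun _ => LinearMap.range_id.symm) β ξ).2 hξ

theorem smashGrade_induction {p : Smash M i → Prop} {γ : ι → ℤ} (h0 : p 0)
    (hadd : ∀ x y, p x → p y → p (x + y))
    (ht : ∀ α β, α + β = γ → ∀ x ∈ coinvariants M i, gr M α x = x →
      ∀ ξ, dualGr M i β ξ = ξ → p (x ⊗ₜ ξ)) {t : Smash M i} (h : t ∈ smashGrade M i γ) : p t := by
  refine Submodule.iSup_induction _ (motive := p) h (fun α => ?_) h0 hadd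
  rintro _ ⟨s, rfl⟩
  induction s with
  | zero => simpa using h0
  | add x y hx hy => rw [map_add]; exact hadd _ _ hx hy
  | tmul x ξ =>
    refine ht α (γ - α) (by abel) x.1 x.2.1 ?_ ξ.1 ?_
    · refine (mem_nGrade (isDec_pi M) _ (fun j => ?_) α x.1).1 x.2.2
      rw [piQ, LinearMap.range_comp, LinearMap.range_eq_top.2 (proj_surjective M j),
        Submodule.map_top]
    · exact (mem_nGrade (M i).dual.isDec_unit _ (fun _ => LinearMap.range_id.symm) _ ξ.1).1 ξ.2

theorem tmul_mem_smash {x : (pi M).Nichols} (hx : x ∈ coinvariants M i)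
    (ξ : (M i).dual.Nichols) : x ⊗ₜ ξ ∈ smash M i := ⟨⟨x, hx⟩ ⊗ₜ ξ, rfl⟩

theorem smashGrade_le (γ : ι → ℤ) : smashGrade M i γ ≤ smash M i := fun t ht =>
  smashGrade_induction (p := fun t => t ∈ smash M i) (zero_mem _) (fun _ _ => add_mem)
    (fun _ _ _ _ hx _ _ _ => tmul_mem_smash hx _) ht

theorem map_gr_dualGr {γ : ι → ℤ} {t : Smash M i} (ht : t ∈ smashGrade M i γ) (α β : ι → ℤ)
    (h : α + β ≠ γ) : TensorProduct.map (gr M α) (dualGr M i β) t = 0 := by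
  refine smashGrade_induction (p := fun t => TensorProduct.map (gr M α) (dualGr M i β) t = 0)
    (map_zero _) (fun x y hx hy => by rw [map_add, hx, hy, add_zero]) ?_ ht
  intro α' β' h' x _ hx ξ hξ
  rw [map_tmul]
  by_cases hα : α = α'
  · rw [(M i).dual.n_isPre.comp_eq_zero (M i).dual.isDec_unit dualGr_isGr hξ, tmul_zero]
    rintro rfl
    exact h (hα ▸ h')
  · rw [(pi M).n_isPre.comp_eq_zero (isDec_pi M) (gr_isGr M) hx hα, zero_tmul]

theorem eq_zero_of_map_gr_dualGr {t : Smash M i}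
    (h : ∀ α β, TensorProduct.map (gr M α) (dualGr M i β) t = 0) : t = 0 := by
  refine (pi M).n_isPre.eq_zero_of_comp_left (isDec_pi M) (gr_isGr M) fun α => ?_
  refine (M i).dual.n_isPre.eq_zero_of_comp_right (M i).dual.isDec_unit dualGr_isGr fun β => ?_
  rw [← LinearMap.comp_apply, LinearMap.lTensor_comp_rTensor]
  exact h α β

theorem pder_smash_tmul {m : ℕ} {t : Fin m → Fin m → H} {e : Fin m → (pi M).Nichols}
    (he : IsCofam (pi M).nCoact.toLinearMap t e) (a : Fin m) (f : (M i).dual)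
    (ξ : (M i).dual.Nichols) : ∃ F : Fin m → (M i).dual,
    pder M i (dualForm f) * smashRep M i (e a ⊗ₜ ξ) =
      smashRep M i (pder M i (dualForm f) (e a) ⊗ₜ ξ +
        ∑ b, e b ⊗ₜ ((M i).dual.nι (F b) * ξ)) := by
  let F : Fin m → (M i).dual := fun b => (dualForm f ∘ₗ (M i).act (t a b) : Module.Dual k (M i))
  have hF : ∀ b, bder M i ((M i).dual.nι (F b)) =
      pder M i (dualForm f ∘ₗ (M i).act (t a b)) := fun b => bder_nι M i (F b)
  refine ⟨F, ?_⟩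
  ext y
  rw [map_add, map_sum]
  simp only [smashRep_tmul, Module.End.mul_apply, LinearMap.comp_apply, LinearMap.mulLeft_apply,
    LinearMap.add_apply, LinearMap.sum_apply, map_mul, hF]
  exact pder_mul he a (dualForm f) (bder M i ξ y)

theorem dualGr_nι_mul {β : ι → ℤ} {ξ : (M i).dual.Nichols} (hξ : dualGr M i β ξ = ξ)
    (f : (M i).dual) : dualGr M i (β - Pi.single i 1) ((M i).dual.nι f * ξ) =
      (M i).dual.nι f * ξ := by
  rw [dualGr_isGr.comp_ι_mul]
  simp [hξ]

theorem exists_pder_smashGrade {γ : ι → ℤ} {t : Smash M i} (ht : t ∈ smashGrade M i γ)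
    (f : (M i).dual) : ∃ t' ∈ smashGrade M i (γ - Pi.single i 1),
      smashRep M i t' = pder M i (dualForm f) * smashRep M i t := by
  let p : Smash M i → Prop := fun t => ∃ t' ∈ smashGrade M i (γ - Pi.single i 1),
    smashRep M i t' = pder M i (dualForm f) * smashRep M i t
  change p t
  refine smashGrade_induction ?_ ?_ ?_ ht
  · refine ⟨0, zero_mem _, ?_⟩
    rw [map_zero, mul_zero]
  · rintro x y ⟨x', hx', hx⟩ ⟨y', hy', hy⟩
    exact ⟨x' + y', add_mem hx' hy', by rw [map_add, map_add, hx, hy, mul_add]⟩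
  · rintro α β rfl x hxK hx ξ hξ
    have hsub : (pi M).nichols.IsSub (LinearMap.eqLocus (gr M α) LinearMap.id) :=
      IsSub.eqLocus (X := (pi M).nichols) ((pi M).n_isPre.comp_hom (isDec_pi M) (gr_isGr M) α)
        (IsYDMap.id' _ _)
    obtain ⟨m, t, e, a, he, heK, rfl⟩ := exists_nichols_cofam
      ((coinv_isSub M i).inf hsub) (x := x) ⟨hxK, hx⟩
    obtain ⟨F, hF⟩ := pder_smash_tmul he a f ξ
    refine ⟨_, add_mem ?_ (sum_mem fun b _ => ?_), hF.symm⟩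
    · have := tmul_mem_smashGrade (pder_coinv hxK (dualForm f)) (α := α - Pi.single i 1)
        (by rw [← pder_gr, hx]) hξ
      rwa [show α - Pi.single i 1 + β = α + β - Pi.single i 1 by abel] at this
    · have := tmul_mem_smashGrade (heK b).1 (heK b).2 (dualGr_nι_mul hξ (F b))
      rwa [← add_sub_assoc] at this

theorem mulLeft_smashRep (x : (pi M).Nichols) (t : Smash M i) :
    smashRep M i ((LinearMap.mulLeft k x).rTensor _ t) =
      LinearMap.mul k (pi M).Nichols x * smashRep M i t := by
  induction t using TensorProduct.induction_on with
  | zero => simp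
  | add x y hx hy => simp only [map_add, hx, hy, mul_add]
  | tmul y ξ => ext z; simp [smashRep_tmul, mul_assoc]

theorem mulLeft_mem_smashGrade {α γ : ι → ℤ} {x : (pi M).Nichols} (hx : x ∈ coinvariants M i)
    (hα : gr M α x = x) {t : Smash M i} (ht : t ∈ smashGrade M i γ) :
    (LinearMap.mulLeft k x).rTensor _ t ∈ smashGrade M i (γ + α) := by
  refine smashGrade_induction (p := fun t =>
    (LinearMap.mulLeft k x).rTensor _ t ∈ smashGrade M i (γ + α)) ?_ ?_ ?_ ht
  · rw [map_zero]; exact zero_mem _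
  · intro a b ha hb
    rw [map_add]; exact add_mem ha hb
  · rintro α' β rfl y hyK hy ξ hξ
    have := tmul_mem_smashGrade (coinv_mul hx hyK) (α := α' + α) (by
      rw [(pi M).n_isPre.comp_mul_of_eq (isDec_pi M) (gr_isGr M) hα, add_sub_cancel_right, hy]) hξ
    rwa [show α' + α + β = α' + β + α by abel] at this

theorem simpleRefl_single_self : simpleRefl M i (Pi.single i 1) = -Pi.single i 1 := by
  rw [simpleRefl_single, cartan, if_pos rfl, two_smul]; abel

theorem simpleRefl_single_of_ne {j : ι} (hj : j ≠ i) :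
    simpleRefl M i (Pi.single j 1) = adDeg i j (topDeg M i j) := by
  rw [simpleRefl_single, cartan, if_neg hj, adDeg, neg_smul, sub_neg_eq_add]

theorem exists_reflectEmb_mul {j : ι} (x : reflect M i j) {γ : ι → ℤ} {t : Smash M i}
    (ht : t ∈ smashGrade M i γ) :
    ∃ t' ∈ smashGrade M i (γ + simpleRefl M i (Pi.single j 1)),
      smashRep M i t' = smashRep M i (reflectEmb M i j x) * smashRep M i t := by
  revert x
  refine reflect_elim (P := fun X E => ∀ x : X,
    ∃ t' ∈ smashGrade M i (γ + simpleRefl M i (Pi.single j 1)),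
      smashRep M i t' = smashRep M i (E x) * smashRep M i t) j (fun hj f => ?_) (fun hj x => ?_)
  · subst hj
    rw [LinearMap.comp_apply, mk_apply, smashRep_one_tmul_nι, simpleRefl_single_self,
      ← sub_eq_add_neg]
    exact exists_pder_smashGrade ht f
  · rw [LinearMap.comp_apply, LinearMap.flip_apply, mk_apply, smashRep_tmul_one,
      simpleRefl_single_of_ne hj]
    exact ⟨_, mulLeft_mem_smashGrade (adPow_le_coinv hj _ (LmaxIncl_mem j x))
      (gr_adPow (LmaxIncl_mem j x)) ht, mulLeft_smashRep _ _⟩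

theorem one_mem_smashGrade : (1 : (pi M).Nichols) ⊗ₜ (1 : (M i).dual.Nichols) ∈
    smashGrade M i 0 := by
  have := tmul_mem_smashGrade (M := M) (i := i) (α := 0) (β := 0) coinv_one
    (by rw [(gr_isGr M).comp_one, if_pos rfl]) (ξ := 1)
    (by rw [dualGr_isGr.comp_one, if_pos rfl])
  rwa [add_zero] at this

theorem smashRep_one : smashRep M i (1 ⊗ₜ 1) = 1 := by
  rw [smashRep_tmul_one]; ext; simp

variable (M i) in
/-- The projections to the components of `T(W')`. -/
def reflectGr (γ : ι → ℤ) : (pi (reflect M i)).T →ₗ[k] (pi (reflect M i)).T :=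
  (pi (reflect M i)).tComp (piQ (reflect M i)) (fun j => simpleRefl M i (Pi.single j 1)) γ

theorem reflectGr_isGr : IsGr (TensorAlgebra.ι k) (piQ (reflect M i))
    (fun j => simpleRefl M i (Pi.single j 1)) (reflectGr M i) := t_isGr _ _ _

theorem exists_smashGrade (γ : ι → ℤ) (x : (pi (reflect M i)).T) :
    ∃ t ∈ smashGrade M i γ, smashRep M i t = reflectRep M i (reflectGr M i γ x) := by
  revert γ
  refine (pi (reflect M i)).t_isPre.ind (fun x => ∀ γ, ∃ t ∈ smashGrade M i γ,
    smashRep M i t = reflectRep M i (reflectGr M i γ x)) ?_ ?_ ?_ ?_ x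
  · intro γ
    rw [reflectGr_isGr.comp_one]
    split_ifs with h
    · subst h
      exact ⟨_, one_mem_smashGrade, by rw [smashRep_one, map_one]⟩
    · exact ⟨0, zero_mem _, by rw [map_zero, map_zero]⟩
  · intro x y hx hy γ
    obtain ⟨s, hs, hs'⟩ := hx γ
    obtain ⟨t, ht, ht'⟩ := hy γ
    exact ⟨s + t, add_mem hs ht, by simp only [map_add, hs', ht']⟩
  · intro c x hx γ
    obtain ⟨s, hs, hs'⟩ := hx γ
    exact ⟨c • s, Submodule.smul_mem _ _ hs, by simp only [map_smul, hs']⟩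
  · intro w x hx γ
    have h1 : ∀ j, ∃ t ∈ smashGrade M i γ, smashRep M i t =
        smashRep M i (reflectEmb M i j (proj (reflect M i) j w)) *
          reflectRep M i (reflectGr M i (γ - simpleRefl M i (Pi.single j 1)) x) := by
      intro j
      obtain ⟨t, ht, ht'⟩ := hx (γ - simpleRefl M i (Pi.single j 1))
      obtain ⟨t', h1, h2⟩ := exists_reflectEmb_mul (proj (reflect M i) j w) ht
      rw [sub_add_cancel] at h1
      exact ⟨t', h1, by rw [h2, ht']⟩
    choose t ht ht' using h1
    refine ⟨∑ j, t j, sum_mem fun j _ => ht j, ?_⟩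
    rw [reflectGr_isGr.comp_ι_mul, map_sum, map_sum]
    refine Finset.sum_congr rfl fun j _ => ?_
    rw [ht', map_mul, reflectRep_ι, piQ, LinearMap.comp_apply, reflectGen_single]

theorem exists_smash (x : (pi (reflect M i)).T) :
    ∃ t ∈ smash M i, smashRep M i t = reflectRep M i x := by
  obtain ⟨s, hs⟩ := (pi (reflect M i)).t_isPre.exists_finset reflectGr_isGr
    (isDec_pi (reflect M i)) x
  choose t ht ht' using fun γ => exists_smashGrade (M := M) (i := i) γ x
  refine ⟨∑ γ ∈ s, t γ, sum_mem fun γ _ => smashGrade_le γ (ht γ), ?_⟩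
  conv_rhs => rw [← hs s subset_rfl]
  simp only [map_sum, ht']

variable (hM : ∀ j, (M j).IsIrreducible) (hF : FinCond M i)
include hM hF

theorem reflectRep_eq_zero {x : (pi (reflect M i)).T}
    (hx : x ∈ (pi (reflect M i)).nicholsSub) : reflectRep M i x = 0 := by
  have hT := (pi (reflect M i)).t_isPre
  have hq := (pi (reflect M i)).isDec_unit
  let c : ℤ → (pi (reflect M i)).T →ₗ[k] (pi (reflect M i)).T :=
    (pi (reflect M i)).tComp (fun _ : Unit => LinearMap.id) (fun _ => (1 : ℤ))
  have hc : IsGr (TensorAlgebra.ι k)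
    (fun _ : Unit => (LinearMap.id : pi (reflect M i) →ₗ[k] pi (reflect M i)))
    (fun _ => (1 : ℤ)) c := t_isGr _ _ _
  have hcn : ∀ n x, x ∈ (pi (reflect M i)).nicholsSub → c n x ∈ (pi (reflect M i)).nicholsSub := by
    intro n x hx
    rw [← nmk_eq_zero] at hx ⊢
    rw [← nComp_nmk hq, hx, map_zero]
  have key : ∀ (n : ℕ) x, x ∈ (pi (reflect M i)).nicholsSub → c n x = x →
      reflectRep M i x = 0 := by
    intro n
    induction n with
    | zero =>
      intro x hx hx0
      rw [nicholsSub_eq_rightRad] at hx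
      have := IsPre.comp_zero hT hc x
      rw [Nat.cast_zero] at hx0
      rw [← hx0, this, (rightRad_stable x hx).1, zero_smul, map_zero]
    | succ n ih =>
      intro x hx hxn
      have h1 : ∀ φ : pi (reflect M i) →ₗ[k] k, reflectRep M i
          (rhit (pi (reflect M i)).tComul (φ ∘ₗ (pi (reflect M i)).tPr) x) = 0 := by
        intro φ
        refine ih _ ?_ ?_
        · rw [nicholsSub_eq_rightRad] at hx ⊢
          exact (rightRad_stable x hx).2 φ
        · have := hT.rder_comp hq hc (n + 1 : ℕ) φ x
          rw [hxn] at this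
          simpa using this.symm
      have h2 : ∀ (Z : Module.End k (pi M).Nichols) g, IsCommForm M i Z g →
          Commute Z (reflectRep M i x) := by
        intro Z g hZ
        have h3 := commutator_reflectRep hZ x
        obtain ⟨r, b, a, hb, hab⟩ := exists_rep_right
          ((pi (reflect M i)).tPr.lTensor _ ((pi (reflect M i)).tComul x))
        obtain ⟨φ, hφ⟩ := exists_dual_family hb
        have h4 : ∀ d, reflectRep M i (a d) = 0 := by
          intro d
          rw [← h1 (φ d)]
          congr 1
          have h5 := rslice_map (φ d) LinearMap.id (pi (reflect M i)).tPr
            ((pi (reflect M i)).tComul x)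
          change rslice (φ d) ((pi (reflect M i)).tPr.lTensor _
            ((pi (reflect M i)).tComul x)) = _ at h5
          rw [hab] at h5
          have h6 : a d = rslice (φ d ∘ₗ (pi (reflect M i)).tPr)
              ((pi (reflect M i)).tComul x) := by simpa [hφ] using h5
          exact h6
        rw [hab, map_sum] at h3
        simp only [commOp_tmul, AlgHom.toLinearMap_apply, h4, zero_mul,
          Finset.sum_const_zero] at h3
        exact sub_eq_zero.1 h3
      obtain ⟨t, ht, ht'⟩ := exists_smash x
      obtain ⟨r, hr⟩ := eq_smul_one_of_commute hM hF ht
        (fun v => by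
          obtain ⟨g, hg⟩ := exists_isCommForm_adOp hM hF v
          rw [ht']; exact h2 _ g hg)
        (fun j hj f => by
          obtain ⟨g, hg⟩ := exists_isCommForm_coinvOp (M := M) hj f
          rw [ht']; exact h2 _ g hg)
      have h3 : reflectRep M i x = r • 1 := by
        rw [← ht', hr, map_smul, smashRep_one]
      have h4 := counit_reflectRep_one x
      rw [nicholsSub_eq_rightRad] at hx
      rw [h3, (rightRad_stable x hx).1] at h4
      have h5 : r = 0 := by simpa using h4
      rw [h3, h5, zero_smul]
  obtain ⟨s, hs⟩ := hT.exists_finset hc hq x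
  rw [← hs s subset_rfl, map_sum]
  refine Finset.sum_eq_zero fun n _ => ?_
  rcases lt_or_ge n 0 with h | h
  · rw [IsPre.comp_neg hT hc h, map_zero]
  · lift n to ℕ using h
    exact key n _ (hcn _ _ hx) (hT.comp_self hq hc _ _)

end Grading

end YDMod

namespace YDMod

variable {ι : Type} [Fintype ι] [DecidableEq ι] {M : ι → YDMod.{u, w, v} k H} {i : ι}
variable [∀ j, FiniteDimensional k (M j)] [BijectiveAntipode k H]

/-! ### The range of the representation -/

section Range

theorem exists_reflectEmb_self (f : (M i).dual) :
    ∃ x, reflectEmb M i i x = 1 ⊗ₜ (M i).dual.nι f :=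
  reflect_elim (P := fun _ E => ∀ f : (M i).dual, ∃ x, E x = 1 ⊗ₜ (M i).dual.nι f) i
    (fun _ f => ⟨f, rfl⟩) (fun h => absurd rfl h) f

theorem exists_reflectEmb_of_ne {j : ι} (hj : j ≠ i) {y : (pi M).Nichols}
    (hy : y ∈ adPow M i j (topDeg M i j)) : ∃ x, reflectEmb M i j x = y ⊗ₜ 1 :=
  reflect_elim (P := fun _ E => ∃ x, E x = y ⊗ₜ 1) j (fun h => absurd h hj)
    (fun _ => ⟨⟨y, hy⟩, rfl⟩)

theorem smashRep_reflectEmb_mem (j : ι) (x : reflect M i j) :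
    smashRep M i (reflectEmb M i j x) ∈ (reflectRep M i).range :=
  ⟨TensorAlgebra.ι k (single (reflect M i) j x), by
    rw [← reflectGen_single]; exact reflectRep_ι _⟩

theorem pder_mem_range (φ : M i →ₗ[k] k) : pder M i φ ∈ (reflectRep M i).range := by
  let f : (M i).dual := (φ : Module.Dual k (M i))
  obtain ⟨x, hx⟩ := exists_reflectEmb_self f
  have := smashRep_reflectEmb_mem i x
  rw [hx, smashRep_one_tmul_nι] at this
  exact this

theorem bder_mem_range (ξ : (M i).dual.Nichols) : bder M i ξ ∈ (reflectRep M i).range := by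
  induction ξ using dual_ind with
  | h1 => rw [map_one]; exact one_mem _
  | ha x y hx hy => rw [map_add]; exact add_mem hx hy
  | hs c x hx => rw [map_smul]; exact Subalgebra.smul_mem _ hx c
  | hm f x hx =>
    rw [map_mul, bder_nι]
    exact mul_mem (pder_mem_range _) hx

variable (hM : ∀ j, (M j).IsIrreducible) (hF : FinCond M i)
include hM hF

theorem mul_adPow_mem_range {j : ι} (hj : j ≠ i) (n : ℕ) :
    ∀ x ∈ adPow M i j n, LinearMap.mul k (pi M).Nichols x ∈ (reflectRep M i).range := by
  have := hF j hj
  have key : ∀ d n, n + d = topDeg M i j → ∀ x ∈ adPow M i j n,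
      LinearMap.mul k (pi M).Nichols x ∈ (reflectRep M i).range := by
    intro d
    induction d with
    | zero =>
      rintro n rfl x hx
      obtain ⟨y, hy⟩ := exists_reflectEmb_of_ne hj hx
      have := smashRep_reflectEmb_mem j y
      rwa [hy, smashRep_tmul_one] at this
    | succ d ih =>
      intro n hn x hx
      rw [← dspan_adPow hj (hM j) (by omega)] at hx
      induction hx using Submodule.span_induction with
      | zero => rw [map_zero]; exact zero_mem _
      | add x y _ _ hx hy => rw [map_add]; exact add_mem hx hy
      | smul c x _ hx => rw [map_smul]; exact Subalgebra.smul_mem _ hx c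
      | mem x hx =>
        obtain ⟨φ, y, hy, rfl⟩ := hx
        obtain ⟨m, t, e, a, he, heP, rfl⟩ := exists_nichols_cofam (adPow_isSub M i j (n + 1)) hy
        have h : LinearMap.mul k (pi M).Nichols (pder M i φ (e a)) =
            pder M i φ * LinearMap.mul k (pi M).Nichols (e a) -
              ∑ b, LinearMap.mul k (pi M).Nichols (e b) * pder M i (φ ∘ₗ (M i).act (t a b)) := by
          ext z
          have := pder_mul he a φ z
          simp only [LinearMap.sub_apply, LinearMap.sum_apply, Module.End.mul_apply,
            LinearMap.mul_apply', this]
          abel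
        rw [h]
        have hm : ∀ b, LinearMap.mul k (pi M).Nichols (e b) ∈ (reflectRep M i).range :=
          fun b => ih (n + 1) (by omega) _ (heP b)
        exact sub_mem (mul_mem (pder_mem_range _) (hm a))
          (sum_mem fun b _ => mul_mem (hm b) (pder_mem_range _))
  intro x hx
  by_cases hn : n ≤ topDeg M i j
  · exact key (topDeg M i j - n) n (by omega) x hx
  · rw [← adPow_ne_bot_iff hj (hM j) n, not_not] at hn
    rw [hn, Submodule.mem_bot] at hx
    rw [hx, map_zero]
    exact zero_mem _

theorem mul_coinv_mem_range {x : (pi M).Nichols} (hx : x ∈ coinvariants M i) :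
    LinearMap.mul k (pi M).Nichols x ∈ (reflectRep M i).range := by
  let S : Set (pi M).Nichols := {y | ∃ j, j ≠ i ∧ ∃ n, y ∈ adPow M i j n}
  have hact : ∀ y ∈ Algebra.adjoin k S, ∀ h, (pi M).nAct h y ∈ Algebra.adjoin k S := by
    intro y hy
    refine Algebra.adjoin_induction (p := fun y _ => ∀ h, (pi M).nAct h y ∈ Algebra.adjoin k S)
      ?_ ?_ ?_ ?_ hy
    · rintro y ⟨j, hj, n, hy⟩ h
      exact Algebra.subset_adjoin ⟨j, hj, n, (adPow_isSub M i j n).act_mem h hy⟩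
    · intro r h
      rw [Algebra.algebraMap_eq_smul_one, map_smul, (pi M).n_isPre.act_one]
      exact Subalgebra.smul_mem _ (Subalgebra.smul_mem _ (one_mem _) _) r
    · intro x y _ _ hx hy h
      rw [map_add]
      exact add_mem (hx h) (hy h)
    · intro x y _ _ hx hy h
      rw [(pi M).nAct_mul x y h]
      generalize comul (R := k) h = t
      induction t with
      | zero => rw [map_zero, map_zero]; exact zero_mem _
      | add s t hs ht => rw [map_add, map_add]; exact add_mem hs ht
      | tmul a b => exact mul_mem (hx a) (hy b)
  have hK : coinvariants M i ≤ Subalgebra.toSubmodule (Algebra.adjoin k S) := by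
    refine coinv_le ?_ (one_mem (Algebra.adjoin k S)) ?_ ?_ ?_
    · intro y hy
      refine Algebra.adjoin_induction (p := fun y _ => y ∈ coinvariants M i) ?_ ?_ ?_ ?_ hy
      · rintro y ⟨j, hj, n, hy⟩
        exact adPow_le_coinv hj n hy
      · intro r
        rw [Algebra.algebraMap_eq_smul_one]
        exact Submodule.smul_mem _ r coinv_one
      · exact fun _ _ _ _ => add_mem
      · exact fun _ _ _ _ => coinv_mul
    · intro j hj u y hy
      exact mul_mem (S := Subalgebra k _) (Algebra.subset_adjoin ⟨j, hj, 0, inc_mem M j u⟩) hy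
    · intro v y hy
      revert v
      refine Algebra.adjoin_induction (p := fun y _ => ∀ v : M i,
        (pi M).adc (inc M i v) y ∈ Algebra.adjoin k S) ?_ ?_ ?_ ?_ hy
      · rintro y ⟨j, hj, n, hy⟩ v
        exact Algebra.subset_adjoin ⟨j, hj, n + 1, adc_mem_adPow M i j v hy⟩
      · intro r v
        rw [Algebra.algebraMap_eq_smul_one, map_smul, adc_one, smul_zero]
        exact zero_mem _
      · intro x y _ _ hx hy v
        rw [map_add]
        exact add_mem (hx v) (hy v)
      · intro x y hx' hy' hx hy v
        obtain ⟨m, t, e, a, he, rfl⟩ := (M i).exists_cofam v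
        rw [adc_mul (inc_cofam he)]
        exact add_mem (mul_mem (hx _) hy') (sum_mem fun b _ => mul_mem (hact _ hx' _) (hy _))
    · exact fun h y hy => hact y hy h
  refine Algebra.adjoin_induction (p := fun x _ =>
    LinearMap.mul k (pi M).Nichols x ∈ (reflectRep M i).range) ?_ ?_ ?_ ?_ (hK hx)
  · rintro y ⟨j, hj, n, hy⟩
    exact mul_adPow_mem_range hM hF hj n y hy
  · intro r
    rw [Algebra.algebraMap_eq_smul_one, map_smul]
    refine Subalgebra.smul_mem _ ?_ r
    convert one_mem (reflectRep M i).range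
    ext; simp
  · intro x y _ _ hx hy
    rw [map_add]
    exact add_mem hx hy
  · intro x y _ _ hx hy
    convert mul_mem hx hy
    ext; simp [mul_assoc]

theorem exists_reflectRep {t : Smash M i} (ht : t ∈ smash M i) :
    ∃ x, reflectRep M i x = smashRep M i t := by
  obtain ⟨s, rfl⟩ := ht
  change _ ∈ (reflectRep M i).range
  induction s using TensorProduct.induction_on with
  | zero => rw [map_zero, map_zero]; exact zero_mem _
  | add x y hx hy => rw [map_add, map_add]; exact add_mem hx hy
  | tmul x ξ =>
    exact mul_mem (mul_coinv_mem_range hM hF x.2) (bder_mem_range ξ)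

end Range

/-! ### The isomorphism `B(W') ≅ K # B((M i)*)` -/

section Iso

variable (hM : ∀ j, (M j).IsIrreducible) (hF : FinCond M i)

/-- The isomorphism `B(W') → K # B((M i)*)`, as an injective map to `B(W) ⊗ B((M i)*)`. -/
def reflectIso : (pi (reflect M i)).Nichols →ₗ[k] Smash M i :=
  descend (pi (reflect M i)).nmk.toLinearMap (pi (reflect M i)).nmk_surjective
    ((LinearEquiv.ofInjective (smashRep M i) smashRep_injective).symm.toLinearMap ∘ₗ
      LinearMap.codRestrict (LinearMap.range (smashRep M i)) (reflectRep M i).toLinearMap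
        fun x => (exists_smash x).imp fun _ h => h.2)
    (by
      rw [ker_nmk]
      intro x hx
      have h : LinearMap.codRestrict (LinearMap.range (smashRep M i)) (reflectRep M i).toLinearMap
          (fun x => (exists_smash x).imp fun _ h => h.2) x = 0 :=
        Subtype.ext (reflectRep_eq_zero hM hF hx)
      rw [LinearMap.mem_ker, LinearMap.comp_apply, h, map_zero])

theorem smashRep_reflectIso_nmk (x : (pi (reflect M i)).T) :
    smashRep M i (reflectIso hM hF ((pi (reflect M i)).nmk x)) = reflectRep M i x := by
  have : reflectIso hM hF ((pi (reflect M i)).nmk x) = _ :=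
    descend_apply (pi (reflect M i)).nmk.toLinearMap (pi (reflect M i)).nmk_surjective _ _ x
  rw [this]
  exact congrArg Subtype.val
    ((LinearEquiv.ofInjective (smashRep M i) smashRep_injective).apply_symm_apply _)

theorem reflectIso_nι (w : pi (reflect M i)) :
    reflectIso hM hF ((pi (reflect M i)).nι w) = reflectGen M i w := by
  apply smashRep_injective
  rw [← reflectRep_ι]
  exact smashRep_reflectIso_nmk hM hF _

theorem reflectIso_one : reflectIso hM hF 1 = 1 ⊗ₜ 1 := by
  apply smashRep_injective
  rw [smashRep_one, ← map_one (pi (reflect M i)).nmk, smashRep_reflectIso_nmk, map_one]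

theorem smashRep_reflectIso_mul (x y : (pi (reflect M i)).Nichols) :
    smashRep M i (reflectIso hM hF (x * y)) =
      smashRep M i (reflectIso hM hF x) * smashRep M i (reflectIso hM hF y) := by
  obtain ⟨x, rfl⟩ := (pi (reflect M i)).nmk_surjective x
  obtain ⟨y, rfl⟩ := (pi (reflect M i)).nmk_surjective y
  rw [← map_mul, smashRep_reflectIso_nmk, smashRep_reflectIso_nmk, smashRep_reflectIso_nmk,
    map_mul]

theorem reflectIso_injective : Function.Injective (reflectIso hM hF) := by
  rw [← LinearMap.ker_eq_bot, LinearMap.ker_eq_bot']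
  intro y hy
  obtain ⟨x, rfl⟩ := (pi (reflect M i)).nmk_surjective y
  refine (pi (reflect M i)).nmk_eq_zero.2 (ker_reflectRep_le hM hF ?_)
  change reflectRep M i x = 0
  rw [← smashRep_reflectIso_nmk hM hF, hy, map_zero]

theorem range_reflectIso : LinearMap.range (reflectIso hM hF) = smash M i := by
  apply le_antisymm
  · rintro _ ⟨y, rfl⟩
    obtain ⟨x, rfl⟩ := (pi (reflect M i)).nmk_surjective y
    obtain ⟨t, ht, h⟩ := exists_smash x
    rw [← smashRep_reflectIso_nmk hM hF] at h
    rwa [← smashRep_injective h]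
  · intro t ht
    obtain ⟨x, hx⟩ := exists_reflectRep hM hF ht
    refine ⟨(pi (reflect M i)).nmk x, smashRep_injective ?_⟩
    rw [smashRep_reflectIso_nmk, hx]

theorem reflectIso_hom : IsYDMap (pi (reflect M i)).nAct (pi (reflect M i)).nCoact.toLinearMap
    (smashAct M i) (smashCoact M i) (reflectIso hM hF) where
  map_act h y := by
    obtain ⟨x, rfl⟩ := (pi (reflect M i)).nmk_surjective y
    apply smashRep_injective
    refine comatrix_induction (k := k) (p := fun h =>
      smashRep M i (reflectIso hM hF ((pi (reflect M i)).nAct h ((pi (reflect M i)).nmk x))) =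
      smashRep M i (smashAct M i h (reflectIso hM hF ((pi (reflect M i)).nmk x)))) ?_ ?_ ?_ ?_ h
    · simp only [map_zero, LinearMap.zero_apply]
    · intro g h hg hh
      simp only [map_add, LinearMap.add_apply, hg, hh]
    · intro c h hh
      simp only [map_smul, LinearMap.smul_apply, hh]
    · intro m t ht a b
      rw [nAct_nmk, smashRep_reflectIso_nmk, (smashRep_isEquivariant M i).conj ht,
        smashRep_reflectIso_nmk]
      exact reflectRep_isEquivariant.conj ht a b x
  map_coact y := by
    obtain ⟨x, rfl⟩ := (pi (reflect M i)).nmk_surjective y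
    refine IsCoequivariant.eq_of_map₂_eq (V := (pi M).nichols) smashRep_injective fun z => ?_
    have h1 := smashRep_isCoequivariant M i (reflectIso hM hF ((pi (reflect M i)).nmk x)) z
    have h2 := reflectRep_isCoequivariant (M := M) (i := i) x z
    have h3 : ∀ (s : H ⊗[k] (pi (reflect M i)).T) (r : H ⊗[k] (pi M).Nichols),
        TensorProduct.map₂ (LinearMap.mul k H) (smashRep M i) ((reflectIso hM hF).lTensor H
          ((pi (reflect M i)).nmk.toLinearMap.lTensor H s)) r =
        TensorProduct.map₂ (LinearMap.mul k H) (reflectRep M i).toLinearMap s r := by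
      intro s r
      induction s with
      | zero => simp only [map_zero, LinearMap.zero_apply]
      | add a b ha hb => simp only [map_add, LinearMap.add_apply, ha, hb]
      | tmul g a =>
        induction r with
        | zero => simp only [map_zero]
        | add a b ha hb => simp only [map_add, ha, hb]
        | tmul c u =>
          simp only [LinearMap.lTensor_tmul, TensorProduct.map₂_apply_tmul,
            AlgHom.toLinearMap_apply, smashRep_reflectIso_nmk]
    rw [smashRep_reflectIso_nmk] at h1
    exact h1.symm.trans (h2.trans (h3 _ _).symm)

theorem range_single (j : ι) :
    LinearMap.range (single M j) = LinearMap.range (piQ M j) := by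
  rw [piQ, LinearMap.range_comp, LinearMap.range_eq_top.2 (proj_surjective M j), Submodule.map_top]

theorem map_reflectIso_nGrade (γ : ι → ℤ) :
    ((pi (reflect M i)).nGrade (fun j => LinearMap.range (single (reflect M i) j))
      (fun j => simpleRefl M i (Pi.single j 1)) γ).map (reflectIso hM hF) =
      smashGrade M i γ := by
  have hq := isDec_pi (reflect M i)
  let d : ι → ι → ℤ := fun j => simpleRefl M i (Pi.single j 1)
  have hg := n_isGr hq d
  have hmem := fun γ x => mem_nGrade hq d (fun j => range_single (M := reflect M i) j) γ x
  have hle : ∀ γ y, reflectIso hM hF (nComp hq d γ y) ∈ smashGrade M i γ := by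
    intro γ y
    obtain ⟨x, rfl⟩ := (pi (reflect M i)).nmk_surjective y
    obtain ⟨t, ht, h⟩ := exists_smashGrade γ x
    rw [← smashRep_reflectIso_nmk hM hF] at h
    rw [nComp_nmk]
    exact (smashRep_injective h) ▸ ht
  apply le_antisymm
  · rintro _ ⟨y, hy, rfl⟩
    rw [← (hmem γ y).1 hy]
    exact hle γ y
  · intro t ht
    obtain ⟨y, rfl⟩ : t ∈ LinearMap.range (reflectIso hM hF) := by
      rw [range_reflectIso]; exact smashGrade_le γ ht
    refine ⟨nComp hq d γ y, (hmem γ _).2 ((pi (reflect M i)).n_isPre.comp_self hq hg γ y), ?_⟩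
    obtain ⟨s, hs⟩ := (pi (reflect M i)).n_isPre.exists_finset hg hq y
    have h1 : reflectIso hM hF y = reflectIso hM hF (nComp hq d γ y) +
        ∑ δ ∈ s.erase γ, reflectIso hM hF (nComp hq d δ y) := by
      conv_lhs => rw [← hs (insert γ s) (Finset.subset_insert _ _)]
      rw [map_sum, ← Finset.insert_erase (Finset.mem_insert_self γ s),
        Finset.sum_insert (Finset.notMem_erase _ _), Finset.erase_insert_eq_erase]
    refine (sub_eq_zero.1 (eq_zero_of_map_gr_dualGr fun α β => ?_)).symm
    by_cases h : α + β = γ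
    · rw [h1, add_sub_cancel_left, map_sum]
      refine Finset.sum_eq_zero fun δ hδ => map_gr_dualGr (hle δ y) α β ?_
      rw [h]
      exact (Finset.ne_of_mem_erase hδ).symm
    · exact map_gr_dualGr (sub_mem ht (hle γ y)) α β h

end Iso

end YDMod

namespace YDMod

/-! ### Duals and isomorphisms -/

section Dual

theorem isomorphic_of_range_eq {X : YDMod.{u, w, v} k H} {Y : YDMod k H} {Z : Type*}
    [AddCommGroup Z] [Module k Z] {act : H →ₐ[k] Module.End k Z} {coact : Z →ₗ[k] H ⊗[k] Z}
    {f : X →ₗ[k] Z} {g : Y →ₗ[k] Z} (hf : IsYDMap X.act X.coact act coact f)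
    (hg : IsYDMap Y.act Y.coact act coact g) (hfi : Function.Injective f)
    (hgi : Function.Injective g) (h : LinearMap.range f = LinearMap.range g) :
    X.Isomorphic Y := by
  let e : X ≃ₗ[k] Y := (LinearEquiv.ofInjective f hfi).trans
    ((LinearEquiv.ofEq _ _ h).trans (LinearEquiv.ofInjective g hgi).symm)
  have he : ∀ x, g (e x) = f x := fun x =>
    congrArg Subtype.val ((LinearEquiv.ofInjective g hgi).apply_symm_apply _)
  refine ⟨e, fun a x => hgi ?_, fun x => Module.Flat.lTensor_preserves_injective_linearMap g hgi ?_⟩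
  · rw [LinearEquiv.coe_coe, he, hf.map_act, hg.map_act, he]
  · rw [← hg.map_coact, ← LinearMap.lTensor_comp_apply, show g ∘ₗ (e : X →ₗ[k] Y) = f from
      LinearMap.ext he, ← hf.map_coact]
    exact congrArg coact (he x)

variable [BijectiveAntipode k H] (V : YDMod.{u, w, v} k H) [FiniteDimensional k V]

/-- The isomorphism `V → V**`, `v ↦ (f ↦ ⟨f, S(v₍₋₁₎) · v₍₀₎⟩)`. -/
def bidual : V →ₗ[k] V.dual.dual :=
  (dualForm.flip : V →ₗ[k] Module.Dual k V.dual) ∘ₗ V.twist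

theorem dualForm_bidual (v : V) : dualForm (V.bidual v) = dualEval (V.twist v) := rfl

theorem dual_ext {f g : V.dual} (h : ∀ v, dualForm f v = dualForm g v) : f = g :=
  LinearMap.ext h

theorem dualForm_dual_act (h : H) (f : V.dual) (v : V) :
    dualForm (V.dual.act h f) v = dualForm f (V.act (antipode k h) v) := rfl

theorem bidual_hom : IsHom V.bidual where
  map_act h v := by
    refine V.dual.dual_ext fun f => ?_
    refine comatrix_induction (k := k) (p := fun h => dualForm (V.bidual (V.act h v)) f =
      dualForm (V.dual.dual.act h (V.bidual v)) f) ?_ ?_ ?_ ?_ h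
    · simp
    · intro x y hx hy; simp only [map_add, LinearMap.add_apply, hx, hy]
    · intro c x hx; simp only [map_smul, LinearMap.smul_apply, hx]
    · intro m t ht a b
      rw [dualForm_dual_act, dualForm_bidual, dualForm_bidual, dualEval_apply, dualEval_apply,
        dualForm_dual_act, twist_act ht]
  map_coact v := by
    obtain ⟨m, t, e, a, he, rfl⟩ := V.exists_cofam v
    refine V.dual.dual_tensor_ext fun g => ?_
    have h1 := V.dual.dual_coact_eval (V.bidual (e a)) g
    have h2 := V.dual_coact_eval g (V.twist (e a))
    rw [twist_coact he] at h2
    have h3 : ∀ z, (dualForm (V.bidual (e a))).lTensor H ((antipodeInv k).rTensor V.dual z) =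
        (antipodeInv k).rTensor k ((dualEval (V.twist (e a))).lTensor H z) := by
      intro z
      rw [← LinearMap.comp_apply, LinearMap.lTensor_comp_rTensor, ← LinearMap.rTensor_comp_lTensor,
        dualForm_bidual, LinearMap.comp_apply]
    rw [h3, h2] at h1
    refine h1.trans ?_
    simp only [he.coact_eq, map_sum, LinearMap.rTensor_tmul, LinearMap.lTensor_tmul,
      antipodeInv_antipode]
    exact (map_sum ((dualEval g).lTensor H) (fun b => t a b ⊗ₜ V.bidual (e b)) _).symm

theorem bidual_bijective : Function.Bijective V.bidual := by
  have h : Function.Bijective (dualForm.flip : V →ₗ[k] Module.Dual k V.dual) :=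
    (Module.evalEquiv k V).bijective
  exact h.comp (twist_bijective (V := V))

theorem dual_dual_isomorphic : V.dual.dual.Isomorphic V :=
  isomorphic_of_range_eq (f := LinearMap.id) (IsYDMap.id' _ _) V.bidual_hom
    Function.injective_id V.bidual_bijective.1 (by
      rw [LinearMap.range_id, LinearMap.range_eq_top.2 V.bidual_bijective.2])

variable {V}

theorem IsIrreducible.dual (hV : V.IsIrreducible) : V.dual.IsIrreducible := by
  have := hV.1
  refine ⟨inferInstanceAs (Nontrivial (Module.Dual k V)), fun P hP => ?_⟩
  let P' : Submodule k (Module.Dual k V) := P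
  have hsub : V.IsSub P'.dualCoannihilator := by
    refine IsSub.mk' (fun h v hv => ?_) fun χ v hv => ?_
    · refine (Submodule.mem_dualCoannihilator _).2 fun f hf => ?_
      have := dualForm_act (V := V) f h v
      exact this.trans ((Submodule.mem_dualCoannihilator _).1 hv _ (hP.act_mem _ hf))
    · refine (Submodule.mem_dualCoannihilator _).2 fun f hf => ?_
      obtain ⟨n, t, e, p, he, rfl⟩ := V.exists_cofam v
      obtain ⟨m, s, F, a, hs, hFP, rfl⟩ := hP.exists_cofam hf
      have h1 := dual_cofam_eval hs he a p
      rw [Finset.sum_eq_zero fun b _ => ?_] at h1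
      · have h2 := congrArg (χ ∘ₗ antipode k) h1
        simp only [map_zero, map_sum, map_smul, LinearMap.comp_apply, antipode_antipodeInv] at h2
        change dualForm (F a) (lslice χ (V.coact (e p))) = 0
        rw [he.coact_eq]
        simp only [map_sum, lslice_tmul, map_smul, smul_eq_mul] at h2 ⊢
        rw [h2]
        exact Finset.sum_congr rfl fun q _ => mul_comm _ _
      · have : dualForm (F b) (e p) = 0 := (Submodule.mem_dualCoannihilator _).1 hv _ (hFP b)
        rw [this, zero_smul]
  rcases hV.2 _ hsub with h | h
  · right
    have := Subspace.dualCoannihilator_dualAnnihilator_eq (W := P')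
    rw [h, Submodule.dualAnnihilator_bot] at this
    exact this.symm
  · left
    have := Subspace.dualCoannihilator_dualAnnihilator_eq (W := P')
    rw [h, Submodule.dualAnnihilator_top] at this
    exact this.symm

end Dual

variable {ι : Type} [Fintype ι] [DecidableEq ι] {M : ι → YDMod.{u, w, v} k H} {i : ι}
variable [∀ j, FiniteDimensional k (M j)] [BijectiveAntipode k H]

theorem reflect_self : reflect M i i = (M i).dual := by
  unfold reflect
  generalize decEq i i = d
  cases d with
  | isTrue h => rfl
  | isFalse h => exact absurd rfl h

theorem reflect_of_ne {j : ι} (hj : j ≠ i) : reflect M i j = Lmax M i j := by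
  unfold reflect
  generalize decEq j i = d
  cases d with
  | isTrue h => exact absurd h hj
  | isFalse h => rfl

theorem reflect_irreducible (hM : ∀ j, (M j).IsIrreducible) (hF : FinCond M i) (j : ι) :
    (reflect M i j).IsIrreducible := by
  by_cases hj : j = i
  · subst hj
    rw [reflect_self]
    exact (hM j).dual
  · have := hF j hj
    rw [reflect_of_ne hj]
    exact Lmax_irreducible hj (hM j)

theorem reflect_reflect_self : (reflect (reflect M i) i i).Isomorphic (M i) := by
  have h : ∀ (X : YDMod.{u, w, max u v} k H) [FiniteDimensional k X], X = (M i).dual →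
      X.dual.Isomorphic (M i) := by
    rintro X _ rfl
    exact dual_dual_isomorphic (M i)
  rw [reflect_self]
  exact h _ reflect_self

end YDMod

namespace YDMod

variable {ι : Type} [Fintype ι] [DecidableEq ι] {M : ι → YDMod.{u, w, v} k H} {i : ι}
variable [∀ j, FiniteDimensional k (M j)] [BijectiveAntipode k H]

/-! ### The second reflection -/

omit [∀ j, FiniteDimensional k (M j)] in
theorem coinvProj_mul_inc (y : (pi M).Nichols) (v : M i) :
    coinvProj M i (y * inc M i v) = 0 := by
  rw [coinvProj_eq_zero]
  have h := mul_range_eq_top (K' := coinvariants M i) coinv_one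
    (fun j hj u x hx => coinv_mul (coinv_inc hj u) hx) (fun v x hx => coinv_ad hx v)
    (fun h x hx => coinv_act hx h) y
  refine Submodule.mul_induction_on (C := fun y => y * inc M i v ∈ coinvCompl M i) h ?_ ?_
  · rintro a ha _ ⟨b, rfl⟩
    rw [mul_assoc]
    refine Submodule.mul_mem_mul ha ⟨⟨b * inc M i v, ?_⟩, ?_⟩
    · simp [nIdem_inc]
    · have : (pi M).nCounit (inc M i v) = 0 := (pi M).n_isPre.counit_ι _
      simp [this]
  · intro x y hx hy
    rw [add_mul]
    exact add_mem hx hy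

theorem smashRep_reflectEmb_self (f : reflect M i i) :
    ∃ φ : M i →ₗ[k] k, smashRep M i (reflectEmb M i i f) = pder M i φ :=
  reflect_elim (P := fun _ E => ∀ f, ∃ φ : M i →ₗ[k] k, smashRep M i (E f) = pder M i φ) i
    (fun _ f => ⟨dualForm f, smashRep_one_tmul_nι f⟩) (fun h => absurd rfl h) f

theorem exists_smashRep_reflectEmb_self (φ : M i →ₗ[k] k) :
    ∃ f, smashRep M i (reflectEmb M i i f) = pder M i φ := by
  let f : (M i).dual := (φ : Module.Dual k (M i))
  obtain ⟨x, hx⟩ := exists_reflectEmb_self f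
  exact ⟨x, by rw [hx]; exact smashRep_one_tmul_nι f⟩

theorem reflectEmb_of_ne {j : ι} (hj : j ≠ i) (x : reflect M i j) :
    ∃ y ∈ adPow M i j (topDeg M i j), reflectEmb M i j x = y ⊗ₜ 1 :=
  reflect_elim (P := fun _ E => ∀ x, ∃ y ∈ adPow M i j (topDeg M i j), E x = y ⊗ₜ 1) j
    (fun h => absurd h hj) (fun _ x => ⟨_, LmaxIncl_mem j x, rfl⟩) x

section Eval

variable (hM : ∀ j, (M j).IsIrreducible) (hF : FinCond M i)

/-- The composition of the isomorphism `B(W') ≅ K # B((M i)*)` with `id ⊗ ε`. -/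
def reflectEval : (pi (reflect M i)).Nichols →ₗ[k] (pi M).Nichols :=
  LinearMap.applyₗ 1 ∘ₗ smashRep M i ∘ₗ reflectIso hM hF

theorem reflectEval_apply (y : (pi (reflect M i)).Nichols) :
    reflectEval hM hF y = smashRep M i (reflectIso hM hF y) 1 := rfl

theorem reflectIso_inc (j : ι) (x : reflect M i j) :
    reflectIso hM hF (inc (reflect M i) j x) = reflectEmb M i j x := by
  rw [← reflectGen_single]
  exact reflectIso_nι hM hF _

theorem reflectEval_hom : IsYDMap (pi (reflect M i)).nAct (pi (reflect M i)).nCoact.toLinearMap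
    (pi M).nAct (pi M).nCoact.toLinearMap (reflectEval hM hF) where
  map_act h y := by
    refine comatrix_induction (k := k) (p := fun h => reflectEval hM hF
      ((pi (reflect M i)).nAct h y) = (pi M).nAct h (reflectEval hM hF y)) ?_ ?_ ?_ ?_ h
    · simp only [map_zero, LinearMap.zero_apply]
    · intro x y hx hy; simp only [map_add, LinearMap.add_apply, hx, hy]
    · intro c x hx; simp only [map_smul, LinearMap.smul_apply, hx]
    · intro m t ht a b
      have hT : ∀ c, (pi M).nAct (antipode k (t c b)) 1 =
          (if c = b then 1 else 0 : k) • (1 : (pi M).Nichols) := by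
        intro c
        rw [(pi M).n_isPre.act_one, counit_antipode, ht.counit_eq]
      simp only [reflectEval_apply, (reflectIso_hom hM hF).map_act,
        (smashRep_isEquivariant M i).conj ht, LinearMap.sum_apply, Module.End.mul_apply, hT,
        map_smul]
      rw [Finset.sum_eq_single b, if_pos rfl, one_smul]
      · intro c _ hc; rw [if_neg hc, zero_smul]
      · simp
  map_coact y := by
    have h1 := smashRep_isCoequivariant M i (reflectIso hM hF y) 1
    have h2 : ∀ s : H ⊗[k] (pi (reflect M i)).Nichols, TensorProduct.map₂ (LinearMap.mul k H)
        (smashRep M i) ((reflectIso hM hF).lTensor H s) (1 ⊗ₜ 1) =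
        (reflectEval hM hF).lTensor H s := by
      intro s
      induction s with
      | zero => simp only [map_zero, LinearMap.zero_apply]
      | add a b ha hb => simp only [map_add, LinearMap.add_apply, ha, hb]
      | tmul h x => simp [reflectEval_apply]
    rw [(reflectIso_hom hM hF).map_coact] at h1
    refine h1.trans ?_
    have h3 : (pi M).nCoact.toLinearMap 1 = 1 ⊗ₜ 1 := map_one (pi M).nCoact
    rw [h3]
    exact h2 _

theorem reflectEval_mul (x y : (pi (reflect M i)).Nichols) :
    reflectEval hM hF (x * y) = smashRep M i (reflectIso hM hF x) (reflectEval hM hF y) := by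
  rw [reflectEval_apply, smashRep_reflectIso_mul]; rfl

theorem reflectEval_adc {f : reflect M i i} {φ : M i →ₗ[k] k}
    (h : smashRep M i (reflectEmb M i i f) = pder M i φ) (y : (pi (reflect M i)).Nichols) :
    reflectEval hM hF ((pi (reflect M i)).adc (inc (reflect M i) i f) y) =
      pder M i φ (reflectEval hM hF y) := by
  obtain ⟨m, t, e, a, he, rfl⟩ := (reflect M i i).exists_cofam f
  have h0 : ∀ g, reflectEval hM hF (inc (reflect M i) i g) = 0 := by
    intro g
    obtain ⟨ψ, hψ⟩ := smashRep_reflectEmb_self g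
    rw [reflectEval_apply, reflectIso_inc, hψ, pder_one]
  rw [adc_cofam (inc_cofam he)]
  simp only [map_sub, map_sum, reflectEval_mul, h0, map_zero, Finset.sum_const_zero, sub_zero,
    reflectIso_inc, h]

theorem map_reflectEval_adPow_succ (j : ι) (n : ℕ) :
    (adPow (reflect M i) i j (n + 1)).map (reflectEval hM hF) =
      dspan (i := i) ((adPow (reflect M i) i j n).map (reflectEval hM hF)) := by
  apply le_antisymm
  · rw [Submodule.map_le_iff_le_comap]
    refine adPow_succ_le fun f y hy => ?_
    obtain ⟨φ, hφ⟩ := smashRep_reflectEmb_self f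
    rw [Submodule.mem_comap, reflectEval_adc hM hF hφ]
    exact pder_mem_dspan (Submodule.mem_map_of_mem hy) φ
  · refine dspan_le ?_
    rintro φ _ ⟨y, hy, rfl⟩
    obtain ⟨f, hf⟩ := exists_smashRep_reflectEmb_self φ
    rw [← reflectEval_adc hM hF hf]
    exact Submodule.mem_map_of_mem (adc_mem_adPow _ _ _ f hy)

theorem map_reflectEval_adPow {j : ι} (hj : j ≠ i) {n m : ℕ} (h : n + m = topDeg M i j) :
    (adPow (reflect M i) i j n).map (reflectEval hM hF) = adPow M i j m := by
  have := hF j hj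
  induction n generalizing m with
  | zero =>
    obtain rfl : m = topDeg M i j := by omega
    apply le_antisymm
    · rintro _ ⟨_, hx, rfl⟩
      obtain ⟨u, rfl⟩ := (mem_summand _ j).1 hx
      obtain ⟨y, hy, h⟩ := reflectEmb_of_ne hj u
      rw [reflectEval_apply, reflectIso_inc, h, smashRep_tmul_one, LinearMap.mul_apply', mul_one]
      exact hy
    · intro y hy
      obtain ⟨u, hu⟩ := exists_reflectEmb_of_ne hj hy
      refine ⟨inc _ j u, inc_mem _ j u, ?_⟩
      rw [reflectEval_apply, reflectIso_inc, hu, smashRep_tmul_one, LinearMap.mul_apply', mul_one]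
  | succ n ih =>
    rw [map_reflectEval_adPow_succ, ih (m := m + 1) (by omega),
      dspan_adPow hj (hM j) (by omega)]

theorem map_reflectEval_adPow_eq_bot {j : ι} (hj : j ≠ i) {n : ℕ} (h : topDeg M i j < n) :
    (adPow (reflect M i) i j n).map (reflectEval hM hF) = ⊥ := by
  induction n, h using Nat.le_induction with
  | base =>
    rw [map_reflectEval_adPow_succ, map_reflectEval_adPow hM hF hj (add_zero _), eq_bot_iff]
    refine dspan_le fun φ x hx => ?_
    rw [pder_adPow_zero hj hx]
    exact zero_mem _
  | succ n _ ih =>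
    rw [map_reflectEval_adPow_succ, ih, eq_bot_iff]
    refine dspan_le fun φ x hx => ?_
    rw [(Submodule.mem_bot k).1 hx, map_zero]
    exact zero_mem _

theorem exists_bder (ξ : (M i).dual.Nichols) : ∃ z : (pi (reflect M i)).Nichols,
    smashRep M i (reflectIso hM hF z) = bder M i ξ ∧
      ∀ y, coinvProj (reflect M i) i (y * z) =
        (M i).dual.nCounit ξ • coinvProj (reflect M i) i y := by
  induction ξ using dual_ind with
  | h1 => exact ⟨1, by rw [reflectIso_one, smashRep_one, map_one], fun y => by simp⟩
  | ha x y hx hy =>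
    obtain ⟨a, ha, ha'⟩ := hx
    obtain ⟨b, hb, hb'⟩ := hy
    refine ⟨a + b, by rw [map_add, map_add, ha, hb, map_add], fun y => ?_⟩
    rw [mul_add, map_add, ha', hb', map_add, add_smul]
  | hs c x hx =>
    obtain ⟨a, ha, ha'⟩ := hx
    refine ⟨c • a, by rw [map_smul, map_smul, ha, map_smul], fun y => ?_⟩
    rw [mul_smul_comm, map_smul, ha', map_smul, smul_assoc]
  | hm f x hx =>
    obtain ⟨a, ha, ha'⟩ := hx
    obtain ⟨g, hg⟩ := exists_smashRep_reflectEmb_self (M := M) (i := i) (dualForm f)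
    refine ⟨inc (reflect M i) i g * a, ?_, fun y => ?_⟩
    · rw [smashRep_reflectIso_mul, reflectIso_inc, hg, ha, map_mul, bder_nι]
    · rw [← mul_assoc, ha', coinvProj_mul_inc, smul_zero, map_mul,
        (M i).dual.n_isPre.counit_ι, zero_mul, zero_smul]

theorem exists_coinvProj_eq {t : Smash M i} (ht : t ∈ smash M i) :
    ∃ y z : (pi (reflect M i)).Nichols, reflectIso hM hF y = t ∧
      smashRep M i (reflectIso hM hF z) = LinearMap.mul k (pi M).Nichols (smashRep M i t 1) ∧
      coinvProj (reflect M i) i y = coinvProj (reflect M i) i z := by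
  obtain ⟨s, rfl⟩ := ht
  induction s using TensorProduct.induction_on with
  | zero => exact ⟨0, 0, by simp, by simp, rfl⟩
  | add a b ha hb =>
    obtain ⟨y, z, h1, h2, h3⟩ := ha
    obtain ⟨y', z', h1', h2', h3'⟩ := hb
    refine ⟨y + y', z + z', by rw [map_add, map_add, h1, h1'], ?_, by rw [map_add, map_add, h3, h3']⟩
    rw [map_add, map_add, h2, h2', map_add, map_add, LinearMap.add_apply, map_add]
  | tmul x ξ =>
    obtain ⟨y, hy⟩ : x.1 ⊗ₜ[k] (1 : (M i).dual.Nichols) ∈ LinearMap.range (reflectIso hM hF) := by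
      rw [range_reflectIso]; exact tmul_mem_smash x.2 1
    obtain ⟨z, hz, hz'⟩ := exists_bder hM hF ξ
    refine ⟨y * z, (M i).dual.nCounit ξ • y, smashRep_injective ?_, ?_, ?_⟩
    · rw [smashRep_reflectIso_mul, hy, hz, smashRep_tmul_one]; rfl
    · rw [map_smul, map_smul, hy, smashRep_tmul_one]
      change _ = LinearMap.mul k _ (x.1 * bder M i ξ 1)
      rw [bder_one, mul_smul_comm, mul_one, map_smul]
    · rw [hz', map_smul]

theorem eq_zero_of_reflectEval {y : (pi (reflect M i)).Nichols}
    (hy : y ∈ coinvariants (reflect M i) i) (h : reflectEval hM hF y = 0) : y = 0 := by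
  obtain ⟨y', z, h1, h2, h3⟩ := exists_coinvProj_eq hM hF (t := reflectIso hM hF y)
    (by rw [← range_reflectIso hM hF]; exact ⟨y, rfl⟩)
  obtain rfl := reflectIso_injective hM hF h1
  rw [← reflectEval_apply, h, map_zero, ← map_zero (smashRep M i)] at h2
  have hz : z = 0 := reflectIso_injective hM hF ((smashRep_injective h2).trans (map_zero _).symm)
  rw [← coinvProj_of_mem hy, h3, hz, map_zero]

include hM hF

theorem adPow_reflect_ne_bot_iff {j : ι} (hj : j ≠ i) (n : ℕ) :
    adPow (reflect M i) i j n ≠ ⊥ ↔ n ≤ topDeg M i j := by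
  have := hF j hj
  have h : adPow (reflect M i) i j n = ⊥ ↔
      (adPow (reflect M i) i j n).map (reflectEval hM hF) = ⊥ := by
    refine ⟨fun h => by rw [h, Submodule.map_bot], fun h => (Submodule.eq_bot_iff _).2 fun x hx => ?_⟩
    refine eq_zero_of_reflectEval hM hF (adPow_le_coinv hj n hx) ?_
    rw [← Submodule.mem_bot k, ← h]
    exact Submodule.mem_map_of_mem hx
  rw [Ne, h]
  constructor
  · intro hn
    by_contra! hlt
    exact hn (map_reflectEval_adPow_eq_bot hM hF hj hlt)
  · intro hn
    rw [map_reflectEval_adPow hM hF hj (Nat.add_sub_cancel' hn)]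
    exact (adPow_ne_bot_iff hj (hM j) _).2 (Nat.sub_le _ _)

theorem topDeg_reflect {j : ι} (hj : j ≠ i) : topDeg (reflect M i) i j = topDeg M i j := by
  have : {n | adPow (reflect M i) i j n ≠ ⊥} = Set.Iic (topDeg M i j) :=
    Set.ext fun n => adPow_reflect_ne_bot_iff hM hF hj n
  rw [topDeg, this, csSup_Iic]

theorem finCond_reflect : FinCond (reflect M i) i := by
  intro j hj
  have := hF j hj
  have hmem : ∀ y ∈ adL (reflect M i) i j, reflectEval hM hF y ∈ adL M i j := by
    change adL (reflect M i) i j ≤ (adL M i j).comap (reflectEval hM hF)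
    refine iSup_le fun n => ?_
    rw [← Submodule.map_le_iff_le_comap]
    by_cases hn : n ≤ topDeg M i j
    · rw [map_reflectEval_adPow hM hF hj (Nat.add_sub_cancel' hn)]
      exact le_iSup (adPow M i j) _
    · rw [map_reflectEval_adPow_eq_bot hM hF hj (not_le.1 hn)]
      exact bot_le
  refine FiniteDimensional.of_injective ((reflectEval hM hF).restrict hmem) ?_
  rw [← LinearMap.ker_eq_bot, LinearMap.ker_eq_bot']
  rintro ⟨y, hy⟩ h
  refine Subtype.ext (eq_zero_of_reflectEval hM hF ?_ (congrArg Subtype.val h))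
  exact (iSup_le fun n => adPow_le_coinv hj n : adL (reflect M i) i j ≤ _) hy

theorem simpleRefl_reflect : simpleRefl (reflect M i) i = simpleRefl M i := by
  have h : cartanForm (reflect M i) i = cartanForm M i := by
    unfold cartanForm
    refine Finset.sum_congr rfl fun j _ => ?_
    unfold cartan
    by_cases hj : j = i
    · rw [if_pos hj, if_pos hj]
    · rw [if_neg hj, if_neg hj, topDeg_reflect hM hF hj]
  ext x
  rw [simpleRefl, simpleRefl, Module.reflection_apply, Module.reflection_apply, h]

theorem reflect_reflect_of_ne {j : ι} (hj : j ≠ i) :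
    (reflect (reflect M i) i j).Isomorphic (M j) := by
  rw [reflect_of_ne hj]
  have hE := reflectEval_hom hM hF
  have hL := LmaxIncl_hom (M := reflect M i) (i := i) j
  refine isomorphic_of_range_eq (f := reflectEval hM hF ∘ₗ LmaxIncl (reflect M i) i j)
    (g := inc M j) ⟨fun h x => ?_, fun x => ?_⟩ (inc_hom M j) ?_ (inc_injective j) ?_
  · rw [LinearMap.comp_apply, hL.map_act, hE.map_act, LinearMap.comp_apply]
  · rw [LinearMap.comp_apply, hE.map_coact, hL.map_coact, LinearMap.lTensor_comp_apply]
  · rw [← LinearMap.ker_eq_bot, LinearMap.ker_eq_bot']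
    intro x hx
    exact Subtype.ext (eq_zero_of_reflectEval hM hF
      (adPow_le_coinv hj _ (LmaxIncl_mem (M := reflect M i) j x)) hx)
  · have h : LinearMap.range (LmaxIncl (reflect M i) i j) =
        adPow (reflect M i) i j (topDeg (reflect M i) i j) := Submodule.range_subtype _
    rw [LinearMap.range_comp, h, topDeg_reflect hM hF hj,
      map_reflectEval_adPow hM hF hj (add_zero _)]
    rfl

end Eval

end YDMod

end

theorem theorem3p12 {k : Type u} {H : Type w} [Field k] [Ring H] [HopfAlgebra k H]
    [BijectiveAntipode k H] (θ : ℕ) (M : Fin θ → YDMod.{u, w, v} k H)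
    [∀ j, FiniteDimensional k (M j)] (hM : ∀ j, (M j).IsIrreducible) (i : Fin θ)
    (hF : YDMod.FinCond M i) :
    (Function.Injective (YDMod.smashRep M i) ∧
      ∃ Φ : (YDMod.pi (YDMod.reflect M i)).Nichols →ₗ[k] YDMod.Smash M i,
        (∀ (j : Fin θ) (x : YDMod.reflect M i j),
          Φ ((YDMod.pi (YDMod.reflect M i)).nι (YDMod.single (YDMod.reflect M i) j x)) =
            YDMod.reflectEmb M i j x) ∧
        Function.Injective Φ ∧ LinearMap.range Φ = YDMod.smash M i ∧
        Φ 1 = 1 ⊗ₜ[k] 1 ∧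
        (∀ x y, YDMod.smashRep M i (Φ (x * y)) =
          YDMod.smashRep M i (Φ x) * YDMod.smashRep M i (Φ y)) ∧
        IsYDMap (YDMod.pi (YDMod.reflect M i)).nAct
          (YDMod.pi (YDMod.reflect M i)).nCoact.toLinearMap
          (YDMod.smashAct M i) (YDMod.smashCoact M i) Φ ∧
        ∀ γ : Fin θ → ℤ,
          ((YDMod.pi (YDMod.reflect M i)).nGrade
              (fun j => LinearMap.range (YDMod.single (YDMod.reflect M i) j))
              (fun j => YDMod.simpleRefl M i (Pi.single j 1)) γ).map Φ =
            YDMod.smashGrade M i γ) ∧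
    (∀ j, (YDMod.reflect M i j).IsIrreducible) ∧
    YDMod.FinCond (YDMod.reflect M i) i ∧
    YDMod.simpleRefl (YDMod.reflect M i) i = YDMod.simpleRefl M i ∧
    ∀ j, (YDMod.reflect (YDMod.reflect M i) i j).Isomorphic (M j) := by
  refine ⟨⟨YDMod.smashRep_injective, YDMod.reflectIso hM hF, YDMod.reflectIso_inc hM hF,
    YDMod.reflectIso_injective hM hF, YDMod.range_reflectIso hM hF, YDMod.reflectIso_one hM hF,
    YDMod.smashRep_reflectIso_mul hM hF, YDMod.reflectIso_hom hM hF,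
    YDMod.map_reflectIso_nGrade hM hF⟩, YDMod.reflect_irreducible hM hF,
    YDMod.finCond_reflect hM hF, YDMod.simpleRefl_reflect hM hF, fun j => ?_⟩
  by_cases hj : j = i
  · subst hj
    exact YDMod.reflect_reflect_self
  · exact YDMod.reflect_reflect_of_ne hM hF hj
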